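/- An instance of Weighted Vertex Cover (WVC) consists of a finite simple graph $G=(V,E)$, a weight function $w:V\to\mathbb{R}^{+}$ and a number $W\in\mathbb{R}^{+}$; the task is to return a vertex cover of $G$ of weight at most $W$, or NIL if there is none. In WVC* the input contains in addition a vertex cover $U$ of $G$ of minimum size. Let $n=|V|$ and let $t$ be the minimum size of a vertex cover of $G$; $O^*$ hides factors polynomial in $n$. Running time and space refer to a random access machine with natural-number and real registers: natural numbers are bounded by a polynomial in $n$; real numbers can only be copied, added, subtracted and compared, and are bounded in absolute value by a polynomial in $n$ times $W+\sum_{v\in V}w(v)$. Polynomial space means that polynomially many registers (in $n$) and a recursion depth polynomial in $n$ suffice. For a minimum vertex cover $U$, let $P_2(G,U)$ be the set of connected components of $G[U]$ that are paths on exactly 2 vertices, and let $C_3^*(G,U)$ be the set of connected components of $G[U]$ that are triangles whose three vertices have no common neighbor in $V\setminus U$. Call $U$ good if there is a function $f:C_3^*(G,U)\to P_2(G,U)$ such that for each $c\in C_3^*(G,U)$ some vertex of $V\setminus U$ is a neighbor of a vertex of $c$ and of both vertices of $f(c)$. (1) There is an algorithm that solves WVC* in $O^*(1.443^t)$ time and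 polynomial space, and whose running time on graphs of maximum degree at most 3 is $O^*(1.415^t)$. (2) There is an algorithm that, given an instance of WVC* in which $G$ has maximum degree at most 3, computes in polynomial time a good minimum vertex cover of $G$ together with a corresponding function $f$. (3) There is an algorithm that solves WVC (with no vertex cover given) in $O^*(1.443^t)$ time and polynomial space, and whose running time on graphs of maximum degree at most 3 is $O^*(1.415^t)$. -/

import Mathlib

/-! ## The machine model

A random access machine that runs structured programs with recursive procedures. Its memory consists
of finitely many (as many as the program mentions) one-way infinite arrays of natural numbers and
arrays of real numbers. Natural numbers (also used as addresses) can be added, subtracted, multiplied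
and compared; real numbers can only be copied, added, subtracted and compared. Every operation, test,
assignment and procedure call costs one step. -/

namespace RAM

/-- A memory content: `nat a i` and `real a i` are the `i`-th cells of the `a`-th arrays. -/
structure Store where
  nat : ℕ → ℕ → ℕ
  real : ℕ → ℕ → ℝ

namespace Store

/-- Write `x` into cell `i` of the natural-number array `a`. -/
def setNat (σ : Store) (a i x : ℕ) : Store where
  nat := Function.update σ.nat a (Function.update (σ.nat a) i x)
  real := σ.real

/-- Write `x` into cell `i` of the real array `a`. -/
def setReal (σ : Store) (a i : ℕ) (x : ℝ) : Store where
  nat := σ.nat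
  real := Function.update σ.real a (Function.update (σ.real a) i x)

end Store

/-- Expressions whose value is a natural number. In `get a i`, the array name `a` is fixed in the
program text and the address `i` is computed. Subtraction is truncated. -/
inductive NExp where
  | lit (k : ℕ)
  | get (a : ℕ) (i : NExp)
  | add (e f : NExp)
  | sub (e f : NExp)
  | mul (e f : NExp)

namespace NExp

def eval (σ : Store) : NExp → ℕ
  | lit k => k
  | get a i => σ.nat a (i.eval σ)
  | add e f => e.eval σ + f.eval σ
  | sub e f => e.eval σ - f.eval σ
  | mul e f => e.eval σ * f.eval σ

/-- The number of steps spent on the evaluation. -/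
def cost : NExp → ℕ
  | lit _ => 1
  | get _ i => i.cost + 1
  | add e f => e.cost + f.cost + 1
  | sub e f => e.cost + f.cost + 1
  | mul e f => e.cost + f.cost + 1

/-- No number that occurs in the evaluation, in particular no address, exceeds `S`. -/
def Fits (S : ℕ) (σ : Store) : NExp → Prop
  | lit k => k ≤ S
  | get a i => i.Fits S σ ∧ (get a i).eval σ ≤ S
  | add e f => e.Fits S σ ∧ f.Fits S σ ∧ (add e f).eval σ ≤ S
  | sub e f => e.Fits S σ ∧ f.Fits S σ ∧ (sub e f).eval σ ≤ S
  | mul e f => e.Fits S σ ∧ f.Fits S σ ∧ (mul e f).eval σ ≤ S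

end NExp

/-- Expressions whose value is a real number. -/
inductive RExp where
  | zero
  | get (a : ℕ) (i : NExp)
  | add (e f : RExp)
  | sub (e f : RExp)

namespace RExp

noncomputable def eval (σ : Store) : RExp → ℝ
  | zero => 0
  | get a i => σ.real a (i.eval σ)
  | add e f => e.eval σ + f.eval σ
  | sub e f => e.eval σ - f.eval σ

/-- The number of steps spent on the evaluation. -/
def cost : RExp → ℕ
  | zero => 1
  | get _ i => i.cost + 1
  | add e f => e.cost + f.cost + 1
  | sub e f => e.cost + f.cost + 1

/-- No natural number that occurs in the evaluation exceeds `S`, and no real number exceeds `R` in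
absolute value. -/
def Fits (S : ℕ) (R : ℝ) (σ : Store) : RExp → Prop
  | zero => True
  | get a i => i.Fits S σ ∧ |(get a i).eval σ| ≤ R
  | add e f => e.Fits S R σ ∧ f.Fits S R σ ∧ |(add e f).eval σ| ≤ R
  | sub e f => e.Fits S R σ ∧ f.Fits S R σ ∧ |(sub e f).eval σ| ≤ R

end RExp

/-- Tests. -/
inductive BExp where
  | natLe (e f : NExp)
  | realLe (e f : RExp)
  | not (b : BExp)
  | and (b c : BExp)

namespace BExp

def Holds (σ : Store) : BExp → Prop
  | natLe e f => e.eval σ ≤ f.eval σ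
  | realLe e f => e.eval σ ≤ f.eval σ
  | not b => ¬ b.Holds σ
  | and b c => b.Holds σ ∧ c.Holds σ

/-- The number of steps spent on the evaluation. -/
def cost : BExp → ℕ
  | natLe e f => e.cost + f.cost + 1
  | realLe e f => e.cost + f.cost + 1
  | not b => b.cost + 1
  | and b c => b.cost + c.cost + 1

/-- All numbers that occur in the evaluation are within the bounds `S` and `R`. -/
def Fits (S : ℕ) (R : ℝ) (σ : Store) : BExp → Prop
  | natLe e f => e.Fits S σ ∧ f.Fits S σ
  | realLe e f => e.Fits S R σ ∧ f.Fits S R σ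
  | not b => b.Fits S R σ
  | and b c => b.Fits S R σ ∧ c.Fits S R σ

end BExp

/-- Commands. `call p` runs the `p`-th procedure of the program; procedures have no parameters and
work on the common memory. -/
inductive Cmd where
  | skip
  | setNat (a : ℕ) (i e : NExp)
  | setReal (a : ℕ) (i : NExp) (r : RExp)
  | seq (c d : Cmd)
  | ite (b : BExp) (c d : Cmd)
  | while (b : BExp) (c : Cmd)
  | call (p : ℕ)

/-- A program: its main command and its finite list of procedure bodies. -/
structure Program where
  main : Cmd
  procs : List Cmd

/-- `Exec procs S R d c σ t σ'`: started with memory `σ`, the command `c` halts after exactly `t`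
steps with memory `σ'`; during this run no address and no natural number exceeds `S`, no real number
exceeds `R` in absolute value, and never more than `d` procedure calls are open at the same time.
A call of a procedure that does not exist does nothing. -/
inductive Exec (procs : List Cmd) (S : ℕ) (R : ℝ) : ℕ → Cmd → Store → ℕ → Store → Prop where
  | skip (d : ℕ) (σ : Store) : Exec procs S R d Cmd.skip σ 1 σ
  | setNat (d a : ℕ) (i e : NExp) (σ : Store) (hi : i.Fits S σ) (he : e.Fits S σ) :
      Exec procs S R d (Cmd.setNat a i e) σ (i.cost + e.cost + 1)
        (σ.setNat a (i.eval σ) (e.eval σ))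
  | setReal (d a : ℕ) (i : NExp) (r : RExp) (σ : Store) (hi : i.Fits S σ) (hr : r.Fits S R σ) :
      Exec procs S R d (Cmd.setReal a i r) σ (i.cost + r.cost + 1)
        (σ.setReal a (i.eval σ) (r.eval σ))
  | seq {d : ℕ} {c₁ c₂ : Cmd} {σ₀ σ₁ σ₂ : Store} {t₁ t₂ : ℕ}
      (h₁ : Exec procs S R d c₁ σ₀ t₁ σ₁) (h₂ : Exec procs S R d c₂ σ₁ t₂ σ₂) :
      Exec procs S R d (Cmd.seq c₁ c₂) σ₀ (t₁ + t₂) σ₂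
  | iteTrue {d : ℕ} {b : BExp} {c₁ c₂ : Cmd} {σ σ' : Store} {t : ℕ}
      (hf : b.Fits S R σ) (hb : b.Holds σ) (h : Exec procs S R d c₁ σ t σ') :
      Exec procs S R d (Cmd.ite b c₁ c₂) σ (b.cost + 1 + t) σ'
  | iteFalse {d : ℕ} {b : BExp} {c₁ c₂ : Cmd} {σ σ' : Store} {t : ℕ}
      (hf : b.Fits S R σ) (hb : ¬ b.Holds σ) (h : Exec procs S R d c₂ σ t σ') :
      Exec procs S R d (Cmd.ite b c₁ c₂) σ (b.cost + 1 + t) σ'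
  | whileFalse {d : ℕ} {b : BExp} {c : Cmd} {σ : Store}
      (hf : b.Fits S R σ) (hb : ¬ b.Holds σ) :
      Exec procs S R d (Cmd.while b c) σ (b.cost + 1) σ
  | whileTrue {d : ℕ} {b : BExp} {c : Cmd} {σ₀ σ₁ σ₂ : Store} {t₁ t₂ : ℕ}
      (hf : b.Fits S R σ₀) (hb : b.Holds σ₀) (h₁ : Exec procs S R d c σ₀ t₁ σ₁)
      (h₂ : Exec procs S R d (Cmd.while b c) σ₁ t₂ σ₂) :
      Exec procs S R d (Cmd.while b c) σ₀ (b.cost + 1 + t₁ + t₂) σ₂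
  | call {d p : ℕ} {σ σ' : Store} {t : ℕ}
      (h : Exec procs S R d (procs.getD p Cmd.skip) σ t σ') :
      Exec procs S R (d + 1) (Cmd.call p) σ (t + 1) σ'

/-- The program halts after `t` steps, turning `σ` into `σ'`, and uses at most `S` cells of each
array, natural numbers up to `S`, real numbers up to `S * M` in absolute value, and recursion depth
at most `S`. Polynomially bounded `S` means polynomial space: every natural number then has
`O(log n)` bits, and for rational inputs whose absolute values sum up to `M` every real number in
memory has a length polynomial in that of the input (no operation leaves the lattice that the input
numbers generate). -/
def Program.Runs (P : Program) (S : ℕ) (M : ℝ) (σ : Store) (t : ℕ) (σ' : Store) : Prop :=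
  Exec P.procs S (S * M) S P.main σ t σ'

end RAM

/-! ## Weighted vertex cover -/

/-- An instance of Weighted Vertex Cover on the vertex set `{0, …, n - 1}`. -/
structure WVCInstance (n : ℕ) where
  graph : SimpleGraph (Fin n)
  weight : Fin n → ℝ
  budget : ℝ
  weight_pos : ∀ v, 0 < weight v
  budget_pos : 0 < budget

namespace WVCInstance

variable {n : ℕ}

/-- The sum of all numbers of the instance. -/
noncomputable def total (I : WVCInstance n) : ℝ := I.budget + ∑ v, I.weight v

/-- `A` is a solution: a vertex cover of weight at most the budget. -/
def IsSolution (I : WVCInstance n) (A : Finset (Fin n)) : Prop :=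
  I.graph.IsVertexCover (A : Set (Fin n)) ∧ ∑ v ∈ A, I.weight v ≤ I.budget

open Classical in
/-- The initial memory for the instance `I` together with a vertex set `U`: array `0` holds `n`,
array `1` the adjacency matrix, array `2` the indicator of `U`; real array `0` holds the weights, real
array `1` the budget. All other cells are zero. -/
noncomputable def inputWith (I : WVCInstance n) (U : Finset (Fin n)) : RAM.Store where
  nat a i :=
    if a = 0 then (if i = 0 then n else 0)
    else if a = 1 then (if ∃ u v : Fin n, I.graph.Adj u v ∧ i = u * n + v then 1 else 0)
    else if a = 2 then (if ∃ v ∈ U, i = v then 1 else 0)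
    else 0
  real a i :=
    if a = 0 then (if h : i < n then I.weight ⟨i, h⟩ else 0)
    else if a = 1 then (if i = 0 then I.budget else 0)
    else 0

/-- The initial memory for the instance `I` alone. -/
noncomputable def input (I : WVCInstance n) : RAM.Store := I.inputWith ∅

end WVCInstance

/-- The vertex set whose indicator a memory content holds in array `4`. -/
def outputSet (n : ℕ) (σ : RAM.Store) : Finset (Fin n) :=
  Finset.univ.filter fun v => σ.nat 4 v = 1

/-- The memory content answers the instance: either cell `0` of array `3` is `1` and array `4` holds
a solution, or that cell is `0` (the answer NIL) and there is no solution. -/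
def WVCInstance.AnsweredBy {n : ℕ} (I : WVCInstance n) (σ : RAM.Store) : Prop :=
  (σ.nat 3 0 = 1 ∧ I.IsSolution (outputSet n σ)) ∨
    (σ.nat 3 0 = 0 ∧ ∀ A : Finset (Fin n), ¬ I.IsSolution A)

namespace SimpleGraph

variable {V : Type*}

/-- `U` is a vertex cover of minimum size. -/
def IsMinVertexCover (G : SimpleGraph V) (U : Finset V) : Prop :=
  G.IsVertexCover (U : Set V) ∧ (U.card : ℕ∞) = G.vertexCoverNum

/-- The maximum degree is at most `3`. -/
def IsDegreeThree (G : SimpleGraph V) : Prop :=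
  ∀ v, (G.neighborSet v).encard ≤ 3

/-- The connected components of `G[U]`. -/
abbrev CoverComponent (G : SimpleGraph V) (U : Finset V) : Type _ :=
  (G.induce (U : Set V)).ConnectedComponent

/-- The component is a triangle. -/
def CoverComponent.IsTriangle {G : SimpleGraph V} {U : Finset V} (c : G.CoverComponent U) : Prop :=
  c.supp.encard = 3 ∧ (G.induce (U : Set V)).IsClique c.supp

/-- The component is a path on two vertices. -/
def CoverComponent.IsPathTwo {G : SimpleGraph V} {U : Finset V} (c : G.CoverComponent U) : Prop :=
  c.supp.encard = 2 ∧ (G.induce (U : Set V)).IsClique c.supp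

/-- The triangle components of `G[U]` whose vertices have no common neighbor outside `U`. -/
abbrev FreeTriangle (G : SimpleGraph V) (U : Finset V) : Type _ :=
  {c : G.CoverComponent U // c.IsTriangle ∧ ¬ ∃ z : V, z ∉ U ∧
    ∀ x : (U : Set V), x ∈ c.supp → G.Adj x.1 z}

/-- The components of `G[U]` that are paths on two vertices. -/
abbrev PathTwo (G : SimpleGraph V) (U : Finset V) : Type _ :=
  {c : G.CoverComponent U // c.IsPathTwo}

/-- `f` shows that `U` is good: for each triangle component `c` without a common neighbor outside
`U`, some vertex outside `U` is a neighbor of a vertex of `c` and of both vertices of the path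
`f c`. -/
def IsGoodFor (G : SimpleGraph V) (U : Finset V) (f : G.FreeTriangle U → G.PathTwo U) : Prop :=
  ∀ c, ∃ z : V, z ∉ U ∧ (∃ x : (U : Set V), x ∈ c.1.supp ∧ G.Adj x.1 z) ∧
    ∀ y : (U : Set V), y ∈ (f c).1.supp → G.Adj y.1 z

end SimpleGraph

/-- Array `5` of the memory content encodes `f`: for every vertex `x` of a triangle `c`, cell `x`
holds the name of a vertex of the path `f c`. -/
def EncodesMap {n : ℕ} (G : SimpleGraph (Fin n)) (U : Finset (Fin n)) (σ : RAM.Store)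
    (f : G.FreeTriangle U → G.PathTwo U) : Prop :=
  ∀ c, ∀ x : (U : Set (Fin n)), x ∈ c.1.supp →
    ∃ y : (U : Set (Fin n)), y ∈ (f c).1.supp ∧ σ.nat 5 x.1 = y.1

/-- A bound polynomial in the number of vertices. -/
def polyBound (C k n : ℕ) : ℕ := C * (n + 1) ^ k

/-!
The problems with and without a given minimum cover are solved by one program, which ignores the
given cover. It tests whether the maximum degree is at most three and then runs one of two
algorithms. A cover of minimum weight is computed and compared with the budget at the end.

*Arbitrary graphs.* Let a cover with `f` vertices be known; its vertices are undecided at first.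
While some vertex is undecided, select an undecided vertex `v` with the minimum number `m` of
undecided neighbours, and branch on its closed undecided neighbourhood: choosing a member `u`
forces the undecided neighbours of `u` into the cover and leaves `u` itself open. Every cover `A`
that contains the forced vertices survives in some branch: take `u` outside `A` if possible, and
`u = v` if the whole neighbourhood belongs to `A` (`exists_branch`). Each of the `m + 1` branches
decides at least `m + 1` vertices, and `m + 1 ≤ 1.443 ^ (m + 1)`, so up to polynomial factors
there are `1.443 ^ f` branches (`branch_time`, `tri_branch`). At a leaf the chosen vertices are
independent, as are the vertices outside the known cover; so the vertices that are not forced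
induce a bipartite graph, in which a cover of minimum weight is a minimum cut
(`cover_of_min_cut`). The cut comes from a push-relabel computation, which only adds, subtracts
and compares capacities: once no node of height at most `n + 1` except the sink has excess, the
nodes above an empty level form a minimum cut (`gap_cut_le`, `ok_cover`). The known cover comes
from iterative compression: adding one vertex at a time gives covers of size at most `t + 1`, and
the same branching with constant weights shrinks each of them to minimum size (`tri_general`).

*Maximum degree three.* The problem is a minimisation over `0`-`1` assignments whose cost is a sum
of costs of pairs of variables, an uncovered edge being charged a big penalty. A variable of
degree at most two can be eliminated, which adds its minimum to the cost of the pair of its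
neighbours and does not increase degrees (`Minimizes.elim`). If all variables have degree three,
branching on the value of one of them removes four variables of degree three
(`card_cubic_fix_le`). At most `2 * t` vertices have degree three (`card_cubic_le`), so there are
at most `2 ^ (2 * t / 4) ≤ 1.415 ^ t` leaves (`tri_network`, `tri_cubic`).

*Good covers.* Let `x` be a vertex of a triangle in a minimum cover, and let `z` be a neighbour of
`x` outside the cover which is not adjacent to both other vertices of the triangle. As `x` has no
further neighbours, exchanging `x` for `z` gives a minimum cover again. This destroys the
triangle, and no new one arises unless `z` is adjacent to both ends of a path component; so in the
absence of such a path the number of vertices in triangles drops (`CubicMin.move`). When no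
exchange is possible, each triangle without a common neighbour leads to such a path, which is the
value of `f` (`exists_target`, `exists_isGoodFor`).

*Programs.* Call-free programs with counted loops have a denotation `Prog.den`, and a run yields
it whenever all values stay bounded (`Prog.exec`). Time and space of such a program are bounded by
polynomials in `n` that depend on its text alone (`isPoly_resources`, `fit_resources`). Tests are
written as first-order formulas with bounded quantifiers (`Fm`) and compiled to nested loops. The
two recursive procedures are treated with triples `Tri`, which add a time bound to a Hoare triple.
-/

namespace RAM

/-! ### Memory contents -/

@[simp] theorem Store.setNat_nat (σ : Store) (a i x b j : ℕ) :
    (σ.setNat a i x).nat b j = if b = a ∧ j = i then x else σ.nat b j := by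
  by_cases h : b = a
  · subst h
    by_cases h' : j = i
    · subst h'; simp [Store.setNat]
    · simp [Store.setNat, h']
  · simp [Store.setNat, h]

@[simp] theorem Store.setNat_nat_of_ne (σ : Store) {a b : ℕ} (i x : ℕ) (h : b ≠ a) :
    (σ.setNat a i x).nat b = σ.nat b := by
  simp [Store.setNat, h]

@[simp] theorem Store.setNat_real (σ : Store) (a i x : ℕ) : (σ.setNat a i x).real = σ.real := rfl

@[simp] theorem Store.setReal_real (σ : Store) (a i : ℕ) (x : ℝ) (b j : ℕ) :
    (σ.setReal a i x).real b j = if b = a ∧ j = i then x else σ.real b j := by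
  by_cases h : b = a
  · subst h
    by_cases h' : j = i
    · subst h'; simp [Store.setReal]
    · simp [Store.setReal, h']
  · simp [Store.setReal, h]

@[simp] theorem Store.setReal_real_of_ne (σ : Store) {a b : ℕ} (i : ℕ) (x : ℝ) (h : b ≠ a) :
    (σ.setReal a i x).real b = σ.real b := by
  simp [Store.setReal, h]

@[simp] theorem Store.setReal_nat (σ : Store) (a i : ℕ) (x : ℝ) :
    (σ.setReal a i x).nat = σ.nat := rfl

/-- The memory contents `σ` and `τ` agree outside the natural-number arrays in `LN` and the real
arrays in `LR`. -/
structure Same (LN LR : List ℕ) (σ τ : Store) : Prop where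
  nat : ∀ (a) (_ : a ∉ LN := by decide), τ.nat a = σ.nat a
  real : ∀ (a) (_ : a ∉ LR := by decide), τ.real a = σ.real a

theorem Same.refl (LN LR : List ℕ) (σ : Store) : Same LN LR σ σ := ⟨fun _ _ => rfl, fun _ _ => rfl⟩

theorem Same.trans {LN LR : List ℕ} {σ τ ρ : Store} (h₁ : Same LN LR σ τ) (h₂ : Same LN LR τ ρ) :
    Same LN LR σ ρ :=
  ⟨fun a ha => (h₂.nat a ha).trans (h₁.nat a ha), fun a ha => (h₂.real a ha).trans (h₁.real a ha)⟩

theorem Same.mono {LN LR LN' LR' : List ℕ} {σ τ : Store} (h : Same LN LR σ τ)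
    (h₁ : LN ⊆ LN') (h₂ : LR ⊆ LR') : Same LN' LR' σ τ :=
  ⟨fun a ha => h.nat a fun h' => ha (h₁ h'), fun a ha => h.real a fun h' => ha (h₂ h')⟩

theorem Same.setNat {LN LR : List ℕ} {σ τ : Store} (h : Same LN LR σ τ) {a : ℕ} (i x : ℕ)
    (ha : a ∈ LN) : Same LN LR σ (τ.setNat a i x) := by
  refine ⟨fun b hb => ?_, fun b hb => h.real b hb⟩
  have hne : b ≠ a := fun e => hb (e ▸ ha)
  rw [Store.setNat_nat_of_ne _ _ _ hne, h.nat b hb]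

theorem Same.setReal {LN LR : List ℕ} {σ τ : Store} (h : Same LN LR σ τ) {a : ℕ} (i : ℕ) (x : ℝ)
    (ha : a ∈ LR) : Same LN LR σ (τ.setReal a i x) := by
  refine ⟨fun b hb => h.nat b hb, fun b hb => ?_⟩
  have hne : b ≠ a := fun e => hb (e ▸ ha)
  rw [Store.setReal_real_of_ne _ _ _ hne, h.real b hb]

/-- All cells are bounded: the natural numbers by `B`, the real numbers in absolute value by `R`. -/
structure Bdd (B : ℕ) (R : ℝ) (σ : Store) : Prop where
  nat : ∀ a i, σ.nat a i ≤ B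
  real : ∀ a i, |σ.real a i| ≤ R

theorem Bdd.setNat {B : ℕ} {R : ℝ} {σ : Store} (h : Bdd B R σ) (a i : ℕ) {x : ℕ} (hx : x ≤ B) :
    Bdd B R (σ.setNat a i x) := by
  refine ⟨fun b j => ?_, h.real⟩
  rw [Store.setNat_nat]; split_ifs
  · exact hx
  · exact h.nat b j

theorem Bdd.setReal {B : ℕ} {R : ℝ} {σ : Store} (h : Bdd B R σ) (a i : ℕ) {x : ℝ} (hx : |x| ≤ R) :
    Bdd B R (σ.setReal a i x) := by
  refine ⟨h.nat, fun b j => ?_⟩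
  rw [Store.setReal_real]; split_ifs
  · exact hx
  · exact h.real b j

/-! ### Expressions -/

instance : Add NExp := ⟨NExp.add⟩
instance : Sub NExp := ⟨NExp.sub⟩
instance : Mul NExp := ⟨NExp.mul⟩
instance (k : ℕ) : OfNat NExp k := ⟨NExp.lit k⟩
instance : Add RExp := ⟨RExp.add⟩
instance : Sub RExp := ⟨RExp.sub⟩

namespace NExp

@[simp] theorem eval_add (σ : Store) (e f : NExp) : (e + f).eval σ = e.eval σ + f.eval σ := rfl
@[simp] theorem eval_sub (σ : Store) (e f : NExp) : (e - f).eval σ = e.eval σ - f.eval σ := rfl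
@[simp] theorem eval_mul (σ : Store) (e f : NExp) : (e * f).eval σ = e.eval σ * f.eval σ := rfl
@[simp] theorem eval_ofNat (σ : Store) (k : ℕ) :
    NExp.eval σ (no_index (OfNat.ofNat k)) = OfNat.ofNat k := rfl
@[simp] theorem eval_zero (σ : Store) : NExp.eval σ 0 = 0 := rfl
@[simp] theorem eval_one (σ : Store) : NExp.eval σ 1 = 1 := rfl
@[simp] theorem eval_get (σ : Store) (a : ℕ) (i : NExp) :
    (NExp.get a i).eval σ = σ.nat a (i.eval σ) := rfl
@[simp] theorem eval_lit (σ : Store) (k : ℕ) : (NExp.lit k).eval σ = k := rfl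

/-- The arrays that an expression reads. -/
def reads : NExp → List ℕ
  | lit _ => []
  | get a i => a :: i.reads
  | add e f => e.reads ++ f.reads
  | sub e f => e.reads ++ f.reads
  | mul e f => e.reads ++ f.reads

/-- A bound for all numbers in the evaluation when all cells are at most `B`. -/
def bnd (B : ℕ) : NExp → ℕ
  | lit k => k
  | get _ i => i.bnd B + B
  | add e f => e.bnd B + f.bnd B
  | sub e f => e.bnd B + f.bnd B
  | mul e f => e.bnd B + f.bnd B + e.bnd B * f.bnd B

theorem eval_congr {σ τ : Store} (e : NExp) (h : ∀ a ∈ e.reads, τ.nat a = σ.nat a) :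
    e.eval τ = e.eval σ := by
  induction e with
  | lit k => rfl
  | get a i ih =>
    simp only [eval_get, ih fun b hb => h b (by simp [reads, hb]), h a (by simp [reads])]
  | add e f ihe ihf =>
    simp only [eval, ihe fun b hb => h b (by simp [reads, hb]),
      ihf fun b hb => h b (by simp [reads, hb])]
  | sub e f ihe ihf =>
    simp only [eval, ihe fun b hb => h b (by simp [reads, hb]),
      ihf fun b hb => h b (by simp [reads, hb])]
  | mul e f ihe ihf =>
    simp only [eval, ihe fun b hb => h b (by simp [reads, hb]),
      ihf fun b hb => h b (by simp [reads, hb])]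

theorem eval_le_bnd {B : ℕ} {R : ℝ} {σ : Store} (h : Bdd B R σ) (e : NExp) :
    e.eval σ ≤ e.bnd B := by
  induction e with
  | lit k => exact le_rfl
  | get a i ih => exact (h.nat a _).trans (Nat.le_add_left _ _)
  | add e f ihe ihf => exact Nat.add_le_add ihe ihf
  | sub e f ihe ihf => simp only [eval, bnd]; omega
  | mul e f ihe ihf => exact (Nat.mul_le_mul ihe ihf).trans (Nat.le_add_left _ _)

theorem fits {B S : ℕ} {R : ℝ} {σ : Store} (h : Bdd B R σ) (e : NExp) (hS : e.bnd B ≤ S) :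
    e.Fits S σ := by
  have key := eval_le_bnd h
  induction e with
  | lit k => exact hS
  | get a i ih =>
    simp only [bnd] at hS
    exact ⟨ih (by omega), (h.nat a _).trans (by omega)⟩
  | add e f ihe ihf =>
    have := key (e.add f)
    simp only [bnd] at hS this
    exact ⟨ihe (by omega), ihf (by omega), by omega⟩
  | sub e f ihe ihf =>
    have := key (e.sub f)
    simp only [bnd] at hS this
    exact ⟨ihe (by omega), ihf (by omega), by omega⟩
  | mul e f ihe ihf =>
    have := key (e.mul f)
    simp only [bnd] at hS this
    exact ⟨ihe (by omega), ihf (by omega), by omega⟩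

end NExp

namespace RExp

@[simp] theorem eval_add (σ : Store) (e f : RExp) : (e + f).eval σ = e.eval σ + f.eval σ := rfl
@[simp] theorem eval_sub (σ : Store) (e f : RExp) : (e - f).eval σ = e.eval σ - f.eval σ := rfl
@[simp] theorem eval_zero (σ : Store) : RExp.zero.eval σ = 0 := rfl
@[simp] theorem eval_get (σ : Store) (a : ℕ) (i : NExp) :
    (RExp.get a i).eval σ = σ.real a (i.eval σ) := rfl

/-- The natural-number arrays that an expression reads. -/
def reads : RExp → List ℕ
  | zero => []
  | get _ i => i.reads
  | add e f => e.reads ++ f.reads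
  | sub e f => e.reads ++ f.reads

/-- The real arrays that an expression reads. -/
def rreads : RExp → List ℕ
  | zero => []
  | get a _ => [a]
  | add e f => e.rreads ++ f.rreads
  | sub e f => e.rreads ++ f.rreads

/-- A bound for all natural numbers in the evaluation when all cells are at most `B`. -/
def bnd (B : ℕ) : RExp → ℕ
  | zero => 0
  | get _ i => i.bnd B
  | add e f => e.bnd B + f.bnd B
  | sub e f => e.bnd B + f.bnd B

/-- The number of leaves, which bounds the growth of the absolute value in the evaluation. -/
def size : RExp → ℕ
  | zero => 1
  | get _ _ => 1
  | add e f => e.size + f.size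
  | sub e f => e.size + f.size

theorem eval_congr {σ τ : Store} (e : RExp) (h : ∀ a ∈ e.reads, τ.nat a = σ.nat a)
    (h' : ∀ a ∈ e.rreads, τ.real a = σ.real a) : e.eval τ = e.eval σ := by
  induction e with
  | zero => rfl
  | get a i => simp only [eval_get, i.eval_congr h, h' a (by simp [rreads])]
  | add e f ihe ihf =>
    simp only [eval, ihe (fun b hb => h b (by simp [reads, hb])) fun b hb => h' b
      (by simp [rreads, hb]), ihf (fun b hb => h b (by simp [reads, hb])) fun b hb => h' b
      (by simp [rreads, hb])]
  | sub e f ihe ihf =>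
    simp only [eval, ihe (fun b hb => h b (by simp [reads, hb])) fun b hb => h' b
      (by simp [rreads, hb]), ihf (fun b hb => h b (by simp [reads, hb])) fun b hb => h' b
      (by simp [rreads, hb])]

theorem abs_eval_le {B : ℕ} {R : ℝ} {σ : Store} (h : Bdd B R σ) (e : RExp) :
    |e.eval σ| ≤ e.size * R := by
  have hR : 0 ≤ R := (abs_nonneg _).trans (h.real 0 0)
  induction e with
  | zero => simpa [size] using hR
  | get a i => simpa [size] using h.real a _
  | add e f ihe ihf =>
    simp only [eval, size]; push_cast; rw [add_mul]
    exact (abs_add_le _ _).trans (add_le_add ihe ihf)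
  | sub e f ihe ihf =>
    simp only [eval, size]; push_cast; rw [add_mul]
    exact (abs_sub _ _).trans (add_le_add ihe ihf)

theorem fits {B S : ℕ} {R R' : ℝ} {σ : Store} (h : Bdd B R σ) (e : RExp) (hS : e.bnd B ≤ S)
    (hR : e.size * R ≤ R') : e.Fits S R' σ := by
  have key := abs_eval_le h
  have h0 : 0 ≤ R := (abs_nonneg _).trans (h.real 0 0)
  induction e with
  | zero => trivial
  | get a i => exact ⟨i.fits h hS, (key (get a i)).trans hR⟩
  | add e f ihe ihf =>
    have hk := (key (add e f)).trans hR
    simp only [size] at hR; push_cast at hR; rw [add_mul] at hR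
    simp only [bnd] at hS
    have h1 : 0 ≤ (e.size : ℝ) * R := by positivity
    have h2 : 0 ≤ (f.size : ℝ) * R := by positivity
    exact ⟨ihe (by omega) (by linarith), ihf (by omega) (by linarith), hk⟩
  | sub e f ihe ihf =>
    have hk := (key (sub e f)).trans hR
    simp only [size] at hR; push_cast at hR; rw [add_mul] at hR
    simp only [bnd] at hS
    have h1 : 0 ≤ (e.size : ℝ) * R := by positivity
    have h2 : 0 ≤ (f.size : ℝ) * R := by positivity
    exact ⟨ihe (by omega) (by linarith), ihf (by omega) (by linarith), hk⟩

end RExp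

namespace BExp

/-- The natural-number arrays that a test reads. -/
def reads : BExp → List ℕ
  | natLe e f => e.reads ++ f.reads
  | realLe e f => e.reads ++ f.reads
  | not b => b.reads
  | and b c => b.reads ++ c.reads

/-- The real arrays that a test reads. -/
def rreads : BExp → List ℕ
  | natLe _ _ => []
  | realLe e f => e.rreads ++ f.rreads
  | not b => b.rreads
  | and b c => b.rreads ++ c.rreads

/-- A bound for all natural numbers in the evaluation when all cells are at most `B`. -/
def bnd (B : ℕ) : BExp → ℕ
  | natLe e f => e.bnd B + f.bnd B
  | realLe e f => e.bnd B + f.bnd B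
  | not b => b.bnd B
  | and b c => b.bnd B + c.bnd B

/-- The number of leaves, which bounds the growth of the absolute value in the evaluation. -/
def size : BExp → ℕ
  | natLe _ _ => 1
  | realLe e f => e.size + f.size
  | not b => b.size
  | and b c => b.size + c.size

@[simp] theorem holds_natLe (σ : Store) (e f : NExp) :
    (natLe e f).Holds σ ↔ e.eval σ ≤ f.eval σ := Iff.rfl
@[simp] theorem holds_realLe (σ : Store) (e f : RExp) :
    (realLe e f).Holds σ ↔ e.eval σ ≤ f.eval σ := Iff.rfl
@[simp] theorem holds_not (σ : Store) (b : BExp) : b.not.Holds σ ↔ ¬ b.Holds σ := Iff.rfl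
@[simp] theorem holds_and (σ : Store) (b c : BExp) :
    (b.and c).Holds σ ↔ b.Holds σ ∧ c.Holds σ := Iff.rfl

/-- The test for equality of two natural numbers. -/
def eq (e f : NExp) : BExp := and (natLe e f) (natLe f e)

/-- The test whether one natural number is less than another. -/
def lt (e f : NExp) : BExp := not (natLe f e)

@[simp] theorem holds_eq (σ : Store) (e f : NExp) : (eq e f).Holds σ ↔ e.eval σ = f.eval σ := by
  simp [eq, le_antisymm_iff]

@[simp] theorem holds_lt (σ : Store) (e f : NExp) : (lt e f).Holds σ ↔ e.eval σ < f.eval σ := by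
  simp [lt]

theorem holds_congr {σ τ : Store} (b : BExp) (h : ∀ a ∈ b.reads, τ.nat a = σ.nat a)
    (h' : ∀ a ∈ b.rreads, τ.real a = σ.real a) : b.Holds τ ↔ b.Holds σ := by
  induction b with
  | natLe e f =>
    simp only [holds_natLe, e.eval_congr fun a ha => h a (by simp [reads, ha]),
      f.eval_congr fun a ha => h a (by simp [reads, ha])]
  | realLe e f =>
    simp only [holds_realLe, e.eval_congr (fun a ha => h a (by simp [reads, ha])) fun a ha =>
      h' a (by simp [rreads, ha]), f.eval_congr (fun a ha => h a (by simp [reads, ha])) fun a ha =>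
      h' a (by simp [rreads, ha])]
  | not b ih => simp only [holds_not, ih h h']
  | and b c ihb ihc =>
    simp only [holds_and, ihb (fun a ha => h a (by simp [reads, ha])) fun a ha =>
      h' a (by simp [rreads, ha]), ihc (fun a ha => h a (by simp [reads, ha])) fun a ha =>
      h' a (by simp [rreads, ha])]

theorem fits {B S : ℕ} {R R' : ℝ} {σ : Store} (h : Bdd B R σ) (b : BExp) (hS : b.bnd B ≤ S)
    (hR : b.size * R ≤ R') : b.Fits S R' σ := by
  have h0 : 0 ≤ R := (abs_nonneg _).trans (h.real 0 0)
  induction b with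
  | natLe e f =>
    simp only [bnd] at hS
    exact ⟨e.fits h (by omega), f.fits h (by omega)⟩
  | realLe e f =>
    simp only [size] at hR; push_cast at hR; rw [add_mul] at hR
    simp only [bnd] at hS
    have h1 : 0 ≤ (e.size : ℝ) * R := by positivity
    have h2 : 0 ≤ (f.size : ℝ) * R := by positivity
    exact ⟨e.fits h (by omega) (by linarith), f.fits h (by omega) (by linarith)⟩
  | not b ih => exact ih hS hR
  | and b c ihb ihc =>
    simp only [size] at hR; push_cast at hR; rw [add_mul] at hR
    simp only [bnd] at hS
    have h1 : 0 ≤ (b.size : ℝ) * R := by positivity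
    have h2 : 0 ≤ (c.size : ℝ) * R := by positivity
    exact ⟨ihb (by omega) (by linarith), ihc (by omega) (by linarith)⟩

end BExp

/-! ### Call-free programs whose loops are counted -/

/-- Call-free programs whose only loops are counted loops. `loop x N p` runs `p` with cell `0` of
array `x` equal to `0, …, N - 1`. -/
inductive Prog where
  | skip
  | setN (a : ℕ) (i e : NExp)
  | setR (a : ℕ) (i : NExp) (r : RExp)
  | seq (p q : Prog)
  | ite (b : BExp) (p q : Prog)
  | loop (x : ℕ) (N : NExp) (p : Prog)

namespace Prog

/-- The machine program. -/
def cmd : Prog → Cmd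
  | skip => .skip
  | setN a i e => .setNat a i e
  | setR a i r => .setReal a i r
  | seq p q => .seq p.cmd q.cmd
  | ite b p q => .ite b p.cmd q.cmd
  | loop x N p => .seq (.setNat x 0 0)
      (.while (.not (.natLe N (.get x 0))) (.seq p.cmd (.setNat x 0 (.get x 0 + 1))))

open Classical in
/-- The memory content that results from a run. -/
noncomputable def den : Prog → Store → Store
  | skip, σ => σ
  | setN a i e, σ => σ.setNat a (i.eval σ) (e.eval σ)
  | setR a i r, σ => σ.setReal a (i.eval σ) (r.eval σ)
  | seq p q, σ => q.den (p.den σ)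
  | ite b p q, σ => if b.Holds σ then p.den σ else q.den σ
  | loop x N p, σ => Nat.rec (motive := fun _ => Store) (σ.setNat x 0 0)
      (fun i τ => (p.den τ).setNat x 0 (i + 1)) (N.eval σ)

/-- The memory content after `i` rounds of a loop. -/
noncomputable def iter (x : ℕ) (p : Prog) (σ : Store) : ℕ → Store
  | 0 => σ.setNat x 0 0
  | i + 1 => (p.den (iter x p σ i)).setNat x 0 (i + 1)

theorem den_loop (x : ℕ) (N : NExp) (p : Prog) (σ : Store) :
    (loop x N p).den σ = iter x p σ (N.eval σ) := by
  simp only [den]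
  induction N.eval σ with
  | zero => rfl
  | succ k ih => simp only [iter, ih]

/-- Every value that the run stores is at most `B` (natural numbers) or `R` (absolute values of real
numbers). -/
def Safe (B : ℕ) (R : ℝ) : Prog → Store → Prop
  | skip, _ => True
  | setN _ _ e, σ => e.eval σ ≤ B
  | setR _ _ r, σ => |r.eval σ| ≤ R
  | seq p q, σ => p.Safe B R σ ∧ q.Safe B R (p.den σ)
  | ite b p q, σ => (b.Holds σ → p.Safe B R σ) ∧ (¬ b.Holds σ → q.Safe B R σ)
  | loop x N p, σ => N.eval σ ≤ B ∧ ∀ i < N.eval σ, p.Safe B R (iter x p σ i)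

/-- The natural-number arrays that the program writes. -/
def wN : Prog → List ℕ
  | skip => []
  | setN a _ _ => [a]
  | setR _ _ _ => []
  | seq p q => p.wN ++ q.wN
  | ite _ p q => p.wN ++ q.wN
  | loop x _ p => x :: p.wN

/-- The real arrays that the program writes. -/
def wR : Prog → List ℕ
  | skip => []
  | setN _ _ _ => []
  | setR a _ _ => [a]
  | seq p q => p.wR ++ q.wR
  | ite _ p q => p.wR ++ q.wR
  | loop _ _ p => p.wR

/-- No loop changes its own counter or its own bound. -/
def wf : Prog → Bool
  | skip => true
  | setN _ _ _ => true
  | setR _ _ _ => true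
  | seq p q => p.wf && q.wf
  | ite _ p q => p.wf && q.wf
  | loop x N p => p.wf && !p.wN.contains x && N.reads.all fun a => !(x :: p.wN).contains a

/-- A bound for the number of steps when all cells are at most `B`. -/
def time (B : ℕ) : Prog → ℕ
  | skip => 1
  | setN _ i e => i.cost + e.cost + 1
  | setR _ i r => i.cost + r.cost + 1
  | seq p q => p.time B + q.time B
  | ite b p q => b.cost + 1 + p.time B + q.time B
  | loop _ N p => (B + 1) * (p.time B + N.cost + 20) + N.cost + 20

/-- A bound for all natural numbers in a run when all cells are at most `B`. -/
def space (B : ℕ) : Prog → ℕ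
  | skip => 0
  | setN _ i e => i.bnd B + e.bnd B
  | setR _ i r => i.bnd B + r.bnd B
  | seq p q => p.space B + q.space B
  | ite b p q => b.bnd B + p.space B + q.space B
  | loop _ N p => N.bnd B + p.space B + B + 1

/-- A bound for the growth of absolute values within the evaluation of expressions. -/
def size : Prog → ℕ
  | skip => 1
  | setN _ _ _ => 1
  | setR _ _ r => r.size
  | seq p q => p.size + q.size
  | ite b p q => b.size + p.size + q.size
  | loop _ _ p => p.size + 1

theorem same_den (p : Prog) : ∀ σ, Same p.wN p.wR σ (p.den σ) := by
  induction p with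
  | skip => exact fun σ => Same.refl _ _ σ
  | setN a i e => exact fun σ => (Same.refl _ _ σ).setNat _ _ (by simp [wN])
  | setR a i r => exact fun σ => (Same.refl _ _ σ).setReal _ _ (by simp [wR])
  | seq p q ihp ihq =>
    exact fun σ => ((ihp σ).mono (by simp [wN]) (by simp [wR])).trans
      ((ihq _).mono (by simp [wN]) (by simp [wR]))
  | ite b p q ihp ihq =>
    intro σ
    by_cases h : b.Holds σ
    · simp only [den, h, if_true]; exact (ihp σ).mono (by simp [wN]) (by simp [wR])
    · simp only [den, h, if_false]; exact (ihq σ).mono (by simp [wN]) (by simp [wR])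
  | loop x N p ih =>
    intro σ
    rw [den_loop]
    induction N.eval σ with
    | zero => exact (Same.refl _ _ σ).setNat _ _ (by simp [wN])
    | succ k ihk =>
      exact (ihk.trans ((ih _).mono (by simp [wN]) (by simp [wR]))).setNat _ _ (by simp [wN])

theorem same_iter (x : ℕ) (p : Prog) (σ : Store) (i : ℕ) :
    Same (x :: p.wN) p.wR σ (iter x p σ i) := by
  induction i with
  | zero => exact (Same.refl _ _ σ).setNat _ _ (by simp)
  | succ k ih =>
    exact (ih.trans ((same_den p _).mono (by simp) (by simp))).setNat _ _ (by simp)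

theorem iter_nat (x : ℕ) (p : Prog) (σ : Store) (i : ℕ) : (iter x p σ i).nat x 0 = i := by
  cases i <;> simp [iter]

theorem wf_loop {x : ℕ} {N : NExp} {p : Prog} (h : (loop x N p).wf = true) :
    p.wf = true ∧ x ∉ p.wN ∧ ∀ a ∈ N.reads, a ∉ x :: p.wN := by
  simpa [wf, and_assoc] using h

theorem eval_iter {x : ℕ} {N : NExp} {p : Prog} (h : (loop x N p).wf = true) (σ : Store) (i : ℕ) :
    N.eval (iter x p σ i) = N.eval σ :=
  N.eval_congr fun a ha => (same_iter x p σ i).nat a ((wf_loop h).2.2 a ha)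

theorem bdd_den {B : ℕ} {R : ℝ} (p : Prog) (hw : p.wf = true) :
    ∀ σ, Bdd B R σ → p.Safe B R σ → Bdd B R (p.den σ) := by
  induction p with
  | skip => exact fun σ h _ => h
  | setN a i e => exact fun σ h hs => h.setNat _ _ hs
  | setR a i r => exact fun σ h hs => h.setReal _ _ hs
  | seq p q ihp ihq =>
    simp only [wf, Bool.and_eq_true] at hw
    exact fun σ h hs => ihq hw.2 _ (ihp hw.1 σ h hs.1) hs.2
  | ite b p q ihp ihq =>
    simp only [wf, Bool.and_eq_true] at hw
    intro σ h hs
    by_cases hb : b.Holds σ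
    · simp only [den, hb, if_true]; exact ihp hw.1 σ h (hs.1 hb)
    · simp only [den, hb, if_false]; exact ihq hw.2 σ h (hs.2 hb)
  | loop x N p ih =>
    intro σ h hs
    rw [den_loop]
    have : ∀ i ≤ N.eval σ, Bdd B R (iter x p σ i) := by
      intro i
      induction i with
      | zero => exact fun _ => h.setNat _ _ (Nat.zero_le _)
      | succ k ihk =>
        intro hk
        exact (ih (wf_loop hw).1 _ (ihk (by omega)) (hs.2 k hk)).setNat _ _ (hk.trans hs.1)
    exact this _ le_rfl

theorem bdd_iter {B : ℕ} {R : ℝ} {x : ℕ} {N : NExp} {p : Prog}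
    (hw : (loop x N p).wf = true) {σ : Store} (h : Bdd B R σ) (hs : (loop x N p).Safe B R σ)
    {i : ℕ} (hi : i ≤ N.eval σ) : Bdd B R (iter x p σ i) := by
  induction i with
  | zero => exact h.setNat _ _ (Nat.zero_le _)
  | succ k ihk =>
    exact (bdd_den p (wf_loop hw).1 _ (ihk (by omega)) (hs.2 k hi)).setNat _ _ (hi.trans hs.1)

/-- A safe program runs within its static bounds. -/
theorem exec {procs : List Cmd} {B S d : ℕ} {R R' : ℝ} (p : Prog) (hw : p.wf = true)
    (hS : p.space B ≤ S) (hR : p.size * R ≤ R') : ∀ σ, Bdd B R σ → p.Safe B R σ →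
    ∃ t ≤ p.time B, Exec procs S R' d p.cmd σ t (p.den σ) := by
  induction p with
  | skip => exact fun σ _ _ => ⟨1, le_rfl, .skip _ _⟩
  | setN a i e =>
    simp only [space] at hS
    exact fun σ h _ => ⟨_, le_rfl, .setNat _ _ _ _ _ (i.fits h (by omega)) (e.fits h (by omega))⟩
  | setR a i r =>
    simp only [space] at hS
    exact fun σ h _ => ⟨_, le_rfl,
      .setReal _ _ _ _ _ (i.fits h (by omega)) (r.fits h (by omega) hR)⟩
  | seq p q ihp ihq =>
    intro σ h hs
    have h0 : 0 ≤ R := (abs_nonneg _).trans (h.real 0 0)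
    simp only [space] at hS
    simp only [size] at hR; push_cast at hR; rw [add_mul] at hR
    simp only [wf, Bool.and_eq_true] at hw
    have h1 : 0 ≤ (p.size : ℝ) * R := by positivity
    have h2 : 0 ≤ (q.size : ℝ) * R := by positivity
    obtain ⟨t₁, ht₁, e₁⟩ := ihp hw.1 (by omega) (by linarith) σ h hs.1
    obtain ⟨t₂, ht₂, e₂⟩ := ihq hw.2 (by omega) (by linarith) _ (bdd_den p hw.1 σ h hs.1) hs.2
    exact ⟨t₁ + t₂, Nat.add_le_add ht₁ ht₂, .seq e₁ e₂⟩
  | ite b p q ihp ihq =>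
    intro σ h hs
    have h0 : 0 ≤ R := (abs_nonneg _).trans (h.real 0 0)
    simp only [space] at hS
    simp only [size] at hR; push_cast at hR; rw [add_mul, add_mul] at hR
    simp only [wf, Bool.and_eq_true] at hw
    have h1 : 0 ≤ (p.size : ℝ) * R := by positivity
    have h2 : 0 ≤ (q.size : ℝ) * R := by positivity
    have h3 : 0 ≤ (b.size : ℝ) * R := by positivity
    have hf := b.fits h (S := S) (R' := R') (by omega) (by linarith)
    by_cases hb : b.Holds σ
    · obtain ⟨t₁, ht₁, e₁⟩ := ihp hw.1 (by omega) (by linarith) σ h (hs.1 hb)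
      simp only [den, hb, if_true]
      exact ⟨b.cost + 1 + t₁, by simp only [time]; omega, .iteTrue hf hb e₁⟩
    · obtain ⟨t₁, ht₁, e₁⟩ := ihq hw.2 (by omega) (by linarith) σ h (hs.2 hb)
      simp only [den, hb, if_false]
      exact ⟨b.cost + 1 + t₁, by simp only [time]; omega, .iteFalse hf hb e₁⟩
  | loop x N p ih =>
    intro σ h hs
    have h0 : 0 ≤ R := (abs_nonneg _).trans (h.real 0 0)
    simp only [space] at hS
    simp only [size] at hR; push_cast at hR; rw [add_mul] at hR
    have hfit : ∀ i ≤ N.eval σ,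
        (BExp.not (.natLe N (.get x 0))).Fits S R' (iter x p σ i) := by
      intro i hi
      have hb := bdd_iter hw h hs hi
      refine ⟨N.fits hb (by omega), NExp.fits hb _ ?_⟩
      show 0 + B ≤ S
      omega
    have hsum : ∀ k i, i + k = N.eval σ → ∃ t ≤ k * (p.time B + N.cost + 20) + N.cost + 10,
        Exec procs S R' d (.while (.not (.natLe N (.get x 0)))
          (.seq p.cmd (.setNat x 0 (.get x 0 + 1)))) (iter x p σ i) t
          (iter x p σ (N.eval σ)) := by
      intro k
      induction k with
      | zero =>
        intro i hi
        obtain rfl : i = N.eval σ := by omega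
        refine ⟨_, ?_, .whileFalse (hfit _ le_rfl) ?_⟩
        · simp [BExp.cost, NExp.cost]
        · simp [eval_iter hw, iter_nat]
      | succ k ihk =>
        intro i hi
        obtain ⟨t₂, ht₂, e₂⟩ := ihk (i + 1) (by omega)
        have hb := bdd_iter hw h hs (i := i) (by omega)
        obtain ⟨t₁, ht₁, e₁⟩ := ih (wf_loop hw).1 (by omega) (by linarith) _ hb
          (hs.2 i (by omega))
        have hx : (p.den (iter x p σ i)).nat x 0 = i := by
          rw [(same_den p _).nat x (wf_loop hw).2.1, iter_nat]
        have hb' := bdd_den p (wf_loop hw).1 _ hb (hs.2 i (by omega))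
        have e₃ : Exec procs S R' d (.setNat x 0 (.get x 0 + 1)) (p.den (iter x p σ i)) _ _ :=
          .setNat _ _ _ _ _ (NExp.fits hb' 0 (Nat.zero_le _))
            (NExp.fits hb' _ (by show 0 + B + 1 ≤ S; omega))
        have e₄ := Exec.whileTrue (hfit i (by omega))
          (by simp [eval_iter hw, iter_nat]; omega) (.seq e₁ e₃)
          (show Exec procs S R' d _ _ t₂ _ from by
            simpa [iter, hx] using e₂)
        refine ⟨_, ?_, e₄⟩
        simp only [BExp.cost, NExp.cost]
        have : (k + 1) * (p.time B + N.cost + 20) =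
          k * (p.time B + N.cost + 20) + (p.time B + N.cost + 20) := by ring
        omega
    obtain ⟨t, ht, e⟩ := hsum (N.eval σ) 0 (by omega)
    refine ⟨3 + t, ?_, ?_⟩
    · simp only [time]
      have := hs.1
      have : N.eval σ * (p.time B + N.cost + 20) ≤ (B + 1) * (p.time B + N.cost + 20) :=
        Nat.mul_le_mul_right _ (by omega)
      omega
    · rw [den_loop]
      exact .seq (t₁ := 3) (.setNat _ _ _ _ _ (NExp.fits h 0 (Nat.zero_le _))
        (NExp.fits h 0 (Nat.zero_le _))) e

end Prog

open Prog

/-! ### Reasoning about call-free programs -/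

/-- The program `p` is safe at `σ` and leads to a memory content with property `Q`. -/
def Ok (B : ℕ) (R : ℝ) (p : Prog) (σ : Store) (Q : Store → Prop) : Prop :=
  p.Safe B R σ ∧ Q (p.den σ)

section Ok

variable {B : ℕ} {R : ℝ} {p q : Prog} {σ : Store} {Q Q' : Store → Prop}

theorem Ok.mono (h : Ok B R p σ Q) (h' : ∀ τ, Same p.wN p.wR σ τ → Q τ → Q' τ) : Ok B R p σ Q' :=
  ⟨h.1, h' _ (p.same_den σ) h.2⟩

theorem ok_skip : Ok B R .skip σ Q ↔ Q σ := by simp [Ok, Safe, den]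

theorem ok_setN {a : ℕ} {i e : NExp} :
    Ok B R (.setN a i e) σ Q ↔ e.eval σ ≤ B ∧ Q (σ.setNat a (i.eval σ) (e.eval σ)) := Iff.rfl

theorem ok_setR {a : ℕ} {i : NExp} {r : RExp} :
    Ok B R (.setR a i r) σ Q ↔ |r.eval σ| ≤ R ∧ Q (σ.setReal a (i.eval σ) (r.eval σ)) := Iff.rfl

theorem ok_seq : Ok B R (.seq p q) σ Q ↔ Ok B R p σ fun τ => Ok B R q τ Q := by
  simp only [Ok, Safe, den, and_assoc]

theorem ok_ite {b : BExp} :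
    Ok B R (.ite b p q) σ Q ↔ (b.Holds σ → Ok B R p σ Q) ∧ (¬ b.Holds σ → Ok B R q σ Q) := by
  by_cases h : b.Holds σ <;> simp [Ok, Safe, den, h]

theorem Ok.seq (h : Ok B R p σ Q') (h' : ∀ τ, Same p.wN p.wR σ τ → Q' τ → Ok B R q τ Q) :
    Ok B R (.seq p q) σ Q :=
  ok_seq.2 (h.mono h')

/-- The invariant rule for counted loops. -/
theorem Ok.loop {x : ℕ} {N : NExp} (I : ℕ → Store → Prop)
    (hN : N.eval σ ≤ B) (h0 : I 0 (σ.setNat x 0 0))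
    (hs : ∀ i < N.eval σ, ∀ τ, Same (x :: p.wN) p.wR σ τ → τ.nat x 0 = i → I i τ →
      Ok B R p τ fun τ' => I (i + 1) (τ'.setNat x 0 (i + 1))) :
    Ok B R (.loop x N p) σ (I (N.eval σ)) := by
  have key : ∀ i ≤ N.eval σ, I i (iter x p σ i) ∧ ∀ j < i, p.Safe B R (iter x p σ j) := by
    intro i
    induction i with
    | zero => exact fun _ => ⟨h0, by simp⟩
    | succ k ih =>
      intro hk
      obtain ⟨h₁, h₂⟩ := ih (by omega)
      obtain ⟨h₃, h₄⟩ := hs k (by omega) _ (same_iter x p σ k) (iter_nat x p σ k) h₁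
      refine ⟨h₄, fun j hj => ?_⟩
      rcases Nat.lt_succ_iff_lt_or_eq.1 hj with h | rfl
      · exact h₂ j h
      · exact h₃
  obtain ⟨h₁, h₂⟩ := key _ le_rfl
  exact ⟨⟨hN, h₂⟩, by rw [den_loop]; exact h₁⟩

end Ok

/-! ### Bounded first-order formulas -/

/-- First-order formulas over the memory. The quantifier of `ex x c φ` ranges over the values below
`n + c` of cell `0` of array `x`, where `n` is the content of cell `0` of array `0`. -/
inductive Fm where
  | base (b : BExp)
  | neg (φ : Fm)
  | conj (φ ψ : Fm)
  | ex (x c : ℕ) (φ : Fm)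

namespace Fm

/-- The truth value. -/
def Holds : Fm → Store → Prop
  | base b, σ => b.Holds σ
  | neg φ, σ => ¬ φ.Holds σ
  | conj φ ψ, σ => φ.Holds σ ∧ ψ.Holds σ
  | ex x c φ, σ => ∃ i < σ.nat 0 0 + c, φ.Holds (σ.setNat x 0 i)

@[simp] theorem holds_base (σ : Store) (b : BExp) : (base b).Holds σ ↔ b.Holds σ := Iff.rfl
@[simp] theorem holds_neg (σ : Store) (φ : Fm) : (neg φ).Holds σ ↔ ¬ φ.Holds σ := Iff.rfl
@[simp] theorem holds_conj (σ : Store) (φ ψ : Fm) :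
    (conj φ ψ).Holds σ ↔ φ.Holds σ ∧ ψ.Holds σ := Iff.rfl
@[simp] theorem holds_ex (σ : Store) (x c : ℕ) (φ : Fm) :
    (ex x c φ).Holds σ ↔ ∃ i < σ.nat 0 0 + c, φ.Holds (σ.setNat x 0 i) := Iff.rfl

/-- The universal quantifier. -/
def all (x c : ℕ) (φ : Fm) : Fm := neg (ex x c (neg φ))

/-- The disjunction. -/
def or (φ ψ : Fm) : Fm := neg (conj (neg φ) (neg ψ))

@[simp] theorem holds_all (σ : Store) (x c : ℕ) (φ : Fm) :
    (all x c φ).Holds σ ↔ ∀ i < σ.nat 0 0 + c, φ.Holds (σ.setNat x 0 i) := by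
  simp [all]

@[simp] theorem holds_or (σ : Store) (φ ψ : Fm) :
    (or φ ψ).Holds σ ↔ φ.Holds σ ∨ ψ.Holds σ := by
  simp only [or, holds_neg, holds_conj]; tauto

/-- The quantified variables. -/
def bvars : Fm → List ℕ
  | base _ => []
  | neg φ => φ.bvars
  | conj φ ψ => φ.bvars ++ ψ.bvars
  | ex x _ φ => x :: φ.bvars

/-- The arrays on which the truth value depends. -/
def fv : Fm → List ℕ
  | base b => b.reads
  | neg φ => φ.fv
  | conj φ ψ => φ.fv ++ ψ.fv
  | ex x _ φ => 0 :: φ.fv.filter fun a => a != x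

/-- The quantified variables are used properly. -/
def ok : Fm → Bool
  | base b => !b.reads.contains 6
  | neg φ => φ.ok
  | conj φ ψ => φ.ok && ψ.ok && ψ.fv.all fun a => !φ.bvars.contains a
  | ex x c φ => φ.ok && !φ.bvars.contains x && x != 0 && x != 6 && Nat.ble c 5 &&
      φ.fv.all fun a => !φ.bvars.contains a

/-- The program that writes the truth value into cell `0` of array `6`. -/
def prog : Fm → Prog
  | base b => .ite b (.setN 6 0 1) (.setN 6 0 0)
  | neg φ => .seq φ.prog (.setN 6 0 (1 - .get 6 0))
  | conj φ ψ => .seq φ.prog (.ite (.natLe 1 (.get 6 0)) ψ.prog .skip)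
  | ex x c φ => .seq (.setN 6 (.lit (x + 1)) 0) (.seq (.loop x (.get 0 0 + .lit c)
      (.seq φ.prog (.ite (.natLe 1 (.get 6 0)) (.setN 6 (.lit (x + 1)) 1) .skip)))
      (.setN 6 0 (.get 6 (.lit (x + 1)))))

/-- The memory contents differ at most in array `6` and in the cells `0` of the arrays in `L`. -/
structure Agree (L : List ℕ) (σ τ : Store) : Prop where
  nat : ∀ a j, a ≠ 6 → (j ≠ 0 ∨ a ∉ L) → τ.nat a j = σ.nat a j
  real : τ.real = σ.real

theorem Agree.setNat {L : List ℕ} {σ τ : Store} (h : Agree L σ τ) (x i : ℕ) :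
    Agree (L.filter fun a => a != x) (σ.setNat x 0 i) (τ.setNat x 0 i) := by
  refine ⟨fun a j h6 hj => ?_, h.real⟩
  simp only [Store.setNat_nat]
  split_ifs with hx
  · rfl
  · refine h.nat a j h6 ?_
    by_cases h0 : j = 0
    · refine .inr fun ha => ?_
      rcases hj with hj | hj
      · exact hj h0
      · exact hj (by simpa [ha] using fun h' => hx ⟨h', h0⟩)
    · exact .inl h0

/-- The truth value depends only on the free arrays. -/
theorem holds_congr (φ : Fm) : ∀ {L : List ℕ} {σ τ : Store}, φ.ok = true → (0 ∉ L) →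
    (∀ a ∈ φ.fv, a ∉ L) → Agree L σ τ → (φ.Holds τ ↔ φ.Holds σ) := by
  induction φ with
  | base b =>
    intro L σ τ ho _ hL h
    refine b.holds_congr (fun a ha => funext fun j => h.nat a j ?_ (.inr (hL a ha)))
      fun a _ => by rw [h.real]
    rintro rfl
    simp [ok, ha] at ho
  | neg φ ih => exact fun ho h0 hL h => not_congr (ih ho h0 hL h)
  | conj φ ψ ih₁ ih₂ =>
    intro L σ τ ho h0 hL h
    simp only [ok, Bool.and_eq_true] at ho
    exact and_congr (ih₁ ho.1.1 h0 (fun a ha => hL a (by simp [fv, ha])) h)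
      (ih₂ ho.1.2 h0 (fun a ha => hL a (by simp [fv, ha])) h)
  | ex x c φ ih =>
    intro L σ τ ho h0 hL h
    simp only [ok, Bool.and_eq_true] at ho
    simp only [holds_ex, h.nat 0 0 (by decide) (.inr h0)]
    refine exists_congr fun i => and_congr_right fun _ =>
      ih ho.1.1.1.1.1 (by simp [h0]) (fun a ha h' => ?_) (h.setNat x i)
    simp only [List.mem_filter, bne_iff_ne] at h'
    exact hL a (by simp [fv, ha, h'.2]) h'.1

theorem zero_notMem_bvars (φ : Fm) (h : φ.ok = true) : 0 ∉ φ.bvars := by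
  induction φ with
  | base b => simp [bvars]
  | neg φ ih => exact ih h
  | conj φ ψ ih₁ ih₂ =>
    simp only [ok, Bool.and_eq_true] at h
    simp [bvars, ih₁ h.1.1, ih₂ h.1.2]
  | ex x c φ ih =>
    simp only [ok, Bool.and_eq_true, bne_iff_ne] at h
    simp [bvars, ih h.1.1.1.1.1, Ne.symm h.1.1.1.2]

theorem ex_ok {x c : ℕ} {φ : Fm} (h : (ex x c φ).ok = true) :
    φ.ok = true ∧ x ∉ φ.bvars ∧ x ≠ 0 ∧ x ≠ 6 ∧ c ≤ 5 ∧ ∀ a ∈ φ.fv, a ∉ φ.bvars := by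
  simpa [ok, and_assoc] using h

theorem Agree.trans {L : List ℕ} {σ τ ρ : Store} (h₁ : Agree L σ τ) (h₂ : Agree L τ ρ) :
    Agree L σ ρ :=
  ⟨fun a j h h' => (h₂.nat a j h h').trans (h₁.nat a j h h'), h₂.real.trans h₁.real⟩

theorem Agree.mono {L L' : List ℕ} {σ τ : Store} (h : Agree L σ τ) (hL : L ⊆ L') :
    Agree L' σ τ :=
  ⟨fun a j h6 hj => h.nat a j h6 (hj.imp_right fun h' h'' => h' (hL h'')), h.real⟩

theorem Agree.set_six {L : List ℕ} {σ τ : Store} (h : Agree L σ τ) (i v : ℕ) :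
    Agree L σ (τ.setNat 6 i v) :=
  ⟨fun a j h6 hj => by rw [Store.setNat_nat_of_ne _ _ _ h6]; exact h.nat a j h6 hj, h.real⟩

theorem Agree.set_mem {L : List ℕ} {σ τ : Store} (h : Agree L σ τ) {x : ℕ} (hx : x ∈ L) (v : ℕ) :
    Agree L σ (τ.setNat x 0 v) := by
  refine ⟨fun a j h6 hj => ?_, h.real⟩
  rw [Store.setNat_nat, if_neg]
  · exact h.nat a j h6 hj
  · rintro ⟨rfl, rfl⟩; simp [hx] at hj

open Classical in
/-- The program of a formula computes its truth value. -/
theorem ok_prog {B : ℕ} {R : ℝ} (φ : Fm) : ∀ {σ : Store}, φ.ok = true → σ.nat 0 0 + 5 ≤ B →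
    Ok B R φ.prog σ fun τ => τ.nat 6 0 = (if φ.Holds σ then 1 else 0) ∧ Agree φ.bvars σ τ ∧
      ∀ j ∉ φ.bvars, τ.nat 6 (j + 1) = σ.nat 6 (j + 1) := by
  induction φ with
  | base b =>
    intro σ _ hB
    simp only [prog, ok_ite, ok_setN, NExp.eval_zero, NExp.eval_one, holds_base]
    refine ⟨fun h => ⟨by omega, by simp [h], ?_, by simp⟩,
      fun h => ⟨by omega, by simp [h], ?_, by simp⟩⟩ <;>
    exact Agree.set_six ⟨fun _ _ _ _ => rfl, rfl⟩ _ _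
  | neg φ ih =>
    intro σ ho hB
    refine (ih ho hB).seq fun τ _ ⟨h₁, h₂, h₃⟩ => ?_
    rw [ok_setN]
    refine ⟨by simp only [NExp.eval_sub, NExp.eval_one]; omega, ?_, h₂.set_six _ _, ?_⟩
    · by_cases h : φ.Holds σ <;> simp [h₁, h]
    · intro j hj
      simpa using h₃ j hj
  | conj φ ψ ih₁ ih₂ =>
    intro σ ho hB
    simp only [ok, Bool.and_eq_true, List.all_eq_true, Bool.not_eq_true', List.contains_eq_mem,
      decide_eq_false_iff_not] at ho
    refine (ih₁ ho.1.1 hB).seq fun τ _ ⟨h₁, h₂, h₃⟩ => ?_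
    have h00 : τ.nat 0 0 = σ.nat 0 0 :=
      h₂.nat 0 0 (by decide) (.inr (zero_notMem_bvars _ ho.1.1))
    have hψ : ψ.Holds τ ↔ ψ.Holds σ :=
      ψ.holds_congr ho.1.2 (zero_notMem_bvars _ ho.1.1) ho.2 h₂
    rw [ok_ite]
    constructor
    · intro hb
      have hφ : φ.Holds σ := by
        by_contra h; simp [h₁, h] at hb
      refine (ih₂ ho.1.2 (h00 ▸ hB)).mono fun ρ _ ⟨k₁, k₂, k₃⟩ => ⟨?_, ?_, fun j hj => ?_⟩
      · simp [k₁, hψ, hφ]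
      · exact (h₂.mono (by simp [bvars])).trans (k₂.mono (by simp [bvars]))
      · simp only [bvars, List.mem_append, not_or] at hj
        rw [k₃ j hj.2, h₃ j hj.1]
    · intro hb
      have hφ : ¬ φ.Holds σ := by
        intro h; simp [h₁, h] at hb
      rw [ok_skip]
      refine ⟨by simp [h₁, hφ], h₂.mono (by simp [bvars]), fun j hj => ?_⟩
      simp only [bvars, List.mem_append, not_or] at hj
      exact h₃ j hj.1
  | ex x c φ ih =>
    intro σ ho hB
    obtain ⟨o₁, o₂, o₃, o₄, o₅, o₆⟩ := ex_ok ho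
    have hb0 := zero_notMem_bvars _ o₁
    simp only [prog, ok_seq, ok_setN]
    refine ⟨by simp, ?_⟩
    set σ₁ := σ.setNat 6 (NExp.eval σ (.lit (x + 1))) (NExp.eval σ 0) with hσ₁
    have hs : ∀ i, σ₁.nat 6 (i + 1) = if i = x then 0 else σ.nat 6 (i + 1) := by
      intro i; simp [hσ₁]
    have ha : Agree (x :: φ.bvars) σ σ₁ := Agree.set_six ⟨fun _ _ _ _ => rfl, rfl⟩ _ _
    have h0 : σ₁.nat 0 0 = σ.nat 0 0 := by simp [hσ₁]
    clear_value σ₁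
    refine (Ok.loop (fun i τ => (τ.nat 6 (x + 1) =
        if ∃ j < i, φ.Holds (σ.setNat x 0 j) then 1 else 0) ∧ Agree (x :: φ.bvars) σ τ ∧
        ∀ j ∉ x :: φ.bvars, τ.nat 6 (j + 1) = σ.nat 6 (j + 1)) ?_ ?_ ?_).mono ?_
    · simp [h0]; omega
    · refine ⟨by simp [o₄.symm, hs], ha.set_mem (by simp) _, fun j hj => ?_⟩
      simp only [List.mem_cons, not_or] at hj
      simp [o₄.symm, hs, hj.1]
    · intro i hi τ _ hτi ⟨h₁, h₂, h₃⟩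
      have h00 : τ.nat 0 0 = σ.nat 0 0 := h₂.nat 0 0 (by decide) (.inr (by simp [o₃.symm, hb0]))
      have hφ : φ.Holds τ ↔ φ.Holds (σ.setNat x 0 i) := by
        refine φ.holds_congr o₁ hb0 o₆ ⟨fun a j h6 hj => ?_, h₂.real⟩
        rw [Store.setNat_nat]
        split_ifs with hx
        · rw [hx.1, hx.2, hτi]
        · refine h₂.nat a j h6 ?_
          by_cases hj0 : j = 0
          · subst hj0
            simp only [and_true] at hx
            simp only [ne_eq, not_true_eq_false, false_or] at hj
            simp [hx, hj]
          · exact .inl hj0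
      refine (ih o₁ (h00 ▸ hB)).seq fun ρ _ ⟨k₁, k₂, k₃⟩ => ?_
      have k₄ : Agree (x :: φ.bvars) σ ρ := h₂.trans (k₂.mono (by simp))
      have k₅ : ∀ j ∉ x :: φ.bvars, ρ.nat 6 (j + 1) = σ.nat 6 (j + 1) := fun j hj => by
        rw [k₃ j fun h => hj (by simp [h]), h₃ j hj]
      rw [ok_ite]
      have hex : (∃ j < i + 1, φ.Holds (σ.setNat x 0 j)) ↔
          φ.Holds (σ.setNat x 0 i) ∨ ∃ j < i, φ.Holds (σ.setNat x 0 j) := by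
        constructor
        · rintro ⟨j, hj, h⟩
          rcases Nat.lt_succ_iff_lt_or_eq.1 hj with hj | rfl
          · exact .inr ⟨j, hj, h⟩
          · exact .inl h
        · rintro (h | ⟨j, hj, h⟩)
          · exact ⟨i, by omega, h⟩
          · exact ⟨j, by omega, h⟩
      constructor
      · intro hb
        have hh : φ.Holds (σ.setNat x 0 i) := by
          rw [← hφ]; by_contra h; simp [k₁, h] at hb
        rw [ok_setN]
        refine ⟨by simp; omega, ?_, (k₄.set_six _ _).set_mem (by simp) _, fun j hj => ?_⟩
        · rw [if_pos (hex.2 (.inl hh))]; simp [o₄.symm]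
        · have := k₅ j hj
          simp only [List.mem_cons, not_or] at hj
          simp [o₄.symm, hj.1, this]
      · intro hb
        have hh : ¬ φ.Holds (σ.setNat x 0 i) := by
          rw [← hφ]; intro h; simp [k₁, h] at hb
        rw [ok_skip]
        refine ⟨?_, k₄.set_mem (by simp) _, fun j hj => ?_⟩
        · rw [Store.setNat_nat_of_ne _ _ _ o₄.symm, k₃ x o₂, h₁]
          simp only [hex, hh, false_or]
        · rw [Store.setNat_nat_of_ne _ _ _ o₄.symm, k₅ j hj]
    · intro τ _ ⟨h₁, h₂, h₃⟩
      have hN : NExp.eval σ₁ (.get 0 0 + .lit c) = σ.nat 0 0 + c := by simp [h0]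
      rw [hN] at h₁
      refine ⟨?_, ?_, h₂.set_six _ _, fun j hj => ?_⟩
      · simp only [NExp.eval_get, NExp.eval_lit, h₁]; split_ifs <;> omega
      · simp [h₁]
      · simp [h₃ j hj]

end Fm

open Classical in
/-- The last number below the bound with the property `P`, or `0`. -/
noncomputable def lastSat (P : ℕ → Prop) : ℕ → ℕ
  | 0 => 0
  | n + 1 => if P n then n else lastSat P n

theorem lastSat_spec {P : ℕ → Prop} {n : ℕ} (h : ∃ i < n, P i) :
    lastSat P n < n ∧ P (lastSat P n) := by
  induction n with
  | zero => obtain ⟨i, hi, _⟩ := h; omega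
  | succ n ih =>
    simp only [lastSat]
    split_ifs with hn
    · exact ⟨by omega, hn⟩
    · obtain ⟨i, hi, hP⟩ := h
      have : i ≠ n := fun e => hn (e ▸ hP)
      obtain ⟨h₁, h₂⟩ := ih ⟨i, by omega, hP⟩
      exact ⟨by omega, h₂⟩

theorem lastSat_le (P : ℕ → Prop) (n : ℕ) : lastSat P n ≤ n := by
  induction n with
  | zero => exact le_rfl
  | succ n ih => simp only [lastSat]; split_ifs <;> omega

namespace Fm

/-- The program that sets cell `0` of array `x` to the last value for which `φ` holds. -/
def choose (x c : ℕ) (φ : Fm) : Prog :=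
  .seq (.setN 6 (.lit (x + 1)) 0) (.seq (.loop x (.get 0 0 + .lit c)
    (.seq φ.prog (.ite (.natLe 1 (.get 6 0)) (.setN 6 (.lit (x + 1)) (.get x 0)) .skip)))
    (.setN x 0 (.get 6 (.lit (x + 1)))))

/-- The program that sets cell `0` of array `x` to the number of values for which `φ` holds. -/
def count (x c : ℕ) (φ : Fm) : Prog :=
  .seq (.setN 6 (.lit (x + 1)) 0) (.seq (.loop x (.get 0 0 + .lit c)
    (.seq φ.prog (.ite (.natLe 1 (.get 6 0))
      (.setN 6 (.lit (x + 1)) (.get 6 (.lit (x + 1)) + 1)) .skip)))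
    (.setN x 0 (.get 6 (.lit (x + 1)))))

/-- The loop that evaluates `φ` for all values of a variable and updates an accumulator. -/
theorem ok_scan {B : ℕ} {R : ℝ} {x c : ℕ} {φ : Fm} {σ : Store} (h : (ex x c φ).ok = true)
    (hB : σ.nat 0 0 + 5 ≤ B) (e : NExp) (F : ℕ → ℕ) (hF0 : F 0 = 0)
    (hpos : ∀ i < σ.nat 0 0 + c, φ.Holds (σ.setNat x 0 i) → F (i + 1) ≤ B ∧
      ∀ τ : Store, τ.nat x 0 = i → τ.nat 6 (x + 1) = F i → e.eval τ = F (i + 1))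
    (hneg : ∀ i < σ.nat 0 0 + c, ¬ φ.Holds (σ.setNat x 0 i) → F (i + 1) = F i)
    (hlast : F (σ.nat 0 0 + c) ≤ B) :
    Ok B R (.seq (.setN 6 (.lit (x + 1)) 0) (.seq (.loop x (.get 0 0 + .lit c)
      (.seq φ.prog (.ite (.natLe 1 (.get 6 0)) (.setN 6 (.lit (x + 1)) e) .skip)))
      (.setN x 0 (.get 6 (.lit (x + 1)))))) σ
      fun τ => τ.nat x 0 = F (σ.nat 0 0 + c) ∧ Agree (x :: φ.bvars) σ τ := by
  obtain ⟨o₁, o₂, o₃, o₄, o₅, o₆⟩ := ex_ok h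
  have hb0 := zero_notMem_bvars _ o₁
  simp only [ok_seq, ok_setN]
  refine ⟨by simp, ?_⟩
  set σ₁ := σ.setNat 6 (NExp.eval σ (.lit (x + 1))) (NExp.eval σ 0) with hσ₁
  have hs : σ₁.nat 6 (x + 1) = 0 := by simp [hσ₁]
  have ha : Agree (x :: φ.bvars) σ σ₁ := Agree.set_six ⟨fun _ _ _ _ => rfl, rfl⟩ _ _
  have h0 : σ₁.nat 0 0 = σ.nat 0 0 := by simp [hσ₁]
  have hN : NExp.eval σ₁ (.get 0 0 + .lit c) = σ.nat 0 0 + c := by simp [h0]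
  clear_value σ₁
  refine (Ok.loop (fun i τ => τ.nat 6 (x + 1) = F i ∧ Agree (x :: φ.bvars) σ τ) ?_ ?_ ?_).mono ?_
  · rw [hN]; omega
  · exact ⟨by simp [o₄.symm, hs, hF0], ha.set_mem (by simp) _⟩
  · intro i hi τ _ hτi ⟨h₁, h₂⟩
    rw [hN] at hi
    have h00 : τ.nat 0 0 = σ.nat 0 0 := h₂.nat 0 0 (by decide) (.inr (by simp [o₃.symm, hb0]))
    have hφ : φ.Holds τ ↔ φ.Holds (σ.setNat x 0 i) := by
      refine φ.holds_congr o₁ hb0 o₆ ⟨fun a j h6 hj => ?_, h₂.real⟩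
      rw [Store.setNat_nat]
      split_ifs with hx
      · rw [hx.1, hx.2, hτi]
      · refine h₂.nat a j h6 ?_
        by_cases hj0 : j = 0
        · subst hj0
          simp only [and_true] at hx
          simp only [ne_eq, not_true_eq_false, false_or] at hj
          simp [hx, hj]
        · exact .inl hj0
    refine (ok_prog φ o₁ (h00 ▸ hB)).seq fun ρ hρ ⟨k₁, k₂, k₃⟩ => ?_
    have k₄ : Agree (x :: φ.bvars) σ ρ := h₂.trans (k₂.mono (by simp))
    have hx0 : ρ.nat x 0 = i := by rw [k₂.nat x 0 o₄ (.inr o₂), hτi]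
    rw [ok_ite]
    constructor
    · intro hb
      have hh : φ.Holds (σ.setNat x 0 i) := by
        rw [← hφ]; by_contra h; simp [k₁, h] at hb
      have he := (hpos i hi hh).2 ρ hx0 (by rw [k₃ x o₂, h₁])
      rw [ok_setN]
      refine ⟨he ▸ (hpos i hi hh).1, ?_, (k₄.set_six _ _).set_mem (by simp) _⟩
      simp [o₄.symm, he]
    · intro hb
      have hh : ¬ φ.Holds (σ.setNat x 0 i) := by
        rw [← hφ]; intro h; simp [k₁, h] at hb
      rw [ok_skip]
      refine ⟨?_, k₄.set_mem (by simp) _⟩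
      rw [Store.setNat_nat_of_ne _ _ _ o₄.symm, k₃ x o₂, h₁, hneg i hi hh]
  · intro τ _ ⟨h₁, h₂⟩
    rw [hN] at h₁
    refine ⟨?_, ?_, h₂.set_mem (by simp) _⟩
    · simpa [h₁] using hlast
    · simp [h₁]

theorem ok_choose {B : ℕ} {R : ℝ} {x c : ℕ} {φ : Fm} {σ : Store} (h : (ex x c φ).ok = true)
    (hB : σ.nat 0 0 + 5 ≤ B) :
    Ok B R (choose x c φ) σ fun τ =>
      τ.nat x 0 = lastSat (fun i => φ.Holds (σ.setNat x 0 i)) (σ.nat 0 0 + c) ∧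
      Agree (x :: φ.bvars) σ τ := by
  have o₅ := (ex_ok h).2.2.2.2.1
  have hle := lastSat_le (fun i => φ.Holds (σ.setNat x 0 i))
  refine ok_scan h hB _ _ rfl (fun i hi hh => ?_)
    (fun i hi hh => by simp [lastSat, hh]) ((hle _).trans (by omega))
  refine ⟨(hle _).trans (by omega), fun τ h₁ _ => ?_⟩
  simp [lastSat, hh, h₁]

open Classical in
theorem ok_count {B : ℕ} {R : ℝ} {x c : ℕ} {φ : Fm} {σ : Store} (h : (ex x c φ).ok = true)
    (hB : σ.nat 0 0 + 5 ≤ B) :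
    Ok B R (count x c φ) σ fun τ =>
      τ.nat x 0 = ((Finset.range (σ.nat 0 0 + c)).filter fun i => φ.Holds (σ.setNat x 0 i)).card ∧
      Agree (x :: φ.bvars) σ τ := by
  have o₅ := (ex_ok h).2.2.2.2.1
  have hle : ∀ i, ((Finset.range i).filter fun i => φ.Holds (σ.setNat x 0 i)).card ≤ i := fun i =>
    (Finset.card_filter_le _ _).trans (by simp)
  refine ok_scan h hB _ (fun i => ((Finset.range i).filter fun i =>
    φ.Holds (σ.setNat x 0 i)).card) rfl
    (fun i hi hh => ?_) (fun i hi hh => ?_) ((hle _).trans (by omega))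
  · refine ⟨(hle _).trans (by omega), fun τ _ h₁ => ?_⟩
    simp only [NExp.eval_add, NExp.eval_get, NExp.eval_lit, NExp.eval_one, h₁]
    rw [Finset.range_add_one, Finset.filter_insert, if_pos hh, Finset.card_insert_of_notMem]
    simp
  · rw [Finset.range_add_one, Finset.filter_insert, if_neg hh]

end Fm

/-! ### Loops that fill arrays -/

/-- The memory contents differ at most in the cells `0` of the arrays in `XS`, in the
natural-number arrays in `LN` and in the real arrays in `LR`. -/
structure Near (XS LN LR : List ℕ) (σ τ : Store) : Prop where
  nat : ∀ a j, a ∉ LN → (j ≠ 0 ∨ a ∉ XS) → τ.nat a j = σ.nat a j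
  real : ∀ a, a ∉ LR → τ.real a = σ.real a

theorem Near.refl (XS LN LR : List ℕ) (σ : Store) : Near XS LN LR σ σ :=
  ⟨fun _ _ _ _ => rfl, fun _ _ => rfl⟩

/-- Started near `σ`, the program writes exactly the values given by `W` into the array that `get`
selects: `W j v` means that cell `j` receives the value `v`. -/
def Fills {α : Type} (B : ℕ) (R : ℝ) (get : Store → ℕ → α) (XS LN LR : List ℕ) (p : Prog)
    (σ : Store) (W : ℕ → α → Prop) : Prop :=
  ∀ τ, Near XS LN LR σ τ → Ok B R p τ fun τ' => Near XS LN LR σ τ' ∧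
    (∀ j v, W j v → get τ' j = v) ∧ ∀ j, (∀ v, ¬ W j v) → get τ' j = get τ j

section Fills

variable {α : Type} {B : ℕ} {R : ℝ} {get : Store → ℕ → α} {XS LN LR : List ℕ} {p q : Prog}
  {σ : Store}

theorem Near.eval_congr {τ : Store} (h : Near XS LN LR σ τ) (e : NExp)
    (he : ∀ b ∈ e.reads, b ∉ XS ++ LN) : e.eval τ = e.eval σ :=
  e.eval_congr fun b hb => by
    have := he b hb
    rw [List.mem_append, not_or] at this
    exact funext fun j => h.nat b j this.2 (.inr this.1)

theorem Near.reval_congr {τ : Store} (h : Near XS LN LR σ τ) (e : RExp)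
    (he : ∀ b ∈ e.reads, b ∉ XS ++ LN) (he' : ∀ b ∈ e.rreads, b ∉ LR) : e.eval τ = e.eval σ :=
  e.eval_congr (fun b hb => by
    have := he b hb
    rw [List.mem_append, not_or] at this
    exact funext fun j => h.nat b j this.2 (.inr this.1)) fun b hb => h.real b (he' b hb)

theorem Near.holds_congr {τ : Store} (h : Near XS LN LR σ τ) (e : BExp)
    (he : ∀ b ∈ e.reads, b ∉ XS ++ LN) (he' : ∀ b ∈ e.rreads, b ∉ LR) :
    e.Holds τ ↔ e.Holds σ :=
  e.holds_congr (fun b hb => by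
    have := he b hb
    rw [List.mem_append, not_or] at this
    exact funext fun j => h.nat b j this.2 (.inr this.1)) fun b hb => h.real b (he' b hb)

theorem fills_setR {a : ℕ} {i : NExp} {r : RExp} {A : ℕ} {V : ℝ} (hA : i.eval σ = A)
    (hV : r.eval σ = V) (hR : |V| ≤ R) (hi : ∀ b ∈ i.reads, b ∉ XS ++ LN := by decide)
    (hr : ∀ b ∈ r.reads, b ∉ XS ++ LN := by decide) (hr' : ∀ b ∈ r.rreads, b ∉ LR := by decide)
    (ha : a ∈ LR := by decide) :
    Fills B R (fun τ => τ.real a) XS LN LR (.setR a i r) σ fun j v => j = A ∧ v = V := by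
  subst hA hV
  intro τ h
  rw [ok_setR, h.eval_congr i hi, h.reval_congr r hr hr']
  refine ⟨hR, ⟨h.nat, fun b hb => ?_⟩, ?_, ?_⟩
  · have hne : b ≠ a := fun e => hb (e ▸ ha)
    rw [Store.setReal_real_of_ne _ _ _ hne, h.real b hb]
  · rintro j v ⟨rfl, rfl⟩; simp
  · intro j hj
    have : j ≠ i.eval σ := fun h' => hj _ ⟨h', rfl⟩
    simp [this]

theorem fills_setN {a : ℕ} {i e : NExp} {A V : ℕ} (hA : i.eval σ = A) (hV : e.eval σ = V)
    (hB : V ≤ B) (hi : ∀ b ∈ i.reads, b ∉ XS ++ LN := by decide)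
    (hr : ∀ b ∈ e.reads, b ∉ XS ++ LN := by decide)
    (ha : a ∈ LN := by decide) :
    Fills B R (fun τ => τ.nat a) XS LN LR (.setN a i e) σ fun j v => j = A ∧ v = V := by
  subst hA hV
  intro τ h
  rw [ok_setN, h.eval_congr i hi, h.eval_congr e hr]
  refine ⟨hB, ⟨fun b j hb hj => ?_, h.real⟩, ?_, ?_⟩
  · have hne : b ≠ a := fun e => hb (e ▸ ha)
    rw [Store.setNat_nat_of_ne _ _ _ hne, h.nat b j hb hj]
  · rintro j v ⟨rfl, rfl⟩; simp
  · intro j hj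
    have : j ≠ i.eval σ := fun h' => hj _ ⟨h', rfl⟩
    simp [this]

theorem fills_ite {b : BExp} {W : ℕ → α → Prop} (hp : b.Holds σ → Fills B R get XS LN LR p σ W)
    (hq : ¬ b.Holds σ → Fills B R get XS LN LR q σ W)
    (hb : ∀ a ∈ b.reads, a ∉ XS ++ LN := by decide) (hb' : ∀ a ∈ b.rreads, a ∉ LR := by decide) :
    Fills B R get XS LN LR (.ite b p q) σ W := by
  intro τ h
  rw [ok_ite, h.holds_congr b hb hb']
  exact ⟨fun hh => hp hh τ h, fun hh => hq hh τ h⟩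

/-- A loop fills the union of what its rounds fill. The hypothesis `hW` says that different rounds
write into different cells. -/
theorem fills_loop {x : ℕ} {N : NExp} {W : ℕ → ℕ → α → Prop}
    (hB : N.eval σ ≤ B) (hg : ∀ (τ : Store) (v : ℕ), get (τ.setNat x 0 v) = get τ)
    (hW : ∀ i < N.eval σ, ∀ i' < N.eval σ, ∀ j v v', W i j v → W i' j v' → i = i')
    (hp : ∀ i < N.eval σ, Fills B R get XS LN LR p (σ.setNat x 0 i) (W i))
    (hN : ∀ b ∈ N.reads, b ∉ (x :: XS) ++ LN := by decide) (hx : x ∉ LN ∧ x ∉ XS := by decide) :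
    Fills B R get (x :: XS) LN LR (.loop x N p) σ fun j v => ∃ i < N.eval σ, W i j v := by
  intro τ h
  have e := h.eval_congr N hN
  have hset : ∀ ρ v, Near (x :: XS) LN LR σ ρ → Near (x :: XS) LN LR σ (ρ.setNat x 0 v) := by
    intro ρ v hρ
    refine ⟨fun a j ha hj => ?_, hρ.real⟩
    rw [Store.setNat_nat, if_neg]
    · exact hρ.nat a j ha hj
    · rintro ⟨rfl, rfl⟩; simp at hj
  refine (Ok.loop (fun i ρ => Near (x :: XS) LN LR σ ρ ∧ (∀ j v, (∃ i' < i, W i' j v) →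
    get ρ j = v) ∧ ∀ j, (∀ v, ¬ ∃ i' < i, W i' j v) → get ρ j = get τ j) (by rw [e]; exact hB)
    ⟨hset _ _ h, by simp [hg]⟩ ?_).mono ?_
  · rw [e]
    intro i hi ρ _ hρi ⟨h₁, h₂, h₃⟩
    have hn : Near XS LN LR (σ.setNat x 0 i) ρ := by
      refine ⟨fun a j ha hj => ?_, h₁.real⟩
      rw [Store.setNat_nat]
      split_ifs with h'
      · rw [h'.1, h'.2, hρi]
      · refine h₁.nat a j ha ?_
        by_cases h0 : j = 0
        · subst h0
          simp only [and_true] at h'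
          simp only [ne_eq, not_true_eq_false, false_or] at hj
          simp [h', hj]
        · exact .inl h0
    refine (hp i hi ρ hn).mono fun ρ' _ ⟨k₁, k₂, k₃⟩ => ⟨hset _ _ ⟨fun a j ha hj => ?_, ?_⟩, ?_, ?_⟩
    · have : j ≠ 0 ∨ a ∉ XS := hj.imp_right fun h h' => h (List.mem_cons_of_mem _ h')
      rw [k₁.nat a j ha this, Store.setNat_nat, if_neg]
      rintro ⟨rfl, rfl⟩; simp at hj
    · exact k₁.real
    · rintro j v ⟨i', hi', hw⟩
      rw [hg]
      by_cases hex : ∃ v', W i j v'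
      · obtain ⟨v', hv'⟩ := hex
        obtain rfl := hW i hi i' (by omega) j v' v hv' hw
        exact k₂ j v hw
      · push Not at hex
        rw [k₃ j hex]
        refine h₂ j v ⟨i', ?_, hw⟩
        rcases Nat.lt_succ_iff_lt_or_eq.1 hi' with h' | rfl
        · exact h'
        · exact absurd hw (hex v)
    · intro j hj
      rw [hg, k₃ j fun v hv => hj v ⟨i, by omega, hv⟩]
      exact h₃ j fun v ⟨i', hi', hv⟩ => hj v ⟨i', by omega, hv⟩
  · rw [e]
    exact fun _ _ h => h

theorem Fills.ok {W : ℕ → α → Prop} (h : Fills B R get XS LN LR p σ W) :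
    Ok B R p σ fun τ => (∀ j v, W j v → get τ j = v) ∧
      ∀ j, (∀ v, ¬ W j v) → get τ j = get σ j :=
  (h σ (Near.refl _ _ _ σ)).mono fun _ _ h => h.2

end Fills

/-! ### Polynomial bounds -/

/-- The function is bounded by a polynomial. -/
def IsPoly (f : ℕ → ℕ) : Prop := ∃ C k, ∀ n, f n ≤ polyBound C k n

namespace IsPoly

theorem of_le {f g : ℕ → ℕ} (hg : IsPoly g) (h : ∀ n, f n ≤ g n) : IsPoly f := by
  obtain ⟨C, k, hg⟩ := hg
  exact ⟨C, k, fun n => (h n).trans (hg n)⟩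

theorem const (c : ℕ) : IsPoly fun _ => c := ⟨c, 0, fun n => by simp [polyBound]⟩

theorem id : IsPoly fun n => n := ⟨1, 1, fun n => by simp [polyBound]⟩

theorem add {f g : ℕ → ℕ} (hf : IsPoly f) (hg : IsPoly g) : IsPoly fun n => f n + g n := by
  obtain ⟨C, k, hf⟩ := hf
  obtain ⟨C', k', hg⟩ := hg
  refine ⟨C + C', k + k', fun n => ?_⟩
  have h₁ : (n + 1) ^ k ≤ (n + 1) ^ (k + k') := Nat.pow_le_pow_right (by omega) (by omega)
  have h₂ : (n + 1) ^ k' ≤ (n + 1) ^ (k + k') := Nat.pow_le_pow_right (by omega) (by omega)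
  calc f n + g n ≤ C * (n + 1) ^ k + C' * (n + 1) ^ k' := Nat.add_le_add (hf n) (hg n)
    _ ≤ C * (n + 1) ^ (k + k') + C' * (n + 1) ^ (k + k') :=
      Nat.add_le_add (Nat.mul_le_mul_left _ h₁) (Nat.mul_le_mul_left _ h₂)
    _ = _ := by simp only [polyBound]; ring

theorem mul {f g : ℕ → ℕ} (hf : IsPoly f) (hg : IsPoly g) : IsPoly fun n => f n * g n := by
  obtain ⟨C, k, hf⟩ := hf
  obtain ⟨C', k', hg⟩ := hg
  refine ⟨C * C', k + k', fun n => ?_⟩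
  calc f n * g n ≤ (C * (n + 1) ^ k) * (C' * (n + 1) ^ k') := Nat.mul_le_mul (hf n) (hg n)
    _ = _ := by simp only [polyBound]; ring

theorem comp_add {f : ℕ → ℕ} (hf : IsPoly f) (c : ℕ) : IsPoly fun n => f (n + c) := by
  obtain ⟨C, k, hf⟩ := hf
  have h : IsPoly fun n => C * (n + c + 1) ^ k := by
    refine (const C).mul ?_
    clear hf
    induction k with
    | zero => simpa using const 1
    | succ k ih =>
      simp only [pow_succ]
      exact ih.mul ((id.add (const c)).add (const 1))
  exact h.of_le fun n => hf (n + c)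

theorem nexp (e : NExp) : IsPoly fun B => e.bnd B := by
  induction e with
  | lit k => exact const k
  | get a i ih => exact ih.add id
  | add e f ihe ihf => exact ihe.add ihf
  | sub e f ihe ihf => exact ihe.add ihf
  | mul e f ihe ihf => exact (ihe.add ihf).add (ihe.mul ihf)

theorem rexp (e : RExp) : IsPoly fun B => e.bnd B := by
  induction e with
  | zero => exact const 0
  | get a i => exact nexp i
  | add e f ihe ihf => exact ihe.add ihf
  | sub e f ihe ihf => exact ihe.add ihf

theorem bexp (b : BExp) : IsPoly fun B => b.bnd B := by
  induction b with
  | natLe e f => exact (nexp e).add (nexp f)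
  | realLe e f => exact (rexp e).add (rexp f)
  | not b ih => exact ih
  | and b c ihb ihc => exact ihb.add ihc

theorem space (p : Prog) : IsPoly fun B => p.space B := by
  induction p with
  | skip => exact const 0
  | setN a i e => exact (nexp i).add (nexp e)
  | setR a i r => exact (nexp i).add (rexp r)
  | seq p q ihp ihq => exact ihp.add ihq
  | ite b p q ihp ihq => exact ((bexp b).add ihp).add ihq
  | loop x N p ih => exact (((nexp N).add ih).add id).add (const 1)

theorem time (p : Prog) : IsPoly fun B => p.time B := by
  induction p with
  | skip => exact const 1
  | setN a i e => exact const _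
  | setR a i r => exact const _
  | seq p q ihp ihq => exact ihp.add ihq
  | ite b p q ihp ihq => exact ((const _).add ihp).add ihq
  | loop x N p ih =>
    exact (((id.add (const 1)).mul ((ih.add (const _)).add (const 20))).add (const _)).add
      (const 20)

end IsPoly

/-! ### Programs with calls -/

/-- The command `c` halts within `T` steps in a memory content with property `Q`. -/
def Tri (procs : List Cmd) (S : ℕ) (R : ℝ) (d : ℕ) (c : Cmd) (σ : Store) (T : ℝ)
    (Q : Store → Prop) : Prop :=
  ∃ t τ, Exec procs S R d c σ t τ ∧ (t : ℝ) ≤ T ∧ Q τ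

section Tri

variable {procs : List Cmd} {S : ℕ} {R : ℝ} {d : ℕ} {c c' : Cmd} {σ : Store} {T T' : ℝ}
  {Q Q' : Store → Prop}

theorem Tri.mono (h : Tri procs S R d c σ T Q) (hT : T ≤ T') (hQ : ∀ τ, Q τ → Q' τ) :
    Tri procs S R d c σ T' Q' := by
  obtain ⟨t, τ, h₁, h₂, h₃⟩ := h
  exact ⟨t, τ, h₁, h₂.trans hT, hQ τ h₃⟩

theorem Tri.seq (h : Tri procs S R d c σ T Q) (h' : ∀ τ, Q τ → Tri procs S R d c' τ T' Q') :
    Tri procs S R d (.seq c c') σ (T + T') Q' := by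
  obtain ⟨t, τ, h₁, h₂, h₃⟩ := h
  obtain ⟨t', τ', k₁, k₂, k₃⟩ := h' τ h₃
  exact ⟨t + t', τ', .seq h₁ k₁, by push_cast; linarith, k₃⟩

theorem Tri.ite {b : BExp} (hb : b.Fits S R σ) (h : b.Holds σ → Tri procs S R d c σ T Q)
    (h' : ¬ b.Holds σ → Tri procs S R d c' σ T Q) :
    Tri procs S R d (.ite b c c') σ (b.cost + 1 + T) Q := by
  by_cases hh : b.Holds σ
  · obtain ⟨t, τ, h₁, h₂, h₃⟩ := h hh
    exact ⟨_, τ, .iteTrue hb hh h₁, by push_cast; linarith, h₃⟩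
  · obtain ⟨t, τ, h₁, h₂, h₃⟩ := h' hh
    exact ⟨_, τ, .iteFalse hb hh h₁, by push_cast; linarith, h₃⟩

theorem Tri.call {p : ℕ} (h : Tri procs S R d (procs.getD p .skip) σ T Q) :
    Tri procs S R (d + 1) (.call p) σ (T + 1) Q := by
  obtain ⟨t, τ, h₁, h₂, h₃⟩ := h
  exact ⟨_, τ, .call h₁, by push_cast; linarith, h₃⟩

/-- The invariant rule for loops whose round `i` takes at most `T i` steps. -/
theorem Tri.while {b : BExp} (I : ℕ → Store → Prop) (N : ℕ) (T : ℕ → ℝ) (h0 : I 0 σ)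
    (hb : ∀ i ≤ N, ∀ τ, I i τ → b.Fits S R τ ∧ (b.Holds τ ↔ i < N))
    (hs : ∀ i < N, ∀ τ, I i τ → Tri procs S R d c τ (T i) (I (i + 1))) :
    Tri procs S R d (.while b c) σ
      (∑ i ∈ Finset.range N, (T i + b.cost + 1) + b.cost + 1) (I N) := by
  have key : ∀ k i τ, i + k = N → I i τ → Tri procs S R d (.while b c) τ
      (∑ j ∈ Finset.range k, (T (i + j) + b.cost + 1) + b.cost + 1) (I N) := by
    intro k
    induction k with
    | zero =>
      intro i τ hi hI
      obtain rfl : i = N := by omega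
      obtain ⟨h₁, h₂⟩ := hb i le_rfl τ hI
      exact ⟨_, τ, .whileFalse h₁ (by simp [h₂]), by simp, hI⟩
    | succ k ih =>
      intro i τ hi hI
      obtain ⟨h₁, h₂⟩ := hb i (by omega) τ hI
      obtain ⟨t, τ', k₁, k₂, k₃⟩ := hs i (by omega) τ hI
      obtain ⟨t', τ'', l₁, l₂, l₃⟩ := ih (i + 1) τ' (by omega) k₃
      refine ⟨_, τ'', .whileTrue h₁ (h₂.2 (by omega)) k₁ l₁, ?_, l₃⟩
      rw [Finset.sum_range_succ']
      push_cast
      have : ∀ j, i + 1 + j = i + (j + 1) := by omega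
      simp only [this] at l₂
      simp only [add_zero]
      linarith
  simpa using key N 0 σ (by omega) h0

theorem Ok.tri {B : ℕ} {Rb : ℝ} {p : Prog} (h : Ok B Rb p σ Q) (hσ : Bdd B Rb σ)
    (hw : p.wf = true) (hS : p.space B ≤ S) (hR : p.size * Rb ≤ R) :
    Tri procs S R d p.cmd σ (p.time B) fun τ => Bdd B Rb τ ∧ Same p.wN p.wR σ τ ∧ Q τ := by
  obtain ⟨t, ht, he⟩ := p.exec hw hS hR σ hσ h.1 (procs := procs) (d := d)
  exact ⟨t, _, he, by exact_mod_cast ht, bdd_den p hw σ hσ h.1, p.same_den σ, h.2⟩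

end Tri

end RAM

/-! ### Preflows and minimum cuts -/

/-- A preflow with a valid height function on the nodes `0, …, n`, of which `n` is the sink. It is
given by its residual capacities `c` and its excesses `e`; the initial capacities are `c₀`, and
`e₀ u` is the capacity of the arc from the source to `u`. -/
structure Preflow (n : ℕ) (c₀ : ℕ → ℕ → ℝ) (e₀ : ℕ → ℝ) (c : ℕ → ℕ → ℝ) (e : ℕ → ℝ)
    (h : ℕ → ℕ) : Prop where
  c_nonneg : ∀ u ≤ n, ∀ v ≤ n, 0 ≤ c u v
  e_nonneg : ∀ u ≤ n, 0 ≤ e u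
  symm : ∀ u ≤ n, ∀ v ≤ n, c u v + c v u = c₀ u v + c₀ v u
  cons : ∀ u ≤ n, e u = e₀ u + ∑ b ∈ Finset.range (n + 1), (c u b - c₀ u b)
  valid : ∀ u ≤ n, ∀ v ≤ n, 0 < c u v → h u ≤ h v + 1

namespace Preflow

variable {n : ℕ} {c₀ c c' : ℕ → ℕ → ℝ} {e₀ e e' : ℕ → ℝ} {h h' : ℕ → ℕ}

/-- A push along an arc that descends by one level: its reverse arc ascends, so the heights remain
valid. -/
theorem push (p : Preflow n c₀ e₀ c e h) {u v : ℕ} (hu : u ≤ n) (hv : v ≤ n)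
    (huv : h u = h v + 1) {δ : ℝ} (h0 : 0 ≤ δ) (h1 : δ ≤ e u) (h2 : δ ≤ c u v)
    (hc : ∀ a ≤ n, ∀ b ≤ n, c' a b = if a = v ∧ b = u then c a b + δ else
      if a = u ∧ b = v then c a b - δ else c a b)
    (he : ∀ a ≤ n, e' a = if a = v then e a + δ else if a = u then e a - δ else e a) :
    Preflow n c₀ e₀ c' e' h := by
  have hne : u ≠ v := by rintro rfl; omega
  constructor
  · intro a ha b hb
    have := p.c_nonneg a ha b hb
    rw [hc a ha b hb]
    split_ifs with h₁ h₂
    · linarith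
    · rw [h₂.1, h₂.2]; linarith
    · exact this
  · intro a ha
    have := p.e_nonneg a ha
    rw [he a ha]
    split_ifs with h₁ h₂
    · linarith
    · rw [h₂]; linarith
    · exact this
  · intro a ha b hb
    have := p.symm a ha b hb
    rw [hc a ha b hb, hc b hb a ha]
    by_cases h₁ : a = v ∧ b = u
    · obtain ⟨rfl, rfl⟩ := h₁
      simp only [and_self, if_true, hne, hne.symm, if_false]
      linarith
    · by_cases h₂ : a = u ∧ b = v
      · obtain ⟨rfl, rfl⟩ := h₂
        simp only [and_self, if_true, hne, hne.symm, if_false]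
        linarith
      · rw [if_neg h₁, if_neg h₂, if_neg (by tauto), if_neg (by tauto)]
        exact this
  · intro a ha
    rw [he a ha]
    have hsum : ∑ b ∈ Finset.range (n + 1), (c' a b - c₀ a b) =
        ∑ b ∈ Finset.range (n + 1), (c a b - c₀ a b) +
          ∑ b ∈ Finset.range (n + 1), ((if b = u then (if a = v then δ else 0) else 0) -
            if b = v then (if a = u then δ else 0) else 0) := by
      rw [← Finset.sum_add_distrib]
      refine Finset.sum_congr rfl fun b hb => ?_
      rw [hc a ha b (by simp at hb; omega)]
      by_cases h₁ : a = v
      · by_cases h₂ : b = u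
        · simp [h₁, h₂, hne]; ring
        · simp [h₁, h₂, hne.symm]
      · by_cases h₂ : a = u
        · by_cases h₃ : b = v
          · simp [h₂, h₃, hne, hne.symm]; ring
          · simp [h₂, h₃, hne]
        · simp [h₁, h₂]
    have hu' : u ∈ Finset.range (n + 1) := by simp; omega
    have hv' : v ∈ Finset.range (n + 1) := by simp; omega
    rw [hsum, ← add_assoc, ← p.cons a ha, Finset.sum_sub_distrib, Finset.sum_ite_eq',
      Finset.sum_ite_eq', if_pos hu', if_pos hv']
    by_cases h₁ : a = v
    · simp [h₁, hne.symm]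
    · by_cases h₂ : a = u
      · simp [h₂, hne]; ring
      · simp [h₁, h₂]
  · intro a ha b hb hpos
    rw [hc a ha b hb] at hpos
    split_ifs at hpos with h₁ h₂
    · rw [h₁.1, h₁.2]; omega
    · rw [h₂.1, h₂.2]; omega
    · exact p.valid a ha b hb hpos

/-- A node without admissible arcs may be raised by one level. -/
theorem relabel (p : Preflow n c₀ e₀ c e h) {u : ℕ} (hu : u ≤ n)
    (hadm : ∀ v ≤ n, h u = h v + 1 → c u v = 0)
    (hh : ∀ a ≤ n, h' a = if a = u then h a + 1 else h a) : Preflow n c₀ e₀ c e h' := by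
  refine ⟨p.c_nonneg, p.e_nonneg, p.symm, p.cons, fun a ha b hb hpos => ?_⟩
  have hv := p.valid a ha b hb hpos
  rw [hh a ha, hh b hb]
  split_ifs with h₁ h₂ h₂
  · omega
  · subst h₁
    have : h a ≠ h b + 1 := fun h' => by rw [hadm b hb h'] at hpos; exact lt_irrefl _ hpos
    omega
  · omega
  · exact hv

/-- The capacity of a cut is at least the excess on its sink side; the difference is the residual
capacity. -/
theorem cut_eq (p : Preflow n c₀ e₀ c e h) (X : ℕ → Prop) [DecidablePred X] :
    (∑ u ∈ Finset.range (n + 1) with ¬ X u, e u) +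
      ∑ u ∈ Finset.range (n + 1) with X u, ∑ v ∈ Finset.range (n + 1) with ¬ X v, c u v =
    (∑ u ∈ Finset.range (n + 1) with ¬ X u, e₀ u) +
      ∑ u ∈ Finset.range (n + 1) with X u, ∑ v ∈ Finset.range (n + 1) with ¬ X v, c₀ u v := by
  set A := (Finset.range (n + 1)).filter X with hA
  set Y := (Finset.range (n + 1)).filter fun u => ¬ X u with hY
  have hAn : ∀ u ∈ A, u ≤ n := fun u hu => by simp [hA] at hu; omega
  have hYn : ∀ u ∈ Y, u ≤ n := fun u hu => by simp [hY] at hu; omega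
  have h1 : ∑ u ∈ Y, e u = ∑ u ∈ Y, e₀ u + (∑ u ∈ Y, ∑ b ∈ A, (c u b - c₀ u b) +
      ∑ u ∈ Y, ∑ b ∈ Y, (c u b - c₀ u b)) := by
    rw [← Finset.sum_add_distrib, ← Finset.sum_add_distrib]
    refine Finset.sum_congr rfl fun u hu => ?_
    rw [p.cons u (hYn u hu), hA, hY, Finset.sum_filter_add_sum_filter_not]
  have h2 : ∑ u ∈ Y, ∑ b ∈ Y, (c u b - c₀ u b) = 0 := by
    have : ∑ u ∈ Y, ∑ b ∈ Y, (c u b - c₀ u b) = - ∑ u ∈ Y, ∑ b ∈ Y, (c u b - c₀ u b) := by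
      conv_rhs => rw [Finset.sum_comm]
      rw [← Finset.sum_neg_distrib]
      refine Finset.sum_congr rfl fun u hu => ?_
      rw [← Finset.sum_neg_distrib]
      refine Finset.sum_congr rfl fun b hb => ?_
      have := p.symm u (hYn u hu) b (hYn b hb)
      linarith
    linarith
  have h3 : ∑ u ∈ Y, ∑ b ∈ A, (c u b - c₀ u b) =
      ∑ u ∈ A, ∑ v ∈ Y, c₀ u v - ∑ u ∈ A, ∑ v ∈ Y, c u v := by
    rw [Finset.sum_comm, ← Finset.sum_sub_distrib]
    refine Finset.sum_congr rfl fun u hu => ?_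
    rw [← Finset.sum_sub_distrib]
    refine Finset.sum_congr rfl fun b hb => ?_
    have := p.symm u (hAn u hu) b (hYn b hb)
    linarith
  rw [h1, h2, h3]
  ring

theorem sum_e (p : Preflow n c₀ e₀ c e h) :
    ∑ u ∈ Finset.range (n + 1), e u = ∑ u ∈ Finset.range (n + 1), e₀ u := by
  simpa using p.cut_eq (fun _ => False)

theorem e_le (p : Preflow n c₀ e₀ c e h) {u : ℕ} (hu : u ≤ n) :
    e u ≤ ∑ u ∈ Finset.range (n + 1), e₀ u := by
  rw [← p.sum_e]
  exact Finset.single_le_sum (f := e) (fun i hi => p.e_nonneg i (by simp at hi; omega))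
    (by simp; omega)

/-- If the nodes below the height `n + 2` have no excess, then an empty level `g` yields a minimum
cut: the nodes above it. -/
theorem gap_cut_le (p : Preflow n c₀ e₀ c e h) (hn : h n = 0) {g : ℕ} (hg : 1 ≤ g) (hg' : g ≤ n + 1)
    (hgap : ∀ u < n, h u ≠ g) (hdone : ∀ u < n, h u ≤ n + 1 → e u = 0)
    (X : ℕ → Prop) [DecidablePred X] (hX : ¬ X n) :
    (∑ u ∈ Finset.range (n + 1) with ¬ g < h u, e₀ u) +
      ∑ u ∈ Finset.range (n + 1) with g < h u, ∑ v ∈ Finset.range (n + 1) with ¬ g < h v, c₀ u v ≤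
    (∑ u ∈ Finset.range (n + 1) with ¬ X u, e₀ u) +
      ∑ u ∈ Finset.range (n + 1) with X u, ∑ v ∈ Finset.range (n + 1) with ¬ X v, c₀ u v := by
  rw [← p.cut_eq, ← p.cut_eq]
  have h1 : ∑ u ∈ Finset.range (n + 1) with g < h u,
      ∑ v ∈ Finset.range (n + 1) with ¬ g < h v, c u v = 0 := by
    refine Finset.sum_eq_zero fun u hu => Finset.sum_eq_zero fun v hv => ?_
    simp only [Finset.mem_filter, Finset.mem_range] at hu hv
    by_contra hne
    have := p.valid u (by omega) v (by omega)
      (lt_of_le_of_ne (p.c_nonneg u (by omega) v (by omega)) (Ne.symm hne))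
    rcases Nat.lt_or_ge v n with h' | h'
    · have := hgap v h'; omega
    · obtain rfl : v = n := by omega
      omega
  have h2 : ∑ u ∈ Finset.range (n + 1) with ¬ g < h u, e u = e n := by
    refine Finset.sum_eq_single n (fun u hu hun => ?_) fun h' => ?_
    · simp only [Finset.mem_filter, Finset.mem_range] at hu
      exact hdone u (by omega) (by omega)
    · simp [hn] at h'
  have h3 : e n ≤ ∑ u ∈ Finset.range (n + 1) with ¬ X u, e u :=
    Finset.single_le_sum (f := e) (fun i hi => p.e_nonneg i (by simp at hi; omega))
      (by simp [hX])
  have h4 : 0 ≤ ∑ u ∈ Finset.range (n + 1) with X u,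
      ∑ v ∈ Finset.range (n + 1) with ¬ X v, c u v :=
    Finset.sum_nonneg fun u hu => Finset.sum_nonneg fun v hv =>
      p.c_nonneg u (by simp at hu; omega) v (by simp at hv; omega)
  rw [h1, h2]
  linarith

/-- The `n` heights leave one of the levels `1, …, n + 1` empty. -/
theorem exists_gap (n : ℕ) (h : ℕ → ℕ) : ∃ g, 1 ≤ g ∧ g ≤ n + 1 ∧ ∀ u < n, h u ≠ g := by
  by_contra! hc
  have hsub : Finset.Icc 1 (n + 1) ⊆ (Finset.range n).image h := by
    intro g hg
    simp only [Finset.mem_Icc] at hg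
    obtain ⟨u, hu, rfl⟩ := hc g hg.1 hg.2
    exact Finset.mem_image_of_mem _ (by simpa using hu)
  have := (Finset.card_le_card hsub).trans Finset.card_image_le
  simp at this

end Preflow

/-! ### One sweep of the push-relabel algorithm -/

/-- The state in a sweep of the push-relabel algorithm that has dealt with the levels above `L` and
with the nodes below `i` on level `L`. The sweep began with sum of heights `H₀`, and `D₀` says that
no excess was left to be pushed when it began. Unless a height has increased, the nodes dealt with
have no excess. -/
structure Sweep (n : ℕ) (c₀ : ℕ → ℕ → ℝ) (e₀ : ℕ → ℝ) (H₀ : ℕ) (D₀ : Prop) (L i : ℕ)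
    (c : ℕ → ℕ → ℝ) (e : ℕ → ℝ) (h : ℕ → ℕ) : Prop where
  pf : Preflow n c₀ e₀ c e h
  sink : h n = 0
  low : ∀ u < n, 1 ≤ h u ∧ h u ≤ n + 2
  sum : H₀ ≤ ∑ u ∈ Finset.range n, h u
  flush : H₀ < (∑ u ∈ Finset.range n, h u) ∨
    ∀ a < n, ((L < h a ∧ h a ≤ n + 1) ∨ (h a = L ∧ a < i)) → e a = 0
  done : D₀ → ∀ a < n, h a ≤ n + 1 → e a = 0

namespace Sweep

variable {n H₀ L i : ℕ} {D₀ : Prop} {c₀ c c' : ℕ → ℕ → ℝ} {e₀ e e' : ℕ → ℝ} {h h' : ℕ → ℕ}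

theorem push (p : Sweep n c₀ e₀ H₀ D₀ L i c e h) {v : ℕ} (hi : i < n) (hv : v ≤ n) (hL : h i = L)
    (hLn : L ≤ n + 1) (huv : h i = h v + 1) {δ : ℝ} (h0 : 0 ≤ δ) (h1 : δ ≤ e i) (h2 : δ ≤ c i v)
    (hc : ∀ a ≤ n, ∀ b ≤ n, c' a b = if a = v ∧ b = i then c a b + δ else
      if a = i ∧ b = v then c a b - δ else c a b)
    (he : ∀ a ≤ n, e' a = if a = v then e a + δ else if a = i then e a - δ else e a) :
    Sweep n c₀ e₀ H₀ D₀ L i c' e' h := by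
  refine ⟨p.pf.push hi.le hv huv h0 h1 h2 hc he, p.sink, p.low, p.sum, ?_, fun hd a ha hal => ?_⟩
  · refine p.flush.imp_right fun hf a ha haL => ?_
    rw [he a ha.le, if_neg (by rintro rfl; omega), if_neg (by rintro rfl; omega)]
    exact hf a ha haL
  · have hδ : δ = 0 := le_antisymm (h1.trans_eq (p.done hd i hi (by omega))) h0
    have := p.done hd a ha hal
    rw [he a ha.le, hδ]
    split_ifs <;> linarith

theorem relabel (p : Sweep n c₀ e₀ H₀ D₀ L i c e h) (hi : i < n) (hL : h i = L) (hLn : L ≤ n + 1)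
    (hadm : ∀ v ≤ n, h i = h v + 1 → c i v = 0) (hpos : 0 < e i)
    (hh : ∀ a ≤ n, h' a = if a = i then h a + 1 else h a) :
    Sweep n c₀ e₀ H₀ D₀ L (i + 1) c e h' := by
  have hs : ∑ u ∈ Finset.range n, h' u = ∑ u ∈ Finset.range n, h u + 1 := by
    have : ∀ u ∈ Finset.range n, h' u = h u + if u = i then 1 else 0 := fun u hu => by
      rw [hh u (by simp at hu; omega)]; split_ifs <;> rfl
    rw [Finset.sum_congr rfl this, Finset.sum_add_distrib, Finset.sum_ite_eq',
      if_pos (by simpa using hi)]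
  refine ⟨p.pf.relabel hi.le hadm hh, ?_, fun u hu => ?_, ?_, .inl ?_, fun hd => ?_⟩
  · rw [hh n le_rfl, if_neg (by omega)]; exact p.sink
  · rw [hh u hu.le]
    have := p.low u hu
    split_ifs with h₁
    · subst h₁; omega
    · exact this
  · rw [hs]; exact p.sum.trans (Nat.le_succ _)
  · rw [hs]; exact Nat.lt_succ_of_le p.sum
  · exact absurd (p.done hd i hi (by omega)) hpos.ne'

theorem next (p : Sweep n c₀ e₀ H₀ D₀ L i c e h) (hi : h i = L → e i = 0) :
    Sweep n c₀ e₀ H₀ D₀ L (i + 1) c e h := by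
  refine ⟨p.pf, p.sink, p.low, p.sum, p.flush.imp_right fun hf a ha haL => ?_, p.done⟩
  rcases haL with haL | ⟨haL, hai⟩
  · exact hf a ha (.inl haL)
  · rcases Nat.lt_succ_iff_lt_or_eq.1 hai with h' | rfl
    · exact hf a ha (.inr ⟨haL, h'⟩)
    · exact hi haL

theorem level (p : Sweep n c₀ e₀ H₀ D₀ (L + 1) n c e h) : Sweep n c₀ e₀ H₀ D₀ L 0 c e h := by
  refine ⟨p.pf, p.sink, p.low, p.sum, p.flush.imp_right fun hf a ha haL => ?_, p.done⟩
  refine hf a ha ?_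
  omega

end Sweep

/-! ### Bipartite vertex covers from cuts -/

/-- The capacities of the arcs between the nodes of the network whose minimum cuts are the minimum
weight vertex covers of a bipartite graph with sides `1` and `2`. -/
noncomputable def coverCap (n : ℕ) (E : ℕ → ℕ → Prop) [DecidableRel E] (s : ℕ → ℕ) (w : ℕ → ℝ)
    (M : ℝ) (u v : ℕ) : ℝ :=
  if u < n ∧ v < n ∧ s u = 1 ∧ s v = 2 ∧ E u v then M
  else if u < n ∧ v = n ∧ s u = 2 then w u else 0

/-- The capacities of the arcs from the source of that network. -/
noncomputable def coverSrc (n : ℕ) (s : ℕ → ℕ) (w : ℕ → ℝ) (u : ℕ) : ℝ :=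
  if u < n ∧ s u = 1 then w u else 0

section Cover

variable {n : ℕ} {E : ℕ → ℕ → Prop} [DecidableRel E] {s : ℕ → ℕ} {w : ℕ → ℝ} {M : ℝ}

/-- The capacity of a cut `X` is the weight of the corresponding vertex set, plus the big number `M`
for each edge that this set does not cover. -/
theorem coverCap_cut (X : ℕ → Prop) [DecidablePred X] (hX : ¬ X n) :
    (∑ u ∈ Finset.range (n + 1) with ¬ X u, coverSrc n s w u) +
      ∑ u ∈ Finset.range (n + 1) with X u,
        ∑ v ∈ Finset.range (n + 1) with ¬ X v, coverCap n E s w M u v =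
    (∑ v ∈ Finset.range n with (s v = 1 ∧ ¬ X v) ∨ (s v = 2 ∧ X v), w v) +
      ∑ u ∈ Finset.range n, ∑ v ∈ Finset.range n,
        if s u = 1 ∧ X u ∧ s v = 2 ∧ ¬ X v ∧ E u v then M else 0 := by
  have h1 : ∑ u ∈ Finset.range (n + 1) with ¬ X u, coverSrc n s w u =
      ∑ u ∈ Finset.range n, if s u = 1 ∧ ¬ X u then w u else 0 := by
    rw [Finset.sum_filter, Finset.sum_range_succ]
    simp only [coverSrc, lt_irrefl, false_and, if_false, ite_self, add_zero]
    refine Finset.sum_congr rfl fun u hu => ?_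
    simp only [Finset.mem_range] at hu
    simp only [hu, true_and]
    split_ifs <;> tauto
  have h2 : ∑ u ∈ Finset.range (n + 1) with X u,
      ∑ v ∈ Finset.range (n + 1) with ¬ X v, coverCap n E s w M u v =
      ∑ u ∈ Finset.range n, ((∑ v ∈ Finset.range n,
        if s u = 1 ∧ X u ∧ s v = 2 ∧ ¬ X v ∧ E u v then M else 0) +
        if s u = 2 ∧ X u then w u else 0) := by
    rw [Finset.sum_filter, Finset.sum_range_succ, if_neg hX, add_zero]
    refine Finset.sum_congr rfl fun u hu => ?_
    simp only [Finset.mem_range] at hu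
    by_cases hXu : X u
    · simp only [hXu, if_true]
      rw [Finset.sum_filter, Finset.sum_range_succ, if_pos hX]
      congr 1
      · refine Finset.sum_congr rfl fun v hv => ?_
        simp only [Finset.mem_range] at hv
        simp only [coverCap, hu, hv, hv.ne, true_and, false_and, if_false]
        split_ifs <;> tauto
      · simp [coverCap, hu]
    · simp [hXu]
  rw [h1, h2, Finset.sum_add_distrib, Finset.sum_filter]
  have h3 : ∑ v ∈ Finset.range n, (if (s v = 1 ∧ ¬ X v) ∨ (s v = 2 ∧ X v) then w v else 0) =
      (∑ u ∈ Finset.range n, if s u = 1 ∧ ¬ X u then w u else 0) +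
        ∑ u ∈ Finset.range n, if s u = 2 ∧ X u then w u else 0 := by
    rw [← Finset.sum_add_distrib]
    refine Finset.sum_congr rfl fun v _ => ?_
    by_cases h₁ : s v = 1
    · simp [h₁]
    · simp [h₁]
  rw [h3]
  ring

/-- A minimum cut yields a minimum weight vertex cover between the two sides. -/
theorem cover_of_min_cut (hw : ∀ v < n, 0 ≤ w v) (hM : ∑ v ∈ Finset.range n, w v < M)
    (X : ℕ → Prop) [DecidablePred X] (hX : ¬ X n)
    (hmin : ∀ Y : ℕ → Prop, ∀ _ : DecidablePred Y, ¬ Y n →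
      (∑ u ∈ Finset.range (n + 1) with ¬ X u, coverSrc n s w u) +
        ∑ u ∈ Finset.range (n + 1) with X u,
          ∑ v ∈ Finset.range (n + 1) with ¬ X v, coverCap n E s w M u v ≤
      (∑ u ∈ Finset.range (n + 1) with ¬ Y u, coverSrc n s w u) +
        ∑ u ∈ Finset.range (n + 1) with Y u,
          ∑ v ∈ Finset.range (n + 1) with ¬ Y v, coverCap n E s w M u v) :
    (∀ u < n, ∀ v < n, s u = 1 → s v = 2 → E u v → ¬ X u ∨ X v) ∧
    ∀ D : ℕ → Prop, ∀ _ : DecidablePred D,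
      (∀ u < n, ∀ v < n, s u = 1 → s v = 2 → E u v → D u ∨ D v) →
      ∑ v ∈ Finset.range n with (s v = 1 ∧ ¬ X v) ∨ (s v = 2 ∧ X v), w v ≤
        ∑ v ∈ Finset.range n with (s v = 1 ∨ s v = 2) ∧ D v, w v := by
  classical
  have hM0 : 0 < M := (Finset.sum_nonneg fun v hv => hw v (by simpa using hv)).trans_lt hM
  have key : ∀ D : ℕ → Prop, ∀ _ : DecidablePred D,
      (∀ u < n, ∀ v < n, s u = 1 → s v = 2 → E u v → D u ∨ D v) →
      (∑ v ∈ Finset.range n with (s v = 1 ∧ ¬ X v) ∨ (s v = 2 ∧ X v), w v) +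
      ∑ u ∈ Finset.range n, (∑ v ∈ Finset.range n,
        if s u = 1 ∧ X u ∧ s v = 2 ∧ ¬ X v ∧ E u v then M else 0) ≤
        ∑ v ∈ Finset.range n with (s v = 1 ∨ s v = 2) ∧ D v, w v := by
    intro D _ hD
    have h1 := hmin (fun v => v < n ∧ ((s v = 1 ∧ ¬ D v) ∨ (s v = 2 ∧ D v)))
      (fun _ => inferInstance) (by simp)
    rw [coverCap_cut X hX, coverCap_cut _ (by simp)] at h1
    refine h1.trans (le_of_eq ?_)
    have h2 : ∑ u ∈ Finset.range n, (∑ v ∈ Finset.range n,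
        if s u = 1 ∧ (u < n ∧ ((s u = 1 ∧ ¬ D u) ∨ (s u = 2 ∧ D u))) ∧ s v = 2 ∧
          ¬ (v < n ∧ ((s v = 1 ∧ ¬ D v) ∨ (s v = 2 ∧ D v))) ∧ E u v then M else 0) = 0 := by
      refine Finset.sum_eq_zero fun u hu => Finset.sum_eq_zero fun v hv => ?_
      simp only [Finset.mem_range] at hu hv
      rw [if_neg]
      rintro ⟨a₁, a₂, a₃, a₄, a₅⟩
      have := hD u hu v hv a₁ a₃ a₅
      have h12 : ¬ (s u = 2) := by omega
      have h21 : ¬ (s v = 1) := by omega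
      tauto
    rw [h2, add_zero]
    refine Finset.sum_congr (Finset.filter_congr fun v hv => ?_) fun _ _ => rfl
    simp only [Finset.mem_range] at hv
    have : s v = 1 → s v ≠ 2 := by omega
    tauto
  have hnn : ∀ u ∈ Finset.range n, 0 ≤ ∑ v ∈ Finset.range n,
        if s u = 1 ∧ X u ∧ s v = 2 ∧ ¬ X v ∧ E u v then M else 0 := fun u _ =>
    Finset.sum_nonneg fun v _ => by split_ifs <;> linarith
  refine ⟨fun u hu v hv hsu hsv huv => ?_, fun D hd hD => ?_⟩
  · by_contra! hc
    have h1 := key (fun v => s v = 1) (fun _ => inferInstance) (fun u _ v _ h _ _ => .inl h)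
    have h2 : M ≤ ∑ u ∈ Finset.range n, (∑ v ∈ Finset.range n,
        if s u = 1 ∧ X u ∧ s v = 2 ∧ ¬ X v ∧ E u v then M else 0) := by
      refine le_trans ?_ (Finset.single_le_sum hnn (Finset.mem_range.2 hu))
      refine le_trans ?_ (Finset.single_le_sum (fun v _ => ?_) (Finset.mem_range.2 hv))
      · rw [if_pos ⟨hsu, hc.1, hsv, hc.2, huv⟩]
      · split_ifs <;> linarith
    have h3 : ∑ v ∈ Finset.range n with (s v = 1 ∨ s v = 2) ∧ s v = 1, w v ≤
        ∑ v ∈ Finset.range n, w v :=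
      Finset.sum_le_sum_of_subset_of_nonneg (Finset.filter_subset _ _)
        fun v hv _ => hw v (by simpa using hv)
    have h4 : 0 ≤ ∑ v ∈ Finset.range n with (s v = 1 ∧ ¬ X v) ∨ (s v = 2 ∧ X v), w v :=
      Finset.sum_nonneg fun v hv => hw v (by simp at hv; exact hv.1)
    linarith
  · have := key D hd hD
    have := Finset.sum_nonneg hnn
    linarith

end Cover

namespace RAM

open Prog

/-! ### The push-relabel program -/

/-! The arrays of the algorithm for arbitrary graphs: the adjacency matrix of the current graph,
the known cover, the states at each depth of the branching, the depth, the sides of the bipartite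
graph, the heights, the cover read off from the cut, the best cover so far, and the position of
the loop at each depth; among the real ones the weights, the big capacity, the residual
capacities, the excesses, the amount pushed, the weight of the computed cover, and that of the
best cover. -/

notation "aAdj" => 7
notation "aUse" => 8
notation "aStat" => 9
notation "aDepth" => 10
notation "aSide" => 11
notation "aHgt" => 12
notation "aOut" => 13
notation "aBest" => 14
notation "aPos" => 15
notation "rWgt" => 2
notation "rBig" => 3
notation "rCap" => 4
notation "rExc" => 5
notation "rDel" => 6
notation "rVal" => 7
notation "rBest" => 8

/-- The number of vertices. -/
abbrev vn : NExp := .get 0 0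

/-- The variable that is kept in cell `0` of array `x`. -/
abbrev vr (x : ℕ) : NExp := .get x 0

theorem addr_inj {m u v u' v' : ℕ} (hv : v < m) (hv' : v' < m) :
    u * m + v = u' * m + v' ↔ u = u' ∧ v = v' := by
  constructor
  · intro h
    have hm : 0 < m := by omega
    have h1 : (u * m + v) / m = (u' * m + v') / m := by rw [h]
    have h2 : (u * m + v) % m = (u' * m + v') % m := by rw [h]
    rw [mul_comm u, mul_comm u', Nat.mul_add_div hm, Nat.mul_add_div hm, Nat.div_eq_of_lt hv,
      Nat.div_eq_of_lt hv'] at h1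
    rw [mul_comm u, mul_comm u', Nat.mul_add_mod, Nat.mul_add_mod, Nat.mod_eq_of_lt hv,
      Nat.mod_eq_of_lt hv'] at h2
    exact ⟨by simpa using h1, h2⟩
  · rintro ⟨rfl, rfl⟩; rfl

/-- The cell of the residual capacity of the arc between two nodes. -/
abbrev capAt (e f : NExp) : NExp := e * (vn + 1) + f

/-- Push along the arc from node `20` to node `21`. -/
def pushProg : Prog :=
  .seq (.ite (.realLe (.get rExc (vr 20)) (.get rCap (capAt (vr 20) (vr 21))))
    (.setR rDel 0 (.get rExc (vr 20))) (.setR rDel 0 (.get rCap (capAt (vr 20) (vr 21)))))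
  (.seq (.setR rCap (capAt (vr 20) (vr 21)) (.get rCap (capAt (vr 20) (vr 21)) - .get rDel 0))
  (.seq (.setR rCap (capAt (vr 21) (vr 20)) (.get rCap (capAt (vr 21) (vr 20)) + .get rDel 0))
  (.seq (.setR rExc (vr 20) (.get rExc (vr 20) - .get rDel 0))
    (.setR rExc (vr 21) (.get rExc (vr 21) + .get rDel 0)))))

/-- Push the excess of node `20` to all admissible nodes. -/
def dischargeProg : Prog :=
  .loop 21 (vn + 1) (.ite (.eq (.get aHgt (vr 20)) (.get aHgt (vr 21) + 1)) pushProg .skip)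

/-- One sweep through the levels from top to bottom. -/
def sweepProg : Prog :=
  .loop 22 (vn + 1) (.loop 20 vn (.ite (.eq (.get aHgt (vr 20)) (vn + 1 - vr 22))
    (.seq dischargeProg (.ite (.realLe (.get rExc (vr 20)) .zero) .skip
      (.setN aHgt (vr 20) (.get aHgt (vr 20) + 1)))) .skip))

/-- Sufficiently many sweeps. -/
def sweepsProg : Prog := .loop 23 (vn + 3) (.loop 24 (vn + 3) sweepProg)

/-- The state of a sweep, read from the memory. -/
def SweepAt (n : ℕ) (c₀ : ℕ → ℕ → ℝ) (e₀ : ℕ → ℝ) (H₀ : ℕ) (D₀ : Prop) (L i : ℕ) (σ : Store) :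
    Prop :=
  Sweep n c₀ e₀ H₀ D₀ L i (fun u v => σ.real rCap (u * (n + 1) + v)) (σ.real rExc) (σ.nat aHgt)

section

variable {n B H₀ L u v : ℕ} {R : ℝ} {D₀ : Prop} {c₀ : ℕ → ℕ → ℝ} {e₀ : ℕ → ℝ} {σ : Store}

@[simp] theorem sweepAt_setNat {x j w i : ℕ} (hx : 12 ≠ x) :
    SweepAt n c₀ e₀ H₀ D₀ L i (σ.setNat x j w) ↔ SweepAt n c₀ e₀ H₀ D₀ L i σ := by
  simp only [SweepAt, Store.setNat_real, Store.setNat_nat_of_ne σ j w hx]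

theorem ok_push (hc₀ : ∀ u ≤ n, ∀ v ≤ n, c₀ u v + c₀ v u ≤ R)
    (he₀ : ∑ u ∈ Finset.range (n + 1), e₀ u ≤ R) (hn : σ.nat 0 0 = n) (h20 : σ.nat 20 0 = u)
    (h21 : σ.nat 21 0 = v) (hu : u < n) (hv : v ≤ n) (hL : σ.nat aHgt u = L) (hLn : L ≤ n + 1)
    (huv : σ.nat aHgt u = σ.nat aHgt v + 1) (hs : SweepAt n c₀ e₀ H₀ D₀ L u σ) :
    Ok B R pushProg σ fun τ => SweepAt n c₀ e₀ H₀ D₀ L u τ ∧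
      (τ.real rExc u = 0 ∨ τ.real rCap (u * (n + 1) + v) = 0) ∧
      (∀ v' ≤ n, v' ≠ v → τ.real rCap (u * (n + 1) + v') = σ.real rCap (u * (n + 1) + v')) ∧
      (σ.real rExc u = 0 → τ.real rExc u = 0) := by
  have hne : u ≠ v := by rintro rfl; omega
  have a₁ : ∀ {a b a' b'}, b ≤ n → b' ≤ n →
      (a * (n + 1) + b = a' * (n + 1) + b' ↔ a = a' ∧ b = b') :=
    fun hb hb' => addr_inj (by omega) (by omega)
  have e₁ : ¬ (v * (n + 1) + u = u * (n + 1) + v) := by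
    rw [a₁ hu.le hv]; omega
  have ce := hs.pf.c_nonneg u hu.le v hv
  have cv := hs.pf.c_nonneg v hv u hu.le
  have ee := hs.pf.e_nonneg u hu.le
  have ev := hs.pf.e_nonneg v hv
  have cs := hs.pf.symm u hu.le v hv
  have cb := hc₀ u hu.le v hv
  have el := hs.pf.e_le hu.le
  have hsum : σ.real rExc u + σ.real rExc v ≤ ∑ u ∈ Finset.range (n + 1), e₀ u := by
    rw [← hs.pf.sum_e, ← Finset.sum_pair hne]
    refine Finset.sum_le_sum_of_subset_of_nonneg ?_ fun i hi _ =>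
      hs.pf.e_nonneg i (by simp at hi; omega)
    intro i hi
    simp only [Finset.mem_insert, Finset.mem_singleton] at hi
    simp only [Finset.mem_range]
    omega
  unfold pushProg
  rw [ok_seq]
  have main : ∀ δ : ℝ, 0 ≤ δ → δ ≤ σ.real rExc u → δ ≤ σ.real rCap (u * (n + 1) + v) →
      (δ = σ.real rExc u ∨ δ = σ.real rCap (u * (n + 1) + v)) →
      Ok B R (.seq (.setR rCap (capAt (vr 20) (vr 21))
        (.get rCap (capAt (vr 20) (vr 21)) - .get rDel 0))
      (.seq (.setR rCap (capAt (vr 21) (vr 20)) (.get rCap (capAt (vr 21) (vr 20)) + .get rDel 0))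
      (.seq (.setR rExc (vr 20) (.get rExc (vr 20) - .get rDel 0))
        (.setR rExc (vr 21) (.get rExc (vr 21) + .get rDel 0))))) (σ.setReal rDel 0 δ)
      fun τ => SweepAt n c₀ e₀ H₀ D₀ L u τ ∧
      (τ.real rExc u = 0 ∨ τ.real rCap (u * (n + 1) + v) = 0) ∧
      (∀ v' ≤ n, v' ≠ v → τ.real rCap (u * (n + 1) + v') = σ.real rCap (u * (n + 1) + v')) ∧
      (σ.real rExc u = 0 → τ.real rExc u = 0) := by
    intro δ h0 h1 h2 h3
    simp only [ok_seq, ok_setR]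
    simp [hn, h20, h21, e₁, hne, hne.symm]
    refine ⟨?_, ?_, ?_, ?_, ?_, ?_, ?_, ?_⟩
    · rw [abs_le]; constructor <;> linarith
    · rw [abs_le]; constructor <;> linarith
    · rw [abs_le]; constructor <;> linarith
    · rw [abs_le]; constructor <;> linarith
    · refine hs.push hu hv hL hLn huv h0 h1 h2 ?_ ?_
      · intro a ha b hb
        simp [a₁ hb hu.le, a₁ hb hv]
        split_ifs with h h'
        · rw [h.1, h.2]
        · rw [h'.1, h'.2]
        · rfl
      · intro a ha
        simp
        split_ifs with h h'
        · rw [h]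
        · rw [h']
        · rfl
    · rcases h3 with h3 | h3
      · exact .inl (by rw [h3]; ring)
      · right; rw [if_neg (fun h => e₁ h.symm)]; linarith
    · intro v' hv' hv'v
      simp [a₁ hv' hu.le, hne, hv'v]
    · intro h
      linarith
  rw [ok_ite]
  constructor
  · intro hle
    simp [hn, h20, h21] at hle
    rw [ok_setR]
    simp only [RExp.eval_get, NExp.eval_get, NExp.eval_zero, h20]
    refine ⟨?_, main _ ee le_rfl hle (.inl rfl)⟩
    rw [abs_le]; constructor <;> linarith
  · intro hle
    simp [hn, h20, h21] at hle
    rw [ok_setR]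
    simp only [RExp.eval_get, NExp.eval_get, NExp.eval_add, NExp.eval_mul, NExp.eval_one,
      NExp.eval_zero, h20, h21, hn]
    refine ⟨?_, main _ ce hle.le le_rfl (.inr rfl)⟩
    rw [abs_le]; constructor <;> linarith

theorem ok_discharge (hc₀ : ∀ u ≤ n, ∀ v ≤ n, c₀ u v + c₀ v u ≤ R)
    (he₀ : ∑ u ∈ Finset.range (n + 1), e₀ u ≤ R) (hB : n + 5 ≤ B) (hn : σ.nat 0 0 = n)
    (h20 : σ.nat 20 0 = u) (hu : u < n) (hL : σ.nat aHgt u = L) (hLn : L ≤ n + 1)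
    (hs : SweepAt n c₀ e₀ H₀ D₀ L u σ) :
    Ok B R dischargeProg σ fun τ => SweepAt n c₀ e₀ H₀ D₀ L u τ ∧
      ∀ v ≤ n, τ.nat aHgt u = τ.nat aHgt v + 1 →
        τ.real rExc u = 0 ∨ τ.real rCap (u * (n + 1) + v) = 0 := by
  unfold dischargeProg
  refine (Ok.loop (fun j τ => SweepAt n c₀ e₀ H₀ D₀ L u τ ∧
      ∀ v < j, v ≤ n → τ.nat aHgt u = τ.nat aHgt v + 1 →
        τ.real rExc u = 0 ∨ τ.real rCap (u * (n + 1) + v) = 0) ?_ ?_ ?_).mono ?_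
  · simp [hn]; omega
  · simpa using hs
  · intro v hv τ hS hτ ⟨h₁, h₂⟩
    simp [hn] at hv
    have k0 : τ.nat 0 0 = n := by rw [hS.nat 0, hn]
    have k20 : τ.nat 20 0 = u := by rw [hS.nat 20, h20]
    have kh : τ.nat aHgt = σ.nat aHgt := hS.nat aHgt
    rw [ok_ite]
    constructor
    · intro hadm
      simp [k20, hτ] at hadm
      refine (ok_push hc₀ he₀ k0 k20 hτ hu (by omega) (by rw [kh, hL]) hLn hadm h₁).mono ?_
      intro ρ hρ ⟨l₁, l₂, l₃, l₄⟩
      have kh' : ρ.nat aHgt = τ.nat aHgt := hρ.nat aHgt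
      refine ⟨by simpa using l₁, fun v' hv' hv'n => ?_⟩
      simp only [Store.setNat_real, kh',
        Store.setNat_nat_of_ne ρ (a := 21) (b := 12) 0 (v + 1) (by decide)]
      intro hh
      by_cases hvv : v' = v
      · subst hvv; exact l₂
      · rw [l₃ v' hv'n hvv]
        exact (h₂ v' (by omega) hv'n hh).imp_left l₄
    · intro hadm
      simp [k20, hτ] at hadm
      rw [ok_skip]
      refine ⟨by simpa using h₁, fun v' hv' hv'n => ?_⟩
      simp only [Store.setNat_real,
        Store.setNat_nat_of_ne τ (a := 21) (b := 12) 0 (v + 1) (by decide)]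
      intro hh
      by_cases hvv : v' = v
      · subst hvv; exact absurd hh hadm
      · exact h₂ v' (by omega) hv'n hh
  · intro τ hS ⟨h₁, h₂⟩
    refine ⟨h₁, fun v hv => h₂ v ?_ hv⟩
    simp [hn]; omega

theorem ok_sweep (hc₀ : ∀ u ≤ n, ∀ v ≤ n, c₀ u v + c₀ v u ≤ R)
    (he₀ : ∑ u ∈ Finset.range (n + 1), e₀ u ≤ R) (hB : n + 5 ≤ B) (hn : σ.nat 0 0 = n)
    (hs : SweepAt n c₀ e₀ H₀ D₀ (n + 1) 0 σ) :
    Ok B R sweepProg σ fun τ => SweepAt n c₀ e₀ H₀ D₀ 0 0 τ := by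
  unfold sweepProg
  refine (Ok.loop (fun r τ => SweepAt n c₀ e₀ H₀ D₀ (n + 1 - r) 0 τ) ?_ ?_ ?_).mono ?_
  · simp [hn]; omega
  · simpa using hs
  · intro r hr τ hS hτ h₁
    simp [hn] at hr
    have k0 : τ.nat 0 0 = n := by rw [hS.nat 0, hn]
    refine (Ok.loop (fun i τ => SweepAt n c₀ e₀ H₀ D₀ (n + 1 - r) i τ) ?_ ?_ ?_).mono ?_
    · simp [k0]; omega
    · simpa using h₁
    · intro u hu ρ hS' hρ l₁
      simp [k0] at hu
      have l0 : ρ.nat 0 0 = n := by rw [hS'.nat 0, k0]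
      have l22 : ρ.nat 22 0 = r := by rw [hS'.nat 22, hτ]
      rw [ok_ite]
      constructor
      · intro hL
        simp [hρ, l0, l22] at hL
        refine (ok_discharge hc₀ he₀ hB l0 hρ hu hL (by omega) l₁).seq ?_
        intro κ hκ ⟨m₁, m₂⟩
        have m20 : κ.nat 20 0 = u := by rw [hκ.nat 20, hρ]
        have mh : κ.nat aHgt = ρ.nat aHgt := hκ.nat aHgt
        have me := m₁.pf.e_nonneg u hu.le
        rw [ok_ite]
        constructor
        · intro hz
          simp [m20] at hz
          rw [ok_skip]
          have : SweepAt n c₀ e₀ H₀ D₀ (n + 1 - r) (u + 1) κ := m₁.next fun _ => le_antisymm hz me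
          simpa using this
        · intro hz
          simp [m20] at hz
          rw [ok_setN]
          simp only [NExp.eval_add, NExp.eval_get, NExp.eval_zero, NExp.eval_one, m20]
          have hlow := m₁.low u hu
          have hLκ : κ.nat aHgt u = n + 1 - r := by rw [mh, hL]
          refine ⟨by omega, ?_⟩
          refine (sweepAt_setNat (by decide)).2 (m₁.relabel hu hLκ (by omega) (fun v hv hh =>
            (m₂ v hv hh).resolve_left hz.ne') hz fun a ha => ?_)
          simp only [Store.setNat_nat, true_and]
          split_ifs with h <;> simp [h]
      · intro hL
        simp [hρ, l0, l22] at hL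
        rw [ok_skip]
        have : SweepAt n c₀ e₀ H₀ D₀ (n + 1 - r) (u + 1) ρ := l₁.next fun h => absurd h hL
        simpa using this
    · intro ρ hS' l₁
      simp only [NExp.eval_get, NExp.eval_zero, k0] at l₁
      have h' : n + 1 - r = (n + 1 - (r + 1)) + 1 := by omega
      rw [h'] at l₁
      have : SweepAt n c₀ e₀ H₀ D₀ (n + 1 - (r + 1)) 0 ρ := l₁.level
      simpa using this
  · intro τ hS h₁
    simpa [hn] using h₁

/-- Every sweep that does not finish increases the sum of the heights, which is bounded. -/
theorem ok_sweeps (hc₀ : ∀ u ≤ n, ∀ v ≤ n, c₀ u v + c₀ v u ≤ R)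
    (he₀ : ∑ u ∈ Finset.range (n + 1), e₀ u ≤ R) (hB : n + 5 ≤ B) (hn : σ.nat 0 0 = n)
    (hs : SweepAt n c₀ e₀ 0 False (n + 1) 0 σ) :
    Ok B R sweepsProg σ fun τ => SweepAt n c₀ e₀ 0 False (n + 1) 0 τ ∧
      ∀ u < n, τ.nat aHgt u ≤ n + 1 → τ.real rExc u = 0 := by
  unfold sweepsProg
  let I : ℕ → Store → Prop := fun k τ => SweepAt n c₀ e₀ 0 False (n + 1) 0 τ ∧
    ((∀ u < n, τ.nat aHgt u ≤ n + 1 → τ.real rExc u = 0) ∨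
      k ≤ ∑ u ∈ Finset.range n, τ.nat aHgt u)
  have hI : ∀ {k τ} {x : ℕ} (i : ℕ), 12 ≠ x → (I k (τ.setNat x 0 i) ↔ I k τ) := by
    intro k τ x i hx
    simp only [I, sweepAt_setNat hx, Store.setNat_nat_of_ne τ 0 i hx, Store.setNat_real]
  refine (Ok.loop (fun a τ => I (a * (n + 3)) τ) ?_ ?_ ?_).mono ?_
  · simp [hn]; omega
  · rw [hI _ (by decide)]
    exact ⟨hs, .inr (by simp)⟩
  · intro a ha τ hS hτ h₁
    have k0 : τ.nat 0 0 = n := by rw [hS.nat 0, hn]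
    refine (Ok.loop (fun b τ => I (a * (n + 3) + b) τ) ?_ ?_ ?_).mono ?_
    · simp [k0]; omega
    · rw [hI _ (by decide)]
      simpa using h₁
    · intro b hb ρ hS' hρ ⟨l₁, l₂⟩
      have l0 : ρ.nat 0 0 = n := by rw [hS'.nat 0, k0]
      have hstart : SweepAt n c₀ e₀ (∑ u ∈ Finset.range n, ρ.nat aHgt u)
          (∀ u < n, ρ.nat aHgt u ≤ n + 1 → ρ.real rExc u = 0) (n + 1) 0 ρ :=
        ⟨l₁.pf, l₁.sink, l₁.low, le_rfl, .inr fun a ha h => absurd h (by omega), id⟩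
      refine (ok_sweep hc₀ he₀ hB l0 hstart).mono fun κ _ hκ => ?_
      rw [hI _ (by decide)]
      refine ⟨⟨hκ.pf, hκ.sink, hκ.low, Nat.zero_le _, .inr fun a ha h => absurd h (by omega),
        False.elim⟩, ?_⟩
      have hlow := hκ.low
      rcases l₂ with l₂ | l₂
      · exact .inl (hκ.done l₂)
      · rcases hκ.flush with hf | hf
        · right; omega
        · left
          intro u hu hh
          exact hf u hu (.inl ⟨by have := hlow u hu; omega, hh⟩)
    · intro ρ _ l
      rw [hI _ (by decide)]
      have : a * (n + 3) + (n + 3) = (a + 1) * (n + 3) := by ring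
      simpa [k0, this] using l
  · intro τ _ ⟨h₁, h₂⟩
    refine ⟨h₁, h₂.resolve_right fun h => ?_⟩
    simp only [NExp.eval_add, NExp.eval_get, hn, NExp.eval_ofNat] at h
    have : ∑ u ∈ Finset.range n, τ.nat aHgt u ≤ ∑ u ∈ Finset.range n, (n + 2) :=
      Finset.sum_le_sum fun u hu => (h₁.low u (by simpa using hu)).2
    rw [Finset.sum_const, Finset.card_range, smul_eq_mul] at this
    nlinarith

end

/-! ### The program for bipartite graphs -/

/-- Set up the network. -/
def networkProg : Prog :=
  .seq (.loop 20 (vn + 1) (.ite (.lt (vr 20) vn) (.setN aHgt (vr 20) 1) (.setN aHgt (vr 20) 0)))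
  (.seq (.loop 20 (vn + 1) (.ite (.and (.lt (vr 20) vn) (.eq (.get aSide (vr 20)) 1))
    (.setR rExc (vr 20) (.get rWgt (vr 20))) (.setR rExc (vr 20) .zero)))
  (.loop 20 (vn + 1) (.loop 21 (vn + 1) (.ite (.and (.lt (vr 20) vn) (.and (.lt (vr 21) vn)
    (.and (.eq (.get aSide (vr 20)) 1) (.and (.eq (.get aSide (vr 21)) 2)
      (.eq (.get aAdj (vr 20 * vn + vr 21)) 1)))))
    (.setR rCap (capAt (vr 20) (vr 21)) (.get rBig 0))
    (.ite (.and (.lt (vr 20) vn) (.and (.eq (vr 21) vn) (.eq (.get aSide (vr 20)) 2)))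
      (.setR rCap (capAt (vr 20) (vr 21)) (.get rWgt (vr 20)))
      (.setR rCap (capAt (vr 20) (vr 21)) .zero))))))

/-- Level `25` is empty. -/
def gapFm : Fm := .conj (.base (.natLe 1 (vr 25)))
  (.all 26 0 (.base (.not (.eq (.get aHgt (vr 26)) (vr 25)))))

/-- Write the vertex cover that belongs to the cut above an empty level. -/
def readCutProg : Prog :=
  .seq (Fm.choose 25 2 gapFm) (.loop 20 vn (.ite (.eq (.get aSide (vr 20)) 1)
    (.ite (.lt (vr 25) (.get aHgt (vr 20))) (.setN aOut (vr 20) 0) (.setN aOut (vr 20) 1))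
    (.ite (.eq (.get aSide (vr 20)) 2)
      (.ite (.lt (vr 25) (.get aHgt (vr 20))) (.setN aOut (vr 20) 1) (.setN aOut (vr 20) 0))
      (.setN aOut (vr 20) 1))))

/-- Compute the weight of the vertex set in the array `aOut`. -/
def weighProg : Prog :=
  .seq (.setR rVal 0 .zero) (.loop 20 vn (.ite (.eq (.get aOut (vr 20)) 1)
    (.setR rVal 0 (.get rVal 0 + .get rWgt (vr 20))) .skip))

/-- Compute a minimum weight vertex cover among those that contain all vertices outside the two
sides, for a graph without edges inside the two sides. -/
def coverProg : Prog := .seq networkProg (.seq sweepsProg (.seq readCutProg weighProg))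

section

variable {n B : ℕ} {R : ℝ} {σ : Store}

theorem ok_network (hB : n + 5 ≤ B) (hn : σ.nat 0 0 = n) (hR : 0 ≤ R)
    (hw : ∀ v < n, |σ.real rWgt v| ≤ R) (hM : |σ.real rBig 0| ≤ R) :
    Ok B R networkProg σ fun τ =>
      (∀ u ≤ n, τ.nat aHgt u = if u < n then 1 else 0) ∧
      (∀ u ≤ n, τ.real rExc u = coverSrc n (σ.nat aSide) (σ.real rWgt) u) ∧
      ∀ u ≤ n, ∀ v ≤ n, τ.real rCap (u * (n + 1) + v) = coverCap n
        (fun u v => σ.nat aAdj (u * n + v) = 1) (σ.nat aSide) (σ.real rWgt)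
          (σ.real rBig 0) u v := by
  have e₀ : ∀ τ : Store, Same [aHgt, 20, 21] [rExc] σ τ → τ.nat 0 0 = n := fun τ h => by
    rw [h.nat 0, hn]
  have f₁ : Fills B R (fun τ => τ.nat aHgt) [20] [aHgt] [] (.loop 20 (vn + 1)
      (.ite (.lt (vr 20) vn) (.setN aHgt (vr 20) 1) (.setN aHgt (vr 20) 0))) σ
      (fun j v => ∃ i < NExp.eval σ (vn + 1), j = i ∧ v = if i < n then 1 else 0) :=
    fills_loop (by simp [hn]; omega) (fun τ v => by simp)
      (by omega) fun i hi => fills_ite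
        (fun h => fills_setN (by simp) (by simp [hn] at h; simp [h]) (by split_ifs <;> omega))
        (fun h => fills_setN (by simp) (by simp [hn] at h; simp [h]) (by split_ifs <;> omega))
  have f₂ : ∀ τ : Store, Same [aHgt, 20, 21] [rExc] σ τ →
      Fills B R (fun τ => τ.real rExc) [20] [] [rExc] (.loop 20 (vn + 1)
      (.ite (.and (.lt (vr 20) vn) (.eq (.get aSide (vr 20)) 1))
        (.setR rExc (vr 20) (.get rWgt (vr 20))) (.setR rExc (vr 20) .zero))) τ
      (fun j v => ∃ i < NExp.eval τ (vn + 1),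
        j = i ∧ v = coverSrc n (σ.nat aSide) (σ.real rWgt) i) := by
    intro τ hτ
    have hS : ∀ i, |coverSrc n (σ.nat aSide) (σ.real rWgt) i| ≤ R := fun i => by
      unfold coverSrc
      split_ifs with h
      · exact hw i h.1
      · simpa using hR
    refine fills_loop (by simp [e₀ τ hτ]; omega) (fun τ v => by simp)
      (by omega) fun i hi => fills_ite
        (fun h => fills_setR (by simp) ?_ (hS i))
        (fun h => fills_setR (by simp) ?_ (hS i))
    · simp [e₀ τ hτ, hτ.nat aSide] at h
      simp [coverSrc, h, hτ.real rWgt]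
    · simp [e₀ τ hτ, hτ.nat aSide] at h
      simp only [coverSrc, RExp.eval_zero]
      rw [if_neg]; tauto
  have f₃ : ∀ τ : Store, Same [aHgt, 20, 21] [rExc] σ τ →
      Fills B R (fun τ => τ.real rCap) [20, 21] [] [rCap]
      (.loop 20 (vn + 1) (.loop 21 (vn + 1) (.ite (.and (.lt (vr 20) vn) (.and (.lt (vr 21) vn)
        (.and (.eq (.get aSide (vr 20)) 1) (.and (.eq (.get aSide (vr 21)) 2)
          (.eq (.get aAdj (vr 20 * vn + vr 21)) 1)))))
        (.setR rCap (capAt (vr 20) (vr 21)) (.get rBig 0))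
        (.ite (.and (.lt (vr 20) vn) (.and (.eq (vr 21) vn) (.eq (.get aSide (vr 20)) 2)))
          (.setR rCap (capAt (vr 20) (vr 21)) (.get rWgt (vr 20)))
          (.setR rCap (capAt (vr 20) (vr 21)) .zero))))) τ
      (fun j x => ∃ u < NExp.eval τ (vn + 1), ∃ v < NExp.eval (τ.setNat 20 0 u) (vn + 1),
        j = u * (n + 1) + v ∧ x = coverCap n
        (fun u v => σ.nat aAdj (u * n + v) = 1) (σ.nat aSide) (σ.real rWgt)
          (σ.real rBig 0) u v) := by
    intro τ hτ
    have k₁ := hτ.nat aSide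
    have k₂ := hτ.real rWgt
    have k₃ := hτ.real rBig
    have k₄ := hτ.nat aAdj
    have hS : ∀ u v, |coverCap n (fun u v => σ.nat aAdj (u * n + v) = 1) (σ.nat aSide)
        (σ.real rWgt) (σ.real rBig 0) u v| ≤ R := fun u v => by
      unfold coverCap
      split_ifs with h h'
      · exact hM
      · exact hw u h'.1
      · simpa using hR
    refine fills_loop (by simp [e₀ τ hτ]; omega) (fun τ v => by simp) ?_
      fun u hu => fills_loop (by simp [e₀ τ hτ]; omega)
        (fun τ v => by simp) ?_ fun v hv => fills_ite
        (fun h => fills_setR (by simp [e₀ τ hτ]) ?_ (hS u v))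
        (fun h => fills_ite
          (fun h' => fills_setR (by simp [e₀ τ hτ]) ?_ (hS u v))
          (fun h' => fills_setR (by simp [e₀ τ hτ]) ?_ (hS u v)))
    · rintro i _ i' _ j x x' ⟨v, hv, rfl, _⟩ ⟨v', hv', h, _⟩
      simp [e₀ τ hτ] at hv hv'
      exact ((addr_inj (by omega) (by omega)).1 h).1
    · rintro i _ i' _ j x x' ⟨rfl, _⟩ ⟨h, _⟩
      omega
    · simp [e₀ τ hτ, k₁, k₄] at h
      simp [coverCap, h, k₃]
    · simp [e₀ τ hτ, k₁, k₄] at h h'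
      simp [coverCap, h', k₂]
    · simp [e₀ τ hτ, k₁, k₄] at h h'
      simp only [coverCap, RExp.eval_zero]
      rw [if_neg (by tauto), if_neg (by tauto)]
  refine (f₁.ok).seq fun τ hτ ⟨h₁, _⟩ => ?_
  have hτ' : Same [aHgt, 20, 21] [rExc] σ τ := hτ.mono (by decide) (by decide)
  refine ((f₂ τ hτ').ok).seq fun ρ hρ ⟨h₂, _⟩ => ?_
  have hρ' : Same [aHgt, 20, 21] [rExc] σ ρ := hτ'.trans (hρ.mono (by decide) (by decide))
  refine ((f₃ ρ hρ').ok).mono fun κ hκ ⟨h₃, _⟩ =>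
    ⟨fun u hu => ?_, fun u hu => ?_, fun u hu v hv => ?_⟩
  · rw [hκ.nat aHgt, hρ.nat aHgt]
    exact h₁ u _ ⟨u, by simp [hn]; omega, rfl, rfl⟩
  · rw [hκ.real rExc]
    exact h₂ u _ ⟨u, by simp [e₀ τ hτ']; omega, rfl, rfl⟩
  · exact h₃ _ _ ⟨u, by simp [e₀ ρ hρ']; omega, v, by simp [e₀ ρ hρ']; omega, rfl, rfl⟩

/-- The cut is read off at an empty level `g`. -/
theorem ok_readCut (hB : n + 5 ≤ B) (hn : σ.nat 0 0 = n) :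
    Ok B R readCutProg σ fun τ => ∃ g, 1 ≤ g ∧ g ≤ n + 1 ∧ (∀ u < n, σ.nat aHgt u ≠ g) ∧
      ∀ u < n, τ.nat aOut u = if (σ.nat aSide u = 1 ∧ ¬ g < σ.nat aHgt u) ∨
        (σ.nat aSide u = 2 ∧ g < σ.nat aHgt u) ∨ (σ.nat aSide u ≠ 1 ∧ σ.nat aSide u ≠ 2)
        then 1 else 0 := by
  refine (Fm.ok_choose (by decide) (by omega)).seq fun τ hτ ⟨h₁, _⟩ => ?_
  have hgap := Preflow.exists_gap n (σ.nat aHgt)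
  have hP : ∀ i, gapFm.Holds (σ.setNat 25 0 i) ↔ 1 ≤ i ∧ ∀ u < n, σ.nat aHgt u ≠ i := by
    intro i
    simp [gapFm, hn]
  obtain ⟨g, hg⟩ : ∃ g, g = τ.nat 25 0 := ⟨_, rfl⟩
  have hspec : g < n + 2 ∧ gapFm.Holds (σ.setNat 25 0 g) := by
    rw [hg, h₁, ← hn]
    refine lastSat_spec (P := fun i => gapFm.Holds (σ.setNat 25 0 i)) ?_
    obtain ⟨g, k₁, k₂, k₃⟩ := hgap
    exact ⟨g, by omega, (hP g).2 ⟨k₁, k₃⟩⟩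
  rw [hP] at hspec
  have f : Fills B R (fun τ => τ.nat aOut) [20] [aOut] [] (.loop 20 vn
      (.ite (.eq (.get aSide (vr 20)) 1)
      (.ite (.lt (vr 25) (.get aHgt (vr 20))) (.setN aOut (vr 20) 0) (.setN aOut (vr 20) 1))
      (.ite (.eq (.get aSide (vr 20)) 2)
        (.ite (.lt (vr 25) (.get aHgt (vr 20))) (.setN aOut (vr 20) 1) (.setN aOut (vr 20) 0))
        (.setN aOut (vr 20) 1)))) τ
      (fun j v => ∃ u < NExp.eval τ vn, j = u ∧ v = if (σ.nat aSide u = 1 ∧ ¬ g < σ.nat aHgt u) ∨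
        (σ.nat aSide u = 2 ∧ g < σ.nat aHgt u) ∨ (σ.nat aSide u ≠ 1 ∧ σ.nat aSide u ≠ 2)
        then 1 else 0) := by
    have k₀ : τ.nat 0 0 = n := by rw [hτ.nat 0, hn]
    have k₁ := hτ.nat aSide
    have k₂ := hτ.nat aHgt
    refine fills_loop (by simp [k₀]; omega) (fun τ v => by simp)
      (by omega) fun u hu => fills_ite
      (fun h => fills_ite
        (fun h' => fills_setN (by simp) ?_ (by split_ifs <;> omega))
        (fun h' => fills_setN (by simp) ?_ (by split_ifs <;> omega)))
      (fun h => fills_ite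
        (fun h'' => fills_ite
          (fun h' => fills_setN (by simp) ?_ (by split_ifs <;> omega))
          (fun h' => fills_setN (by simp) ?_ (by split_ifs <;> omega)))
        (fun h' => fills_setN (by simp) ?_ (by split_ifs <;> omega)))
    · simp [← hg, k₁, k₂] at h h'; simp [h, h']
    · simp [← hg, k₁, k₂] at h h'; simp [h, h']
    · simp [← hg, k₁, k₂] at h h' h''; simp [h', h'']
    · simp [← hg, k₁, k₂] at h h' h''; simp [h', h'']
    · simp [k₁] at h h'; simp [h, h']
  refine f.ok.mono fun ρ hρ ⟨k₁, _⟩ => ⟨g, hspec.2.1, by omega, hspec.2.2, fun u hu => ?_⟩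
  exact k₁ u _ ⟨u, by simp [hτ.nat 0, hn, hu], rfl, rfl⟩

theorem ok_weigh (hB : n + 5 ≤ B) (hn : σ.nat 0 0 = n) (hw : ∀ v < n, 0 ≤ σ.real rWgt v)
    (hR : ∑ v ∈ Finset.range n, σ.real rWgt v ≤ R) :
    Ok B R weighProg σ fun τ => τ.real rVal 0 =
      ∑ v ∈ Finset.range n with σ.nat aOut v = 1, σ.real rWgt v := by
  have hR0 : 0 ≤ R := (Finset.sum_nonneg fun v hv => hw v (by simpa using hv)).trans hR
  unfold weighProg
  rw [ok_seq, ok_setR]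
  refine ⟨by simpa using hR0, ?_⟩
  have hp : ∀ i ≤ n, 0 ≤ (∑ v ∈ Finset.range i with σ.nat aOut v = 1, σ.real rWgt v) ∧
      (∑ v ∈ Finset.range i with σ.nat aOut v = 1, σ.real rWgt v) ≤ R := by
    intro i hi
    refine ⟨Finset.sum_nonneg fun v hv => hw v (by simp at hv; omega), le_trans ?_ hR⟩
    refine Finset.sum_le_sum_of_subset_of_nonneg (fun v hv => ?_) fun v hv _ =>
      hw v (by simpa using hv)
    simp at hv ⊢; omega
  refine (Ok.loop (fun i τ => τ.real rVal 0 =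
    ∑ v ∈ Finset.range i with σ.nat aOut v = 1, σ.real rWgt v) ?_ ?_ ?_).mono ?_
  · simp [hn]; omega
  · simp
  · intro i hi τ hS hτ h₁
    simp [hn] at hi
    have k₁ := hS.nat aOut
    have k₂ := hS.real rWgt
    simp at k₁ k₂
    have hsum : ∑ v ∈ Finset.range (i + 1) with σ.nat aOut v = 1, σ.real rWgt v =
        (∑ v ∈ Finset.range i with σ.nat aOut v = 1, σ.real rWgt v) +
          if σ.nat aOut i = 1 then σ.real rWgt i else 0 := by
      rw [Finset.sum_filter, Finset.sum_filter, Finset.sum_range_succ]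
    rw [ok_ite]
    constructor
    · intro hb
      simp [k₁, hτ] at hb
      rw [ok_setR]
      have := hp (i + 1) (by omega)
      rw [hsum, if_pos hb] at this
      simp only [RExp.eval_add, RExp.eval_get, NExp.eval_get, NExp.eval_zero, hτ, h₁, k₂]
      refine ⟨?_, ?_⟩
      · rw [abs_of_nonneg this.1]; exact this.2
      · rw [hsum, if_pos hb]; simp
    · intro hb
      simp [k₁, hτ] at hb
      rw [ok_skip, hsum, if_neg hb]
      simpa using h₁
  · intro τ _ h
    simpa [hn] using h

/-- The program for bipartite graphs finds a minimum weight vertex cover among those that contain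
all vertices outside the two sides. -/
theorem ok_cover (hB : n + 5 ≤ B) (hn : σ.nat 0 0 = n) (hw : ∀ v < n, 0 ≤ σ.real rWgt v)
    (hM : ∑ v ∈ Finset.range n, σ.real rWgt v < σ.real rBig 0) (hR : 2 * σ.real rBig 0 ≤ R) :
    Ok B R coverProg σ fun τ =>
      (∀ v < n, σ.nat aSide v ≠ 1 → σ.nat aSide v ≠ 2 → τ.nat aOut v = 1) ∧
      (∀ v < n, τ.nat aOut v = 0 ∨ τ.nat aOut v = 1) ∧
      (∀ u < n, ∀ v < n, σ.nat aSide u = 1 → σ.nat aSide v = 2 → σ.nat aAdj (u * n + v) = 1 →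
        τ.nat aOut u = 1 ∨ τ.nat aOut v = 1) ∧
      τ.real rVal 0 = (∑ v ∈ Finset.range n with τ.nat aOut v = 1, σ.real rWgt v) ∧
      ∀ D : ℕ → Prop, ∀ _ : DecidablePred D,
        (∀ v < n, σ.nat aSide v ≠ 1 → σ.nat aSide v ≠ 2 → D v) →
        (∀ u < n, ∀ v < n, σ.nat aSide u = 1 → σ.nat aSide v = 2 → σ.nat aAdj (u * n + v) = 1 →
          D u ∨ D v) →
        τ.real rVal 0 ≤ ∑ v ∈ Finset.range n with D v, σ.real rWgt v := by
  classical
  have hsum0 : 0 ≤ ∑ v ∈ Finset.range n, σ.real rWgt v :=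
    Finset.sum_nonneg fun v hv => hw v (by simpa using hv)
  have hw' : ∀ v < n, σ.real rWgt v ≤ ∑ v ∈ Finset.range n, σ.real rWgt v := fun v hv =>
    Finset.single_le_sum (f := σ.real rWgt) (fun u hu => hw u (by simpa using hu))
      (by simpa using hv)
  set s := σ.nat aSide with hs
  set w := σ.real rWgt with hwdef
  set M := σ.real rBig 0 with hMdef
  set E : ℕ → ℕ → Prop := fun u v => σ.nat aAdj (u * n + v) = 1 with hE
  have hcap0 : ∀ u v, 0 ≤ coverCap n E s w M u v := fun u v => by
    unfold coverCap; split_ifs with h h'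
    · linarith
    · exact hw u h'.1
    · exact le_rfl
  have hcapM : ∀ u v, coverCap n E s w M u v ≤ M := fun u v => by
    unfold coverCap; split_ifs with h h'
    · exact le_rfl
    · linarith [hw' u h'.1]
    · linarith
  have hsrc0 : ∀ u, 0 ≤ coverSrc n s w u := fun u => by
    unfold coverSrc; split_ifs with h
    · exact hw u h.1
    · exact le_rfl
  have hsrc : ∑ u ∈ Finset.range (n + 1), coverSrc n s w u ≤ R := by
    rw [Finset.sum_range_succ]
    have h1 : coverSrc n s w n = 0 := by simp [coverSrc]
    have h2 : ∑ u ∈ Finset.range n, coverSrc n s w u ≤ ∑ u ∈ Finset.range n, w u :=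
      Finset.sum_le_sum fun u hu => by
        unfold coverSrc; split_ifs with h
        · exact le_rfl
        · exact hw u (by simpa using hu)
    linarith
  unfold coverProg
  refine (ok_network hB hn (by linarith) (fun v hv => ?_) ?_).seq fun τ hτ ⟨h₁, h₂, h₃⟩ => ?_
  · rw [abs_of_nonneg (hw v hv)]; linarith [hw' v hv]
  · rw [abs_of_nonneg (by linarith)]; linarith
  have t0 : τ.nat 0 0 = n := by rw [hτ.nat 0, hn]
  have hstart : SweepAt n (coverCap n E s w M) (coverSrc n s w) 0 False (n + 1) 0 τ := by
    refine ⟨⟨fun u hu v hv => ?_, fun u hu => ?_, fun u hu v hv => ?_, fun u hu => ?_,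
      fun u hu v hv _ => ?_⟩, by simpa using h₁ n le_rfl, fun u hu => ?_, Nat.zero_le _,
      .inr fun a ha h => absurd h (by omega), False.elim⟩
    · rw [h₃ u hu v hv]; exact hcap0 u v
    · rw [h₂ u hu]; exact hsrc0 u
    · rw [h₃ u hu v hv, h₃ v hv u hu]
    · rw [h₂ u hu, Finset.sum_eq_zero, add_zero]
      intro b hb
      rw [h₃ u hu b (by simp at hb; omega), sub_self]
    · rw [h₁ u hu, h₁ v hv]; split_ifs <;> omega
    · rw [h₁ u hu.le, if_pos hu]; omega
  refine (ok_sweeps (fun u _ v _ => ?_) hsrc hB t0 hstart).seq fun ρ hρ ⟨k₁, k₂⟩ => ?_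
  · linarith [hcapM u v, hcapM v u]
  have r0 : ρ.nat 0 0 = n := by rw [hρ.nat 0, t0]
  have rs : ρ.nat aSide = s := by rw [hρ.nat aSide, hτ.nat aSide]
  have rw' : ρ.real rWgt = w := by rw [hρ.real rWgt, hτ.real rWgt]
  refine (ok_readCut hB r0).seq fun κ hκ ⟨g, g₁, g₂, g₃, g₄⟩ => ?_
  have q0 : κ.nat 0 0 = n := by rw [hκ.nat 0, r0]
  have qw : κ.real rWgt = w := by rw [hκ.real rWgt, rw']
  refine (ok_weigh hB q0 (by rw [qw]; exact hw) (by rw [qw]; linarith)).mono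
    fun κ' hκ' l => ?_
  rw [rs] at g₄
  have qo : κ'.nat aOut = κ.nat aOut := hκ'.nat aOut
  have hmin := cover_of_min_cut (E := E) (s := s) hw hM (fun u => g < ρ.nat aHgt u)
    (by rw [k₁.sink]; omega) fun Y _ hY => k₁.pf.gap_cut_le k₁.sink g₁ g₂ g₃ k₂ Y hY
  have hout : ∀ u < n, (κ.nat aOut u = 1 ↔ (s u = 1 ∧ ¬ g < ρ.nat aHgt u) ∨
        (s u = 2 ∧ g < ρ.nat aHgt u) ∨ (s u ≠ 1 ∧ s u ≠ 2)) := fun u hu => by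
    rw [g₄ u hu]; split_ifs with h
    · exact iff_of_true rfl h
    · exact iff_of_false (by decide) h
  simp only [qo]
  rw [l, qw]
  refine ⟨fun v hv a b => ?_, fun v hv => ?_, fun u hu v hv a b c => ?_, rfl, fun D _ hD hD' => ?_⟩
  · rw [hout v hv]; tauto
  · rw [g₄ v hv]; split_ifs <;> simp
  · rw [hout u hu, hout v hv]
    have := hmin.1 u hu v hv a b c
    tauto
  · have h := hmin.2 D inferInstance hD'
    have e₁ : ∑ v ∈ Finset.range n with κ.nat aOut v = 1, w v =
        (∑ v ∈ Finset.range n with (s v = 1 ∧ ¬ g < ρ.nat aHgt v) ∨ (s v = 2 ∧ g < ρ.nat aHgt v),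
          w v) + ∑ v ∈ Finset.range n with s v ≠ 1 ∧ s v ≠ 2, w v := by
      rw [Finset.sum_filter, Finset.sum_filter, Finset.sum_filter, ← Finset.sum_add_distrib]
      refine Finset.sum_congr rfl fun v hv => ?_
      simp only [hout v (by simpa using hv)]
      by_cases a : s v = 1
      · simp [a]
      · by_cases b : s v = 2 <;> simp [a, b]
    have e₂ : ∑ v ∈ Finset.range n with D v, w v =
        (∑ v ∈ Finset.range n with (s v = 1 ∨ s v = 2) ∧ D v, w v) +
          ∑ v ∈ Finset.range n with s v ≠ 1 ∧ s v ≠ 2, w v := by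
      rw [Finset.sum_filter, Finset.sum_filter, Finset.sum_filter, ← Finset.sum_add_distrib]
      refine Finset.sum_congr rfl fun v hv => ?_
      have hd := hD v (by simpa using hv)
      by_cases a : s v = 1
      · simp [a]
      · by_cases b : s v = 2
        · simp [b]
        · simp [a, b, hd a b]
    rw [e₁, e₂]
    linarith

end

/-! ### Branching into maximal independent sets -/

/-- The vertex set `A` covers all edges of the graph `E` on the first `n` numbers. -/
def Covers (n : ℕ) (E : ℕ → ℕ → Prop) (A : ℕ → Prop) : Prop :=
  ∀ u < n, ∀ v < n, E u v → A u ∨ A v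

open Classical in
/-- The weight of a vertex set. -/
noncomputable def wt (n : ℕ) (w : ℕ → ℝ) (A : ℕ → Prop) : ℝ :=
  ∑ v ∈ Finset.range n, if A v then w v else 0

theorem sum_filter_eq_wt (n : ℕ) (w : ℕ → ℝ) (A : ℕ → Prop) [DecidablePred A] :
    ∑ v ∈ Finset.range n with A v, w v = wt n w A := by
  rw [Finset.sum_filter, wt]
  exact Finset.sum_congr rfl fun v _ => by split_ifs <;> rfl

/-- The states of the vertices in the course of the branching: `0` undecided, `1` chosen,
`2` forced into the cover, `3` outside the initial cover. Chosen vertices are adjacent to neither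
chosen nor undecided ones, and the vertices outside the initial cover form an independent set. -/
structure Branching (n : ℕ) (E : ℕ → ℕ → Prop) (s : ℕ → ℕ) : Prop where
  one : ∀ u < n, ∀ v < n, s u = 1 → s v = 0 ∨ s v = 1 → ¬ E u v
  three : ∀ u < n, ∀ v < n, s u = 3 → s v = 3 → ¬ E u v
  le : ∀ u < n, s u ≤ 3

/-- The undecided vertices. -/
def undecided (n : ℕ) (s : ℕ → ℕ) : Finset ℕ := (Finset.range n).filter fun v => s v = 0

@[simp] theorem mem_undecided {n : ℕ} {s : ℕ → ℕ} {v : ℕ} :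
    v ∈ undecided n s ↔ v < n ∧ s v = 0 := by simp [undecided]

open Classical in
/-- The undecided neighbours of `u`. -/
noncomputable def undecidedNbrs (n : ℕ) (E : ℕ → ℕ → Prop) (s : ℕ → ℕ) (u : ℕ) : Finset ℕ :=
  (Finset.range n).filter fun v => s v = 0 ∧ E u v

@[simp] theorem mem_undecidedNbrs {n : ℕ} {E : ℕ → ℕ → Prop} {s : ℕ → ℕ} {u v : ℕ} :
    v ∈ undecidedNbrs n E s u ↔ v < n ∧ s v = 0 ∧ E u v := by
  simp [undecidedNbrs]

open Classical in
/-- The states after `u` has been chosen. -/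
noncomputable def chooseSt (E : ℕ → ℕ → Prop) (s : ℕ → ℕ) (u x : ℕ) : ℕ :=
  if x = u then 1 else if s x = 0 ∧ E u x then 2 else s x

section

variable {n : ℕ} {E : ℕ → ℕ → Prop} {s : ℕ → ℕ} {u v : ℕ}

/-- A chosen vertex and its neighbours, which are forced into the cover, satisfy the invariant. -/
theorem Branching.choose (h : Branching n E s) (hE : ∀ a < n, ∀ b < n, E a b → E b a)
    (hirr : ∀ a < n, ¬ E a a) (hu : u < n) (hs : s u = 0) :
    Branching n E (chooseSt E s u) := by
  refine ⟨fun a ha b hb h₁ h₂ => ?_, fun a ha b hb h₁ h₂ => ?_, fun a ha => ?_⟩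
  · by_cases hau : a = u
    · subst hau
      by_cases hbu : b = a
      · subst hbu; exact hirr b hb
      · by_cases h' : s b = 0 ∧ E a b
        · simp [chooseSt, hbu, h'] at h₂
        · simp only [chooseSt, if_neg hbu, if_neg h'] at h₂
          rcases h₂ with h₂ | h₂
          · exact fun hE' => h' ⟨h₂, hE'⟩
          · exact fun hE' => h.one b hb a ha h₂ (.inl hs) (hE a ha b hb hE')
    · have h' : ¬ (s a = 0 ∧ E u a) := fun h' => by simp [chooseSt, hau, h'] at h₁
      simp only [chooseSt, if_neg hau, if_neg h'] at h₁
      by_cases hbu : b = u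
      · subst hbu; exact h.one a ha b hb h₁ (.inl hs)
      · by_cases h'' : s b = 0 ∧ E u b
        · simp [chooseSt, hbu, h''] at h₂
        · simp only [chooseSt, if_neg hbu, if_neg h''] at h₂
          exact h.one a ha b hb h₁ h₂
  · have key : ∀ a, chooseSt E s u a = 3 → s a = 3 := by
      intro a; unfold chooseSt; split_ifs <;> omega
    exact h.three a ha b hb (key a h₁) (key b h₂)
  · have := h.le a ha
    unfold chooseSt; split_ifs <;> omega

/-- Choosing `u` decides `u` and all its undecided neighbours. -/
theorem card_undecided_choose (hirr : ∀ a < n, ¬ E a a) (hu : u < n) (hs : s u = 0) :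
    (undecided n (chooseSt E s u)).card + ((undecidedNbrs n E s u).card + 1) ≤
      (undecided n s).card := by
  classical
  have h₁ : u ∉ undecidedNbrs n E s u := by simp [hirr u hu]
  rw [← Finset.card_insert_of_notMem h₁, ← Finset.card_union_of_disjoint]
  · refine Finset.card_le_card fun x hx => ?_
    simp only [Finset.mem_union, Finset.mem_insert, mem_undecided, mem_undecidedNbrs] at hx ⊢
    rcases hx with ⟨h, h'⟩ | rfl | h
    · refine ⟨h, ?_⟩
      unfold chooseSt at h'; split_ifs at h'; exact h'
    · exact ⟨hu, hs⟩
    · exact ⟨h.1, h.2.1⟩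
  · rw [Finset.disjoint_left]
    intro x hx hx'
    simp only [Finset.mem_insert, mem_undecided, mem_undecidedNbrs] at hx hx'
    obtain ⟨_, h⟩ := hx
    unfold chooseSt at h
    split_ifs at h with h₁ h₂
    rcases hx' with h' | h'
    · exact h₁ h'
    · exact h₂ h'.2

/-- Every cover that contains the forced vertices is found in some branch: in the closed
neighbourhood of an undecided vertex there is a vertex whose undecided neighbours all belong to the
cover. -/
theorem exists_branch {A : ℕ → Prop} (hA : Covers n E A) (hf : ∀ x < n, s x = 2 → A x)
    (hv : v < n) (hs : s v = 0) : ∃ u < n, s u = 0 ∧ (u = v ∨ E v u) ∧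
      ∀ x < n, chooseSt E s u x = 2 → A x := by
  have key : ∀ u, (∀ x < n, s x = 0 → E u x → A x) → ∀ x < n, chooseSt E s u x = 2 → A x := by
    intro u hu x hx h
    unfold chooseSt at h
    by_cases h₁ : x = u
    · simp [h₁] at h
    · by_cases h₂ : s x = 0 ∧ E u x
      · exact hu x hx h₂.1 h₂.2
      · exact hf x hx (by simpa [h₁, h₂] using h)
  by_cases h : ∃ u < n, s u = 0 ∧ (u = v ∨ E v u) ∧ ¬ A u
  · obtain ⟨u, hu, hsu, huv, hAu⟩ := h
    exact ⟨u, hu, hsu, huv, key u fun x hx _ hE => (hA u hu x hx hE).resolve_left hAu⟩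
  · push Not at h
    exact ⟨v, hv, hs, .inl rfl, key v fun x hx hsx hE => h x hx hsx (.inr hE)⟩

end

theorem natCast_le_pow (m : ℕ) : (m : ℝ) ≤ 1.443 ^ m := by
  have key : ∀ k : ℕ, ((k + 3 : ℕ) : ℝ) ≤ 1.443 ^ (k + 3) := by
    intro k
    induction k with
    | zero => norm_num
    | succ k ih =>
      have : (1.443 : ℝ) ^ (k + 1 + 3) = 1.443 ^ (k + 3) * 1.443 := by ring
      rw [this]
      have h : ((k + 3 : ℕ) : ℝ) * 1.443 ≤ 1.443 ^ (k + 3) * 1.443 :=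
        mul_le_mul_of_nonneg_right ih (by norm_num)
      push_cast at h ⊢
      have hk : (0 : ℝ) ≤ k := k.cast_nonneg
      linarith
  match m with
  | 0 => norm_num
  | 1 => norm_num
  | 2 => norm_num
  | k + 3 => exact key k

/-! ### The branching program -/

/-! Two further arrays: the vertex selected at each depth, and the numbers of undecided
neighbours. -/

notation "aPick" => 16
notation "aDeg" => 30

/-- The state of a vertex in the current frame. -/
abbrev stat (e : NExp) : NExp := .get aStat (.get aDepth 0 * vn + e)

/-- The adjacency test. -/
abbrev adjB (e f : NExp) : BExp := .eq (.get aAdj (e * vn + f)) 1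

/-- The treatment of a leaf of the branching: all vertices are decided. -/
def leafProg : Prog :=
  .seq (.loop 20 vn (.ite (.eq (stat (vr 20)) 1) (.setN aSide (vr 20) 1)
    (.ite (.eq (stat (vr 20)) 3) (.setN aSide (vr 20) 2) (.setN aSide (vr 20) 0))))
  (.seq coverProg (.ite (.realLe (.get rBest 0) (.get rVal 0)) .skip
    (.seq (.setR rBest 0 (.get rVal 0)) (.loop 20 vn (.setN aBest (vr 20) (.get aOut (vr 20)))))))

/-- The formula that no vertex is undecided. -/
def leafFm : Fm := .all 20 0 (.neg (.base (.eq (stat (vr 20)) 0)))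

/-- The formula that vertex `21` is an undecided neighbour of vertex `20`. -/
def nbrFm : Fm := .conj (.base (.eq (stat (vr 21)) 0)) (.base (adjB (vr 20) (vr 21)))

/-- The formula that vertex `22` has minimum degree among the undecided vertices. -/
def pickFm : Fm := .conj (.base (.eq (stat (vr 22)) 0)) (.all 23 0
  (.or (.neg (.base (.eq (stat (vr 23)) 0)))
    (.base (.natLe (.get aDeg (vr 22)) (.get aDeg (vr 23))))))

/-- Select an undecided vertex of minimum degree. -/
def pickProg : Prog :=
  .seq (.loop 20 vn (.seq (Fm.count 21 0 nbrFm) (.setN aDeg (vr 20) (vr 21))))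
  (.seq (Fm.choose 22 0 pickFm) (.seq (.setN aPick (.get aDepth 0) (vr 22))
    (.setN aPos (.get aDepth 0) 0)))

/-- The current candidate of the current frame. -/
abbrev pos : NExp := .get aPos (.get aDepth 0)

/-- The selected vertex of the current frame. -/
abbrev pick : NExp := .get aPick (.get aDepth 0)

/-- Write the next frame, in which the current candidate has been chosen, and enter it. -/
def descendProg : Prog :=
  .seq (.loop 20 vn (.ite (.eq (vr 20) pos)
      (.setN aStat ((.get aDepth 0 + 1) * vn + vr 20) 1)
    (.ite (.and (.eq (stat (vr 20)) 0) (adjB pos (vr 20)))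
      (.setN aStat ((.get aDepth 0 + 1) * vn + vr 20) 2)
      (.setN aStat ((.get aDepth 0 + 1) * vn + vr 20) (stat (vr 20))))))
  (.setN aDepth 0 (.get aDepth 0 + 1))

/-- The test whether the current candidate is an undecided vertex in the closed neighbourhood of the
selected vertex. -/
def candB : BExp :=
  .and (.eq (stat pos) 0) (.not (.and (.not (.eq pos pick)) (.not (adjB pick pos))))

/-- Advance to the next candidate. -/
def nextProg : Prog := .setN aPos (.get aDepth 0) (pos + 1)

/-- Leave the current frame. -/
def ascendProg : Prog := .setN aDepth 0 (.get aDepth 0 - 1)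

/-- The recursive procedure; it calls itself as procedure `0`. -/
def branchCmd : Cmd :=
  .seq leafFm.prog.cmd (.ite (.natLe 1 (.get 6 0)) leafProg.cmd
    (.seq pickProg.cmd (.while (.lt pos vn)
      (.seq (.ite candB (.seq descendProg.cmd (.seq (.call 0) ascendProg.cmd)) Cmd.skip)
        nextProg.cmd))))

/-- The memory holds the graph `E` with the weights `w`, and a number `M`. -/
structure GraphAt (n : ℕ) (E : ℕ → ℕ → Prop) (w : ℕ → ℝ) (M : ℝ) (σ : Store) : Prop where
  n_eq : σ.nat 0 0 = n
  adj : ∀ u < n, ∀ v < n, σ.nat aAdj (u * n + v) = 1 ↔ E u v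
  wgt : ∀ v < n, σ.real rWgt v = w v
  big : σ.real rBig 0 = M

theorem GraphAt.congr {n : ℕ} {E : ℕ → ℕ → Prop} {w : ℕ → ℝ} {M : ℝ} {σ τ : Store}
    {LN LR : List ℕ} (h : GraphAt n E w M σ) (hS : Same LN LR σ τ) (h₀ : 0 ∉ LN := by decide)
    (h₁ : aAdj ∉ LN := by decide)
    (h₂ : rWgt ∉ LR := by decide) (h₃ : rBig ∉ LR := by decide) : GraphAt n E w M τ :=
  ⟨by rw [hS.nat 0 h₀, h.n_eq], by rw [hS.nat aAdj h₁]; exact h.adj,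
    by rw [hS.real rWgt h₂]; exact h.wgt, by rw [hS.real rBig h₃, h.big]⟩

/-- The best cover so far and its weight. -/
structure BestAt (n : ℕ) (E : ℕ → ℕ → Prop) (w : ℕ → ℝ) (σ : Store) : Prop where
  covers : Covers n E fun v => σ.nat aBest v = 1
  weight : σ.real rBest 0 = wt n w fun v => σ.nat aBest v = 1

theorem BestAt.congr {n : ℕ} {E : ℕ → ℕ → Prop} {w : ℕ → ℝ} {σ τ : Store}
    (h : BestAt n E w σ) (h₁ : τ.nat aBest = σ.nat aBest) (h₂ : τ.real rBest = σ.real rBest) :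
    BestAt n E w τ := by
  obtain ⟨a, b⟩ := h
  exact ⟨by rw [h₁]; exact a, by rw [h₁, h₂]; exact b⟩

/-- The states in the current frame. -/
abbrev St (n k : ℕ) (σ : Store) : ℕ → ℕ := fun u => σ.nat aStat (k * n + u)

section

variable {n B k : ℕ} {R M : ℝ} {E : ℕ → ℕ → Prop} {w : ℕ → ℝ} {σ : Store}

/-- When no vertex is undecided, the chosen vertices and the vertices outside the known cover are
the two sides of a bipartite graph, and a minimum cut gives the best cover that contains the
forced vertices. -/
theorem ok_leaf (hB : n + 5 ≤ B) (hg : GraphAt n E w M σ) (hd : σ.nat aDepth 0 = k)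
    (hw : ∀ v < n, 0 ≤ w v) (hM : ∑ v ∈ Finset.range n, w v < M) (hR : 2 * M ≤ R)
    (hE : ∀ a < n, ∀ b < n, E a b → E b a) (hb : Branching n E (St n k σ))
    (hu : ∀ v < n, St n k σ v ≠ 0) :
    Ok B R leafProg σ fun τ => τ.real rBest 0 ≤ σ.real rBest 0 ∧
      (∀ A, Covers n E A → (∀ v < n, St n k σ v = 2 → A v) → τ.real rBest 0 ≤ wt n w A) ∧
      (BestAt n E w σ → BestAt n E w τ) := by
  set s := St n k σ with hs
  have hsum0 : 0 ≤ ∑ v ∈ Finset.range n, w v :=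
    Finset.sum_nonneg fun v hv => hw v (by simpa using hv)
  have hn := hg.n_eq
  have f : Fills B R (fun τ => τ.nat aSide) [20] [aSide] [] (.loop 20 vn
      (.ite (.eq (stat (vr 20)) 1) (.setN aSide (vr 20) 1)
      (.ite (.eq (stat (vr 20)) 3) (.setN aSide (vr 20) 2) (.setN aSide (vr 20) 0)))) σ
      (fun j v => ∃ u < NExp.eval σ vn, j = u ∧
        v = if s u = 1 then 1 else if s u = 3 then 2 else 0) := by
    refine fills_loop (by simp [hn]; omega) (fun τ v => by simp)
      (by omega) fun u hu => fills_ite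
      (fun h => fills_setN (by simp) ?_ (by split_ifs <;> omega))
      (fun h => fills_ite
        (fun h' => fills_setN (by simp) ?_ (by split_ifs <;> omega))
        (fun h' => fills_setN (by simp) ?_ (by split_ifs <;> omega)))
    · simp [hn, hd] at h; simp [hs, h]
    · simp [hn, hd] at h h'; simp [hs, h']
    · simp [hn, hd] at h h'; simp [hs, h, h']
  unfold leafProg
  refine f.ok.seq fun τ hτ ⟨h₁, _⟩ => ?_
  have side : ∀ u < n, τ.nat aSide u = if s u = 1 then 1 else if s u = 3 then 2 else 0 :=
    fun u hu => h₁ u _ ⟨u, by simpa [hn] using hu, rfl, rfl⟩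
  have gτ := hg.congr hτ
  have hwτ : ∀ A : ℕ → Prop, ∀ _ : DecidablePred A,
      (∑ v ∈ Finset.range n with A v, τ.real rWgt v) = wt n w A := by
    intro A _
    rw [← sum_filter_eq_wt]
    exact Finset.sum_congr rfl fun v hv => gτ.wgt v (by simp at hv; exact hv.1)
  have hwτ' : ∑ v ∈ Finset.range n, τ.real rWgt v = ∑ v ∈ Finset.range n, w v :=
    Finset.sum_congr rfl fun v hv => gτ.wgt v (by simpa using hv)
  refine (ok_cover hB gτ.n_eq (fun v hv => by rw [gτ.wgt v hv]; exact hw v hv)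
    (by rw [hwτ', gτ.big]; exact hM) (by rw [gτ.big]; exact hR)).seq
    fun ρ hρ ⟨k₁, k₂, k₃, k₄, k₅⟩ => ?_
  have side0 : ∀ u < n, τ.nat aSide u ≠ 1 → τ.nat aSide u ≠ 2 → s u = 2 := by
    intro u hu' h h'
    rw [side u hu'] at h h'
    have := hb.le u hu'
    have := hu u hu'
    split_ifs at h h' with h₁ h₂ <;> simp at h h' <;> omega
  have side1 : ∀ u < n, τ.nat aSide u = 1 → s u = 1 := by
    intro u hu' h; by_contra hne; rw [side u hu', if_neg hne] at h; split_ifs at h; simp at h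
  have side2 : ∀ u < n, τ.nat aSide u = 2 → s u = 3 := by
    intro u hu' h; by_contra hne; rw [side u hu', if_neg hne] at h; split_ifs at h; simp at h
  have hcov : Covers n E fun v => ρ.nat aOut v = 1 := by
    intro u hu' v hv' huv
    by_contra hcon
    push Not at hcon
    have c₁ : ∀ x < n, ρ.nat aOut x ≠ 1 → τ.nat aSide x = 1 ∨ τ.nat aSide x = 2 := by
      intro x hx h; by_contra h'; push Not at h'; exact h (k₁ x hx h'.1 h'.2)
    rcases c₁ u hu' hcon.1 with a | a <;> rcases c₁ v hv' hcon.2 with b | b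
    · exact hb.one u hu' v hv' (side1 u hu' a) (.inr (side1 v hv' b)) huv
    · have := k₃ u hu' v hv' a b ((gτ.adj u hu' v hv').2 huv)
      tauto
    · have := k₃ v hv' u hu' b a ((gτ.adj v hv' u hu').2 (hE u hu' v hv' huv))
      tauto
    · exact hb.three u hu' v hv' (side2 u hu' a) (side2 v hv' b) huv
  have hval : ρ.real rVal 0 = wt n w fun v => ρ.nat aOut v = 1 := by
    rw [k₄]; exact hwτ _ _
  have hopt : ∀ A, Covers n E A → (∀ v < n, s v = 2 → A v) → ρ.real rVal 0 ≤ wt n w A := by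
    intro A hA hA'
    classical
    rw [← hwτ A inferInstance]
    exact k₅ A inferInstance (fun v hv h h' => hA' v hv (side0 v hv h h'))
      fun u hu v hv _ _ h => hA u hu v hv ((gτ.adj u hu v hv).1 h)
  have hbest : ρ.real rBest = σ.real rBest := by
    rw [hρ.real rBest, hτ.real rBest]
  have hbest' : ρ.nat aBest = σ.nat aBest := by
    rw [hρ.nat aBest, hτ.nat aBest]
  rw [ok_ite]
  constructor
  · intro h
    simp at h
    rw [ok_skip, hbest]
    rw [hbest] at h
    exact ⟨le_rfl, fun A hA hA' => h.trans (hopt A hA hA'), fun hb => hb.congr hbest' hbest⟩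
  · intro h
    simp at h
    have gρ := gτ.congr hρ
    have hle : ρ.real rVal 0 ≤ ∑ v ∈ Finset.range n, w v := by
      refine (hopt (fun _ => True) (fun _ _ _ _ _ => .inl trivial) fun _ _ _ => trivial).trans ?_
      simp [wt]
    have hge : 0 ≤ ρ.real rVal 0 := by
      rw [hval, wt]
      refine Finset.sum_nonneg fun v hv => ?_
      have := hw v (by simpa using hv)
      split_ifs <;> simp [this]
    rw [ok_seq, ok_setR]
    refine ⟨?_, ?_⟩
    · simp only [RExp.eval_get, NExp.eval_zero]
      rw [abs_of_nonneg hge]; linarith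
    set ρ' := ρ.setReal rBest (NExp.eval ρ 0) (RExp.eval ρ (.get rVal 0)) with hρ'
    have o' : ρ'.nat aOut = ρ.nat aOut := by simp [hρ']
    have f : Fills B R (fun τ => τ.nat aBest) [20] [aBest] [] (.loop 20 vn
        (.setN aBest (vr 20) (.get aOut (vr 20)))) ρ'
        (fun j v => ∃ u < NExp.eval ρ' vn, j = u ∧ v = ρ.nat aOut u) := by
      refine fills_loop (by simp [hρ', gρ.n_eq]; omega)
        (fun τ v => by simp) (by omega) fun u hu => fills_setN (by simp) (by simp [hρ']) ?_
      simp [hρ', gρ.n_eq] at hu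
      rcases k₂ u hu with h | h <;> omega
    refine f.ok.mono fun κ hκ ⟨l₁, _⟩ => ?_
    have hb' : ∀ v < n, κ.nat aBest v = ρ.nat aOut v :=
      fun u hu => l₁ u _ ⟨u, by simpa [hρ', gρ.n_eq] using hu, rfl, rfl⟩
    have hr : κ.real rBest 0 = ρ.real rVal 0 := by
      rw [hκ.real rBest]; simp [hρ']
    rw [hr]
    refine ⟨?_, hopt, fun _ => ⟨?_, ?_⟩⟩
    · rw [← hbest]; exact h.le
    · intro u hu v hv huv
      simp only [hb' u hu, hb' v hv]
      exact hcov u hu v hv huv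
    · rw [hr, hval, wt, wt]
      refine Finset.sum_congr rfl fun v hv => ?_
      have := hb' v (by simpa using hv)
      simp [this]

theorem ok_leafFm (hB : n + 5 ≤ B) (hn : σ.nat 0 0 = n) (hd : σ.nat aDepth 0 = k) :
    Ok B R leafFm.prog σ fun τ => τ.nat 6 0 ≤ 1 ∧
      (1 ≤ τ.nat 6 0 ↔ ∀ v < n, St n k σ v ≠ 0) := by
  refine (Fm.ok_prog leafFm (by decide) (by omega)).mono fun τ _ ⟨h, _⟩ => ?_
  have : leafFm.Holds σ ↔ ∀ v < n, St n k σ v ≠ 0 := by simp [leafFm, hn, hd]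
  rw [h, ← this]
  split_ifs with h' <;> simp [h']

open Classical in
/-- The selected vertex has the minimum number of undecided neighbours. -/
theorem ok_pick (hB : n + 5 ≤ B) (hg : GraphAt n E w M σ) (hd : σ.nat aDepth 0 = k)
    (hu : ∃ v < n, St n k σ v = 0) :
    Ok B R pickProg σ fun τ => ∃ v < n, τ.nat aPick k = v ∧ τ.nat aPos k = 0 ∧ St n k σ v = 0 ∧
      (∀ u < n, St n k σ u = 0 →
        (undecidedNbrs n E (St n k σ) v).card ≤ (undecidedNbrs n E (St n k σ) u).card) ∧
      (∀ j ≠ k, τ.nat aPick j = σ.nat aPick j) ∧ (∀ j ≠ k, τ.nat aPos j = σ.nat aPos j) := by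
  have hn := hg.n_eq
  set s := St n k σ with hs
  have hcard : ∀ u, (undecidedNbrs n E s u).card ≤ n := fun u =>
    (Finset.card_filter_le _ _).trans (by simp)
  unfold pickProg
  refine (Ok.loop (fun i τ => ∀ u < i, τ.nat aDeg u = (undecidedNbrs n E s u).card) ?_ ?_ ?_).seq ?_
  · simp [hn]; omega
  · simp
  · intro i hi τ hτ hi' hI
    simp [hn] at hi
    have gτ := hg.congr hτ
    have dτ : τ.nat aDepth 0 = k := by rw [hτ.nat aDepth, hd]
    have sτ : τ.nat aStat = σ.nat aStat := hτ.nat aStat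
    refine (Fm.ok_count (by decide) (by rw [gτ.n_eq]; omega)).seq fun ρ hρ ⟨h₁, _⟩ => ?_
    have hc : ρ.nat 21 0 = (undecidedNbrs n E s i).card := by
      rw [h₁, gτ.n_eq]
      refine congrArg _ (Finset.filter_congr fun v hv => ?_)
      simp at hv
      simp [nbrFm, gτ.n_eq, dτ, sτ, hi', gτ.adj i hi v hv, hs, St]
    rw [ok_setN]
    simp only [NExp.eval_get, NExp.eval_zero, hc]
    refine ⟨(hcard i).trans (by omega), fun u hu => ?_⟩
    have h20 : ρ.nat 20 0 = i := by rw [hρ.nat 20, hi']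
    simp only [h20, Store.setNat_nat]
    simp
    split_ifs with h
    · rw [h]
    · rw [hρ.nat aDeg]
      exact hI u (by omega)
  · intro τ hτ hI
    simp only [NExp.eval_get, NExp.eval_zero, hn] at hI
    have gτ := hg.congr hτ
    have dτ : τ.nat aDepth 0 = k := by rw [hτ.nat aDepth, hd]
    have sτ : τ.nat aStat = σ.nat aStat := hτ.nat aStat
    have hP : ∀ i < n, pickFm.Holds (τ.setNat 22 0 i) ↔ s i = 0 ∧ ∀ u < n, s u = 0 →
        (undecidedNbrs n E s i).card ≤ (undecidedNbrs n E s u).card := by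
      intro i hi
      simp only [pickFm, Fm.holds_conj, Fm.holds_base, Fm.holds_all, Fm.holds_or, Fm.holds_neg]
      simp [gτ.n_eq, dτ, sτ, hI i hi, hs, St]
      intro _
      refine forall_congr' fun u => forall_congr' fun hu => ?_
      rw [hI u hu]; tauto
    refine (Fm.ok_choose (by decide) (by rw [gτ.n_eq]; omega)).seq fun ρ hρ ⟨h₁, _⟩ => ?_
    rw [gτ.n_eq, add_zero] at h₁
    have hex : ∃ i < n, pickFm.Holds (τ.setNat 22 0 i) := by
      have hne : (undecided n s).Nonempty := by
        obtain ⟨v, hv, hv'⟩ := hu; exact ⟨v, by simp [hv, hv']⟩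
      obtain ⟨i, hi, hi'⟩ := Finset.exists_min_image _ (fun i => (undecidedNbrs n E s i).card) hne
      simp only [mem_undecided] at hi hi'
      exact ⟨i, hi.1, (hP i hi.1).2 ⟨hi.2, fun u hu hu' => hi' u ⟨hu, hu'⟩⟩⟩
    obtain ⟨l₁, l₂⟩ := lastSat_spec hex
    rw [← h₁] at l₁ l₂
    rw [hP _ l₁] at l₂
    have dρ : ρ.nat aDepth 0 = k := by rw [hρ.nat aDepth, dτ]
    simp only [ok_seq, ok_setN, NExp.eval_get, NExp.eval_zero, dρ]
    refine ⟨by omega, Nat.zero_le _, ρ.nat 22 0, l₁, by simp, by simp [dρ], l₂.1, l₂.2,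
      fun j hj => ?_, fun j hj => ?_⟩
    · simp [hj, hρ.nat aPick, hτ.nat aPick]
    · simp [hj, dρ, hρ.nat aPos, hτ.nat aPos]

theorem ok_descend (hB : n + 5 ≤ B) (hg : GraphAt n E w M σ) (hd : σ.nat aDepth 0 = k)
    {u : ℕ} (hp : σ.nat aPos k = u) (hu : u < n) (hk : k < n) (hb : Branching n E (St n k σ)) :
    Ok B R descendProg σ fun τ => τ.nat aDepth 0 = k + 1 ∧
      (∀ x < n, St n (k + 1) τ x = chooseSt E (St n k σ) u x) ∧
      ∀ j < (k + 1) * n, τ.nat aStat j = σ.nat aStat j := by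
  have hn := hg.n_eq
  set s := St n k σ with hs
  have hle : ∀ x < n, chooseSt E s u x ≤ B := by
    intro x hx
    have := hb.le x hx
    unfold chooseSt; split_ifs <;> omega
  -- The new frame lies above all cells that the loop reads, but in the same array, so the loop is
  -- followed round by round.
  unfold descendProg
  refine (Ok.loop (fun i τ => (∀ x < i, St n (k + 1) τ x = chooseSt E s u x) ∧
      ∀ j < (k + 1) * n, τ.nat aStat j = σ.nat aStat j) ?_ ?_ ?_).seq ?_
  · simp [hn]; omega
  · simp
  · intro i hi τ hτ hi' ⟨h₁, h₂⟩
    simp [hn] at hi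
    have gτ := hg.congr hτ
    have dτ : τ.nat aDepth 0 = k := by rw [hτ.nat aDepth, hd]
    have pτ : τ.nat aPos k = u := by rw [hτ.nat aPos, hp]
    have cell : k * n + i < (k + 1) * n := by rw [add_mul]; omega
    have sτ : τ.nat aStat (k * n + i) = s i := h₂ _ cell
    have step : ∀ v, v = chooseSt E s u i →
        ∀ e : NExp, e.eval τ = v → Ok B R (.setN aStat ((.get aDepth 0 + 1) * vn + vr 20) e) τ
          fun τ' => (∀ x < i + 1, St n (k + 1) (τ'.setNat 20 0 (i + 1)) x = chooseSt E s u x) ∧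
            ∀ j < (k + 1) * n, (τ'.setNat 20 0 (i + 1)).nat aStat j = σ.nat aStat j := by
      intro v hv e he
      rw [ok_setN, he]
      refine ⟨hv ▸ hle i hi, fun x hx => ?_, fun j hj => ?_⟩
      · simp [St, dτ, gτ.n_eq, hi']
        split_ifs with h
        · rw [h, hv]
        · exact h₁ x (by omega)
      · simp [dτ, gτ.n_eq, hi']
        rw [if_neg (by omega), h₂ j hj]
    rw [ok_ite, ok_ite]
    refine ⟨fun h => ?_, fun h => ⟨fun h' => ?_, fun h' => ?_⟩⟩
    · simp [hi', dτ, pτ] at h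
      exact step _ rfl _ (by simp [chooseSt, h])
    · simp [hi', dτ, pτ, gτ.n_eq, sτ, gτ.adj u hu i hi] at h h'
      exact step _ rfl _ (by simp [chooseSt, h, h'])
    · simp [hi', dτ, pτ, gτ.n_eq, sτ, gτ.adj u hu i hi] at h h'
      refine step _ rfl _ ?_
      simp [hi', dτ, gτ.n_eq, sτ, chooseSt, h]
      intro a b; exact absurd b (h' a)
  · intro τ hτ ⟨h₁, h₂⟩
    simp only [NExp.eval_get, NExp.eval_zero, hn] at h₁
    have dτ : τ.nat aDepth 0 = k := by rw [hτ.nat aDepth, hd]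
    rw [ok_setN]
    simp [dτ]
    exact ⟨by omega, h₁, h₂⟩

end

/-! ### The running time of the branching -/

/-- The program is well-formed, and its static bounds are at most `S` (natural numbers), `R'`
(absolute values of real numbers) and `D` (steps) when all cells are bounded by `B` and `R`. -/
structure Fit (B S : ℕ) (R R' D : ℝ) (p : Prog) : Prop where
  wf : p.wf = true
  space : p.space B ≤ S
  size : p.size * R ≤ R'
  time : (p.time B : ℝ) ≤ D

section

variable {procs : List Cmd} {B S d : ℕ} {R R' D : ℝ} {σ : Store}

theorem Ok.tri_fit {p : Prog} {Q : Store → Prop} (h : Ok B R p σ Q) (hσ : Bdd B R σ)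
    (hp : Fit B S R R' D p) :
    Tri procs S R' d p.cmd σ D fun τ => Bdd B R τ ∧ Same p.wN p.wR σ τ ∧ Q τ :=
  (h.tri hσ hp.wf hp.space hp.size).mono hp.time fun _ h => h

theorem Fit.fits {b : BExp} (hp : Fit B S R R' D (.ite b .skip .skip)) (hσ : Bdd B R σ) :
    b.Fits S R' σ := by
  have h0 : 0 ≤ R := (abs_nonneg _).trans (hσ.real 0 0)
  have h₁ := hp.space
  have h₂ := hp.size
  simp only [Prog.space] at h₁
  simp only [Prog.size] at h₂
  push_cast at h₂
  exact b.fits hσ (by omega) (by nlinarith)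

theorem Fit.cost {b : BExp} (hp : Fit B S R R' D (.ite b .skip .skip)) : (b.cost : ℝ) + 3 ≤ D := by
  have h := hp.time
  simp only [Prog.time] at h
  push_cast at h
  linarith

end

/-- The natural-number arrays that the branching writes. -/
def branchN : List ℕ := [6, 9, 10, 11, 12, 13, 14, 15, 16, 20, 21, 22, 23, 24, 25, 26, 30]

/-- The real arrays that the branching writes. -/
def branchR : List ℕ := [4, 5, 6, 7, 8]

/-- The call-free parts of the branching. -/
def branchProgs : List Prog :=
  [leafFm.prog, leafProg, pickProg, descendProg, ascendProg, nextProg, .skip,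
    .ite (.natLe 1 (.get 6 0)) .skip .skip, .ite (.lt pos vn) .skip .skip, .ite candB .skip .skip]

/-- What the branching at depth `k` leaves unchanged. -/
structure Keeps (n k : ℕ) (σ τ : Store) : Prop where
  same : Same branchN branchR σ τ
  depth : τ.nat aDepth 0 = k
  stat : ∀ j < (k + 1) * n, τ.nat aStat j = σ.nat aStat j
  pos : ∀ j < k, τ.nat aPos j = σ.nat aPos j
  pick : ∀ j < k, τ.nat aPick j = σ.nat aPick j

theorem Keeps.trans {n k : ℕ} {σ τ ρ : Store} (h : Keeps n k σ τ) (h' : Keeps n k τ ρ) :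
    Keeps n k σ ρ :=
  ⟨h.same.trans h'.same, h'.depth, fun j hj => (h'.stat j hj).trans (h.stat j hj),
    fun j hj => (h'.pos j hj).trans (h.pos j hj), fun j hj => (h'.pick j hj).trans (h.pick j hj)⟩

theorem Keeps.of_same {n k : ℕ} {σ τ : Store} {LN LR : List ℕ} (h : Same LN LR σ τ)
    (hd : σ.nat aDepth 0 = k) (h₁ : LN ⊆ branchN := by decide) (h₂ : LR ⊆ branchR := by decide)
    (hs : aDepth ∉ LN := by decide) (h₃ : aStat ∉ LN := by decide) (h₄ : aPos ∉ LN := by decide)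
    (h₅ : aPick ∉ LN := by decide) : Keeps n k σ τ :=
  ⟨h.mono h₁ h₂, by rw [h.nat _ hs, hd], fun j _ => by rw [h.nat _ h₃],
    fun j _ => by rw [h.nat _ h₄], fun j _ => by rw [h.nat _ h₅]⟩

/-- The best cover has been improved to at least the quality of all covers that contain the forced
vertices of the states `s`. -/
structure Improves (n : ℕ) (E : ℕ → ℕ → Prop) (w : ℕ → ℝ) (s : ℕ → ℕ) (σ τ : Store) : Prop where
  le : τ.real rBest 0 ≤ σ.real rBest 0
  opt : ∀ A, Covers n E A → (∀ v < n, s v = 2 → A v) → τ.real rBest 0 ≤ wt n w A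
  best : BestAt n E w σ → BestAt n E w τ

theorem Branching.congr {n : ℕ} {E : ℕ → ℕ → Prop} {s s' : ℕ → ℕ} (h : Branching n E s)
    (hs : ∀ u < n, s' u = s u) : Branching n E s' :=
  ⟨fun u hu v hv h₁ h₂ => h.one u hu v hv (by rwa [← hs u hu]) (by rwa [← hs v hv]),
    fun u hu v hv h₁ h₂ => h.three u hu v hv (by rwa [← hs u hu]) (by rwa [← hs v hv]),
    fun u hu => by rw [hs u hu]; exact h.le u hu⟩

theorem undecided_congr {n : ℕ} {s s' : ℕ → ℕ} (hs : ∀ u < n, s' u = s u) :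
    undecided n s' = undecided n s :=
  Finset.filter_congr fun v hv => by rw [hs v (by simpa using hv)]

open Classical in
theorem card_candidates {n : ℕ} {E : ℕ → ℕ → Prop} {s : ℕ → ℕ} {v : ℕ} (hirr : ∀ a < n, ¬ E a a)
    (hv : v < n) (hs : s v = 0) :
    ((Finset.range n).filter fun u => s u = 0 ∧ (u = v ∨ E v u)).card =
      (undecidedNbrs n E s v).card + 1 := by
  have h₁ : v ∉ undecidedNbrs n E s v := by simp [hirr v hv]
  rw [← Finset.card_insert_of_notMem h₁]
  congr 1
  ext u
  simp only [Finset.mem_filter, Finset.mem_range, Finset.mem_insert, mem_undecidedNbrs]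
  constructor
  · rintro ⟨h, h', rfl | h''⟩
    · exact .inl rfl
    · exact .inr ⟨h, h', h''⟩
  · rintro (rfl | ⟨h, h', h''⟩)
    · exact ⟨hv, hs, .inl rfl⟩
    · exact ⟨h, h', .inr h''⟩

/-- The branching on `m + 1` candidates, each of which decides at least `m + 1` vertices, stays
within the bound because `m + 1 ≤ 1.443 ^ (m + 1)`. -/
theorem branch_time {f m : ℕ} {D N : ℝ} (hm : m + 1 ≤ f) (hD : 0 ≤ D) (hN : 0 ≤ N) :
    (6 * N + 5) * D + ((m + 1 : ℕ) : ℝ) *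
      ((6 * N + 6) * D * (((f - (m + 1) : ℕ) : ℝ) + 1) * 1.443 ^ (f - (m + 1))) ≤
      (6 * N + 6) * D * (f + 1) * 1.443 ^ f := by
  have h₁ := natCast_le_pow (m + 1)
  have h₂ : (1.443 : ℝ) ^ f = 1.443 ^ (m + 1) * 1.443 ^ (f - (m + 1)) := by
    rw [← pow_add]; congr 1; omega
  have h₃ : (1 : ℝ) ≤ 1.443 ^ f := one_le_pow₀ (by norm_num)
  have h₄ : (((f - (m + 1) : ℕ) : ℝ) + 1) ≤ f := by
    have : f - (m + 1) + 1 ≤ f := by omega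
    exact_mod_cast this
  have h₅ : (0 : ℝ) ≤ 1.443 ^ (f - (m + 1)) := by positivity
  have h₆ : 0 ≤ (6 * N + 6) * D := by positivity
  have h₇ : ((m + 1 : ℕ) : ℝ) * 1.443 ^ (f - (m + 1)) ≤ 1.443 ^ f := by
    rw [h₂]; exact mul_le_mul_of_nonneg_right h₁ h₅
  have h₈ : (0 : ℝ) ≤ ((m + 1 : ℕ) : ℝ) * 1.443 ^ (f - (m + 1)) := by positivity
  calc (6 * N + 5) * D + ((m + 1 : ℕ) : ℝ) *
      ((6 * N + 6) * D * (((f - (m + 1) : ℕ) : ℝ) + 1) * 1.443 ^ (f - (m + 1)))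
      = (6 * N + 5) * D + (6 * N + 6) * D * ((((f - (m + 1) : ℕ) : ℝ) + 1) *
        (((m + 1 : ℕ) : ℝ) * 1.443 ^ (f - (m + 1)))) := by ring
    _ ≤ (6 * N + 6) * D * 1.443 ^ f + (6 * N + 6) * D * (f * 1.443 ^ f) := by
      refine add_le_add ?_ (mul_le_mul_of_nonneg_left ?_ h₆)
      · calc (6 * N + 5) * D ≤ (6 * N + 6) * D * 1 := by linarith
          _ ≤ _ := mul_le_mul_of_nonneg_left h₃ h₆
      · exact mul_le_mul h₄ h₇ h₈ (by positivity)
    _ = _ := by ring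

set_option maxHeartbeats 1600000 in
/-- The branching procedure, by induction on the number `f` of undecided vertices. The loop calls
it for the closed undecided neighbourhood of the selected vertex `v`, which has `m + 1` members if
`v` has `m` undecided neighbours. By the choice of `v`, each call decides at least `m + 1`
vertices. -/
theorem tri_branch {procs : List Cmd} {n B S : ℕ} {R R' D M : ℝ} {E : ℕ → ℕ → Prop} {w : ℕ → ℝ}
    (hproc : procs.getD 0 .skip = branchCmd) (hfit : ∀ p ∈ branchProgs, Fit B S R R' D p)
    (hB : n + 5 ≤ B) (hw : ∀ v < n, 0 ≤ w v) (hM : ∑ v ∈ Finset.range n, w v < M) (hR : 2 * M ≤ R)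
    (hE : ∀ a < n, ∀ b < n, E a b → E b a) (hirr : ∀ a < n, ¬ E a a) :
    ∀ f k d σ, Bdd B R σ → GraphAt n E w M σ → σ.nat aDepth 0 = k → Branching n E (St n k σ) →
      (undecided n (St n k σ)).card ≤ f → k + f ≤ n → f ≤ d →
      Tri procs S R' d branchCmd σ ((6 * n + 6) * D * (f + 1) * 1.443 ^ f) fun τ =>
        Bdd B R τ ∧ Keeps n k σ τ ∧ Improves n E w (St n k σ) σ τ := by
  have hD : 3 ≤ D := by
    have := (hfit (.ite candB .skip .skip) (by simp [branchProgs])).cost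
    have : (0 : ℝ) ≤ candB.cost := Nat.cast_nonneg _
    linarith
  intro f
  induction f using Nat.strong_induction_on with
  | _ f ih =>
  intro k d σ hσ hg hd hb hf hkf hfd
  have hn0 : (0 : ℝ) ≤ n := Nat.cast_nonneg _
  unfold branchCmd
  have t₁ := (ok_leafFm hB hg.n_eq hd).tri_fit (procs := procs) (d := d) hσ
    (hfit _ (by simp [branchProgs]))
  by_cases hu : ∃ v < n, St n k σ v = 0
  swap
  · push Not at hu
    refine (t₁.seq (T' := (D + D)) fun τ ⟨bτ, sτ, l₁, l₂⟩ => ?_).mono ?_ fun _ h => h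
    · have fi := hfit (.ite (.natLe 1 (.get 6 0)) .skip .skip) (by simp [branchProgs])
      have kτ : Keeps n k σ τ := Keeps.of_same sτ hd
      have eS : St n k τ = St n k σ := by
        funext x; exact congrFun (sτ.nat aStat) _
      refine (Tri.ite (T := D) (fi.fits bτ) (fun _ => ?_) fun h => absurd (l₂.2 hu) h).mono
        (by linarith [fi.cost]) fun _ h => h
      refine ((ok_leaf (k := k) hB (hg.congr sτ)
        kτ.depth hw hM hR hE (by rw [eS]; exact hb) (by rw [eS]; exact hu)).tri_fit bτ
        (hfit _ (by simp [branchProgs]))).mono le_rfl fun ρ ⟨bρ, sρ, m₁, m₂, m₃⟩ => ?_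
      have eR : τ.real rBest = σ.real rBest := sτ.real rBest
      refine ⟨bρ, kτ.trans (Keeps.of_same sρ kτ.depth),
        ⟨by rw [← eR]; exact m₁, by rw [← eS]; exact m₂,
        fun h => m₃ (h.congr (sτ.nat aBest) eR)⟩⟩
    · have h₁ : (1 : ℝ) ≤ (f + 1) * 1.443 ^ f := by
        have : (1 : ℝ) ≤ 1.443 ^ f := one_le_pow₀ (by norm_num)
        have hf0 : (0 : ℝ) ≤ f := Nat.cast_nonneg _
        nlinarith
      calc D + (D + D) ≤ (6 * n + 6) * D * 1 := by nlinarith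
        _ ≤ (6 * n + 6) * D * ((f + 1) * 1.443 ^ f) :=
          mul_le_mul_of_nonneg_left h₁ (by positivity)
        _ = _ := by ring
  · classical
    set s := St n k σ with hs
    obtain ⟨v₀, hv₀, hv₀'⟩ := hu
    have hf1 : 1 ≤ f := by
      have : 0 < (undecided n s).card := Finset.card_pos.2 ⟨v₀, by simp [hv₀, hv₀']⟩
      omega
    have hkn : k < n := by omega
    -- The selected vertex depends on the run, so the time bound is fixed only after the selection.
    obtain ⟨t₁, τ, e₁, le₁, bτ, sτ, l₁, l₂⟩ := t₁
    have kτ : Keeps n k σ τ := Keeps.of_same sτ hd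
    have gτ := hg.congr sτ
    have eS : St n k τ = s := by
      funext x; exact congrFun (sτ.nat aStat) _
    obtain ⟨t₂, ρ, e₂, le₂, bρ, sρ, v, hv, p₁, p₂, p₃, p₄, p₅, p₆⟩ :=
      (ok_pick hB gτ kτ.depth ⟨v₀, hv₀, by rw [eS]; exact hv₀'⟩).tri_fit (procs := procs) (d := d)
        bτ (hfit _ (by simp [branchProgs]))
    rw [eS] at p₃ p₄
    have kρ : Keeps n k σ ρ := by
      refine kτ.trans ⟨sρ.mono (by decide) (by decide), ?_, fun j _ => ?_,
        fun j hj => p₆ j (by omega),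
        fun j hj => p₅ j (by omega)⟩
      · rw [sρ.nat aDepth, kτ.depth]
      · rw [sρ.nat aStat]
    have gρ := gτ.congr sρ
    have rρ : ρ.real rBest = σ.real rBest := by
      rw [sρ.real rBest, sτ.real rBest]
    have nρ : ρ.nat aBest = σ.nat aBest := by
      rw [sρ.nat aBest, sτ.nat aBest]
    set m := (undecidedNbrs n E s v).card with hm
    have hmf : m + 1 ≤ f := by
      have := card_undecided_choose hirr hv p₃
      omega
    set X : ℝ := (6 * n + 6) * D * (((f - (m + 1) : ℕ) : ℝ) + 1) * 1.443 ^ (f - (m + 1)) with hX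
    have hX0 : 0 ≤ X := by positivity
    set cand : ℕ → Prop := fun u => s u = 0 ∧ (u = v ∨ E v u) with hcand
    -- The invariant: the candidates below `i` have been dealt with.
    let I : ℕ → Store → Prop := fun i κ => Bdd B R κ ∧ Keeps n k σ κ ∧ κ.nat aPick k = v ∧
      κ.nat aPos k = i ∧ κ.real rBest 0 ≤ σ.real rBest 0 ∧
      (∀ u < i, cand u → ∀ A, Covers n E A → (∀ x < n, chooseSt E s u x = 2 → A x) →
        κ.real rBest 0 ≤ wt n w A) ∧ (BestAt n E w σ → BestAt n E w κ)
    have fW := hfit (.ite (.lt pos vn) .skip .skip) (by simp [branchProgs])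
    have fC := hfit (.ite candB .skip .skip) (by simp [branchProgs])
    have hwhile : Tri procs S R' d (.while (.lt pos vn)
        (.seq (.ite candB (.seq descendProg.cmd (.seq (.call 0) ascendProg.cmd)) Cmd.skip)
        nextProg.cmd)) ρ (∑ i ∈ Finset.range n, ((4 * D + if cand i then X + D else 0) +
          ((BExp.lt pos vn).cost : ℝ) + 1) + ((BExp.lt pos vn).cost : ℝ) + 1) (I n) := by
      refine Tri.while I n (fun i => 4 * D + if cand i then X + D else 0) ?_ ?_ ?_
      · exact ⟨bρ, kρ, p₁, p₂, by rw [rρ], by simp, fun h => h.congr nρ rρ⟩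
      · intro i _ κ ⟨bκ, kκ, _, iκ, _⟩
        refine ⟨fW.fits bκ, ?_⟩
        have : κ.nat 0 0 = n := by rw [kκ.same.nat 0, hg.n_eq]
        simp [kκ.depth, iκ, this]
      · intro i hi κ ⟨bκ, kκ, vκ, iκ, c₁, c₂, c₃⟩
        have gκ := hg.congr kκ.same
        have sκ : ∀ x < n, St n k κ x = s x := fun x hx =>
          kκ.stat _ (by rw [add_mul]; omega)
        have hc : candB.Holds κ ↔ cand i := by
          have h₁ : κ.nat aStat (k * n + i) = s i := sκ i hi
          simp [candB, hcand, kκ.depth, iκ, vκ, gκ.n_eq, h₁, gκ.adj v hv i hi]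
          tauto
        have next : ∀ μ : Store, Bdd B R μ → Keeps n k σ μ → μ.nat aPick k = v → μ.nat aPos k = i →
            μ.real rBest 0 ≤ σ.real rBest 0 →
            (∀ u < i + 1, cand u → ∀ A, Covers n E A → (∀ x < n, chooseSt E s u x = 2 → A x) →
              μ.real rBest 0 ≤ wt n w A) → (BestAt n E w σ → BestAt n E w μ) →
            Tri procs S R' d nextProg.cmd μ D (I (i + 1)) := by
          intro μ bμ kμ vμ iμ c₁ c₂ c₃
          have hk := kμ.depth
          have : Ok B R nextProg μ fun ν => ν = μ.setNat aPos k (i + 1) := by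
            unfold nextProg
            rw [ok_setN]
            simp only [NExp.eval_add, NExp.eval_get, NExp.eval_zero, NExp.eval_one, hk, iμ]
            exact ⟨by omega, trivial⟩
          refine (this.tri_fit bμ (hfit _ (by simp [branchProgs]))).mono le_rfl ?_
          rintro ν ⟨bν, sν, rfl⟩
          refine ⟨bν,
            kμ.trans ⟨sν.mono (by decide) (by decide), by simp [hk], by simp, ?_, by simp⟩,
            by simp [vμ], by simp, by simpa using c₁, by simpa using c₂, fun h => ?_⟩
          · intro j hj
            have : j ≠ k := by omega
            simp [this]
          · exact (c₃ h).congr (by simp) rfl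
        have body : Tri procs S R' d
            (.ite candB (.seq descendProg.cmd (.seq (.call 0) ascendProg.cmd)) Cmd.skip) κ
            (candB.cost + 1 + (D + if cand i then X + D + 1 else 0)) fun μ =>
            Bdd B R μ ∧ Keeps n k σ μ ∧ μ.nat aPick k = v ∧ μ.nat aPos k = i ∧
            μ.real rBest 0 ≤ σ.real rBest 0 ∧
            (∀ u < i + 1, cand u → ∀ A, Covers n E A → (∀ x < n, chooseSt E s u x = 2 → A x) →
              μ.real rBest 0 ≤ wt n w A) ∧ (BestAt n E w σ → BestAt n E w μ) := by
          refine Tri.ite (fC.fits bκ) (fun h => ?_) fun h => ?_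
          · rw [hc] at h
            rw [if_pos h]
            obtain ⟨d, rfl⟩ : ∃ d', d = d' + 1 := ⟨d - 1, by omega⟩
            have bκ' : Branching n E (St n k κ) := hb.congr sκ
            have hch : ∀ x < n, chooseSt E (St n k κ) i x = chooseSt E s i x := fun x hx => by
              unfold chooseSt; rw [sκ x hx]
            refine ((ok_descend hB gκ kκ.depth iκ hi hkn bκ').tri_fit bκ
              (hfit _ (by simp [branchProgs]))).seq (T' := (X + 1) + D)
              (fun μ ⟨bμ, sμ, d₁, d₂, d₃⟩ => ?_) |>.mono (by linarith) fun _ h => h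
            have gμ := gκ.congr sμ
            have d₂' : ∀ x < n, St n (k + 1) μ x = chooseSt E s i x := fun x hx => by
              rw [d₂ x hx, hch x hx]
            have hcard : (undecided n (St n (k + 1) μ)).card ≤ f - (m + 1) := by
              rw [undecided_congr d₂']
              have h₁ := card_undecided_choose hirr hi h.1
              have h₂ := p₄ i hi h.1
              omega
            have hrec := ih (f - (m + 1)) (by omega) (k + 1) d μ bμ gμ d₁
              ((hb.choose hE hirr hi h.1).congr d₂') hcard (by omega) (by omega)
            rw [← hproc] at hrec
            refine hrec.call.seq fun ν ⟨bν, kν, iν⟩ => ?_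
            have : Ok B R ascendProg ν fun ξ => ξ = ν.setNat aDepth 0 k := by
              unfold ascendProg
              rw [ok_setN]
              simp only [NExp.eval_sub, NExp.eval_get, NExp.eval_zero, NExp.eval_one, kν.depth]
              exact ⟨by omega, rfl⟩
            refine (this.tri_fit bν (hfit _ (by simp [branchProgs]))).mono le_rfl ?_
            rintro ξ ⟨bξ, sξ, rfl⟩
            have pν : ν.nat aPos k = i := by
              rw [kν.pos k (by omega), sμ.nat aPos, iκ]
            have qν : ν.nat aPick k = v := by
              rw [kν.pick k (by omega), sμ.nat aPick, vκ]
            have rμ : μ.real rBest = κ.real rBest := sμ.real rBest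
            have i₁ := iν.le
            rw [rμ] at i₁
            refine ⟨bξ, kκ.trans ⟨?_, by simp, fun j hj => ?_, fun j hj => ?_, fun j hj => ?_⟩,
              by simp [qν], by simp [pν], by simpa using i₁.trans c₁, fun u hu hcu A hA hA' => ?_,
              fun hbest => ?_⟩
            · exact (sμ.mono (by decide) (by decide)).trans
                (kν.same.trans (sξ.mono (by decide) (by decide)))
            · have hj' : j < (k + 1 + 1) * n := by rw [add_mul]; omega
              simp [kν.stat j hj', d₃ j hj]
            · simp [kν.pos j (by omega), sμ.nat aPos]
            · simp [kν.pick j (by omega), sμ.nat aPick]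
            · simp only [Store.setNat_real]
              rcases Nat.lt_succ_iff_lt_or_eq.1 hu with hu | rfl
              · exact i₁.trans (c₂ u hu hcu A hA hA')
              · exact iν.opt A hA fun x hx hx' => hA' x hx (by rw [← d₂' x hx]; exact hx')
            · exact (iν.best ((c₃ hbest).congr (sμ.nat aBest) rμ)).congr (by simp) rfl
          · rw [hc] at h
            refine (Ok.tri_fit (p := .skip) (ok_skip.2 ⟨kκ, vκ, iκ, c₁, fun u hu hcu => ?_, c₃⟩) bκ
              (hfit .skip (by simp [branchProgs]))).mono (by rw [if_neg h]; linarith)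
              fun μ ⟨bμ, _, h⟩ => ⟨bμ, h⟩
            rcases Nat.lt_succ_iff_lt_or_eq.1 hu with hu | rfl
            · exact c₂ u hu hcu
            · exact absurd hcu h
        refine (body.seq fun μ ⟨h₁, h₂, h₃, h₄, h₅, h₆, h₇⟩ => next μ h₁ h₂ h₃ h₄ h₅ h₆ h₇).mono ?_
          fun _ h => h
        have := fC.cost
        split_ifs <;> linarith
    obtain ⟨t₃, κ, e₃, le₃, bκ, kκ, _, _, c₁, c₂, c₃⟩ := hwhile
    have fi := hfit (.ite (.natLe 1 (.get 6 0)) .skip .skip) (by simp [branchProgs])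
    refine ⟨_, κ, .seq e₁ (.iteFalse (fi.fits bτ) ?_ (.seq e₂ e₃)), ?_, bκ, kκ,
      ⟨c₁, fun A hA hA' => ?_,
      c₃⟩⟩
    · simp only [BExp.holds_natLe]
      intro h
      exact l₂.1 (by simpa using h) v₀ hv₀ hv₀'
    · refine le_trans ?_ (branch_time hmf (by linarith) hn0)
      have hsum : ∑ i ∈ Finset.range n, (4 * D + (if cand i then X + D else 0) +
          ((BExp.lt pos vn).cost : ℝ) + 1) ≤ 6 * n * D + ((m + 1 : ℕ) : ℝ) * X := by
        have hi : ∀ i, 4 * D + (if cand i then X + D else 0) + ((BExp.lt pos vn).cost : ℝ) + 1 ≤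
            6 * D + if cand i then X else 0 := fun i => by
          have := fW.cost
          split_ifs <;> linarith
        refine (Finset.sum_le_sum fun i _ => hi i).trans (le_of_eq ?_)
        rw [Finset.sum_add_distrib, Finset.sum_const, Finset.card_range, ← Finset.sum_filter,
          Finset.sum_const, card_candidates hirr hv p₃]
        simp only [nsmul_eq_mul]
        ring
      have := fi.cost
      have := fW.cost
      rw [← hX]
      push_cast at hsum ⊢
      linarith
    · obtain ⟨u, hu, h₁, h₂, h₃⟩ := exists_branch hA hA' hv p₃
      exact c₂ u hu ⟨h₁, h₂⟩ A hA h₃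

/-! ### Iterative compression -/

/-! One further array: the number of vertices that the compression has dealt with. -/

notation "aIdx" => 17

/-- Prepare the branching on the subgraph that is induced by the vertices up to the current index:
the vertices of the known cover are undecided, and the best cover so far consists of all
vertices. -/
def setupProg : Prog :=
  .seq (.loop 20 vn (.loop 21 vn (.ite (.and (.and (.natLe (vr 20) (.get aIdx 0))
      (.natLe (vr 21) (.get aIdx 0))) (.eq (.get 1 (vr 20 * vn + vr 21)) 1))
      (.setN aAdj (vr 20 * vn + vr 21) 1) (.setN aAdj (vr 20 * vn + vr 21) 0))))
  (.seq (.loop 20 vn (.ite (.eq (.get aUse (vr 20)) 1) (.setN aStat (vr 20) 0)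
    (.setN aStat (vr 20) 3)))
  (.seq (.loop 20 vn (.setN aBest (vr 20) 1))
  (.seq (.setN aDepth 0 0)
  (.seq (.setR rBest 0 .zero) (.loop 20 vn (.setR rBest 0 (.get rBest 0 + .get rWgt (vr 20))))))))

/-- The edges among the vertices below `i`. -/
def below (E : ℕ → ℕ → Prop) (i u v : ℕ) : Prop := u < i ∧ v < i ∧ E u v

open Classical in
/-- The number of elements of a vertex set. -/
noncomputable def size (n : ℕ) (A : ℕ → Prop) : ℕ := ((Finset.range n).filter fun v => A v).card

theorem size_le (n : ℕ) (A : ℕ → Prop) : size n A ≤ n := by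
  classical
  exact (Finset.card_filter_le _ _).trans (by simp)

theorem wt_const (n : ℕ) (b : ℝ) (A : ℕ → Prop) : wt n (fun _ => b) A = size n A * b := by
  rw [wt, size, ← Finset.sum_filter, Finset.sum_const, nsmul_eq_mul]

theorem wt_le {n : ℕ} {w : ℕ → ℝ} (hw : ∀ v < n, 0 ≤ w v) (A : ℕ → Prop) :
    wt n w A ≤ ∑ v ∈ Finset.range n, w v := by
  refine Finset.sum_le_sum fun v hv => ?_
  have := hw v (by simpa using hv)
  split_ifs
  · exact le_rfl
  · exact this

theorem wt_congr {n : ℕ} (w : ℕ → ℝ) {A A' : ℕ → Prop} (h : ∀ v < n, A v ↔ A' v) :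
    wt n w A = wt n w A' := by
  classical
  refine Finset.sum_congr rfl fun v hv => ?_
  have := h v (by simpa using hv)
  simp only [this]

/-- A loop that sums up. -/
theorem ok_sum {n B a : ℕ} {R : ℝ} {σ : Store} {e : RExp} {g : ℕ → ℝ} {c : ℝ} (hB : n ≤ B)
    (hn : σ.nat 0 0 = n) (ha : σ.real a 0 = c) (hc : 0 ≤ c) (hg : ∀ i < n, 0 ≤ g i)
    (hR : c + ∑ i ∈ Finset.range n, g i ≤ R)
    (hev : ∀ i < n, ∀ τ, Same [20] [a] σ τ → τ.nat 20 0 = i → e.eval τ = g i) :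
    Ok B R (.loop 20 vn (.setR a 0 (.get a 0 + e))) σ fun τ =>
      τ.real a 0 = c + ∑ i ∈ Finset.range n, g i := by
  refine (Ok.loop (fun i τ => τ.real a 0 = c + ∑ j ∈ Finset.range i, g j) ?_ ?_ ?_).mono ?_
  · simpa [hn] using hB
  · simpa using ha
  · intro i hi τ hS hτ h₁
    simp [hn] at hi
    have h₂ : e.eval τ = g i := hev i hi τ hS hτ
    have h₃ : ∑ j ∈ Finset.range (i + 1), g j ≤ ∑ j ∈ Finset.range n, g j :=
      Finset.sum_le_sum_of_subset_of_nonneg (fun v hv => by simp at hv ⊢; omega) fun v hv _ =>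
        hg v (by simpa using hv)
    have h₄ : 0 ≤ ∑ j ∈ Finset.range (i + 1), g j :=
      Finset.sum_nonneg fun v hv => hg v (by simp at hv; omega)
    have h₅ : τ.real a 0 + g i = c + ∑ j ∈ Finset.range (i + 1), g j := by
      rw [h₁, Finset.sum_range_succ]; ring
    rw [ok_setR]
    simp only [RExp.eval_add, RExp.eval_get, NExp.eval_zero, h₂, h₅]
    refine ⟨?_, by simp⟩
    rw [abs_of_nonneg (by linarith)]; linarith
  · intro τ _ h
    simpa [hn] using h

/-- The graph of the input and the weights in use. -/
structure InputAt (n : ℕ) (E : ℕ → ℕ → Prop) (w : ℕ → ℝ) (M : ℝ) (σ : Store) : Prop where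
  n_eq : σ.nat 0 0 = n
  adj : ∀ u < n, ∀ v < n, σ.nat 1 (u * n + v) = 1 ↔ E u v
  wgt : ∀ v < n, σ.real rWgt v = w v
  big : σ.real rBig 0 = M

theorem InputAt.congr {n : ℕ} {E : ℕ → ℕ → Prop} {w : ℕ → ℝ} {M : ℝ} {σ τ : Store}
    {LN LR : List ℕ} (h : InputAt n E w M σ) (hS : Same LN LR σ τ) (h₀ : 0 ∉ LN := by decide)
    (h₁ : 1 ∉ LN := by decide)
    (h₂ : rWgt ∉ LR := by decide) (h₃ : rBig ∉ LR := by decide) : InputAt n E w M τ :=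
  ⟨by rw [hS.nat 0 h₀, h.n_eq], by rw [hS.nat 1 h₁]; exact h.adj,
    by rw [hS.real rWgt h₂]; exact h.wgt, by rw [hS.real rBig h₃, h.big]⟩

section

variable {n B i : ℕ} {R M : ℝ} {E : ℕ → ℕ → Prop} {w : ℕ → ℝ} {σ : Store}

/-- The vertices of the known cover become undecided; the others form an independent set. -/
theorem ok_setup (hB : n + 5 ≤ B) (hg : InputAt n E w M σ) (hi : σ.nat aIdx 0 = i)
    (hw : ∀ v < n, 0 ≤ w v) (hR : ∑ v ∈ Finset.range n, w v ≤ R) :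
    Ok B R setupProg σ fun τ => GraphAt n (below E (i + 1)) w M τ ∧ τ.nat aDepth 0 = 0 ∧
      (∀ u < n, St n 0 τ u = if σ.nat aUse u = 1 then 0 else 3) ∧
      BestAt n (below E (i + 1)) w τ := by
  have hn := hg.n_eq
  have hsum0 : 0 ≤ ∑ v ∈ Finset.range n, w v :=
    Finset.sum_nonneg fun v hv => hw v (by simpa using hv)
  have f₁ : Fills B R (fun τ => τ.nat aAdj) [20, 21] [aAdj] [] (.loop 20 vn (.loop 21 vn
      (.ite (.and (.and (.natLe (vr 20) (.get aIdx 0))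
      (.natLe (vr 21) (.get aIdx 0))) (.eq (.get 1 (vr 20 * vn + vr 21)) 1))
      (.setN aAdj (vr 20 * vn + vr 21) 1) (.setN aAdj (vr 20 * vn + vr 21) 0)))) σ
      (fun j x => ∃ u < NExp.eval σ vn, ∃ v < NExp.eval (σ.setNat 20 0 u) vn, j = u * n + v ∧
        x = if u ≤ i ∧ v ≤ i ∧ σ.nat 1 (u * n + v) = 1 then 1 else 0) := by
    refine fills_loop (by simp [hn]; omega) (fun τ v => by simp) ?_
      fun u hu => fills_loop (by simp [hn]; omega)
        (fun τ v => by simp) ?_ fun v hv => fills_ite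
        (fun h => fills_setN (by simp [hn]) ?_ (by split_ifs <;> omega))
        (fun h => fills_setN (by simp [hn]) ?_ (by split_ifs <;> omega))
    · rintro a _ a' _ j x x' ⟨v, hv, rfl, _⟩ ⟨v', hv', h, _⟩
      simp [hn] at hv hv'
      exact ((addr_inj (by omega) (by omega)).1 h).1
    · rintro a _ a' _ j x x' ⟨rfl, _⟩ ⟨h, _⟩
      omega
    · simp [hn, hi] at h; simp [h]
    · simp [hn, hi] at h; simp; intro a b; exact h a b
  unfold setupProg
  refine f₁.ok.seq fun τ hτ ⟨h₁, _⟩ => ?_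
  have gτ := hg.congr hτ
  have f₂ : Fills B R (fun τ => τ.nat aStat) [20] [aStat] [] (.loop 20 vn
      (.ite (.eq (.get aUse (vr 20)) 1) (.setN aStat (vr 20) 0) (.setN aStat (vr 20) 3))) τ
      (fun j x => ∃ u < NExp.eval τ vn, j = u ∧ x = if σ.nat aUse u = 1 then 0 else 3) := by
    have k := hτ.nat aUse
    refine fills_loop (by simp [gτ.n_eq]; omega) (fun τ v => by simp)
      (by omega) fun u hu => fills_ite
        (fun h => fills_setN (by simp) ?_ (by split_ifs <;> omega))
        (fun h => fills_setN (by simp) ?_ (by split_ifs <;> omega))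
    · simp [k] at h; simp [h]
    · simp [k] at h; simp [h]
  refine f₂.ok.seq fun ρ hρ ⟨h₂, _⟩ => ?_
  have gρ := gτ.congr hρ
  have f₃ : Fills B R (fun τ => τ.nat aBest) [20] [aBest] [] (.loop 20 vn
      (.setN aBest (vr 20) 1)) ρ (fun j x => ∃ u < NExp.eval ρ vn, j = u ∧ x = 1) :=
    fills_loop (by simp [gρ.n_eq]; omega) (fun τ v => by simp)
      (by omega) fun u hu => fills_setN (by simp) (by simp) (by omega)
  refine f₃.ok.seq fun κ hκ ⟨h₃, _⟩ => ?_
  have gκ := gρ.congr hκ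
  rw [ok_seq, ok_setN]
  refine ⟨Nat.zero_le _, ?_⟩
  rw [ok_seq, ok_setR]
  refine ⟨by simpa using hsum0.trans hR, ?_⟩
  set μ := (κ.setNat aDepth (NExp.eval κ 0) (NExp.eval κ 0)).setReal rBest
    (NExp.eval (κ.setNat aDepth (NExp.eval κ 0) (NExp.eval κ 0)) 0)
    (RExp.eval (κ.setNat aDepth (NExp.eval κ 0) (NExp.eval κ 0)) .zero) with hμ
  have sμ : Same [aDepth] [rBest] κ μ :=
    ((Same.refl _ _ κ).setNat _ _ (by decide)).setReal _ _ (by decide)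
  have gμ := gκ.congr sμ
  refine (ok_sum (g := w) (c := 0) (by omega) gμ.n_eq (by simp [hμ]) le_rfl hw
    (by simpa using hR) fun i hi τ hτ h => ?_).mono fun ν hν h => ?_
  · simp only [RExp.eval_get, NExp.eval_get, NExp.eval_zero, h]
    rw [hτ.real rWgt]
    exact gμ.wgt i hi
  have gν := gμ.congr hν
  have hbest : ∀ v < n, ν.nat aBest v = 1 := fun v hv => by
    rw [hν.nat aBest, sμ.nat aBest]
    exact h₃ v 1 ⟨v, by simpa [gρ.n_eq] using hv, rfl, rfl⟩
  refine ⟨⟨gν.n_eq, fun u hu v hv => ?_, gν.wgt, gν.big⟩, ?_, fun u hu => ?_,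
    fun u hu _ _ _ => .inl (hbest u hu), ?_⟩
  · rw [hν.nat aAdj, sμ.nat aAdj, hκ.nat aAdj,
      hρ.nat aAdj, h₁ _ _ ⟨u, by simpa [hn] using hu, v, by simpa [hn] using hv, rfl, rfl⟩]
    simp only [below, ← hg.adj u hu v hv, Nat.lt_succ_iff]
    split_ifs with h <;> simp [h]
  · rw [hν.nat aDepth]; simp [hμ]
  · have : ν.nat aStat u = if σ.nat aUse u = 1 then 0 else 3 := by
      rw [hν.nat aStat, sμ.nat aStat, hκ.nat aStat]
      exact h₂ _ _ ⟨u, by simpa [gτ.n_eq] using hu, rfl, rfl⟩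
    simpa [St] using this
  · rw [h, zero_add, wt]
    exact Finset.sum_congr rfl fun v hv => by rw [if_pos (hbest v (by simpa using hv))]

end

/-- Find a cover of minimum weight by means of the known cover. -/
def solveCmd : Cmd := .seq setupProg.cmd (.call 0)

/-- The natural-number arrays that the search for a cover writes. -/
def solveN : List ℕ := aAdj :: branchN

/-- From a cover of size at most `f`, the branching finds a cover of minimum weight. -/
theorem tri_solve {procs : List Cmd} {n B S d i f : ℕ} {R R' D M : ℝ} {E : ℕ → ℕ → Prop}
    {w : ℕ → ℝ} {σ : Store}
    (hproc : procs.getD 0 .skip = branchCmd) (hfit : ∀ p ∈ branchProgs, Fit B S R R' D p)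
    (hfit' : Fit B S R R' D setupProg) (hD : 1 ≤ D)
    (hB : n + 5 ≤ B) (hw : ∀ v < n, 0 ≤ w v) (hM : ∑ v ∈ Finset.range n, w v < M) (hR : 2 * M ≤ R)
    (hE : ∀ a < n, ∀ b < n, E a b → E b a) (hirr : ∀ a < n, ¬ E a a) (hσ : Bdd B R σ)
    (hg : InputAt n E w M σ) (hi : σ.nat aIdx 0 = i)
    (hc : Covers n (below E (i + 1)) fun v => σ.nat aUse v = 1)
    (hf : size n (fun v => σ.nat aUse v = 1) ≤ f) (hfn : f ≤ n) (hfd : f + 1 ≤ d) :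
    Tri procs S R' d solveCmd σ ((6 * n + 8) * D * (f + 1) * 1.443 ^ f) fun τ =>
      Bdd B R τ ∧ Same solveN branchR σ τ ∧ BestAt n (below E (i + 1)) w τ ∧
      ∀ A, Covers n (below E (i + 1)) A → τ.real rBest 0 ≤ wt n w A := by
  obtain ⟨d, rfl⟩ : ∃ d', d = d' + 1 := ⟨d - 1, by omega⟩
  have hsum0 : 0 ≤ ∑ v ∈ Finset.range n, w v :=
    Finset.sum_nonneg fun v hv => hw v (by simpa using hv)
  refine (((ok_setup hB hg hi hw (by linarith)).tri_fit hσ hfit').seq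
    (T' := (6 * n + 6) * D * (f + 1) * 1.443 ^ f + 1) fun τ ⟨bτ, sτ, gτ, dτ, h₁, h₂⟩ => ?_).mono ?_
    fun _ h => h
  · have hb : Branching n (below E (i + 1)) (St n 0 τ) := by
      refine ⟨fun u hu v _ h => ?_, fun u hu v hv h h' hE' => ?_, fun u hu => ?_⟩
      · rw [h₁ u hu] at h; split_ifs at h; simp at h
      · rw [h₁ u hu] at h
        rw [h₁ v hv] at h'
        rcases hc u hu v hv hE' with h'' | h''
        · simp [h''] at h
        · simp [h''] at h'
      · rw [h₁ u hu]; split_ifs <;> omega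
    have hcard : (undecided n (St n 0 τ)).card ≤ f := by
      classical
      refine le_trans (Finset.card_le_card fun v hv => ?_) hf
      rw [mem_undecided] at hv
      rw [h₁ v hv.1] at hv
      have := hv.2
      simp only [Finset.mem_filter, Finset.mem_range]
      refine ⟨hv.1, ?_⟩
      by_contra hne
      rw [if_neg hne] at this
      omega
    have key := tri_branch hproc hfit hB hw hM hR
      (fun a ha b hb h => ⟨h.2.1, h.1, hE a ha b hb h.2.2⟩) (fun a ha h => hirr a ha h.2.2)
      f 0 d τ bτ gτ dτ hb hcard (by omega) (by omega)
    rw [← hproc] at key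
    refine key.call.mono le_rfl fun ρ ⟨bρ, kρ, iρ⟩ => ⟨bρ, (sτ.mono (by decide) (by decide)).trans
      (kρ.same.mono (by decide) (by decide)), iρ.best h₂, fun A hA => iρ.opt A hA fun v hv h => ?_⟩
    rw [h₁ v hv] at h
    split_ifs at h; simp at h
  · have h₁ : (1 : ℝ) ≤ (f + 1) * 1.443 ^ f := by
      have : (1 : ℝ) ≤ 1.443 ^ f := one_le_pow₀ (by norm_num)
      have hf0 : (0 : ℝ) ≤ f := Nat.cast_nonneg _
      nlinarith
    have h₂ : D ≤ D * ((f + 1) * 1.443 ^ f) := le_mul_of_one_le_right (by linarith) h₁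
    calc D + ((6 * n + 6) * D * (f + 1) * 1.443 ^ f + 1)
        ≤ 2 * D + (6 * n + 6) * D * (f + 1) * 1.443 ^ f := by linarith
      _ ≤ 2 * (D * ((f + 1) * 1.443 ^ f)) + (6 * n + 6) * D * (f + 1) * 1.443 ^ f := by linarith
      _ = _ := by ring

/-! ### Weighted vertex cover on arbitrary graphs -/

/-- Give all vertices the weight of the budget. -/
def unitProg : Prog :=
  .seq (.setR rBig 0 (.get 1 0)) (.seq (.loop 20 vn (.setR rBig 0 (.get rBig 0 + .get 1 0)))
  (.seq (.loop 20 vn (.setR rWgt (vr 20) (.get 1 0))) (.setN aIdx 0 0)))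

/-- Give all vertices their own weights. -/
def weightProg : Prog :=
  .seq (.setR rBig 0 (.get 1 0)) (.seq (.loop 20 vn (.setR rBig 0 (.get rBig 0 + .get 0 (vr 20))))
    (.loop 20 vn (.setR rWgt (vr 20) (.get 0 (vr 20)))))

/-- Add the next vertex to the known cover. -/
def extendProg : Prog := .setN aUse (.get aIdx 0) 1

/-- Replace the known cover by the best one. -/
def compressProg : Prog :=
  .seq (.loop 20 vn (.setN aUse (vr 20) (.get aBest (vr 20))))
    (.setN aIdx 0 (.get aIdx 0 + 1))

/-- Compare the weight of the best cover with the budget. -/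
def answerProg : Prog :=
  .ite (.realLe (.get rBest 0) (.get 1 0))
    (.seq (.setN 3 0 1) (.loop 20 vn (.setN 4 (vr 20) (.get aBest (vr 20))))) (.setN 3 0 0)

/-- Solve the problem: compute a minimum vertex cover by iterative compression, and then use it for
the search for a cover of minimum weight. -/
def generalCmd : Cmd :=
  .seq unitProg.cmd (.seq (.while (.lt (.get aIdx 0) vn)
    (.seq extendProg.cmd (.seq solveCmd compressProg.cmd)))
  (.seq weightProg.cmd (.seq solveCmd answerProg.cmd)))

/-- The call-free parts. -/
def generalProgs : List Prog :=
  setupProg :: unitProg :: weightProg :: extendProg :: compressProg :: answerProg ::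
    .ite (.lt (.get aIdx 0) vn) .skip .skip :: branchProgs

/-- The memory answers whether the graph has a cover of weight at most `W`. -/
def Answers (n : ℕ) (E : ℕ → ℕ → Prop) (w : ℕ → ℝ) (W : ℝ) (σ : Store) : Prop :=
  (σ.nat 3 0 = 1 ∧ Covers n E (fun v => σ.nat 4 v = 1) ∧ wt n w (fun v => σ.nat 4 v = 1) ≤ W) ∨
    (σ.nat 3 0 = 0 ∧ ∀ A, Covers n E A → W < wt n w A)

/-- The memory holds the graph `E`, the weights `w` and the budget `W`. -/
structure InstanceAt (n : ℕ) (E : ℕ → ℕ → Prop) (w : ℕ → ℝ) (W : ℝ) (σ : Store) : Prop where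
  n_eq : σ.nat 0 0 = n
  adj : ∀ u < n, ∀ v < n, σ.nat 1 (u * n + v) = 1 ↔ E u v
  wgt : ∀ v < n, σ.real 0 v = w v
  budget : σ.real 1 0 = W

theorem InstanceAt.congr {n : ℕ} {E : ℕ → ℕ → Prop} {w : ℕ → ℝ} {W : ℝ} {σ τ : Store}
    {LN LR : List ℕ} (h : InstanceAt n E w W σ) (hS : Same LN LR σ τ) (h₀ : 0 ∉ LN := by decide)
    (h₁ : 1 ∉ LN := by decide)
    (h₂ : 0 ∉ LR := by decide) (h₃ : 1 ∉ LR := by decide) : InstanceAt n E w W τ :=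
  ⟨by rw [hS.nat 0 h₀, h.n_eq], by rw [hS.nat 1 h₁]; exact h.adj,
    by rw [hS.real 0 h₂]; exact h.wgt, by rw [hS.real 1 h₃, h.budget]⟩

theorem size_mono {n : ℕ} {A A' : ℕ → Prop} (h : ∀ v < n, A v → A' v) : size n A ≤ size n A' := by
  classical
  refine Finset.card_le_card fun v hv => ?_
  simp only [Finset.mem_filter, Finset.mem_range] at hv ⊢
  exact ⟨hv.1, h v hv.1 hv.2⟩

theorem size_insert_le {n i : ℕ} {A A' : ℕ → Prop} (h : ∀ v < n, A' v → A v ∨ v = i) :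
    size n A' ≤ size n A + 1 := by
  classical
  refine le_trans (Finset.card_le_card (t := insert i ((Finset.range n).filter fun v => A v))
    fun v hv => ?_) (Finset.card_insert_le _ _)
  simp only [Finset.mem_insert, Finset.mem_filter, Finset.mem_range] at hv ⊢
  rcases h v hv.1 hv.2 with h | h
  · exact .inr ⟨hv.1, h⟩
  · exact .inl h

theorem Covers.congr {n : ℕ} {E : ℕ → ℕ → Prop} {A A' : ℕ → Prop} (h : Covers n E A)
    (hA : ∀ v < n, A v → A' v) : Covers n E A' := fun u hu v hv huv =>
  (h u hu v hv huv).imp (hA u hu) (hA v hv)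

theorem Covers.below {n : ℕ} {E : ℕ → ℕ → Prop} {A : ℕ → Prop} (h : Covers n E A) (i : ℕ) :
    Covers n (RAM.below E i) A := fun u hu v hv huv => h u hu v hv huv.2.2

theorem Covers.of_below {n i : ℕ} {E : ℕ → ℕ → Prop} {A : ℕ → Prop} (hi : n ≤ i)
    (h : Covers n (RAM.below E i) A) : Covers n E A := fun u hu v hv huv =>
  h u hu v hv ⟨by omega, by omega, huv⟩

section

variable {n B i : ℕ} {R W : ℝ} {E : ℕ → ℕ → Prop} {w : ℕ → ℝ} {σ : Store}

theorem ok_unit (hB : n + 5 ≤ B) (hg : InstanceAt n E w W σ) (hW : 0 ≤ W)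
    (hR : (n + 1) * W ≤ R) :
    Ok B R unitProg σ fun τ => InputAt n E (fun _ => W) ((n + 1) * W) τ ∧ τ.nat aIdx 0 = 0 := by
  have hn0 : (0 : ℝ) ≤ n := Nat.cast_nonneg _
  have hWR : W ≤ R := by nlinarith
  unfold unitProg
  rw [ok_seq, ok_setR]
  simp only [RExp.eval_get, NExp.eval_zero, hg.budget]
  refine ⟨by rwa [abs_of_nonneg hW], ?_⟩
  set μ := σ.setReal rBig 0 W with hμ
  have sμ : Same [] [rBig] σ μ := (Same.refl _ _ σ).setReal _ _ (by decide)
  have gμ := hg.congr sμ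
  refine (ok_sum (g := fun _ => W) (c := W) (by omega) gμ.n_eq (by simp [hμ]) hW (fun _ _ => hW)
    (by simp; linarith) fun i hi τ hτ h => ?_).seq fun τ hτ h => ?_
  · simp only [RExp.eval_get, NExp.eval_zero]
    rw [hτ.real 1, gμ.budget]
  have gτ := gμ.congr hτ
  have f : Fills B R (fun τ => τ.real rWgt) [20] [] [rWgt] (.loop 20 vn
      (.setR rWgt (vr 20) (.get 1 0))) τ (fun j x => ∃ u < NExp.eval τ vn, j = u ∧ x = W) :=
    fills_loop (by simp [gτ.n_eq]; omega) (fun τ v => by simp)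
      (by omega) fun u hu => fills_setR (by simp) (by simp [gτ.budget])
        (by rwa [abs_of_nonneg hW])
  refine f.ok.seq fun ρ hρ ⟨h₁, _⟩ => ?_
  rw [ok_setN]
  refine ⟨Nat.zero_le _, ⟨?_, fun u hu v hv => ?_, fun v hv => ?_, ?_⟩, by simp⟩
  · simp [hρ.nat 0, gτ.n_eq]
  · simp [hρ.nat 1, gτ.adj u hu v hv]
  · exact h₁ v _ ⟨v, by simpa [gτ.n_eq] using hv, rfl, rfl⟩
  · simp only [Store.setNat_real]
    rw [hρ.real rBig, h]
    simp; ring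

theorem ok_weight (hB : n + 5 ≤ B) (hg : InstanceAt n E w W σ) (hW : 0 ≤ W)
    (hw : ∀ v < n, 0 ≤ w v) (hR : W + ∑ v ∈ Finset.range n, w v ≤ R) :
    Ok B R weightProg σ fun τ => InputAt n E w (W + ∑ v ∈ Finset.range n, w v) τ := by
  have hsum0 : 0 ≤ ∑ v ∈ Finset.range n, w v :=
    Finset.sum_nonneg fun v hv => hw v (by simpa using hv)
  have hw' : ∀ v < n, w v ≤ ∑ v ∈ Finset.range n, w v := fun v hv =>
    Finset.single_le_sum (f := w) (fun u hu => hw u (by simpa using hu)) (by simpa using hv)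
  unfold weightProg
  rw [ok_seq, ok_setR]
  simp only [RExp.eval_get, NExp.eval_zero, hg.budget]
  refine ⟨by rw [abs_of_nonneg hW]; linarith, ?_⟩
  set μ := σ.setReal rBig 0 W with hμ
  have sμ : Same [] [rBig] σ μ := (Same.refl _ _ σ).setReal _ _ (by decide)
  have gμ := hg.congr sμ
  refine (ok_sum (g := w) (c := W) (by omega) gμ.n_eq (by simp [hμ]) hW hw
    hR fun i hi τ hτ h => ?_).seq fun τ hτ h => ?_
  · simp only [RExp.eval_get, NExp.eval_get, NExp.eval_zero, h]
    rw [hτ.real 0, gμ.wgt i hi]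
  have gτ := gμ.congr hτ
  have f : Fills B R (fun τ => τ.real rWgt) [20] [] [rWgt] (.loop 20 vn
      (.setR rWgt (vr 20) (.get 0 (vr 20)))) τ
      (fun j x => ∃ u < NExp.eval τ vn, j = u ∧ x = τ.real 0 u) := by
    refine fills_loop (by simp [gτ.n_eq]; omega) (fun τ v => by simp)
      (by omega) fun u hu => fills_setR (by simp) (by simp) ?_
    have hu : u < n := by simpa [gτ.n_eq] using hu
    rw [gτ.wgt u hu, abs_of_nonneg (hw u hu)]
    linarith [hw' u hu]
  refine f.ok.mono fun ρ hρ ⟨h₁, _⟩ => ⟨?_, fun u hu v hv => ?_, fun v hv => ?_, ?_⟩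
  · simp [hρ.nat 0, gτ.n_eq]
  · simp [hρ.nat 1, gτ.adj u hu v hv]
  · rw [h₁ v _ ⟨v, by simpa [gτ.n_eq] using hv, rfl, rfl⟩, gτ.wgt v hv]
  · rw [hρ.real rBig, h]

theorem ok_compress (hB : n + 5 ≤ B) (hn : σ.nat 0 0 = n) (hi : σ.nat aIdx 0 = i) (hin : i < n)
    (hσ : Bdd B R σ) :
    Ok B R compressProg σ fun τ => (∀ v < n, τ.nat aUse v = σ.nat aBest v) ∧
      τ.nat aIdx 0 = i + 1 := by
  have f : Fills B R (fun τ => τ.nat aUse) [20] [aUse] [] (.loop 20 vn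
      (.setN aUse (vr 20) (.get aBest (vr 20)))) σ
      (fun j x => ∃ u < NExp.eval σ vn, j = u ∧ x = σ.nat aBest u) :=
    fills_loop (by simp [hn]; omega) (fun τ v => by simp)
      (by omega) fun u hu => fills_setN (by simp) (by simp) (hσ.nat _ _)
  refine f.ok.seq fun τ hτ ⟨h₁, _⟩ => ?_
  rw [ok_setN]
  have : τ.nat aIdx 0 = i := by rw [hτ.nat aIdx, hi]
  simp [this]
  exact ⟨by omega, fun v hv => h₁ v _ ⟨v, by simpa [hn] using hv, rfl, rfl⟩⟩

theorem ok_answer (hB : n + 5 ≤ B) (hg : InstanceAt n E w W σ) (hb : BestAt n E w σ)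
    (ho : ∀ A, Covers n E A → σ.real rBest 0 ≤ wt n w A) (hσ : Bdd B R σ) :
    Ok B R answerProg σ fun τ => Answers n E w W τ := by
  have hn := hg.n_eq
  unfold answerProg
  rw [ok_ite]
  simp only [BExp.holds_realLe, RExp.eval_get, NExp.eval_zero, hg.budget]
  constructor
  · intro h
    rw [ok_seq, ok_setN]
    refine ⟨by simp only [NExp.eval_one]; omega, ?_⟩
    set μ := σ.setNat 3 (NExp.eval σ 0) (NExp.eval σ 1) with hμ
    have sμ : Same [3] [] σ μ := (Same.refl _ _ σ).setNat _ _ (by decide)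
    have nμ : μ.nat 0 0 = n := by rw [sμ.nat 0, hn]
    have f : Fills B R (fun τ => τ.nat 4) [20] [4] [] (.loop 20 vn
        (.setN 4 (vr 20) (.get aBest (vr 20)))) μ
        (fun j x => ∃ u < NExp.eval μ vn, j = u ∧ x = σ.nat aBest u) :=
      fills_loop (by simp [nμ]; omega) (fun τ v => by simp)
        (by omega) fun u hu => fills_setN (by simp) (by simp [sμ.nat aBest])
        (hσ.nat _ _)
    refine f.ok.mono fun ρ hρ ⟨h₁, _⟩ => .inl ⟨?_, ?_, ?_⟩
    · rw [hρ.nat 3]; simp [hμ]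
    · refine hb.covers.congr fun v hv h => ?_
      rw [h₁ v _ ⟨v, by simpa [nμ] using hv, rfl, rfl⟩, h]
    · rw [wt_congr w (A' := fun v => σ.nat aBest v = 1) fun v hv => by
        rw [h₁ v _ ⟨v, by simpa [nμ] using hv, rfl, rfl⟩], ← hb.weight]
      exact h
  · intro h
    rw [ok_setN]
    refine ⟨Nat.zero_le _, .inr ⟨by simp, fun A hA => ?_⟩⟩
    exact (not_le.1 h).trans_le (ho A hA)

end

/-- The algorithm for arbitrary graphs. Round `i` of the iterative compression adds the vertex `i`
to a minimum cover of the graph on the vertices below `i`; the result has at most `t + 1`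
vertices, and the branching with constant weights `W` shrinks it to a minimum cover of the graph
on the vertices up to `i`. At the end the branching runs once with the true weights. -/
theorem tri_general {procs : List Cmd} {n B S d t : ℕ} {R R' D W : ℝ} {E : ℕ → ℕ → Prop}
    {w : ℕ → ℝ} {σ : Store}
    (hproc : procs.getD 0 .skip = branchCmd) (hfit : ∀ p ∈ generalProgs, Fit B S R R' D p)
    (hB : n + 5 ≤ B) (hw : ∀ v < n, 0 < w v) (hW : 0 < W)
    (hR : 2 * ((n + 1) * W) ≤ R) (hR' : 2 * (W + ∑ v ∈ Finset.range n, w v) ≤ R)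
    (hE : ∀ a < n, ∀ b < n, E a b → E b a) (hirr : ∀ a < n, ¬ E a a) (hσ : Bdd B R σ)
    (hg : InstanceAt n E w W σ) (hu : ∀ v, σ.nat aUse v = 0)
    (ht : ∃ A, Covers n E A ∧ size n A ≤ t) (hd : n + 1 ≤ d) :
    Tri procs S R' d generalCmd σ ((6 * n + 16) * (n + 2) ^ 2 * D * 1.443 ^ (t + 1)) fun τ =>
      Answers n E w W τ := by
  have hw0 : ∀ v < n, 0 ≤ w v := fun v hv => (hw v hv).le
  have hsum0 : 0 ≤ ∑ v ∈ Finset.range n, w v :=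
    Finset.sum_nonneg fun v hv => hw0 v (by simpa using hv)
  have hn0 : (0 : ℝ) ≤ n := Nat.cast_nonneg _
  have hnW : 0 ≤ n * W := by positivity
  have hfb : ∀ p ∈ branchProgs, Fit B S R R' D p := fun p hp => hfit p (by simp [generalProgs, hp])
  have hfs : Fit B S R R' D setupProg := hfit _ (by simp [generalProgs])
  have fW := hfit (.ite (.lt (.get aIdx 0) vn) .skip .skip) (by simp [generalProgs])
  have hD : 3 ≤ D := by
    have := fW.cost
    have : (0 : ℝ) ≤ (BExp.lt (.get aIdx 0) vn).cost := Nat.cast_nonneg _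
    linarith
  obtain ⟨A₀, hA₀, hA₀t⟩ := ht
  have hX : ∀ f, f ≤ n → f ≤ t + 1 → (6 * n + 8) * D * (f + 1) * (1.443 : ℝ) ^ f ≤
      (6 * n + 8) * D * (n + 1) * 1.443 ^ (t + 1) := by
    intro f hf hf'
    have h₁ : (f : ℝ) ≤ n := by exact_mod_cast hf
    have h₂ : (1.443 : ℝ) ^ f ≤ 1.443 ^ (t + 1) := pow_le_pow_right₀ (by norm_num) hf'
    gcongr
  set X : ℝ := (6 * n + 8) * D * (n + 1) * 1.443 ^ (t + 1) with hXdef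
  -- The invariant: the known cover is a minimum cover of the graph on the vertices below `i`.
  let K : ℕ → Store → Prop := fun i τ => Bdd B R τ ∧ InstanceAt n E w W τ ∧
    InputAt n E (fun _ => W) ((n + 1) * W) τ ∧ τ.nat aIdx 0 = i ∧
    Covers n (below E i) (fun v => τ.nat aUse v = 1) ∧
    ∀ A, Covers n (below E i) A → size n (fun v => τ.nat aUse v = 1) ≤ size n A
  have hstart : Tri procs S R' d unitProg.cmd σ D (K 0) := by
    refine ((ok_unit hB hg hW.le (by linarith)).tri_fit hσ (hfit _ (by simp [generalProgs]))).mono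
      le_rfl fun τ ⟨bτ, sτ, h₁, h₂⟩ => ⟨bτ, hg.congr sτ, h₁, h₂,
        fun u hu v hv h => absurd h.1 (by omega), fun A _ => ?_⟩
    have : size n (fun v => τ.nat aUse v = 1) = 0 := by
      classical
      rw [sτ.nat aUse]
      simp [size, hu]
    omega
  have hround : ∀ i < n, ∀ τ, K i τ →
      Tri procs S R' d (.seq extendProg.cmd (.seq solveCmd compressProg.cmd)) τ (X + 2 * D)
        (K (i + 1)) := by
    intro i hi τ ⟨bτ, gτ, iτ, xτ, cτ, oτ⟩
    have h₁ : Ok B R extendProg τ fun ρ => ρ = τ.setNat aUse i 1 := by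
      unfold extendProg
      rw [ok_setN]
      simp only [NExp.eval_get, NExp.eval_zero, NExp.eval_one, xτ]
      exact ⟨by omega, trivial⟩
    refine ((h₁.tri_fit bτ (hfit _ (by simp [generalProgs]))).seq (T' := X + D) ?_).mono
      (by linarith) fun _ h => h
    rintro ρ ⟨bρ, sρ, rfl⟩
    have hcov : Covers n (below E (i + 1)) fun v => (τ.setNat aUse i 1).nat aUse v = 1 := by
      intro u hu v hv ⟨h, h', h''⟩
      simp only [Store.setNat_nat]
      by_cases hui : u = i
      · left; simp [hui]
      · by_cases hvi : v = i
        · right; simp [hvi]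
        · have := cτ u hu v hv ⟨by omega, by omega, h''⟩
          simpa [hui, hvi] using this
    have hsize : size n (fun v => (τ.setNat aUse i 1).nat aUse v = 1) ≤ t + 1 := by
      refine (size_insert_le (A := fun v => τ.nat aUse v = 1) (i := i) fun v _ h => ?_).trans
        (Nat.add_le_add_right ((oτ A₀ (hA₀.below i)).trans hA₀t) 1)
      simp only [Store.setNat_nat] at h
      by_cases hvi : v = i
      · exact .inr hvi
      · left; simpa [hvi] using h
    have hsn := size_le n fun v => (τ.setNat aUse i 1).nat aUse v = 1
    refine ((tri_solve (f := size n fun v => (τ.setNat aUse i 1).nat aUse v = 1) hproc hfb hfs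
      (by linarith) hB (fun _ _ => hW.le) (M := (n + 1) * W)
      (by simp; linarith) (by linarith) hE hirr bρ
      (iτ.congr sρ) (i := i) (by simp [xτ]) hcov
      le_rfl hsn (by omega)).mono (hX _ hsn hsize) fun _ h => h).seq ?_
    intro ρ ⟨bρ', sρ', hbest, hopt⟩
    have iρ := (iτ.congr sρ).congr sρ'
    refine ((ok_compress hB iρ.n_eq (i := i) (by rw [sρ'.nat aIdx]; simp [xτ]) hi
      bρ').tri_fit bρ' (hfit _ (by simp [generalProgs]))).mono le_rfl
      fun κ ⟨bκ, sκ, h₁, h₂⟩ => ⟨bκ, ?_, iρ.congr sκ,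
        h₂, ?_, fun A hA => ?_⟩
    · exact ((gτ.congr sρ).congr sρ').congr sκ
    · exact hbest.covers.congr fun v hv h => by rw [h₁ v hv, h]
    · have h₃ := hopt A hA
      rw [hbest.weight, wt_const, wt_const] at h₃
      have h₄ : ((size n fun v => ρ.nat aBest v = 1 : ℕ) : ℝ) ≤ size n A := by
        by_contra hcon
        exact absurd h₃ (not_le.2 (mul_lt_mul_of_pos_right (not_le.1 hcon) hW))
      exact (size_mono (A' := fun v => ρ.nat aBest v = 1) fun v hv h => by rw [← h₁ v hv, h]).trans
        (by exact_mod_cast h₄)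
  refine (hstart.seq (T' := (n * (X + 3 * D) + D) + (D + (X + D))) fun τ hτ =>
    ((Tri.while K n (fun _ => X + 2 * D) hτ (fun i _ κ hκ => ?_) hround).mono ?_
      fun _ h => h).seq fun ρ ⟨bρ, gρ, _, xρ, cρ, oρ⟩ => ?_).mono ?_ fun _ h => h
  · refine ⟨fW.fits hκ.1, ?_⟩
    simp [hκ.2.2.2.1, hκ.2.1.n_eq]
  · have := fW.cost
    rw [Finset.sum_const, Finset.card_range, nsmul_eq_mul]
    have h₁ : (n : ℝ) * (X + 2 * D + (BExp.lt (.get aIdx 0) vn).cost + 1) ≤ n * (X + 3 * D) :=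
      mul_le_mul_of_nonneg_left (by linarith) hn0
    linarith
  · refine ((ok_weight hB gρ hW.le hw0 (by linarith)).tri_fit bρ
      (hfit _ (by simp [generalProgs]))).seq fun κ ⟨bκ, sκ, iκ⟩ => ?_
    have eU : κ.nat aUse = ρ.nat aUse := sκ.nat aUse
    have hsn := size_le n fun v => κ.nat aUse v = 1
    refine ((tri_solve (f := size n fun v => κ.nat aUse v = 1) hproc hfb hfs
      (by linarith) hB hw0 (M := W + ∑ v ∈ Finset.range n, w v)
      (by linarith) (by linarith) hE hirr bκ iκ (i := n)
      (by rw [sκ.nat aIdx, xρ]) ?_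
      le_rfl hsn (by omega)).mono (hX _ hsn ?_) fun _ h => h).seq ?_
    · rw [eU]; exact (cρ.of_below le_rfl).below _
    · rw [eU]; have := oρ A₀ (hA₀.below n); omega
    · intro μ ⟨bμ, sμ, hbest, hopt⟩
      have gμ := (gρ.congr sκ).congr sμ
      exact ((ok_answer hB gμ ⟨hbest.covers.of_below (by omega), hbest.weight⟩
        (fun A hA => hopt A (hA.below _)) bμ).tri_fit bμ (hfit _ (by simp [generalProgs]))).mono
        le_rfl fun _ h => h.2.2
  · have h₁ : (1 : ℝ) ≤ 1.443 ^ (t + 1) := one_le_pow₀ (by norm_num)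
    have h₂ : D ≤ D * 1.443 ^ (t + 1) := le_mul_of_one_le_right (by linarith) h₁
    have h₃ : 0 ≤ D * (1.443 : ℝ) ^ (t + 1) := by positivity
    have h₄ : X = (6 * n + 8) * (n + 1) * (D * 1.443 ^ (t + 1)) := by rw [hXdef]; ring
    have h₅ : (n : ℝ) * D ≤ n * (D * 1.443 ^ (t + 1)) := mul_le_mul_of_nonneg_left h₂ hn0
    have h₆ : (6 * n + 16) * (n + 2) ^ 2 * D * (1.443 : ℝ) ^ (t + 1) =
      (6 * n + 16) * (n + 2) ^ 2 * (D * 1.443 ^ (t + 1)) := by ring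
    rw [h₆, h₄]
    set Y := D * (1.443 : ℝ) ^ (t + 1)
    have h₇ : 0 ≤ n * Y := by positivity
    have h₈ : 0 ≤ n * (n * Y) := by positivity
    have h₉ : 0 ≤ n * (n * (n * Y)) := by positivity
    nlinarith

/-! ### Networks of binary constraints -/

/-- The sum of a matrix over a set of indices. -/
noncomputable def tot (A : Finset ℕ) (b : ℕ → ℕ → ℝ) : ℝ := ∑ u ∈ A, ∑ w ∈ A, b u w

section

variable {A : Finset ℕ} {b b' : ℕ → ℕ → ℝ} {v p q : ℕ}

theorem tot_congr (h : ∀ u ∈ A, ∀ w ∈ A, b u w = b' u w) : tot A b = tot A b' :=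
  Finset.sum_congr rfl fun u hu => Finset.sum_congr rfl fun w hw => h u hu w hw

theorem tot_erase (hv : v ∈ A) (b : ℕ → ℕ → ℝ) :
    tot A b = tot (A.erase v) b + b v v + ∑ u ∈ A.erase v, (b v u + b u v) := by
  unfold tot
  rw [← Finset.add_sum_erase A _ hv, ← Finset.add_sum_erase A (b v) hv]
  have : ∀ u, ∑ w ∈ A, b u w = b u v + ∑ w ∈ A.erase v, b u w := fun u =>
    (Finset.add_sum_erase A (b u) hv).symm
  simp only [this, Finset.sum_add_distrib]
  ring

theorem tot_add (b b' : ℕ → ℕ → ℝ) : tot A (fun u w => b u w + b' u w) = tot A b + tot A b' := by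
  simp only [tot, Finset.sum_add_distrib]

theorem tot_single (hp : p ∈ A) (hq : q ∈ A) (e : ℝ) :
    tot A (fun u w => if u = p ∧ w = q then e else 0) = e := by
  unfold tot
  rw [Finset.sum_eq_single p, Finset.sum_eq_single q] <;> simp +contextual [hp, hq]

theorem tot_diag (d : ℕ → ℝ) : tot A (fun u w => if u = w then d u else 0) = ∑ u ∈ A, d u := by
  unfold tot
  refine Finset.sum_congr rfl fun u hu => ?_
  rw [Finset.sum_ite_eq, if_pos hu]

theorem sum_pair_support {g : ℕ → ℝ} (hp : p ∈ A) (hq : q ∈ A)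
    (hg : ∀ u ∈ A, u ≠ p → u ≠ q → g u = 0) :
    ∑ u ∈ A, g u = g p + if p = q then 0 else g q := by
  split_ifs with h
  · subst h
    rw [add_zero]
    exact Finset.sum_eq_single p (fun u hu h => hg u hu h h) fun h => absurd hp h
  · rw [← Finset.sum_pair h]
    symm
    refine Finset.sum_subset (by simp [Finset.insert_subset_iff, hp, hq]) fun u hu h' => ?_
    simp only [Finset.mem_insert, Finset.mem_singleton, not_or] at h'
    exact hg u hu h'.1 h'.2

theorem pair_le_sum {g : ℕ → ℝ} (hp : p ∈ A) (hq : q ∈ A) (hg : ∀ u ∈ A, 0 ≤ g u) :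
    (g p + if p = q then 0 else g q) ≤ ∑ u ∈ A, g u := by
  split_ifs with h
  · rw [add_zero]; exact Finset.single_le_sum hg hp
  · rw [← Finset.sum_pair h]
    exact Finset.sum_le_sum_of_subset_of_nonneg (by simp [Finset.insert_subset_iff, hp, hq])
      fun u hu _ => hg u hu

end

/-- The costs `f u w a b` of giving the values `a` and `b` to `u` and `w`. -/
abbrev Costs : Type := ℕ → ℕ → ℕ → ℕ → ℝ

/-- The cost of an assignment. -/
noncomputable def energy (A : Finset ℕ) (f : Costs) (x : ℕ → ℕ) : ℝ :=
  tot A fun u w => f u w (x u) (x w)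

open Classical in
/-- The neighbours of `u` among the variables in `A`. -/
noncomputable def nbrs (A : Finset ℕ) (H : ℕ → ℕ → Prop) (u : ℕ) : Finset ℕ :=
  A.filter fun w => H u w

@[simp] theorem mem_nbrs {A : Finset ℕ} {H : ℕ → ℕ → Prop} {u w : ℕ} :
    w ∈ nbrs A H u ↔ w ∈ A ∧ H u w := by simp [nbrs]

/-- The variables of degree at least three. -/
noncomputable def cubic (A : Finset ℕ) (H : ℕ → ℕ → Prop) : Finset ℕ :=
  A.filter fun u => 3 ≤ (nbrs A H u).card

/-- A network of binary constraints with variables in `A`, all of which have values `0` and `1`,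
except that the isolated variable `n` has the value `0`. The graph `H` contains all pairs of
variables that have a joint cost; its maximum degree is at most three. All costs are nonnegative,
and the sum of the maximum costs is at most `R`. -/
structure Network (n : ℕ) (R : ℝ) (A : Finset ℕ) (H : ℕ → ℕ → Prop) (f : Costs) : Prop where
  le : ∀ u ∈ A, u ≤ n
  mem : n ∈ A
  symm : ∀ u w, H u w → H w u
  irrefl : ∀ u, ¬ H u u
  isolated : ∀ u, ¬ H n u
  supp : ∀ u ∈ A, ∀ w ∈ A, u ≠ w → ¬ H u w → ∀ a ≤ 1, ∀ b ≤ 1, f u w a b = 0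
  deg : ∀ u ∈ A, (nbrs A H u).card ≤ 3
  bound : ∃ β : ℕ → ℕ → ℝ, (∀ u ∈ A, ∀ w ∈ A, ∀ a ≤ 1, ∀ b ≤ 1, 0 ≤ f u w a b ∧ f u w a b ≤ β u w) ∧
    tot A β ≤ R

/-- The variable `v` can be eliminated: all its neighbours are among `p` and `q`. -/
structure Eliminable (n : ℕ) (A : Finset ℕ) (H : ℕ → ℕ → Prop) (v p q : ℕ) : Prop where
  v_mem : v ∈ A
  v_ne : v ≠ n
  p_mem : p ∈ A
  q_mem : q ∈ A
  p_ne : p ≠ v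
  q_ne : q ≠ v
  nbr : ∀ u ∈ A, H v u → u = p ∨ u = q
  both : p = q ∨ (H v p ∧ H v q)

/-- The cost of the value `c` of `v` if `p` and `q` have the values `a` and `b`. -/
noncomputable def elimCost (f : Costs) (v p q c a b : ℕ) : ℝ :=
  f v v c c + (f v p c a + f p v a c + if p = q then 0 else f v q c b + f q v b c)

/-- The costs after the elimination of `v`. -/
noncomputable def elimF (f : Costs) (v p q : ℕ) : Costs := fun u w a b =>
  f u w a b + if u = p ∧ w = q then min (elimCost f v p q 0 a b) (elimCost f v p q 1 a b) else 0

/-- The graph after the elimination of `v`. -/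
def elimH (H : ℕ → ℕ → Prop) (p q : ℕ) : ℕ → ℕ → Prop := fun u w =>
  H u w ∨ (p ≠ q ∧ ((u = p ∧ w = q) ∨ (u = q ∧ w = p)))

/-- The costs after `v` has received the value `c`. -/
noncomputable def fixF (n : ℕ) (f : Costs) (v c : ℕ) : Costs := fun u w a b =>
  f u w a b + if u = w then (if u = n then f v v c c else f u v a c + f v u c b) else 0

/-- The assignment `x` has minimum cost `val`. -/
structure Minimizes (n : ℕ) (A : Finset ℕ) (f : Costs) (x : ℕ → ℕ) (val : ℝ) : Prop where
  le_one : ∀ u ∈ A, x u ≤ 1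
  zero : x n = 0
  eq : val = energy A f x
  le : ∀ y : ℕ → ℕ, (∀ u, y u ≤ 1) → y n = 0 → val ≤ energy A f y

theorem energy_congr {A : Finset ℕ} {f : Costs} {x y : ℕ → ℕ} (h : ∀ u ∈ A, x u = y u) :
    energy A f x = energy A f y :=
  tot_congr fun u hu w hw => by rw [h u hu, h w hw]

theorem Minimizes.congr {n : ℕ} {A : Finset ℕ} {f : Costs} {x y : ℕ → ℕ} {val : ℝ}
    (h : Minimizes n A f x val) (hn : n ∈ A) (hxy : ∀ u ∈ A, y u = x u) : Minimizes n A f y val :=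
  ⟨fun u hu => by rw [hxy u hu]; exact h.le_one u hu, by rw [hxy n hn, h.zero],
    by rw [h.eq, energy_congr hxy], h.le⟩

section

variable {n : ℕ} {R : ℝ} {A : Finset ℕ} {H : ℕ → ℕ → Prop} {f : Costs} {v p q c : ℕ}

theorem Network.isolated' (hN : Network n R A H f) (u : ℕ) : ¬ H u n := fun h =>
  hN.isolated u (hN.symm u n h)

/-! ### Elimination of a variable of degree at most two -/

/-- The part of the cost that involves `v` depends only on the values of `v`, `p` and `q`. -/
theorem energy_elim (hN : Network n R A H f) (he : Eliminable n A H v p q) {x : ℕ → ℕ}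
    (hx : ∀ u ∈ A, x u ≤ 1) :
    energy A f x = energy (A.erase v) f x + elimCost f v p q (x v) (x p) (x q) := by
  have hp : p ∈ A.erase v := Finset.mem_erase.2 ⟨he.p_ne, he.p_mem⟩
  have hq : q ∈ A.erase v := Finset.mem_erase.2 ⟨he.q_ne, he.q_mem⟩
  unfold energy
  rw [tot_erase he.v_mem, sum_pair_support hp hq]
  · unfold elimCost; split_ifs <;> ring
  · intro u hu hup huq
    rw [Finset.mem_erase] at hu
    have hH : ¬ H v u := fun h => by rcases he.nbr u hu.2 h with h | h <;> contradiction
    rw [hN.supp v he.v_mem u hu.2 hu.1.symm hH _ (hx v he.v_mem) _ (hx u hu.2),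
      hN.supp u hu.2 v he.v_mem hu.1 (fun h => hH (hN.symm _ _ h)) _ (hx u hu.2) _
      (hx v he.v_mem), add_zero]

theorem energy_elimF (he : Eliminable n A H v p q) (x : ℕ → ℕ) :
    energy (A.erase v) (elimF f v p q) x = energy (A.erase v) f x +
      min (elimCost f v p q 0 (x p) (x q)) (elimCost f v p q 1 (x p) (x q)) := by
  have hp : p ∈ A.erase v := Finset.mem_erase.2 ⟨he.p_ne, he.p_mem⟩
  have hq : q ∈ A.erase v := Finset.mem_erase.2 ⟨he.q_ne, he.q_mem⟩
  unfold energy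
  rw [← tot_single hp hq (min (elimCost f v p q 0 (x p) (x q)) (elimCost f v p q 1 (x p) (x q))),
    ← tot_add]
  refine tot_congr fun u _ w _ => ?_
  unfold elimF
  split_ifs with h
  · rw [h.1, h.2]
  · rfl

/-- An optimal assignment after the elimination of `v` extends by the better value of `v`. -/
theorem Minimizes.elim (hN : Network n R A H f) (he : Eliminable n A H v p q) {x : ℕ → ℕ} {val : ℝ}
    (h : Minimizes n (A.erase v) (elimF f v p q) x val) (hc : c ≤ 1)
    (hmin : elimCost f v p q c (x p) (x q) =
      min (elimCost f v p q 0 (x p) (x q)) (elimCost f v p q 1 (x p) (x q))) :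
    Minimizes n A f (Function.update x v c) val := by
  have hx : ∀ u, u ≠ v → Function.update x v c u = x u := fun u hu => Function.update_of_ne hu ..
  have hle : ∀ u ∈ A, Function.update x v c u ≤ 1 := fun u hu => by
    by_cases huv : u = v
    · subst huv; simpa using hc
    · rw [hx u huv]; exact h.le_one u (Finset.mem_erase.2 ⟨huv, hu⟩)
  refine ⟨hle, by rw [hx n he.v_ne.symm, h.zero], ?_, fun y hy hyn => ?_⟩
  · rw [h.eq, energy_elim hN he hle, energy_elimF he, hx p he.p_ne, hx q he.q_ne,
      Function.update_self, hmin,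
      energy_congr fun u hu => (hx u (Finset.mem_erase.1 hu).1)]
  · refine (h.le y hy hyn).trans ?_
    rw [energy_elim hN he fun u _ => hy u, energy_elimF he]
    have hyv := hy v
    rcases (by omega : y v = 0 ∨ y v = 1) with h0 | h0 <;> rw [h0]
    · linarith [min_le_left (elimCost f v p q 0 (y p) (y q)) (elimCost f v p q 1 (y p) (y q))]
    · linarith [min_le_right (elimCost f v p q 0 (y p) (y q)) (elimCost f v p q 1 (y p) (y q))]

/-- The elimination does not increase degrees: `p` and `q` become adjacent, but both lose the
neighbour `v`. -/
theorem card_nbrs_elimH_le (hN : Network n R A H f) (he : Eliminable n A H v p q) {u : ℕ}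
    (hu : u ∈ A.erase v) : (nbrs (A.erase v) (elimH H p q) u).card ≤ (nbrs A H u).card := by
  classical
  rw [Finset.mem_erase] at hu
  have key : ∀ p q, u = p → p ≠ q → H v p → (∀ w, elimH H p q u w → H u w ∨ w = q) →
      (nbrs (A.erase v) (elimH H p q) u).card ≤ (nbrs A H u).card := by
    rintro p q rfl hpq hvp hH
    have h₁ : v ∈ nbrs A H u := by simp [he.v_mem, hN.symm _ _ hvp]
    rw [← Finset.card_erase_add_one h₁]
    refine le_trans (Finset.card_le_card (t := insert q ((nbrs A H u).erase v)) fun w hw => ?_)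
      (Finset.card_insert_le _ _)
    simp only [mem_nbrs, Finset.mem_erase, Finset.mem_insert] at hw ⊢
    rcases hH w hw.2 with h | h
    · exact .inr ⟨hw.1.1, hw.1.2, h⟩
    · exact .inl h
  by_cases hpq : p = q
  · refine Finset.card_le_card fun w hw => ?_
    simp only [mem_nbrs, Finset.mem_erase, elimH] at hw ⊢
    exact ⟨hw.1.2, hw.2.resolve_right fun h => h.1 hpq⟩
  · obtain ⟨hvp, hvq⟩ := he.both.resolve_left hpq
    by_cases hup : u = p
    · refine key p q hup hpq hvp fun w hw => ?_
      rcases hw with h | ⟨_, ⟨_, h⟩ | ⟨h, _⟩⟩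
      · exact .inl h
      · exact .inr h
      · exact absurd (hup.symm.trans h) hpq
    · by_cases huq : u = q
      · have hsymm : elimH H q p = elimH H p q := by
          funext a b
          simp only [elimH, eq_iff_iff]
          tauto
        rw [← hsymm]
        refine key q p huq (Ne.symm hpq) hvq fun w hw => ?_
        rcases hw with h | ⟨_, ⟨_, h⟩ | ⟨h, _⟩⟩
        · exact .inl h
        · exact .inr h
        · exact absurd h hup
      · refine Finset.card_le_card fun w hw => ?_
        simp only [mem_nbrs, Finset.mem_erase, elimH] at hw ⊢
        exact ⟨hw.1.2, hw.2.resolve_right fun h => by tauto⟩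

theorem elimCost_bounds (he : Eliminable n A H v p q) {β : ℕ → ℕ → ℝ}
    (hβ : ∀ u ∈ A, ∀ w ∈ A, ∀ a ≤ 1, ∀ b ≤ 1, 0 ≤ f u w a b ∧ f u w a b ≤ β u w) {a b : ℕ}
    (hc : c ≤ 1) (ha : a ≤ 1) (hb : b ≤ 1) : 0 ≤ elimCost f v p q c a b ∧
      elimCost f v p q c a b ≤ β v v + (β v p + β p v + if p = q then 0 else β v q + β q v) := by
  have h₁ := hβ v he.v_mem v he.v_mem c hc c hc
  have h₂ := hβ v he.v_mem p he.p_mem c hc a ha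
  have h₃ := hβ p he.p_mem v he.v_mem a ha c hc
  have h₄ := hβ v he.v_mem q he.q_mem c hc b hb
  have h₅ := hβ q he.q_mem v he.v_mem b hb c hc
  unfold elimCost
  split_ifs <;> constructor <;> linarith

theorem elim_tot_le (he : Eliminable n A H v p q) {β : ℕ → ℕ → ℝ}
    (hβ : ∀ u ∈ A, ∀ w ∈ A, 0 ≤ β u w) :
    tot (A.erase v) β + (β v v + (β v p + β p v + if p = q then 0 else β v q + β q v)) ≤
      tot A β := by
  have hp : p ∈ A.erase v := Finset.mem_erase.2 ⟨he.p_ne, he.p_mem⟩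
  have hq : q ∈ A.erase v := Finset.mem_erase.2 ⟨he.q_ne, he.q_mem⟩
  rw [tot_erase he.v_mem]
  have := pair_le_sum (g := fun u => β v u + β u v) hp hq fun u hu => by
    have hu := (Finset.mem_erase.1 hu).2
    linarith [hβ v he.v_mem u hu, hβ u hu v he.v_mem]
  linarith

/-- The elimination of `v` moves the bounds for the costs at `v` to the pair of `p` and `q`, so
the total does not grow. -/
theorem Network.elim (hN : Network n R A H f) (he : Eliminable n A H v p q) :
    Network n R (A.erase v) (elimH H p q) (elimF f v p q) := by
  have hp : p ∈ A.erase v := Finset.mem_erase.2 ⟨he.p_ne, he.p_mem⟩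
  have hq : q ∈ A.erase v := Finset.mem_erase.2 ⟨he.q_ne, he.q_mem⟩
  refine ⟨fun u hu => hN.le u (Finset.mem_of_mem_erase hu),
    Finset.mem_erase.2 ⟨he.v_ne.symm, hN.mem⟩, ?_, ?_, ?_, ?_, fun u hu => ?_, ?_⟩
  · rintro u w (h | ⟨h, h' | h'⟩)
    · exact .inl (hN.symm _ _ h)
    · exact .inr ⟨h, .inr h'.symm⟩
    · exact .inr ⟨h, .inl h'.symm⟩
  · rintro u (h | ⟨h, ⟨rfl, h'⟩ | ⟨rfl, h'⟩⟩)
    · exact hN.irrefl u h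
    · exact h h'
    · exact h h'.symm
  · rintro u (h | ⟨h, ⟨rfl, h'⟩ | ⟨rfl, h'⟩⟩)
    · exact hN.isolated u h
    · exact hN.isolated' v (he.both.resolve_left h).1
    · exact hN.isolated' v (he.both.resolve_left h).2
  · intro u hu w hw huw hH a ha b hb
    have h₁ : ¬ (u = p ∧ w = q) := by
      rintro ⟨rfl, rfl⟩
      exact hH (.inr ⟨huw, .inl ⟨rfl, rfl⟩⟩)
    simp only [elimF, if_neg h₁, add_zero]
    exact hN.supp u (Finset.mem_of_mem_erase hu) w (Finset.mem_of_mem_erase hw) huw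
      (fun h => hH (.inl h)) a ha b hb
  · exact (card_nbrs_elimH_le hN he hu).trans (hN.deg u (Finset.mem_of_mem_erase hu))
  · obtain ⟨β, hβ, hβR⟩ := hN.bound
    set e := β v v + (β v p + β p v + if p = q then 0 else β v q + β q v)
    refine ⟨fun u w => β u w + if u = p ∧ w = q then e else 0, fun u hu w hw a ha b hb => ?_, ?_⟩
    · have h₁ := hβ u (Finset.mem_of_mem_erase hu) w (Finset.mem_of_mem_erase hw) a ha b hb
      have h₂ := elimCost_bounds he hβ (Nat.zero_le 1) ha hb
      have h₃ := elimCost_bounds he hβ le_rfl ha hb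
      simp only [elimF]
      split_ifs
      · refine ⟨add_nonneg h₁.1 (le_min h₂.1 h₃.1), add_le_add h₁.2 ((min_le_left _ _).trans h₂.2)⟩
      · simpa using h₁
    · rw [tot_add, tot_single hp hq]
      exact (elim_tot_le he fun u hu w hw =>
        (hβ u hu w hw 0 (by omega) 0 (by omega)).1.trans
          (hβ u hu w hw 0 (by omega) 0 (by omega)).2).trans hβR

theorem card_cubic_elim_le (hN : Network n R A H f) (he : Eliminable n A H v p q) :
    (cubic (A.erase v) (elimH H p q)).card ≤ (cubic A H).card := by
  refine Finset.card_le_card fun u hu => ?_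
  simp only [cubic, Finset.mem_filter] at hu ⊢
  exact ⟨Finset.mem_of_mem_erase hu.1, hu.2.trans (card_nbrs_elimH_le hN he hu.1)⟩

/-- For degree one, `p = q` is the neighbour; for degree zero, `p = q = n`. -/
theorem exists_eliminable (hN : Network n R A H f) (hv : v ∈ A) (hvn : v ≠ n)
    (hd : (nbrs A H v).card ≤ 2) : ∃ p q, Eliminable n A H v p q := by
  have hne : ∀ u, H v u → u ≠ v := fun u h e => hN.irrefl v (e ▸ h)
  rcases (by omega : (nbrs A H v).card = 0 ∨ (nbrs A H v).card = 1 ∨ (nbrs A H v).card = 2) with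
    h | h | h
  · refine ⟨n, n, hv, hvn, hN.mem, hN.mem, hvn.symm, hvn.symm, fun u hu hH => ?_, .inl rfl⟩
    rw [Finset.card_eq_zero] at h
    have : u ∈ nbrs A H v := by simp [hu, hH]
    simp [h] at this
  · obtain ⟨p, hp⟩ := Finset.card_eq_one.1 h
    have hp' : p ∈ nbrs A H v := by simp [hp]
    rw [mem_nbrs] at hp'
    refine ⟨p, p, hv, hvn, hp'.1, hp'.1, hne p hp'.2, hne p hp'.2, fun u hu hH => ?_, .inl rfl⟩
    have : u ∈ nbrs A H v := by simp [hu, hH]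
    simp only [hp, Finset.mem_singleton] at this
    exact .inl this
  · obtain ⟨p, q, hpq, hp⟩ := Finset.card_eq_two.1 h
    have hp' : p ∈ nbrs A H v := by simp [hp]
    have hq' : q ∈ nbrs A H v := by simp [hp]
    rw [mem_nbrs] at hp' hq'
    refine ⟨p, q, hv, hvn, hp'.1, hq'.1, hne p hp'.2, hne q hq'.2, fun u hu hH => ?_,
      .inr ⟨hp'.2, hq'.2⟩⟩
    have : u ∈ nbrs A H v := by simp [hu, hH]
    simpa [hp] using this

/-! ### Branching on the value of a variable -/

/-- The costs of `v` with its neighbours become costs of single variables, and the cost of `v`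
alone is charged to the constant variable `n`. -/
theorem energy_fixF (hN : Network n R A H f) (hv : v ∈ A) (hvn : v ≠ n) (hc : c ≤ 1) {x : ℕ → ℕ}
    (hx : ∀ u ∈ A.erase v, x u ≤ 1) :
    energy (A.erase v) (fixF n f v c) x = energy A f (Function.update x v c) := by
  have hn : n ∈ A.erase v := Finset.mem_erase.2 ⟨hvn.symm, hN.mem⟩
  have hx' : ∀ u ∈ A.erase v, Function.update x v c u = x u := fun u hu =>
    Function.update_of_ne (Finset.mem_erase.1 hu).1 ..
  have h₀ : ∀ a ≤ 1, f n v a c = 0 := fun a ha =>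
    hN.supp n hN.mem v hv hvn.symm (hN.isolated v) a ha c hc
  have h₁ : ∀ a ≤ 1, f v n c a = 0 := fun a ha =>
    hN.supp v hv n hN.mem hvn (hN.isolated' v) c hc a ha
  have h₂ : energy (A.erase v) (fixF n f v c) x = tot (A.erase v) (fun u w => f u w (x u) (x w)) +
      tot (A.erase v) fun u w => if u = w then
        (if u = n then f v v c c else f u v (x u) c + f v u c (x u)) else 0 := by
    rw [← tot_add]
    refine tot_congr fun u _ w _ => ?_
    unfold fixF
    split_ifs with h
    · rfl
    · rw [h]
    · rfl
  rw [h₂, tot_diag]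
  have h₃ : energy A f (Function.update x v c) = tot (A.erase v) (fun u w => f u w (x u) (x w)) +
      f v v c c + ∑ u ∈ A.erase v, (f v u c (x u) + f u v (x u) c) := by
    unfold energy
    rw [tot_erase hv]
    simp only [Function.update_self]
    have e₁ : tot (A.erase v)
        (fun u w => f u w (Function.update x v c u) (Function.update x v c w)) =
        tot (A.erase v) fun u w => f u w (x u) (x w) :=
      tot_congr fun u hu w hw => by rw [hx' u hu, hx' w hw]
    have e₂ : ∑ u ∈ A.erase v,
        (f v u c (Function.update x v c u) + f u v (Function.update x v c u) c)
        = ∑ u ∈ A.erase v, (f v u c (x u) + f u v (x u) c) :=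
      Finset.sum_congr rfl fun u hu => by rw [hx' u hu]
    rw [e₁, e₂]
  rw [h₃, add_assoc]
  congr 1
  rw [← Finset.add_sum_erase _ _ hn, ← Finset.add_sum_erase _ _ hn, if_pos rfl,
    h₀ _ (hx n hn), h₁ _ (hx n hn)]
  rw [add_zero, zero_add]
  congr 1
  refine Finset.sum_congr rfl fun u hu => ?_
  rw [if_neg (Finset.mem_erase.1 hu).1, add_comm]

theorem Network.fix (hN : Network n R A H f) (hv : v ∈ A) (hvn : v ≠ n) (hc : c ≤ 1) :
    Network n R (A.erase v) H (fixF n f v c) := by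
  classical
  have hn : n ∈ A.erase v := Finset.mem_erase.2 ⟨hvn.symm, hN.mem⟩
  refine ⟨fun u hu => hN.le u (Finset.mem_of_mem_erase hu), hn, hN.symm, hN.irrefl, hN.isolated,
    fun u hu w hw huw hH a ha b hb => ?_, fun u hu => ?_, ?_⟩
  · simp only [fixF, if_neg huw, add_zero]
    exact hN.supp u (Finset.mem_of_mem_erase hu) w (Finset.mem_of_mem_erase hw) huw hH a ha b hb
  · refine le_trans (Finset.card_le_card fun w hw => ?_) (hN.deg u (Finset.mem_of_mem_erase hu))
    simp only [mem_nbrs, Finset.mem_erase] at hw ⊢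
    exact ⟨hw.1.2, hw.2⟩
  · obtain ⟨β, hβ, hβR⟩ := hN.bound
    have hβ0 : ∀ u ∈ A, ∀ w ∈ A, 0 ≤ β u w := fun u hu w hw =>
      (hβ u hu w hw 0 (by omega) 0 (by omega)).1.trans (hβ u hu w hw 0 (by omega) 0 (by omega)).2
    refine ⟨fun u w => β u w + if u = w then (if u = n then β v v else β u v + β v u) else 0,
      fun u hu w hw a ha b hb => ?_, ?_⟩
    · have hu := Finset.mem_of_mem_erase hu
      have hw := Finset.mem_of_mem_erase hw
      have h₁ := hβ u hu w hw a ha b hb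
      have h₂ := hβ v hv v hv c hc c hc
      have h₃ := hβ u hu v hv a ha c hc
      have h₄ := hβ v hv u hu c hc b hb
      simp only [fixF]
      split_ifs <;> constructor <;> linarith
    · rw [tot_add, tot_diag]
      refine le_trans ?_ hβR
      rw [tot_erase hv, add_assoc]
      refine add_le_add le_rfl ?_
      rw [← Finset.add_sum_erase _ _ hn, ← Finset.add_sum_erase _ (fun u => β v u + β u v) hn,
        if_pos rfl]
      refine add_le_add le_rfl ?_
      have h₁ : ∑ u ∈ (A.erase v).erase n, (if u = n then β v v else β u v + β v u) =
          ∑ u ∈ (A.erase v).erase n, (β v u + β u v) :=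
        Finset.sum_congr rfl fun u hu => by rw [if_neg (Finset.mem_erase.1 hu).1, add_comm]
      rw [h₁]
      linarith [hβ0 v hv n hN.mem, hβ0 n hN.mem v hv]

/-- If all variables have degree three, then fixing `v` removes `v` and lowers the degrees of its
three neighbours. -/
theorem card_cubic_fix_le (hN : Network n R A H f) (hv : v ∈ A) (hvn : v ≠ n)
    (h3 : ∀ u ∈ A, u ≠ n → 3 ≤ (nbrs A H u).card) :
    (cubic (A.erase v) H).card + 4 ≤ (cubic A H).card := by
  classical
  have h₁ : v ∉ nbrs A H v := by simp [hN.irrefl v]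
  have h₂ := h3 v hv hvn
  have h₃ : (insert v (nbrs A H v)).card = (nbrs A H v).card + 1 := Finset.card_insert_of_notMem h₁
  have hmono : ∀ u, nbrs (A.erase v) H u ⊆ nbrs A H u := fun u w hw => by
    simp only [mem_nbrs, Finset.mem_erase] at hw ⊢
    exact ⟨hw.1.2, hw.2⟩
  refine le_trans (Nat.add_le_add_left (show 4 ≤ (insert v (nbrs A H v)).card by omega) _) ?_
  rw [← Finset.card_union_of_disjoint]
  · refine Finset.card_le_card fun u hu => ?_
    simp only [cubic, Finset.mem_union, Finset.mem_filter, Finset.mem_insert, mem_nbrs,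
      Finset.mem_erase] at hu ⊢
    rcases hu with h | rfl | h
    · exact ⟨h.1.2, h.2.trans (Finset.card_le_card (hmono u))⟩
    · exact ⟨hv, h₂⟩
    · refine ⟨h.1, h3 u h.1 ?_⟩
      rintro rfl
      exact hN.isolated' v h.2
  · rw [Finset.disjoint_left]
    intro u hu hu'
    simp only [cubic, Finset.mem_filter, Finset.mem_erase, Finset.mem_insert, mem_nbrs] at hu hu'
    rcases hu' with h | h
    · exact hu.1.1 h
    · have h₄ : v ∈ nbrs A H u := by simp [hv, hN.symm _ _ h.2]
      have h₅ : nbrs (A.erase v) H u ⊆ (nbrs A H u).erase v := fun w hw => by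
        simp only [mem_nbrs, Finset.mem_erase] at hw ⊢
        exact ⟨hw.1.1, hw.1.2, hw.2⟩
      have h₆ := Finset.card_le_card h₅
      rw [Finset.card_erase_of_mem h₄] at h₆
      have := hN.deg u h.1
      omega

theorem Minimizes.fix (hN : Network n R A H f) (hv : v ∈ A) (hvn : v ≠ n) {x₀ x₁ : ℕ → ℕ}
    {val₀ val₁ : ℝ} (h₀ : Minimizes n (A.erase v) (fixF n f v 0) x₀ val₀)
    (h₁ : Minimizes n (A.erase v) (fixF n f v 1) x₁ val₁) :
    (val₀ ≤ val₁ → Minimizes n A f (Function.update x₀ v 0) val₀) ∧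
      (val₁ ≤ val₀ → Minimizes n A f (Function.update x₁ v 1) val₁) := by
  have key : ∀ y : ℕ → ℕ, (∀ u, y u ≤ 1) → y n = 0 → val₀ ≤ energy A f y ∨ val₁ ≤ energy A f y := by
    intro y hy hyn
    have hyv := hy v
    have e : y = Function.update y v (y v) := by simp
    rcases (by omega : y v = 0 ∨ y v = 1) with h | h
    · left
      rw [h] at e
      rw [e, ← energy_fixF hN hv hvn (by omega) fun u _ => hy u]
      exact h₀.le y hy hyn
    · right
      rw [h] at e
      rw [e, ← energy_fixF hN hv hvn le_rfl fun u _ => hy u]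
      exact h₁.le y hy hyn
  have main : ∀ c ≤ 1, ∀ (x : ℕ → ℕ) (val : ℝ), Minimizes n (A.erase v) (fixF n f v c) x val →
      (∀ y : ℕ → ℕ, (∀ u, y u ≤ 1) → y n = 0 → val ≤ energy A f y) →
      Minimizes n A f (Function.update x v c) val := by
    intro c hc x val h hmin
    refine ⟨fun u hu => ?_, ?_, ?_, hmin⟩
    · by_cases huv : u = v
      · subst huv; simpa using hc
      · rw [Function.update_of_ne huv]; exact h.le_one u (Finset.mem_erase.2 ⟨huv, hu⟩)
    · rw [Function.update_of_ne hvn.symm, h.zero]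
    · rw [h.eq, energy_fixF hN hv hvn hc h.le_one]
  refine ⟨fun h => main 0 (by omega) x₀ val₀ h₀ fun y hy hyn => ?_,
    fun h => main 1 le_rfl x₁ val₁ h₁ fun y hy hyn => ?_⟩
  · rcases key y hy hyn with h' | h' <;> linarith
  · rcases key y hy hyn with h' | h' <;> linarith

theorem minimizes_base (hA : A = {n}) {x : ℕ → ℕ} (hx : x n = 0) :
    Minimizes n A f x (f n n 0 0) := by
  subst hA
  refine ⟨fun u hu => ?_, hx, by simp [energy, tot, hx], fun y _ hy => by simp [energy, tot, hy]⟩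
  rw [Finset.mem_singleton.1 hu, hx]; omega

theorem Network.le_bound (hN : Network n R A H f) {u w a b : ℕ} (hu : u ∈ A) (hw : w ∈ A)
    (ha : a ≤ 1) (hb : b ≤ 1) : |f u w a b| ≤ R := by
  obtain ⟨β, hβ, hβR⟩ := hN.bound
  have hβ0 : ∀ u ∈ A, ∀ w ∈ A, 0 ≤ β u w := fun u hu w hw =>
    (hβ u hu w hw 0 (by omega) 0 (by omega)).1.trans (hβ u hu w hw 0 (by omega) 0 (by omega)).2
  have h := hβ u hu w hw a ha b hb
  rw [abs_of_nonneg h.1]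
  have h₁ : β u w ≤ ∑ w ∈ A, β u w := Finset.single_le_sum (fun w hw => hβ0 u hu w hw) hw
  have h₂ : ∑ w ∈ A, β u w ≤ tot A β :=
    Finset.single_le_sum (f := fun u => ∑ w ∈ A, β u w)
      (fun u hu => Finset.sum_nonneg fun w hw => hβ0 u hu w hw) hu
  linarith [h.2]

end

/-! ### The program for networks -/

/-! The arrays of the algorithm for networks. For each level of the recursion they hold the
variables, the graph, the costs, the variable that is eliminated or fixed and the two ends of its
arcs, and the result of the first branch. The names with a prime are buffers for the network of
the next level. -/

notation "aAlive" => 40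
notation "aJoin" => 41
notation "aVal" => 42
notation "aSave" => 43
notation "aVar" => 44
notation "aEndP" => 45
notation "aEndQ" => 46
notation "aAlive'" => 47
notation "aJoin'" => 48
notation "aLevel" => 49
notation "rCost" => 10
notation "rCost'" => 11
notation "rMin" => 13
notation "rSave" => 14
notation "rTmp" => 15

/-- The recursion level. -/
abbrev lev : NExp := .get aLevel 0

/-- The test whether a variable is alive at the current level. -/
abbrev aliveB (e : NExp) : BExp := .eq (.get aAlive (lev * (vn + 1) + e)) 1

/-- The test whether two variables are adjacent at the current level. -/
abbrev joinB (e g : NExp) : BExp := .eq (.get aJoin ((lev * (vn + 1) + e) * (vn + 1) + g)) 1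

/-- The address of a cost at the level `l`. -/
abbrev costCell (l e g a b : NExp) : NExp := ((l * (vn + 1) + e) * (vn + 1) + g) * 4 + (2 * a + b)

/-- A cost at the current level. -/
abbrev costAt (e g a b : NExp) : RExp := .get rCost (costCell lev e g a b)

/-- The variable that is removed at the current level. -/
abbrev curV : NExp := .get aVar lev

/-- The first neighbour of the variable that is eliminated at the current level. -/
abbrev curP : NExp := .get aEndP lev

/-- The second neighbour of the variable that is eliminated at the current level. -/
abbrev curQ : NExp := .get aEndQ lev

/-- The formula that variable `50` can be eliminated with the neighbours `51` and `52`. -/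
def elimFm : Fm :=
  .conj (.base (aliveB (vr 50))) (.conj (.base (aliveB (vr 51))) (.conj (.base (aliveB (vr 52)))
  (.conj (.base (.not (.eq (vr 51) (vr 50)))) (.conj (.base (.not (.eq (vr 52) (vr 50))))
  (.conj (.all 53 1 (.or (.neg (.base (.and (aliveB (vr 53)) (joinB (vr 50) (vr 53)))))
    (.or (.base (.eq (vr 53) (vr 51))) (.base (.eq (vr 53) (vr 52))))))
  (.or (.base (.eq (vr 51) (vr 52)))
    (.base (.and (joinB (vr 50) (vr 51)) (joinB (vr 50) (vr 52))))))))))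

/-- The formula that some variable can be eliminated. -/
def elimAnyFm : Fm := .ex 50 0 (.ex 51 1 (.ex 52 1 elimFm))

/-- The formula that no variable is left. -/
def baseFm : Fm := .all 50 0 (.neg (.base (aliveB (vr 50))))

/-- Select a variable that can be eliminated. -/
def elimPickProg : Prog :=
  .seq (Fm.choose 50 0 (.ex 51 1 (.ex 52 1 elimFm))) (.seq (Fm.choose 51 1 (.ex 52 1 elimFm))
  (.seq (Fm.choose 52 1 elimFm) (.seq (.setN aVar lev (vr 50)) (.seq (.setN aEndP lev (vr 51))
    (.setN aEndQ lev (vr 52))))))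

/-- Select a variable for the branching. -/
def fixPickProg : Prog :=
  .seq (Fm.choose 50 0 (.base (aliveB (vr 50)))) (.seq (.setN aVar lev (vr 50))
    (.seq (.setN aEndP lev vn) (.setN aEndQ lev vn)))

/-- Compute the cost of the value `c` of the current variable, given the values of its
neighbours. -/
def elimCostProg (c : ℕ) (a b : NExp) : Prog :=
  .ite (.eq curP curQ)
    (.setR rTmp (.lit c) (costAt curV curV (.lit c) (.lit c) +
      (costAt curV curP (.lit c) a + costAt curP curV a (.lit c))))
    (.setR rTmp (.lit c) (costAt curV curV (.lit c) (.lit c) +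
      ((costAt curV curP (.lit c) a + costAt curP curV a (.lit c)) +
        (costAt curV curQ (.lit c) b + costAt curQ curV b (.lit c)))))

/-- Compute the costs of both values. -/
def elimCostsProg (a b : NExp) : Prog := .seq (elimCostProg 0 a b) (elimCostProg 1 a b)

/-- Compute the minimum cost of the current variable for given values of its neighbours. -/
def minProg (a b : ℕ) : Prog :=
  .seq (elimCostsProg (.lit a) (.lit b)) (.ite (.realLe (.get rTmp 0) (.get rTmp 1))
    (.setR rMin (.lit (2 * a + b)) (.get rTmp 0)) (.setR rMin (.lit (2 * a + b)) (.get rTmp 1)))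

/-- Compute all minimum costs. -/
def minsProg : Prog := .seq (minProg 0 0) (.seq (minProg 0 1) (.seq (minProg 1 0) (minProg 1 1)))

/-- Run a program for all pairs of variables and all pairs of values. -/
def quadProg (p : Prog) : Prog := .loop 53 (vn + 1) (.loop 54 (vn + 1) (.loop 55 2 (.loop 56 2 p)))

/-- The costs after the elimination of the current variable. -/
def elimFillProg : Prog :=
  quadProg (.ite (.and (.eq (vr 53) curP) (.eq (vr 54) curQ))
    (.setR rCost' (costCell 0 (vr 53) (vr 54) (vr 55) (vr 56))
      (costAt (vr 53) (vr 54) (vr 55) (vr 56) + .get rMin (2 * vr 55 + vr 56)))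
    (.setR rCost' (costCell 0 (vr 53) (vr 54) (vr 55) (vr 56))
      (costAt (vr 53) (vr 54) (vr 55) (vr 56))))

/-- The costs after the current variable has received the value `c`. -/
def fixFillProg (c : ℕ) : Prog :=
  quadProg (.ite (.and (.eq (vr 53) (vr 54)) (.and (aliveB (vr 53)) (.not (.eq (vr 53) curV))))
    (.ite (.eq (vr 53) vn)
      (.setR rCost' (costCell 0 (vr 53) (vr 54) (vr 55) (vr 56))
        (costAt (vr 53) (vr 54) (vr 55) (vr 56) + costAt curV curV (.lit c) (.lit c)))
      (.setR rCost' (costCell 0 (vr 53) (vr 54) (vr 55) (vr 56))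
        (costAt (vr 53) (vr 54) (vr 55) (vr 56) +
          (costAt (vr 53) curV (vr 55) (.lit c) + costAt curV (vr 53) (.lit c) (vr 56)))))
    (.setR rCost' (costCell 0 (vr 53) (vr 54) (vr 55) (vr 56))
      (costAt (vr 53) (vr 54) (vr 55) (vr 56))))

/-- The variables that remain alive. -/
def aliveFillProg : Prog :=
  .loop 53 (vn + 1) (.ite (.eq (vr 53) curV) (.setN aAlive' (vr 53) 0)
    (.setN aAlive' (vr 53) (.get aAlive (lev * (vn + 1) + vr 53))))

/-- The graph after the removal of the current variable. -/
def joinFillProg : Prog :=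
  .loop 53 (vn + 1) (.loop 54 (vn + 1) (.ite (.and (.not (.eq curP curQ))
    (.not (.and (.not (.and (.eq (vr 53) curP) (.eq (vr 54) curQ)))
      (.not (.and (.eq (vr 53) curQ) (.eq (vr 54) curP))))))
    (.setN aJoin' (vr 53 * (vn + 1) + vr 54) 1)
    (.setN aJoin' (vr 53 * (vn + 1) + vr 54)
      (.get aJoin ((lev * (vn + 1) + vr 53) * (vn + 1) + vr 54)))))

/-- Copy the prepared data to the current level. -/
def copyProg : Prog :=
  .seq (.loop 53 (vn + 1) (.setN aAlive (lev * (vn + 1) + vr 53) (.get aAlive' (vr 53))))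
  (.seq (.loop 53 (vn + 1) (.loop 54 (vn + 1)
    (.setN aJoin ((lev * (vn + 1) + vr 53) * (vn + 1) + vr 54)
      (.get aJoin' (vr 53 * (vn + 1) + vr 54)))))
    (quadProg (.setR rCost (costCell lev (vr 53) (vr 54) (vr 55) (vr 56))
      (.get rCost' (costCell 0 (vr 53) (vr 54) (vr 55) (vr 56))))))

/-- Enter the next level. -/
def enterProg : Prog :=
  .seq aliveFillProg (.seq joinFillProg (.seq (.setN aLevel 0 (lev + 1)) copyProg))

/-- Enter the next level after the elimination of a variable. -/
def elimEnterProg : Prog := .seq elimPickProg (.seq minsProg (.seq elimFillProg enterProg))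

/-- Enter the next level with the value `c` of the current variable. -/
def fixEnterProg (c : ℕ) : Prog := .seq (fixFillProg c) enterProg

/-- Return to the previous level. -/
def leaveProg : Prog := .setN aLevel 0 (lev - 1)

/-- Choose the value of the eliminated variable. -/
def elimLeaveProg : Prog :=
  .seq leaveProg (.seq (elimCostsProg (.get aVal curP) (.get aVal curQ))
    (.ite (.realLe (.get rTmp 0) (.get rTmp 1)) (.setN aVal curV 0) (.setN aVal curV 1)))

/-- Save the result of the first branch. -/
def saveProg : Prog :=
  .seq leaveProg (.seq (.setN aVal curV 0) (.seq (.setR rSave lev (.get rVal 0))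
    (.loop 53 (vn + 1) (.setN aSave (lev * (vn + 1) + vr 53) (.get aVal (vr 53))))))

/-- Select the better one of the results of the two branches. -/
def selectProg : Prog :=
  .seq leaveProg (.seq (.setN aVal curV 1) (.ite (.realLe (.get rSave lev) (.get rVal 0))
    (.seq (.setR rVal 0 (.get rSave lev))
      (.loop 53 (vn + 1) (.setN aVal (vr 53) (.get aSave (lev * (vn + 1) + vr 53))))) .skip))

/-- The network without variables. -/
def baseProg : Prog := .seq (.setN aVal vn 0) (.setR rVal 0 (costAt vn vn 0 0))

/-- The recursive procedure; it calls itself as procedure `1`. -/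
def networkCmd : Cmd :=
  .seq elimAnyFm.prog.cmd (.ite (.natLe 1 (.get 6 0))
    (.seq elimEnterProg.cmd (.seq (.call 1) elimLeaveProg.cmd))
    (.seq baseFm.prog.cmd (.ite (.natLe 1 (.get 6 0)) baseProg.cmd
      (.seq fixPickProg.cmd (.seq (fixEnterProg 0).cmd (.seq (.call 1) (.seq saveProg.cmd
        (.seq (fixEnterProg 1).cmd (.seq (.call 1) selectProg.cmd)))))))))

/-- The address of a cost. -/
abbrev cell4 (n K u w a b : ℕ) : ℕ := ((K * (n + 1) + u) * (n + 1) + w) * 4 + (2 * a + b)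

theorem addr_lt {K m u w : ℕ} (hu : u < K) (hw : w < m) : u * m + w < K * m := by
  have : (u + 1) * m ≤ K * m := Nat.mul_le_mul_right _ hu
  rw [add_mul] at this
  omega

theorem cell4_inj {n K u w a b u' w' a' b' : ℕ} (hw : w < n + 1) (ha : a < 2) (hb : b < 2)
    (hw' : w' < n + 1) (ha' : a' < 2) (hb' : b' < 2)
    (h : cell4 n K u w a b = cell4 n K u' w' a' b') : u = u' ∧ w = w' ∧ a = a' ∧ b = b' := by
  obtain ⟨h₁, h₂⟩ := (addr_inj (by omega) (by omega)).1 h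
  obtain ⟨h₃, h₄⟩ := (addr_inj hw hw').1 h₁
  omega

theorem cell4_lt {n k K u w a b : ℕ} (hk : k < K) (hu : u < n + 1) (hw : w < n + 1) (ha : a < 2)
    (hb : b < 2) : cell4 n k u w a b < K * (n + 1) * (n + 1) * 4 :=
  addr_lt (addr_lt (addr_lt hk hu) hw) (by omega)

theorem le_cell4 {n K u w a b : ℕ} : K * (n + 1) * (n + 1) * 4 ≤ cell4 n K u w a b := by
  unfold cell4
  have : (K * (n + 1) + u) * (n + 1) = K * (n + 1) * (n + 1) + u * (n + 1) := by ring
  omega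

/-- The network that is stored at level `k`. -/
structure FrameAt (n k : ℕ) (A : Finset ℕ) (H : ℕ → ℕ → Prop) (f : Costs) (σ : Store) : Prop where
  alive : ∀ u ≤ n, (σ.nat aAlive (k * (n + 1) + u) = 1 ↔ u ∈ A)
  join : ∀ u ∈ A, ∀ w ∈ A, (σ.nat aJoin ((k * (n + 1) + u) * (n + 1) + w) = 1 ↔ H u w)
  cost : ∀ u ∈ A, ∀ w ∈ A, ∀ a ≤ 1, ∀ b ≤ 1, σ.real rCost (cell4 n k u w a b) = f u w a b

/-- The networks at all levels up to `k` are unchanged. -/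
structure Below (n k : ℕ) (σ τ : Store) : Prop where
  alive : ∀ j < (k + 1) * (n + 1), τ.nat aAlive j = σ.nat aAlive j
  join : ∀ j < (k + 1) * (n + 1) * (n + 1), τ.nat aJoin j = σ.nat aJoin j
  cost : ∀ j < (k + 1) * (n + 1) * (n + 1) * 4, τ.real rCost j = σ.real rCost j

theorem Below.of_same {n k : ℕ} {σ τ : Store} {LN LR : List ℕ} (h : Same LN LR σ τ)
    (h₁ : aAlive ∉ LN := by decide) (h₂ : aJoin ∉ LN := by decide) (h₃ : rCost ∉ LR := by decide) :
    Below n k σ τ :=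
  ⟨fun j _ => by rw [h.nat _ h₁], fun j _ => by rw [h.nat _ h₂], fun j _ => by rw [h.real _ h₃]⟩

theorem Below.trans {n k : ℕ} {σ τ ρ : Store} (h : Below n k σ τ) (h' : Below n k τ ρ) :
    Below n k σ ρ :=
  ⟨fun j hj => (h'.alive j hj).trans (h.alive j hj), fun j hj => (h'.join j hj).trans (h.join j hj),
    fun j hj => (h'.cost j hj).trans (h.cost j hj)⟩

theorem Below.mono {n k k' : ℕ} {σ τ : Store} (h : Below n k σ τ) (hk : k' ≤ k) :
    Below n k' σ τ := by
  have h₁ : (k' + 1) * (n + 1) ≤ (k + 1) * (n + 1) := Nat.mul_le_mul_right _ (by omega)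
  have h₂ := Nat.mul_le_mul_right (n + 1) h₁
  have h₃ := Nat.mul_le_mul_right 4 h₂
  exact ⟨fun j hj => h.alive j (by omega), fun j hj => h.join j (by omega),
    fun j hj => h.cost j (by omega)⟩

theorem FrameAt.congr {n k : ℕ} {A : Finset ℕ} {H : ℕ → ℕ → Prop} {f : Costs} {σ τ : Store}
    (h : FrameAt n k A H f σ) (hle : ∀ u ∈ A, u ≤ n) (hB : Below n k σ τ) :
    FrameAt n k A H f τ := by
  refine ⟨fun u hu => ?_, fun u hu w hw => ?_, fun u hu w hw a ha b hb => ?_⟩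
  · rw [hB.alive _ (addr_lt (by omega) (by omega))]; exact h.alive u hu
  · have := hle u hu
    have := hle w hw
    rw [hB.join _ (addr_lt (addr_lt (by omega) (by omega)) (by omega))]; exact h.join u hu w hw
  · have := hle u hu
    have := hle w hw
    rw [hB.cost _ (cell4_lt (by omega) (by omega) (by omega) (by omega) (by omega))]
    exact h.cost u hu w hw a ha b hb

section

variable {n B k : ℕ} {R : ℝ} {A : Finset ℕ} {H : ℕ → ℕ → Prop} {f : Costs} {σ : Store} {v p q : ℕ}

/-- A program that writes one cost, run for all pairs of variables and all pairs of values. -/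
theorem ok_quad {r : ℕ} {body : Prog} {LN LR : List ℕ} {K : ℕ} {V : Costs} (hB : n + 5 ≤ B)
    (hn : σ.nat 0 0 = n) (hN : ∀ b ∈ LN, b ≠ 0 ∧ b ≠ 53 ∧ b ≠ 54 ∧ b ≠ 55 ∧ b ≠ 56)
    (hbody : ∀ u < n + 1, ∀ w < n + 1, ∀ a < 2, ∀ b < 2,
      Fills B R (fun τ => τ.real r) [] LN LR body
        ((((σ.setNat 53 0 u).setNat 54 0 w).setNat 55 0 a).setNat 56 0 b)
        fun j x => j = cell4 n K u w a b ∧ x = V u w a b) :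
    Ok B R (quadProg body) σ fun τ =>
      (∀ u < n + 1, ∀ w < n + 1, ∀ a < 2, ∀ b < 2, τ.real r (cell4 n K u w a b) = V u w a b) ∧
      ∀ j < K * (n + 1) * (n + 1) * 4, τ.real r j = σ.real r j := by
  have h0 : 0 ∉ LN := fun h => (hN 0 h).1 rfl
  have h1 : 53 ∉ LN := fun h => (hN _ h).2.1 rfl
  have h2 : 54 ∉ LN := fun h => (hN _ h).2.2.1 rfl
  have h3 : 55 ∉ LN := fun h => (hN _ h).2.2.2.1 rfl
  have h4 : 56 ∉ LN := fun h => (hN _ h).2.2.2.2 rfl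
  have hr : ∀ L : List ℕ, 0 ∉ L → ∀ b ∈ NExp.reads (vn + 1), b ∉ L ++ LN := by
    intro L hL b hb
    have : b = 0 := by
      change b ∈ [0] ++ [] at hb
      simpa using hb
    subst this
    simp [hL, h0]
  have f : Fills B R (fun τ => τ.real r) [53, 54, 55, 56] LN LR (quadProg body) σ
      (fun j x => ∃ u < n + 1, ∃ w < n + 1, ∃ a < 2, ∃ b < 2,
        j = cell4 n K u w a b ∧ x = V u w a b) := by
    have e : ∀ τ : Store, τ.nat 0 0 = n → NExp.eval τ (vn + 1) = n + 1 := by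
      intro τ h; simp [h]
    have l₁ := fun u (hu : u < n + 1) w (hw : w < n + 1) a (ha : a < 2) =>
      fills_loop (x := 56) (N := 2) (XS := []) (LN := LN) (B := B) (R := R) (LR := LR)
        (get := fun τ => τ.real r) (p := body) (hN := by intro b hb; cases hb) (hx := ⟨h4, by simp⟩)
        (by simp; omega) (fun τ v => by simp)
        (W := fun b j x => j = cell4 n K u w a b ∧ x = V u w a b)
        (by
          rintro i hi i' hi' j x x' ⟨rfl, _⟩ ⟨h, _⟩
          exact (cell4_inj hw ha hi hw ha hi' h).2.2.2) (hbody u hu w hw a ha)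
    have l₂ := fun u (hu : u < n + 1) w (hw : w < n + 1) =>
      fills_loop (x := 55) (N := 2) (XS := [56]) (LN := LN) (B := B) (R := R) (LR := LR)
        (get := fun τ => τ.real r) (p := .loop 56 2 body) (hN := by intro b hb; cases hb)
        (hx := ⟨h3, by simp⟩) (by simp; omega) (fun τ v => by simp)
        (W := fun a j x => ∃ b < 2, j = cell4 n K u w a b ∧ x = V u w a b)
        (by
          rintro i hi i' hi' j x x' ⟨b, hb, rfl, _⟩ ⟨b', hb', h, _⟩
          exact (cell4_inj hw hi hb hw hi' hb' h).2.2.1) (l₁ u hu w hw)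
    have l₃ := fun u (hu : u < n + 1) =>
      fills_loop (x := 54) (N := vn + 1) (XS := [55, 56]) (LN := LN) (B := B) (R := R) (LR := LR)
        (σ := σ.setNat 53 0 u)
        (get := fun τ => τ.real r) (p := .loop 55 2 (.loop 56 2 body)) (hN := hr _ (by simp))
        (hx := ⟨h2, by simp⟩) (by rw [e _ (by simpa using hn)]; omega) (fun τ v => by simp)
        (W := fun w j x => ∃ a < 2, ∃ b < 2, j = cell4 n K u w a b ∧ x = V u w a b)
        (by
          rw [e _ (by simpa using hn)]
          rintro i hi i' hi' j x x' ⟨a, ha, b, hb, rfl, _⟩ ⟨a', ha', b', hb', h, _⟩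
          exact (cell4_inj hi ha hb hi' ha' hb' h).2.1)
        (by rw [e _ (by simpa using hn)]; exact l₂ u hu)
    have l₄ :=
      fills_loop (x := 53) (N := vn + 1) (XS := [54, 55, 56]) (LN := LN) (B := B) (R := R)
        (LR := LR)
        (σ := σ)
        (get := fun τ => τ.real r) (p := .loop 54 (vn + 1) (.loop 55 2 (.loop 56 2 body)))
        (hN := hr _ (by simp)) (hx := ⟨h1, by simp⟩) (by rw [e _ hn]; omega) (fun τ v => by simp)
        (W := fun u j x => ∃ w < n + 1, ∃ a < 2, ∃ b < 2, j = cell4 n K u w a b ∧ x = V u w a b)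
        (by
          rintro i hi i' hi' j x x' ⟨w, hw, a, ha, b, hb, rfl, _⟩ ⟨w', hw', a', ha', b', hb', h, _⟩
          exact (cell4_inj hw ha hb hw' ha' hb' h).1)
        (by
          rw [e _ hn]
          intro u hu
          have := l₃ u hu
          rw [e _ (by simpa using hn)] at this
          exact this)
    rw [e _ hn] at l₄
    exact l₄
  refine f.ok.mono fun τ _ ⟨k₁, k₂⟩ => ⟨fun u hu w hw a ha b hb =>
    k₁ _ _ ⟨u, hu, w, hw, a, ha, b, hb, rfl, rfl⟩, fun j hj => k₂ j ?_⟩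
  rintro x ⟨u, hu, w, hw, a, ha, b, hb, rfl, _⟩
  exact absurd (le_cell4 (n := n) (K := K) (u := u) (w := w) (a := a) (b := b)) (by omega)

theorem elimFm_holds (hn : σ.nat 0 0 = n) (hl : σ.nat aLevel 0 = k) (hF : FrameAt n k A H f σ)
    (hle : ∀ u ∈ A, u ≤ n) (h50 : σ.nat 50 0 = v) (h51 : σ.nat 51 0 = p) (h52 : σ.nat 52 0 = q)
    (hv : v < n) (hp : p ≤ n) (hq : q ≤ n) : elimFm.Holds σ ↔ Eliminable n A H v p q := by
  simp only [elimFm, Fm.holds_conj, Fm.holds_base, Fm.holds_all, Fm.holds_or, Fm.holds_neg]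
  simp [hn, hl, h50, h51, h52, hF.alive v hv.le, hF.alive p hp, hF.alive q hq]
  constructor
  · rintro ⟨h₁, h₂, h₃, h₄, h₅, h₆, h₇⟩
    refine ⟨h₁, hv.ne, h₂, h₃, h₄, h₅, fun u hu hH => ?_, ?_⟩
    · have := h₆ u (by have := hle u hu; omega)
      rw [hF.alive u (hle u hu), hF.join v h₁ u hu] at this
      tauto
    · rwa [hF.join v h₁ p h₂, hF.join v h₁ q h₃] at h₇
  · rintro ⟨h₁, _, h₂, h₃, h₄, h₅, h₆, h₇⟩
    refine ⟨h₁, h₂, h₃, h₄, h₅, fun u hu => ?_, ?_⟩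
    · rw [hF.alive u (by omega)]
      by_cases hu' : u ∈ A
      · rw [hF.join v h₁ u hu']
        have := h₆ u hu'
        tauto
      · exact .inl fun h => absurd h hu'
    · rwa [hF.join v h₁ p h₂, hF.join v h₁ q h₃]

end

/-! ### The steps of the program for networks -/

theorem FrameAt.setNat {n k : ℕ} {A : Finset ℕ} {H : ℕ → ℕ → Prop} {f : Costs} {σ : Store}
    (h : FrameAt n k A H f σ) {x : ℕ} (i v : ℕ) (h₁ : aAlive ≠ x) (h₂ : aJoin ≠ x) :
    FrameAt n k A H f (σ.setNat x i v) :=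
  ⟨by simpa [h₁] using h.alive, by simpa [h₂] using h.join, h.cost⟩

/-- The current level and its network. -/
structure LevelAt (n k : ℕ) (A : Finset ℕ) (H : ℕ → ℕ → Prop) (f : Costs) (σ : Store) : Prop where
  n_eq : σ.nat 0 0 = n
  level : σ.nat aLevel 0 = k
  frame : FrameAt n k A H f σ

theorem LevelAt.setNat {n k : ℕ} {A : Finset ℕ} {H : ℕ → ℕ → Prop} {f : Costs} {σ : Store}
    (h : LevelAt n k A H f σ) {x : ℕ} (i v : ℕ) (h₁ : aAlive ≠ x) (h₂ : aJoin ≠ x) (h₃ : 0 ≠ x)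
    (h₄ : aLevel ≠ x) : LevelAt n k A H f (σ.setNat x i v) :=
  ⟨by simp [h₃, h.n_eq], by simp [h₄, h.level], h.frame.setNat i v h₁ h₂⟩

theorem LevelAt.congr {n k : ℕ} {A : Finset ℕ} {H : ℕ → ℕ → Prop} {f : Costs} {σ τ : Store}
    {LN LR : List ℕ} (h : LevelAt n k A H f σ) (hS : Same LN LR σ τ) (h₀ : 0 ∉ LN := by decide)
    (h₁ : aLevel ∉ LN := by decide) (h₂ : aAlive ∉ LN := by decide) (h₃ : aJoin ∉ LN := by decide)
    (h₄ : rCost ∉ LR := by decide) :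
    LevelAt n k A H f τ :=
  ⟨by rw [hS.nat _ h₀, h.n_eq], by rw [hS.nat _ h₁, h.level],
    by rw [hS.nat _ h₂]; exact h.frame.alive, by rw [hS.nat _ h₃]; exact h.frame.join,
    by rw [hS.real _ h₄]; exact h.frame.cost⟩

section

variable {n B k : ℕ} {R : ℝ} {A : Finset ℕ} {H : ℕ → ℕ → Prop} {f : Costs} {σ : Store} {v p q : ℕ}

theorem holds_ex_q (hL : LevelAt n k A H f σ) (hle : ∀ u ∈ A, u ≤ n) (h50 : σ.nat 50 0 = v)
    (h51 : σ.nat 51 0 = p) (hv : v < n) (hp : p ≤ n) :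
    (Fm.ex 52 1 elimFm).Holds σ ↔ ∃ q, Eliminable n A H v p q := by
  simp only [Fm.holds_ex, hL.n_eq]
  constructor
  · rintro ⟨q, hq, h⟩
    have hL' := hL.setNat (x := 52) 0 q (by decide) (by decide) (by decide) (by decide)
    exact ⟨q, (elimFm_holds hL'.n_eq hL'.level hL'.frame hle (by simp [h50]) (by simp [h51])
      (by simp) hv hp (by omega)).1 h⟩
  · rintro ⟨q, h⟩
    have hL' := hL.setNat (x := 52) 0 q (by decide) (by decide) (by decide) (by decide)
    have hq := hle q h.q_mem
    exact ⟨q, by omega, (elimFm_holds hL'.n_eq hL'.level hL'.frame hle (by simp [h50])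
      (by simp [h51]) (by simp) hv hp (by omega)).2 h⟩

theorem holds_ex_p (hL : LevelAt n k A H f σ) (hle : ∀ u ∈ A, u ≤ n) (h50 : σ.nat 50 0 = v)
    (hv : v < n) :
    (Fm.ex 51 1 (Fm.ex 52 1 elimFm)).Holds σ ↔ ∃ p q, Eliminable n A H v p q := by
  rw [Fm.holds_ex, hL.n_eq]
  constructor
  · rintro ⟨p, hp, h⟩
    have hL' := hL.setNat (x := 51) 0 p (by decide) (by decide) (by decide) (by decide)
    exact ⟨p, (holds_ex_q hL' hle (by simp [h50]) (by simp) hv (by omega)).1 h⟩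
  · rintro ⟨p, h⟩
    have hL' := hL.setNat (x := 51) 0 p (by decide) (by decide) (by decide) (by decide)
    have hp := hle p h.choose_spec.p_mem
    exact ⟨p, by omega, (holds_ex_q hL' hle (by simp [h50]) (by simp) hv (by omega)).2 h⟩

theorem holds_elimAny (hL : LevelAt n k A H f σ) (hle : ∀ u ∈ A, u ≤ n) :
    elimAnyFm.Holds σ ↔ ∃ v p q, Eliminable n A H v p q := by
  rw [elimAnyFm, Fm.holds_ex, hL.n_eq]
  constructor
  · rintro ⟨v, hv, h⟩
    have hL' := hL.setNat (x := 50) 0 v (by decide) (by decide) (by decide) (by decide)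
    exact ⟨v, (holds_ex_p hL' hle (by simp) (by omega)).1 h⟩
  · rintro ⟨v, h⟩
    have hL' := hL.setNat (x := 50) 0 v (by decide) (by decide) (by decide) (by decide)
    have hv : v < n := by
      obtain ⟨p, q, h⟩ := h
      have := hle v h.v_mem
      have := h.v_ne
      omega
    exact ⟨v, by omega, (holds_ex_p hL' hle (by simp) hv).2 h⟩

theorem ok_elimPick (hB : n + 5 ≤ B) (hL : LevelAt n k A H f σ) (hle : ∀ u ∈ A, u ≤ n)
    (he : ∃ v p q, Eliminable n A H v p q) :
    Ok B R elimPickProg σ fun τ => ∃ v p q, Eliminable n A H v p q ∧ τ.nat aVar k = v ∧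
      τ.nat aEndP k = p ∧ τ.nat aEndQ k = q ∧ (∀ j ≠ k, τ.nat aVar j = σ.nat aVar j) ∧
      (∀ j ≠ k, τ.nat aEndP j = σ.nat aEndP j) ∧ (∀ j ≠ k, τ.nat aEndQ j = σ.nat aEndQ j) := by
  have hn := hL.n_eq
  refine (Fm.ok_choose (by decide) (by omega)).seq fun τ hτ ⟨h₁, _⟩ => ?_
  have Lτ := hL.congr hτ
  obtain ⟨hv, hv'⟩ := lastSat_spec (n := σ.nat 0 0 + 0)
    (P := fun i => (Fm.ex 51 1 (Fm.ex 52 1 elimFm)).Holds (σ.setNat 50 0 i)) (by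
      have := (holds_elimAny hL hle).2 he
      rwa [elimAnyFm, Fm.holds_ex] at this)
  rw [← h₁, hn, add_zero] at hv
  rw [← h₁, holds_ex_p (hL.setNat (x := 50) 0 _ (by decide) (by decide) (by decide) (by decide)) hle
    (v := τ.nat 50 0) (by simp) hv] at hv'
  obtain ⟨v, hvdef⟩ : ∃ v, v = τ.nat 50 0 := ⟨_, rfl⟩
  rw [← hvdef] at hv hv'
  refine (Fm.ok_choose (by decide) (by rw [Lτ.n_eq]; omega)).seq fun ρ hρ ⟨h₂, _⟩ => ?_
  have Lρ := Lτ.congr hρ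
  obtain ⟨hp, hp'⟩ := lastSat_spec (n := τ.nat 0 0 + 1)
    (P := fun i => (Fm.ex 52 1 elimFm).Holds (τ.setNat 51 0 i)) (by
      have := (holds_ex_p Lτ hle hvdef.symm hv).2 hv'
      rwa [Fm.holds_ex] at this)
  rw [← h₂, Lτ.n_eq] at hp
  rw [← h₂, holds_ex_q (Lτ.setNat (x := 51) 0 _ (by decide) (by decide) (by decide) (by decide)) hle
    (v := τ.nat 50 0) (p := ρ.nat 51 0) (by simp) (by simp) (by omega) (by omega)] at hp'
  obtain ⟨p, hpdef⟩ : ∃ p, p = ρ.nat 51 0 := ⟨_, rfl⟩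
  rw [← hpdef] at hp hp'
  rw [← hvdef] at hp'
  have hv₁ : ρ.nat 50 0 = v := by rw [hρ.nat 50, hvdef]
  refine (Fm.ok_choose (by decide) (by rw [Lρ.n_eq]; omega)).seq fun κ hκ ⟨h₃, _⟩ => ?_
  have Lκ := Lρ.congr hκ
  obtain ⟨hq, hq'⟩ := lastSat_spec (n := ρ.nat 0 0 + 1)
    (P := fun i => elimFm.Holds (ρ.setNat 52 0 i)) (by
      have := (holds_ex_q Lρ hle hv₁ hpdef.symm hv (by omega)).2 hp'
      rwa [Fm.holds_ex] at this)
  rw [← h₃, Lρ.n_eq] at hq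
  have Lρ' := Lρ.setNat (x := 52) 0 (κ.nat 52 0) (by decide) (by decide) (by decide) (by decide)
  rw [← h₃, elimFm_holds Lρ'.n_eq Lρ'.level Lρ'.frame hle (v := v) (p := p) (q := κ.nat 52 0)
    (by simp [hv₁]) (by simp [← hpdef]) (by simp) hv (by omega) (by omega)] at hq'
  have hv₂ : κ.nat 50 0 = v := by rw [hκ.nat 50, hv₁]
  have hp₂ : κ.nat 51 0 = p := by rw [hκ.nat 51, hpdef]
  have hk := Lκ.level
  simp only [ok_seq, ok_setN, NExp.eval_get, NExp.eval_zero, hk]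
  refine ⟨by omega, ?_⟩
  simp [hk, hp₂, hv₂]
  refine ⟨by omega, by omega, hq', fun j hj => ?_, fun j hj => ?_, fun j hj => ?_⟩
  · simp [hj, hκ.nat aVar, hρ.nat aVar, hτ.nat aVar]
  · simp [hj, hκ.nat aEndP, hρ.nat aEndP, hτ.nat aEndP]
  · simp [hj, hκ.nat aEndQ, hρ.nat aEndQ, hτ.nat aEndQ]

theorem ok_fixPick (hB : n + 5 ≤ B) (hL : LevelAt n k A H f σ) (hle : ∀ u ∈ A, u ≤ n)
    (he : ∃ v ∈ A, v ≠ n) :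
    Ok B R fixPickProg σ fun τ => ∃ v ∈ A, v ≠ n ∧ τ.nat aVar k = v ∧
      τ.nat aEndP k = n ∧ τ.nat aEndQ k = n ∧ (∀ j ≠ k, τ.nat aVar j = σ.nat aVar j) ∧
      (∀ j ≠ k, τ.nat aEndP j = σ.nat aEndP j) ∧ (∀ j ≠ k, τ.nat aEndQ j = σ.nat aEndQ j) := by
  have hn := hL.n_eq
  refine (Fm.ok_choose (by decide) (by omega)).seq fun τ hτ ⟨h₁, _⟩ => ?_
  have Lτ := hL.congr hτ
  have hP : ∀ i < n, (Fm.base (aliveB (vr 50))).Holds (σ.setNat 50 0 i) ↔ i ∈ A := by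
    intro i hi
    simp [hn, hL.level, hL.frame.alive i hi.le]
  obtain ⟨hv, hv'⟩ := lastSat_spec (n := σ.nat 0 0 + 0)
    (P := fun i => (Fm.base (aliveB (vr 50))).Holds (σ.setNat 50 0 i)) (by
      obtain ⟨v, hv, hvn⟩ := he
      have := hle v hv
      exact ⟨v, by omega, (hP v (by omega)).2 hv⟩)
  rw [← h₁, hn, add_zero] at hv
  rw [← h₁, hP _ hv] at hv'
  have hk := Lτ.level
  simp only [ok_seq, ok_setN, NExp.eval_get, NExp.eval_zero, hk]
  refine ⟨by omega, ?_⟩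
  have hn' := Lτ.n_eq
  simp only [Store.setNat_nat, hk, hn']
  refine ⟨by simp; omega, by simp; omega, τ.nat 50 0, hv', by omega, by simp,
    by simp, by simp, fun j hj => ?_, fun j hj => ?_, fun j hj => ?_⟩
  · simp [hj, hτ.nat aVar]
  · simp [hj, hτ.nat aEndP]
  · simp [hj, hτ.nat aEndQ]

theorem ok_baseFm (hB : n + 5 ≤ B) (hL : LevelAt n k A H f σ) (hN : Network n R A H f) :
    Ok B R baseFm.prog σ fun τ => τ.nat 6 0 ≤ 1 ∧ (1 ≤ τ.nat 6 0 ↔ A = {n}) := by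
  refine (Fm.ok_prog baseFm (by decide) (by rw [hL.n_eq]; omega)).mono fun τ _ ⟨h, _⟩ => ?_
  have : baseFm.Holds σ ↔ A = {n} := by
    simp only [baseFm, Fm.holds_all, Fm.holds_neg, Fm.holds_base]
    simp [hL.n_eq, hL.level]
    constructor
    · intro h
      ext u
      rw [Finset.mem_singleton]
      refine ⟨fun hu => ?_, fun hu => hu ▸ hN.mem⟩
      by_contra hne
      have := hN.le u hu
      exact h u (by omega) ((hL.frame.alive u this).2 hu)
    · intro h u hu
      rw [hL.frame.alive u hu.le, h]
      simp; omega
  rw [h, ← this]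
  split_ifs with h' <;> simp [h']

theorem ok_elimAny (hB : n + 5 ≤ B) (hL : LevelAt n k A H f σ) (hle : ∀ u ∈ A, u ≤ n) :
    Ok B R elimAnyFm.prog σ fun τ => τ.nat 6 0 ≤ 1 ∧
      (1 ≤ τ.nat 6 0 ↔ ∃ v p q, Eliminable n A H v p q) := by
  refine (Fm.ok_prog elimAnyFm (by decide) (by rw [hL.n_eq]; omega)).mono fun τ _ ⟨h, _⟩ => ?_
  rw [h, ← holds_elimAny hL hle]
  split_ifs with h' <;> simp [h']

/-- The total of the cost bounds limits the costs of an elimination. -/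
theorem elimCost_le (hN : Network n R A H f) (he : Eliminable n A H v p q) {c a b : ℕ} (hc : c ≤ 1)
    (ha : a ≤ 1) (hb : b ≤ 1) : |elimCost f v p q c a b| ≤ R := by
  obtain ⟨β, hβ, hβR⟩ := hN.bound
  have hβ0 : ∀ u ∈ A, ∀ w ∈ A, 0 ≤ β u w := fun u hu w hw =>
    (hβ u hu w hw 0 (by omega) 0 (by omega)).1.trans (hβ u hu w hw 0 (by omega) 0 (by omega)).2
  have h₁ := elimCost_bounds he hβ hc ha hb
  have h₂ := elim_tot_le he hβ0
  have h₃ : 0 ≤ tot (A.erase v) β := Finset.sum_nonneg fun u hu => Finset.sum_nonneg fun w hw =>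
    hβ0 u (Finset.mem_of_mem_erase hu) w (Finset.mem_of_mem_erase hw)
  rw [abs_of_nonneg h₁.1]
  linarith [h₁.2]

theorem ok_elimCosts (hL : LevelAt n k A H f σ) (hN : Network n R A H f)
    (he : Eliminable n A H v p q) (hv : σ.nat aVar k = v) (hp : σ.nat aEndP k = p)
    (hq : σ.nat aEndQ k = q) {ea eb : NExp} {a b : ℕ} (hea : ea.eval σ = a) (heb : eb.eval σ = b)
    (ha : a ≤ 1) (hb : b ≤ 1) :
    Ok B R (elimCostsProg ea eb) σ fun τ => τ.real rTmp 0 = elimCost f v p q 0 a b ∧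
      τ.real rTmp 1 = elimCost f v p q 1 a b := by
  have key : ∀ c ≤ 1, ∀ τ : Store, Same [] [rTmp] σ τ →
      Ok B R (elimCostProg c ea eb) τ fun ρ => ρ = τ.setReal rTmp c (elimCost f v p q c a b) := by
    intro c hc τ hτ
    have Lτ := hL.congr hτ
    have hb' := elimCost_le hN he hc ha hb
    have e₁ : ea.eval τ = a := by rw [← hea]; exact ea.eval_congr fun b _ => hτ.nat b (by simp)
    have e₂ : eb.eval τ = b := by rw [← heb]; exact eb.eval_congr fun b _ => hτ.nat b (by simp)
    have v₁ : τ.nat aVar k = v := by rw [hτ.nat _, hv]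
    have v₂ : τ.nat aEndP k = p := by rw [hτ.nat _, hp]
    have v₃ : τ.nat aEndQ k = q := by rw [hτ.nat _, hq]
    have F := Lτ.frame.cost
    unfold elimCostProg
    rw [ok_ite]
    simp only [BExp.holds_eq, NExp.eval_get, NExp.eval_zero, Lτ.level, v₂, v₃]
    constructor
    · intro h
      rw [ok_setR]
      have : RExp.eval τ (costAt curV curV (.lit c) (.lit c) +
          (costAt curV curP (.lit c) ea + costAt curP curV ea (.lit c))) =
          elimCost f v p q c a b := by
        simp [Lτ.n_eq, Lτ.level, v₁, v₂, e₁, elimCost, h,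
          F v he.v_mem v he.v_mem c hc c hc]
        rw [← h, F v he.v_mem p he.p_mem c hc a ha, F p he.p_mem v he.v_mem a ha c hc]
      rw [this]
      exact ⟨hb', rfl⟩
    · intro h
      rw [ok_setR]
      have : RExp.eval τ (costAt curV curV (.lit c) (.lit c) +
          ((costAt curV curP (.lit c) ea + costAt curP curV ea (.lit c)) +
            (costAt curV curQ (.lit c) eb + costAt curQ curV eb (.lit c)))) =
          elimCost f v p q c a b := by
        simp [Lτ.n_eq, Lτ.level, v₁, v₂, v₃, e₁, e₂, elimCost, h,
          F v he.v_mem v he.v_mem c hc c hc, F v he.v_mem p he.p_mem c hc a ha,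
          F p he.p_mem v he.v_mem a ha c hc, F v he.v_mem q he.q_mem c hc b hb,
          F q he.q_mem v he.v_mem b hb c hc]
      rw [this]
      exact ⟨hb', rfl⟩
  refine (key 0 (by omega) σ (Same.refl _ _ _)).seq ?_
  rintro τ _ rfl
  refine (key 1 le_rfl _ ((Same.refl _ _ _).setReal _ _ (by decide))).mono ?_
  rintro τ _ rfl
  simp

theorem ok_min (hL : LevelAt n k A H f σ) (hN : Network n R A H f)
    (he : Eliminable n A H v p q) (hv : σ.nat aVar k = v) (hp : σ.nat aEndP k = p)
    (hq : σ.nat aEndQ k = q) {a b : ℕ} (ha : a ≤ 1) (hb : b ≤ 1) :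
    Ok B R (minProg a b) σ fun τ =>
      τ.real rMin (2 * a + b) = min (elimCost f v p q 0 a b) (elimCost f v p q 1 a b) ∧
      ∀ j ≠ 2 * a + b, τ.real rMin j = σ.real rMin j := by
  have h₀ := elimCost_le hN he (c := 0) (by omega) ha hb
  have h₁ := elimCost_le hN he (c := 1) le_rfl ha hb
  refine (ok_elimCosts hL hN he hv hp hq (ea := .lit a) (eb := .lit b) rfl rfl ha hb).seq
    fun τ hτ ⟨k₁, k₂⟩ => ?_
  simp only [NExp.eval_lit] at k₁ k₂
  rw [ok_ite]
  simp only [BExp.holds_realLe, RExp.eval_get, NExp.eval_zero, NExp.eval_one, k₁, k₂]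
  have hr : τ.real rMin = σ.real rMin := hτ.real _ (by simp [elimCostsProg, elimCostProg, wR])
  constructor
  · intro h
    rw [ok_setR]
    simp only [RExp.eval_get, NExp.eval_zero, NExp.eval_lit, k₁]
    exact ⟨h₀, by simp [min_eq_left h], fun j hj => by simp [hj, hr]⟩
  · intro h
    rw [ok_setR]
    simp only [RExp.eval_get, NExp.eval_one, NExp.eval_lit, k₂]
    exact ⟨h₁, by simp [min_eq_right (not_le.1 h).le], fun j hj => by simp [hj, hr]⟩

theorem ok_mins (hL : LevelAt n k A H f σ) (hN : Network n R A H f)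
    (he : Eliminable n A H v p q) (hv : σ.nat aVar k = v) (hp : σ.nat aEndP k = p)
    (hq : σ.nat aEndQ k = q) :
    Ok B R minsProg σ fun τ => ∀ a ≤ 1, ∀ b ≤ 1,
      τ.real rMin (2 * a + b) = min (elimCost f v p q 0 a b) (elimCost f v p q 1 a b) := by
  refine (ok_min hL hN he hv hp hq (a := 0) (b := 0) (by omega) (by omega)).seq
    fun τ₁ s₁ ⟨h₁, _⟩ => ?_
  have L₁ := hL.congr s₁
  have v₁ : τ₁.nat aVar k = v := by rw [s₁.nat _, hv]
  have p₁ : τ₁.nat aEndP k = p := by rw [s₁.nat _, hp]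
  have q₁ : τ₁.nat aEndQ k = q := by rw [s₁.nat _, hq]
  refine (ok_min L₁ hN he v₁ p₁ q₁ (a := 0) (b := 1) (by omega) (by omega)).seq
    fun τ₂ s₂ ⟨h₂, h₂'⟩ => ?_
  have L₂ := L₁.congr s₂
  have v₂ : τ₂.nat aVar k = v := by rw [s₂.nat _, v₁]
  have p₂ : τ₂.nat aEndP k = p := by rw [s₂.nat _, p₁]
  have q₂ : τ₂.nat aEndQ k = q := by rw [s₂.nat _, q₁]
  refine (ok_min L₂ hN he v₂ p₂ q₂ (a := 1) (b := 0) (by omega) (by omega)).seq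
    fun τ₃ s₃ ⟨h₃, h₃'⟩ => ?_
  have L₃ := L₂.congr s₃
  have v₃ : τ₃.nat aVar k = v := by rw [s₃.nat _, v₂]
  have p₃ : τ₃.nat aEndP k = p := by rw [s₃.nat _, p₂]
  have q₃ : τ₃.nat aEndQ k = q := by rw [s₃.nat _, q₂]
  refine (ok_min L₃ hN he v₃ p₃ q₃ (a := 1) (b := 1) (by omega) (by omega)).mono
    fun τ₄ s₄ ⟨h₄, h₄'⟩ a ha b hb => ?_
  rcases (by omega : a = 0 ∨ a = 1) with rfl | rfl <;>
    rcases (by omega : b = 0 ∨ b = 1) with rfl | rfl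
  · rw [h₄' _ (by decide), h₃' _ (by decide), h₂' _ (by decide), h₁]
  · rw [h₄' _ (by decide), h₃' _ (by decide), h₂]
  · rw [h₄' _ (by decide), h₃]
  · exact h₄

theorem ok_elimFill (hB : n + 5 ≤ B) (hσ : Bdd B R σ) (hL : LevelAt n k A H f σ)
    (hN : Network n R A H f) (he : Eliminable n A H v p q) (hp : σ.nat aEndP k = p)
    (hq : σ.nat aEndQ k = q)
    (hm : ∀ a ≤ 1, ∀ b ≤ 1,
      σ.real rMin (2 * a + b) = min (elimCost f v p q 0 a b) (elimCost f v p q 1 a b)) :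
    Ok B R elimFillProg σ fun τ => ∀ u ∈ A.erase v, ∀ w ∈ A.erase v, ∀ a ≤ 1, ∀ b ≤ 1,
      τ.real rCost' (cell4 n 0 u w a b) = elimF f v p q u w a b := by
  have F := hL.frame.cost
  have hp' : p ∈ A.erase v := Finset.mem_erase.2 ⟨he.p_ne, he.p_mem⟩
  have hq' : q ∈ A.erase v := Finset.mem_erase.2 ⟨he.q_ne, he.q_mem⟩
  refine (ok_quad (r := rCost') (LN := []) (LR := [rCost']) (K := 0)
    (V := fun u w a b => if u = p ∧ w = q then elimF f v p q u w a b else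
      σ.real rCost (cell4 n k u w a b)) hB hL.n_eq (by simp)
    fun u hu w hw a ha b hb => fills_ite (fun h => fills_setR ?_ ?_ ?_)
      (fun h => fills_setR ?_ ?_ ?_)).mono fun τ hτ ⟨h₁, _⟩ u hu w hw a ha b hb => ?_
  · simp [hL.n_eq]
  · simp [hL.level, hp, hq] at h
    obtain ⟨rfl, rfl⟩ := h
    simp [hL.n_eq, hL.level, F u he.p_mem w he.q_mem a (by omega) b (by omega),
      hm a (by omega) b (by omega), elimF]
  · simp [hL.level, hp, hq] at h
    rw [if_pos h, h.1, h.2]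
    exact (hN.elim he).le_bound hp' hq' (by omega) (by omega)
  · simp [hL.n_eq]
  · simp [hL.level, hp, hq] at h
    rw [if_neg (by tauto)]
    simp [hL.n_eq, hL.level]
  · simp [hL.level, hp, hq] at h
    rw [if_neg (by tauto)]
    exact hσ.real _ _
  · have hu' := Finset.mem_of_mem_erase hu
    have hw' := Finset.mem_of_mem_erase hw
    have := hN.le u hu'
    have := hN.le w hw'
    rw [h₁ u (by omega) w (by omega) a (by omega) b (by omega)]
    split_ifs with h
    · rfl
    · rw [F u hu' w hw' a ha b hb, elimF, if_neg h, add_zero]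

theorem ok_fixFill (hB : n + 5 ≤ B) (hσ : Bdd B R σ) (hL : LevelAt n k A H f σ)
    (hN : Network n R A H f) (hvA : v ∈ A) (hvn : v ≠ n) (hv : σ.nat aVar k = v) {c : ℕ}
    (hc : c ≤ 1) :
    Ok B R (fixFillProg c) σ fun τ => ∀ u ∈ A.erase v, ∀ w ∈ A.erase v, ∀ a ≤ 1, ∀ b ≤ 1,
      τ.real rCost' (cell4 n 0 u w a b) = fixF n f v c u w a b := by
  have F := hL.frame.cost
  -- The arrays that an expression reads do not depend on its literals.
  have d₁ : ∀ c, ∀ b ∈ (costAt (vr 53) (vr 54) (vr 55) (vr 56) +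
      costAt curV curV (.lit c) (.lit c)).reads, b ∉ ([] ++ [] : List ℕ) := by simp
  have d₂ : ∀ c, ∀ b ∈ (costAt (vr 53) (vr 54) (vr 55) (vr 56) +
      costAt curV curV (.lit c) (.lit c)).rreads, b ∉ [rCost'] := fun c =>
    show ∀ b ∈ [rCost, rCost], b ∉ [rCost'] by decide
  have d₃ : ∀ c, ∀ b ∈ (costAt (vr 53) (vr 54) (vr 55) (vr 56) +
      (costAt (vr 53) curV (vr 55) (.lit c) + costAt curV (vr 53) (.lit c) (vr 56))).reads,
      b ∉ ([] ++ [] : List ℕ) := by simp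
  have d₄ : ∀ c, ∀ b ∈ (costAt (vr 53) (vr 54) (vr 55) (vr 56) +
      (costAt (vr 53) curV (vr 55) (.lit c) + costAt curV (vr 53) (.lit c) (vr 56))).rreads,
      b ∉ [rCost'] := fun c => show ∀ b ∈ [rCost, rCost, rCost], b ∉ [rCost'] by decide
  refine (ok_quad (r := rCost') (LN := []) (LR := [rCost']) (K := 0)
    (V := fun u w a b => if u = w ∧ u ∈ A.erase v then fixF n f v c u w a b else
      σ.real rCost (cell4 n k u w a b)) hB hL.n_eq (by simp)
    fun u hu w hw a ha b hb => fills_ite (hb' := by simp [BExp.rreads, BExp.eq])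
      (fun h => fills_ite
        (fun h' => fills_setR ?_ ?_ ?_ (by decide) (d₁ c) (d₂ c))
        (fun h' => fills_setR ?_ ?_ ?_ (by decide) (d₃ c) (d₄ c)))
      (fun h => fills_setR ?_ ?_ ?_)).mono fun τ hτ ⟨h₁, _⟩ u hu w hw a ha b hb => ?_
  · simp [hL.n_eq]
  · simp [hL.n_eq, hL.level, hv, hL.frame.alive u (by omega)] at h h'
    obtain ⟨rfl, h₁, h₂⟩ := h
    have e₁ := F u h₁ u h₁ a (by omega) b (by omega)
    rw [if_pos ⟨rfl, Finset.mem_erase.2 ⟨h₂, h₁⟩⟩, fixF, if_pos rfl, if_pos h', ← e₁,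
      ← F v hvA v hvA c hc c hc]
    simp [hL.n_eq, hL.level, hv]
  · simp [hL.n_eq, hL.level, hv, hL.frame.alive u (by omega)] at h
    have hu' : u ∈ A.erase v := Finset.mem_erase.2 ⟨h.2.2, h.2.1⟩
    rw [if_pos ⟨h.1, hu'⟩, ← h.1]
    exact (hN.fix hvA hvn hc).le_bound hu' hu' (by omega) (by omega)
  · simp [hL.n_eq]
  · simp [hL.n_eq, hL.level, hv, hL.frame.alive u (by omega)] at h h'
    obtain ⟨rfl, h₁, h₂⟩ := h
    simp [hL.n_eq, hL.level, hv, F u h₁ u h₁ a (by omega) b (by omega), h₁, h₂, h',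
      F u h₁ v hvA a (by omega) c hc, F v hvA u h₁ c hc b (by omega), fixF]
  · simp [hL.n_eq, hL.level, hv, hL.frame.alive u (by omega)] at h
    have hu' : u ∈ A.erase v := Finset.mem_erase.2 ⟨h.2.2, h.2.1⟩
    rw [if_pos ⟨h.1, hu'⟩, ← h.1]
    exact (hN.fix hvA hvn hc).le_bound hu' hu' (by omega) (by omega)
  · simp [hL.n_eq]
  · simp [hL.n_eq, hL.level, hv, hL.frame.alive u (by omega)] at h
    rw [if_neg (by rw [Finset.mem_erase]; tauto)]
    simp [hL.n_eq, hL.level]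
  · simp [hL.n_eq, hL.level, hv, hL.frame.alive u (by omega)] at h
    rw [if_neg (by rw [Finset.mem_erase]; tauto)]
    exact hσ.real _ _
  · have hu' := Finset.mem_of_mem_erase hu
    have hw' := Finset.mem_of_mem_erase hw
    have := hN.le u hu'
    have := hN.le w hw'
    rw [h₁ u (by omega) w (by omega) a (by omega) b (by omega)]
    split_ifs with h
    · rfl
    · rw [F u hu' w hw' a ha b hb, fixF, if_neg fun h' => h ⟨h', hu⟩, add_zero]

end

theorem Ok.bdd {B : ℕ} {R : ℝ} {p : Prog} {σ : Store} {Q : Store → Prop} (h : Ok B R p σ Q)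
    (hw : p.wf = true) (hσ : Bdd B R σ) : Ok B R p σ fun τ => Bdd B R τ ∧ Q τ :=
  ⟨h.1, bdd_den p hw σ hσ h.1, h.2⟩

section

variable {n B k : ℕ} {R : ℝ} {A : Finset ℕ} {H : ℕ → ℕ → Prop} {f : Costs} {σ : Store} {v p q : ℕ}

theorem not_mem_of_reads_vn {L : List ℕ} (hL : 0 ∉ L) : ∀ b ∈ NExp.reads (vn + 1), b ∉ L := by
  intro b hb
  have : b = 0 := by
    change b ∈ [0] ++ [] at hb
    simpa using hb
  subst this
  exact hL

/-- A program that writes one cell, run for all variables. -/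
theorem ok_line {get : Store → ℕ → ℕ} {body : Prog} {LN LR : List ℕ} {K : ℕ} {V : ℕ → ℕ}
    (hB : n + 5 ≤ B) (hn : σ.nat 0 0 = n) (h0 : 0 ∉ LN) (h53 : 53 ∉ LN)
    (hg : ∀ (τ : Store) (v : ℕ), get (τ.setNat 53 0 v) = get τ)
    (hbody : ∀ u < n + 1, Fills B R get [] LN LR body (σ.setNat 53 0 u)
      fun j x => j = K * (n + 1) + u ∧ x = V u) :
    Ok B R (.loop 53 (vn + 1) body) σ fun τ =>
      (∀ u < n + 1, get τ (K * (n + 1) + u) = V u) ∧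
      ∀ j < K * (n + 1), get τ j = get σ j := by
  have e : NExp.eval σ (vn + 1) = n + 1 := by simp [hn]
  have f := fills_loop (x := 53) (N := vn + 1) (XS := []) (LN := LN) (LR := LR) (B := B) (R := R)
    (σ := σ) (get := get) (p := body) (hN := not_mem_of_reads_vn (by simp [h0]))
    (hx := ⟨h53, by simp⟩)
    (by rw [e]; omega) hg (W := fun u j x => j = K * (n + 1) + u ∧ x = V u)
    (by rintro i _ i' _ j x x' ⟨rfl, _⟩ ⟨h, _⟩; omega) (by rw [e]; exact hbody)
  rw [e] at f
  refine f.ok.mono fun τ _ ⟨k₁, k₂⟩ => ⟨fun u hu => k₁ _ _ ⟨u, hu, rfl, rfl⟩, fun j hj => k₂ j ?_⟩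
  rintro x ⟨u, hu, rfl, _⟩
  omega

/-- A program that writes one cell, run for all pairs of variables. -/
theorem ok_square {get : Store → ℕ → ℕ} {body : Prog} {LN LR : List ℕ} {K : ℕ} {V : ℕ → ℕ → ℕ}
    (hB : n + 5 ≤ B) (hn : σ.nat 0 0 = n) (h0 : 0 ∉ LN) (h53 : 53 ∉ LN) (h54 : 54 ∉ LN)
    (hg : ∀ (τ : Store) (x v : ℕ), x = 53 ∨ x = 54 → get (τ.setNat x 0 v) = get τ)
    (hbody : ∀ u < n + 1, ∀ w < n + 1,
      Fills B R get [] LN LR body ((σ.setNat 53 0 u).setNat 54 0 w)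
        fun j x => j = (K * (n + 1) + u) * (n + 1) + w ∧ x = V u w) :
    Ok B R (.loop 53 (vn + 1) (.loop 54 (vn + 1) body)) σ fun τ =>
      (∀ u < n + 1, ∀ w < n + 1, get τ ((K * (n + 1) + u) * (n + 1) + w) = V u w) ∧
      ∀ j < K * (n + 1) * (n + 1), get τ j = get σ j := by
  have e : ∀ τ : Store, τ.nat 0 0 = n → NExp.eval τ (vn + 1) = n + 1 := fun τ h => by simp [h]
  have f₁ := fun u (hu : u < n + 1) =>
    fills_loop (x := 54) (N := vn + 1) (XS := []) (LN := LN) (LR := LR) (B := B) (R := R)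
      (σ := σ.setNat 53 0 u) (get := get) (p := body) (hN := not_mem_of_reads_vn (by simp [h0]))
    (hx := ⟨h54, by simp⟩) (by rw [e _ (by simpa using hn)]; omega)
      (fun τ v => hg τ 54 v (.inr rfl))
      (W := fun w j x => j = (K * (n + 1) + u) * (n + 1) + w ∧ x = V u w)
      (by rintro i _ i' _ j x x' ⟨rfl, _⟩ ⟨h, _⟩; omega)
      (by rw [e _ (by simpa using hn)]; exact hbody u hu)
  have f := fills_loop (x := 53) (N := vn + 1) (XS := [54]) (LN := LN) (LR := LR) (B := B) (R := R)
    (σ := σ) (get := get) (p := .loop 54 (vn + 1) body) (hN := not_mem_of_reads_vn (by simp [h0]))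
    (hx := ⟨h53, by simp⟩) (by rw [e _ hn]; omega) (fun τ v => hg τ 53 v (.inl rfl))
    (W := fun u j x => ∃ w < n + 1, j = (K * (n + 1) + u) * (n + 1) + w ∧ x = V u w)
    (by
      rintro i _ i' _ j x x' ⟨w, hw, rfl, _⟩ ⟨w', hw', h, _⟩
      have := ((addr_inj hw hw').1 h).1
      omega)
    (by
      rw [e _ hn]
      intro u hu
      have := f₁ u hu
      rwa [e _ (by simpa using hn)] at this)
  rw [e _ hn] at f
  refine f.ok.mono fun τ _ ⟨k₁, k₂⟩ => ⟨fun u hu w hw => k₁ _ _ ⟨u, hu, w, hw, rfl, rfl⟩,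
    fun j hj => k₂ j ?_⟩
  rintro x ⟨u, hu, w, hw, rfl, _⟩
  have : (K * (n + 1) + u) * (n + 1) = K * (n + 1) * (n + 1) + u * (n + 1) := by ring
  omega

theorem ok_aliveFill (hB : n + 5 ≤ B) (hσ : Bdd B R σ) (hL : LevelAt n k A H f σ)
    (hv : σ.nat aVar k = v) :
    Ok B R aliveFillProg σ fun τ => ∀ u < n + 1,
      τ.nat aAlive' u = if u = v then 0 else σ.nat aAlive (k * (n + 1) + u) := by
  refine (ok_line (get := fun τ => τ.nat aAlive') (LN := [aAlive']) (LR := []) (K := 0)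
    (V := fun u => if u = v then 0 else σ.nat aAlive (k * (n + 1) + u)) hB hL.n_eq (by decide)
    (by decide) (fun τ v => by simp) fun u hu => fills_ite
      (fun h => fills_setN ?_ ?_ ?_)
      (fun h => fills_setN ?_ ?_ ?_)).mono
    fun τ _ ⟨h, _⟩ u hu => by have := h u hu; simpa using this
  all_goals simp [hL.level, hv] at h
  · simp
  · simp [h]
  · simp [h]
  · simp
  · simp [h, hL.n_eq, hL.level]
  · simp only [h, if_false]; exact hσ.nat _ _

theorem ok_joinFill (hB : n + 5 ≤ B) (hσ : Bdd B R σ) (hL : LevelAt n k A H f σ)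
    (hp : σ.nat aEndP k = p) (hq : σ.nat aEndQ k = q) :
    Ok B R joinFillProg σ fun τ => ∀ u < n + 1, ∀ w < n + 1, τ.nat aJoin' (u * (n + 1) + w) =
      if p ≠ q ∧ (u = p ∧ w = q ∨ u = q ∧ w = p) then 1
      else σ.nat aJoin ((k * (n + 1) + u) * (n + 1) + w) := by
  refine (ok_square (get := fun τ => τ.nat aJoin') (LN := [aJoin']) (LR := []) (K := 0)
    (V := fun u w => if p ≠ q ∧ (u = p ∧ w = q ∨ u = q ∧ w = p) then 1
      else σ.nat aJoin ((k * (n + 1) + u) * (n + 1) + w)) hB hL.n_eq (by decide)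
    (by decide) (by decide) (fun τ x v h => by rcases h with rfl | rfl <;> simp)
    fun u hu w hw => fills_ite
      (fun h => fills_setN ?_ ?_ ?_)
      (fun h => fills_setN ?_ ?_ ?_)).mono
    fun τ _ ⟨h, _⟩ u hu w hw => by have := h u hu w hw; simpa using this
  all_goals simp [hL.level, hp, hq] at h
  · simp [hL.n_eq]
  · rw [if_pos (by tauto)]; simp
  · rw [if_pos (by tauto)]; omega
  · simp [hL.n_eq]
  · rw [if_neg (by tauto)]; simp [hL.n_eq, hL.level]
  · rw [if_neg (by tauto)]; exact hσ.nat _ _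

theorem ok_copy {K : ℕ} (hB : n + 5 ≤ B) (hσ : Bdd B R σ) (hn : σ.nat 0 0 = n)
    (hl : σ.nat aLevel 0 = K + 1) :
    Ok B R copyProg σ fun τ => Below n K σ τ ∧
      (∀ u < n + 1, τ.nat aAlive ((K + 1) * (n + 1) + u) = σ.nat aAlive' u) ∧
      (∀ u < n + 1, ∀ w < n + 1, τ.nat aJoin (((K + 1) * (n + 1) + u) * (n + 1) + w) =
        σ.nat aJoin' (u * (n + 1) + w)) ∧
      (∀ u < n + 1, ∀ w < n + 1, ∀ a < 2, ∀ b < 2, τ.real rCost (cell4 n (K + 1) u w a b) =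
        σ.real rCost' (cell4 n 0 u w a b)) := by
  refine (ok_line (get := fun τ => τ.nat aAlive) (LN := [aAlive]) (LR := []) (K := K + 1)
    (V := fun u => σ.nat aAlive' u) hB hn (by decide) (by decide) (fun τ v => by simp)
    fun u hu => fills_setN ?_ ?_ ?_).seq
    fun τ₁ s₁ ⟨h₁, h₁'⟩ => ?_
  · simp [hn, hl]
  · simp
  · exact hσ.nat _ _
  have hn₁ : τ₁.nat 0 0 = n := by rw [s₁.nat 0, hn]
  have hl₁ : τ₁.nat aLevel 0 = K + 1 := by rw [s₁.nat _, hl]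
  refine (ok_square (get := fun τ => τ.nat aJoin) (LN := [aJoin]) (LR := []) (K := K + 1)
    (V := fun u w => σ.nat aJoin' (u * (n + 1) + w)) hB hn₁ (by decide) (by decide) (by decide)
    (fun τ x v h => by rcases h with rfl | rfl <;> simp)
    fun u hu w hw => fills_setN ?_ ?_ ?_).seq
    fun τ₂ s₂ ⟨h₂, h₂'⟩ => ?_
  · simp [hn₁, hl₁]
  · simp [hn₁, s₁.nat aJoin']
  · exact hσ.nat _ _
  have hn₂ : τ₂.nat 0 0 = n := by rw [s₂.nat 0, hn₁]
  have hl₂ : τ₂.nat aLevel 0 = K + 1 := by rw [s₂.nat _, hl₁]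
  refine (ok_quad (r := rCost) (LN := []) (LR := [rCost]) (K := K + 1)
    (V := fun u w a b => σ.real rCost' (cell4 n 0 u w a b)) hB hn₂ (by simp)
    fun u hu w hw a ha b hb => fills_setR ?_ ?_ ?_).mono fun τ₃ s₃ ⟨h₃, h₃'⟩ => ?_
  · simp [hn₂, hl₂]
  · simp [hn₂, cell4, s₁.real rCost', s₂.real rCost']
  · exact hσ.real _ _
  refine ⟨⟨fun j hj => ?_, fun j hj => ?_, fun j hj => ?_⟩, fun u hu => ?_, fun u hu w hw => ?_, h₃⟩
  · rw [s₃.nat aAlive, s₂.nat aAlive, h₁' j hj]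
  · rw [s₃.nat aJoin, h₂' j hj, s₁.nat aJoin]
  · rw [h₃' j hj, s₂.real rCost, s₁.real rCost]
  · rw [s₃.nat aAlive, s₂.nat aAlive, h₁ u hu]
  · rw [s₃.nat aJoin, h₂ u hu w hw]

theorem ok_enter {f' : Costs} (hB : n + 5 ≤ B) (hk : k < n) (hσ : Bdd B R σ)
    (hL : LevelAt n k A H f σ) (hle : ∀ u ∈ A, u ≤ n) (hv : σ.nat aVar k = v)
    (hp : σ.nat aEndP k = p) (hq : σ.nat aEndQ k = q)
    (hf : ∀ u ∈ A.erase v, ∀ w ∈ A.erase v, ∀ a ≤ 1, ∀ b ≤ 1,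
      σ.real rCost' (cell4 n 0 u w a b) = f' u w a b) :
    Ok B R enterProg σ fun τ => LevelAt n (k + 1) (A.erase v) (elimH H p q) f' τ ∧
      Below n k σ τ := by
  refine ((ok_aliveFill hB hσ hL hv).bdd (by decide) hσ).seq fun τ₁ s₁ ⟨b₁, h₁⟩ => ?_
  have L₁ := hL.congr s₁
  refine ((ok_joinFill hB b₁ L₁ (p := p) (q := q) (by rw [s₁.nat _, hp])
    (by rw [s₁.nat _, hq])).bdd (by decide) b₁).seq fun τ₂ s₂ ⟨b₂, h₂⟩ => ?_
  have L₂ := L₁.congr s₂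
  have e₂ : NExp.eval τ₂ (lev + 1) = k + 1 := by simp [L₂.level]
  rw [ok_seq, ok_setN, e₂]
  refine ⟨by omega, ?_⟩
  have s₃ : Same [aLevel] [] τ₂ (τ₂.setNat aLevel 0 (k + 1)) :=
    (Same.refl _ _ _).setNat _ _ (by decide)
  refine (ok_copy (K := k) hB (b₂.setNat _ _ (by omega)) (by simp [L₂.n_eq]) (by simp)).mono
    fun τ s₄ ⟨h₃, h₄, h₅, h₆⟩ => ⟨⟨?_, ?_, ⟨fun u hu => ?_, fun u hu w hw => ?_,
      fun u hu w hw a ha b hb => ?_⟩⟩, ?_⟩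
  · rw [s₄.nat 0]; simp [L₂.n_eq]
  · rw [s₄.nat aLevel]; simp
  · rw [h₄ u (by omega), Store.setNat_nat_of_ne _ _ _ (by decide), s₂.nat aAlive',
      h₁ u (by omega), Finset.mem_erase, ← hL.frame.alive u hu]
    split_ifs with h <;> simp [h]
  · rw [Finset.mem_erase] at hu hw
    have hu' := hle u hu.2
    have hw' := hle w hw.2
    rw [h₅ u (by omega) w (by omega), Store.setNat_nat_of_ne _ _ _ (by decide),
      h₂ u (by omega) w (by omega)]
    have := L₁.frame.join u hu.2 w hw.2
    unfold elimH
    split_ifs with h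
    · simp only [true_iff]; exact .inr h
    · rw [this]; tauto
  · have hu' := hle u (Finset.mem_of_mem_erase hu)
    have hw' := hle w (Finset.mem_of_mem_erase hw)
    rw [h₆ u (by omega) w (by omega) a (by omega) b (by omega), Store.setNat_real,
      s₂.real rCost', s₁.real rCost', hf u hu w hw a ha b hb]
  · exact (Below.of_same s₁).trans
      ((Below.of_same s₂).trans
      ((Below.of_same s₃).trans h₃))

theorem ok_elimEnter (hB : n + 5 ≤ B) (hk : k < n) (hσ : Bdd B R σ) (hL : LevelAt n k A H f σ)
    (hN : Network n R A H f) (he : ∃ v p q, Eliminable n A H v p q) :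
    Ok B R elimEnterProg σ fun τ => ∃ v p q, Eliminable n A H v p q ∧ τ.nat aVar k = v ∧
      τ.nat aEndP k = p ∧ τ.nat aEndQ k = q ∧
      LevelAt n (k + 1) (A.erase v) (elimH H p q) (elimF f v p q) τ ∧ Below n k σ τ ∧
      (∀ j ≠ k, τ.nat aVar j = σ.nat aVar j) ∧
      (∀ j ≠ k, τ.nat aEndP j = σ.nat aEndP j) ∧ (∀ j ≠ k, τ.nat aEndQ j = σ.nat aEndQ j) := by
  refine ((ok_elimPick hB hL hN.le he).bdd (by decide) hσ).seq
    fun τ₁ s₁ ⟨b₁, v, p, q, he, hv, hp, hq, h₁, h₂, h₃⟩ => ?_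
  have L₁ := hL.congr s₁
  refine ((ok_mins L₁ hN he hv hp hq).bdd (by decide) b₁).seq fun τ₂ s₂ ⟨b₂, hm⟩ => ?_
  have L₂ := L₁.congr s₂
  refine ((ok_elimFill hB b₂ L₂ hN he (by rw [s₂.nat _, hp])
    (by rw [s₂.nat _, hq]) hm).bdd (by decide) b₂).seq fun τ₃ s₃ ⟨b₃, hF⟩ => ?_
  have L₃ := L₂.congr s₃
  have eV : τ₃.nat aVar = τ₁.nat aVar := by rw [s₃.nat _, s₂.nat _]
  have eP : τ₃.nat aEndP = τ₁.nat aEndP := by rw [s₃.nat _, s₂.nat _]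
  have eQ : τ₃.nat aEndQ = τ₁.nat aEndQ := by rw [s₃.nat _, s₂.nat _]
  refine (ok_enter hB hk b₃ L₃ hN.le (v := v) (p := p) (q := q) (by rw [eV, hv]) (by rw [eP, hp])
    (by rw [eQ, hq]) hF).mono fun τ s₄ ⟨h₄, h₅⟩ => ?_
  have fV : τ.nat aVar = τ₁.nat aVar := by rw [s₄.nat _, eV]
  have fP : τ.nat aEndP = τ₁.nat aEndP := by rw [s₄.nat _, eP]
  have fQ : τ.nat aEndQ = τ₁.nat aEndQ := by rw [s₄.nat _, eQ]
  exact ⟨v, p, q, he, by rw [fV, hv], by rw [fP, hp], by rw [fQ, hq], h₄,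
    (Below.of_same s₁).trans
      ((Below.of_same s₂).trans
      ((Below.of_same s₃).trans h₅)),
    fun j hj => by rw [fV, h₁ j hj], fun j hj => by rw [fP, h₂ j hj],
    fun j hj => by rw [fQ, h₃ j hj]⟩

theorem elimH_self (H : ℕ → ℕ → Prop) (p : ℕ) : elimH H p p = H := by
  funext u w
  simp [elimH]

theorem ok_fixEnter (hB : n + 5 ≤ B) (hk : k < n) (hσ : Bdd B R σ) (hL : LevelAt n k A H f σ)
    (hN : Network n R A H f) (hvA : v ∈ A) (hvn : v ≠ n) (hv : σ.nat aVar k = v)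
    (hp : σ.nat aEndP k = n) (hq : σ.nat aEndQ k = n) {c : ℕ} (hc : c ≤ 1)
    (hw : (fixFillProg c).wf = true) (hwN : (fixFillProg c).wN = [53, 54, 55, 56])
    (hwR : (fixFillProg c).wR = [rCost', rCost', rCost']) :
    Ok B R (fixEnterProg c) σ fun τ => LevelAt n (k + 1) (A.erase v) H (fixF n f v c) τ ∧
      Below n k σ τ := by
  refine ((ok_fixFill hB hσ hL hN hvA hvn hv hc).bdd hw hσ).seq fun τ s ⟨b, hF⟩ => ?_
  rw [hwN, hwR] at s
  have L := hL.congr s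
  have := ok_enter hB hk b L hN.le (v := v) (p := n) (q := n) (by rw [s.nat _, hv])
    (by rw [s.nat _, hp]) (by rw [s.nat _, hq]) hF
  rw [elimH_self] at this
  exact this.mono fun ρ _ ⟨h₁, h₂⟩ => ⟨h₁, (Below.of_same s).trans h₂⟩

theorem ok_elimLeave (hB : n + 5 ≤ B) (hN : Network n R A H f) (he : Eliminable n A H v p q)
    (hn : σ.nat 0 0 = n) (hl : σ.nat aLevel 0 = k + 1) (hk : k < n) (hF : FrameAt n k A H f σ)
    (hv : σ.nat aVar k = v) (hp : σ.nat aEndP k = p) (hq : σ.nat aEndQ k = q) {x : ℕ → ℕ} {val : ℝ}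
    (hx : σ.nat aVal = x) (hM : Minimizes n (A.erase v) (elimF f v p q) x val) :
    Ok B R elimLeaveProg σ fun τ => τ.nat aLevel 0 = k ∧ Minimizes n A f (τ.nat aVal) val := by
  have e : NExp.eval σ (lev - 1) = k := by simp [hl]
  unfold elimLeaveProg leaveProg
  rw [ok_seq, ok_setN, e]
  refine ⟨by omega, ?_⟩
  have L : LevelAt n k A H f (σ.setNat aLevel 0 k) :=
    ⟨by simp [hn], by simp, hF.setNat _ _ (by decide) (by decide)⟩
  refine (ok_elimCosts L hN he (a := x p) (b := x q) (by simp [hv]) (by simp [hp]) (by simp [hq])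
    (by simp [hp, hx]) (by simp [hq, hx])
    (hM.le_one p (Finset.mem_erase.2 ⟨he.p_ne, he.p_mem⟩))
    (hM.le_one q (Finset.mem_erase.2 ⟨he.q_ne, he.q_mem⟩))).seq fun τ s ⟨h₁, h₂⟩ => ?_
  have hk' : τ.nat aLevel 0 = k := by rw [s.nat _, L.level]
  have hv' : τ.nat aVar k = v := by rw [s.nat _]; simp [hv]
  have hx' : τ.nat aVal = x := by rw [s.nat _]; simp [hx]
  have hu : ∀ c, (τ.setNat aVal v c).nat aVal = Function.update x v c := fun c => by
    funext u
    by_cases h : u = v <;> simp [Function.update, h, hx']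
  rw [ok_ite]
  simp only [BExp.holds_realLe, RExp.eval_get, NExp.eval_zero, NExp.eval_one, h₁, h₂]
  constructor <;> intro h <;> rw [ok_setN] <;>
    simp only [NExp.eval_get, NExp.eval_zero, NExp.eval_one, hk', hv', hu]
  · exact ⟨by omega, by simp [hk'], hM.elim hN he (by omega) (min_eq_left h).symm⟩
  · exact ⟨by omega, by simp [hk'], hM.elim hN he le_rfl (min_eq_right (not_le.1 h).le).symm⟩

theorem ok_save (hB : n + 5 ≤ B) (hσ : Bdd B R σ) (hn : σ.nat 0 0 = n)
    (hl : σ.nat aLevel 0 = k + 1) (hk : k < n) (hv : σ.nat aVar k = v) {x : ℕ → ℕ}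
    (hx : σ.nat aVal = x) :
    Ok B R saveProg σ fun τ => τ.nat aLevel 0 = k ∧ τ.real rSave k = σ.real rVal 0 ∧
      (∀ u < n + 1, τ.nat aSave (k * (n + 1) + u) = Function.update x v 0 u) ∧
      (∀ j < k * (n + 1), τ.nat aSave j = σ.nat aSave j) ∧
      ∀ j ≠ k, τ.real rSave j = σ.real rSave j := by
  have e : NExp.eval σ (lev - 1) = k := by simp [hl]
  unfold saveProg leaveProg
  simp only [ok_seq, ok_setN, ok_setR, e]
  refine ⟨by omega, by simp, ?_, ?_⟩
  · exact hσ.real _ _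
  · refine (ok_line (get := fun τ => τ.nat aSave) (LN := [aSave]) (LR := []) (K := k)
      (V := fun u => Function.update x v 0 u) hB (by simp [hn]) (by decide) (by decide)
      (fun τ v => by simp) fun u hu => fills_setN ?_ ?_ ?_).mono
      fun τ s ⟨h₁, h₂⟩ => ⟨?_, ?_, h₁, fun j hj => ?_, fun j hj => ?_⟩
    · simp [hn]
    · simp [hv, hx, Function.update]
    · subst hx
      by_cases h : u = v
      · subst h; simp
      · rw [Function.update_of_ne h]; exact hσ.nat _ _
    · rw [s.nat _]; simp
    · rw [s.real _]; simp
    · rw [h₂ j hj]; simp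
    · rw [s.real _]; simp [hj]

theorem ok_select (hB : n + 5 ≤ B) (hσ : Bdd B R σ) (hn : σ.nat 0 0 = n)
    (hl : σ.nat aLevel 0 = k + 1) (hk : k < n) (hv : σ.nat aVar k = v) {x : ℕ → ℕ}
    (hx : σ.nat aVal = x) :
    Ok B R selectProg σ fun τ => τ.nat aLevel 0 = k ∧
      ((σ.real rSave k ≤ σ.real rVal 0 ∧ τ.real rVal 0 = σ.real rSave k ∧
        ∀ u < n + 1, τ.nat aVal u = σ.nat aSave (k * (n + 1) + u)) ∨
      (σ.real rVal 0 ≤ σ.real rSave k ∧ τ.real rVal 0 = σ.real rVal 0 ∧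
        τ.nat aVal = Function.update x v 1)) := by
  have e : NExp.eval σ (lev - 1) = k := by simp [hl]
  unfold selectProg leaveProg
  simp only [ok_seq, ok_setN, ok_setR, ok_ite, ok_skip, e]
  refine ⟨by omega, by simp; omega, fun h => ⟨?_, ?_⟩, fun h => ⟨by simp, .inr ⟨?_, by simp, ?_⟩⟩⟩
  · exact hσ.real _ _
  · refine (ok_line (get := fun τ => τ.nat aVal) (LN := [aVal]) (LR := []) (K := 0)
      (V := fun u => σ.nat aSave (k * (n + 1) + u)) hB (by simp [hn]) (by decide) (by decide)
      (fun τ v => by simp) fun u hu => fills_setN ?_ ?_ ?_).mono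
      fun τ s ⟨h₁, h₂⟩ => ⟨?_, .inl ⟨?_, ?_, fun u hu => ?_⟩⟩
    · simp
    · simp [hn]
    · exact hσ.nat _ _
    · rw [s.nat _]; simp
    · simpa using h
    · rw [s.real _]; simp
    · have := h₁ u hu; simpa using this
  · simp at h; exact h.le
  · subst hx
    funext u
    by_cases h' : u = v <;> simp [hv, h', Function.update]

theorem ok_base (hL : LevelAt n k A H f σ) (hN : Network n R A H f) (hA : A = {n}) :
    Ok B R baseProg σ fun τ => Minimizes n A f (τ.nat aVal) (τ.real rVal 0) := by
  have h := hL.frame.cost n hN.mem n hN.mem 0 (by omega) 0 (by omega)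
  have hb := hN.le_bound hN.mem hN.mem (a := 0) (b := 0) (by omega) (by omega)
  unfold baseProg
  rw [ok_seq, ok_setN, ok_setR]
  have e : RExp.eval (σ.setNat aVal (NExp.eval σ vn) (NExp.eval σ 0)) (costAt vn vn 0 0) =
      f n n 0 0 := by
    simp [hL.n_eq, hL.level, ← h, cell4]
  rw [e]
  refine ⟨by simp, hb, ?_⟩
  simp only [Store.setReal_real, NExp.eval_zero, and_self, if_true, Store.setReal_nat]
  exact minimizes_base hA (by simp [hL.n_eq])

end

/-! ### The running time on networks -/

/-- The natural-number arrays that the procedure for networks writes. -/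
def networkN : List ℕ := [6, 40, 41, 42, 43, 44, 45, 46, 47, 48, 49, 50, 51, 52, 53, 54, 55, 56]

/-- The real arrays that the procedure for networks writes. -/
def networkR : List ℕ := [7, 10, 11, 13, 14, 15]

/-- The call-free parts of the procedure for networks. -/
def networkProgs : List Prog :=
  [elimAnyFm.prog, elimEnterProg, elimLeaveProg, baseFm.prog, baseProg, fixPickProg, fixEnterProg 0,
    fixEnterProg 1, saveProg, selectProg, .ite (.natLe 1 (.get 6 0)) .skip .skip]

/-- What the procedure leaves unchanged when it is called at level `k`. -/
structure NetKeeps (n k : ℕ) (σ τ : Store) : Prop where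
  same : Same networkN networkR σ τ
  below : Below n k σ τ
  var : ∀ j < k, τ.nat aVar j = σ.nat aVar j
  endP : ∀ j < k, τ.nat aEndP j = σ.nat aEndP j
  endQ : ∀ j < k, τ.nat aEndQ j = σ.nat aEndQ j
  save : ∀ j < k * (n + 1), τ.nat aSave j = σ.nat aSave j
  saveR : ∀ j < k, τ.real rSave j = σ.real rSave j

theorem NetKeeps.trans {n k : ℕ} {σ τ ρ : Store} (h : NetKeeps n k σ τ) (h' : NetKeeps n k τ ρ) :
    NetKeeps n k σ ρ :=
  ⟨h.same.trans h'.same, h.below.trans h'.below, fun j hj => (h'.var j hj).trans (h.var j hj),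
    fun j hj => (h'.endP j hj).trans (h.endP j hj), fun j hj => (h'.endQ j hj).trans (h.endQ j hj),
    fun j hj => (h'.save j hj).trans (h.save j hj),
    fun j hj => (h'.saveR j hj).trans (h.saveR j hj)⟩

theorem NetKeeps.pred {n k : ℕ} {σ τ : Store} (h : NetKeeps n (k + 1) σ τ) : NetKeeps n k σ τ :=
  ⟨h.same, h.below.mono (by omega), fun j hj => h.var j (by omega), fun j hj => h.endP j (by omega),
    fun j hj => h.endQ j (by omega), fun j hj => h.save j (by rw [add_mul]; omega),
    fun j hj => h.saveR j (by omega)⟩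

theorem NetKeeps.of_same {n k : ℕ} {σ τ : Store} {LN LR : List ℕ} (h : Same LN LR σ τ)
    (h₁ : LN ⊆ networkN := by decide) (h₂ : LR ⊆ networkR := by decide)
    (h₃ : aAlive ∉ LN := by decide) (h₄ : aJoin ∉ LN := by decide) (h₅ : rCost ∉ LR := by decide)
    (h₆ : aVar ∉ LN := by decide) (h₇ : aEndP ∉ LN := by decide) (h₈ : aEndQ ∉ LN := by decide)
    (h₉ : aSave ∉ LN := by decide) (h₀ : rSave ∉ LR := by decide) :
    NetKeeps n k σ τ :=
  ⟨h.mono h₁ h₂, .of_same h h₃ h₄ h₅, fun j _ => by rw [h.nat _ h₆], fun j _ => by rw [h.nat _ h₇],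
    fun j _ => by rw [h.nat _ h₈], fun j _ => by rw [h.nat _ h₉], fun j _ => by rw [h.real _ h₀]⟩

/-- The time bound for an elimination. -/
theorem elim_time {D : ℝ} {m c c' : ℕ} (hD : 3 ≤ D) (hc : c' ≤ c) :
    6 * D + 12 * D * (m + 1) * 2 ^ (c' / 4) ≤ 12 * D * ((m + 1 : ℕ) + 1) * 2 ^ (c / 4) := by
  have h₁ : (2 : ℝ) ^ (c' / 4) ≤ 2 ^ (c / 4) :=
    pow_le_pow_right₀ (by norm_num) (Nat.div_le_div_right hc)
  have h₂ : (1 : ℝ) ≤ 2 ^ (c / 4) := one_le_pow₀ (by norm_num)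
  have h₃ : 12 * D * (m + 1) * 2 ^ (c' / 4) ≤ 12 * D * (m + 1) * 2 ^ (c / 4) :=
    mul_le_mul_of_nonneg_left h₁ (by positivity)
  push_cast
  nlinarith

/-- The time bound for a branching: two branches with four vertices of degree three less. -/
theorem fix_time {D : ℝ} {m c c' : ℕ} (hD : 3 ≤ D) (hc : c' + 4 ≤ c) :
    12 * D + 2 * (12 * D * (m + 1) * 2 ^ (c' / 4)) ≤ 12 * D * ((m + 1 : ℕ) + 1) * 2 ^ (c / 4) := by
  have h₁ : 2 * (2 : ℝ) ^ (c' / 4) ≤ 2 ^ (c / 4) := by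
    rw [mul_comm, ← pow_succ]
    exact pow_le_pow_right₀ (by norm_num) (by omega)
  have h₂ : (1 : ℝ) ≤ 2 ^ (c / 4) := one_le_pow₀ (by norm_num)
  have h₃ : 12 * D * (m + 1) * (2 * 2 ^ (c' / 4)) ≤ 12 * D * (m + 1) * 2 ^ (c / 4) :=
    mul_le_mul_of_nonneg_left h₁ (by positivity)
  push_cast
  nlinarith

set_option maxRecDepth 4000 in
/-- The procedure finds an assignment of minimum cost. The number of calls is governed by the number
of variables of degree three: eliminations do not increase it, and a branching, which happens only
when all variables have degree three, decreases it by four. -/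
theorem tri_network {procs : List Cmd} {n B S : ℕ} {R R' D : ℝ}
    (hproc : procs.getD 1 .skip = networkCmd) (hfit : ∀ p ∈ networkProgs, Fit B S R R' D p)
    (hB : n + 5 ≤ B) :
    ∀ m k d σ A H f, Bdd B R σ → LevelAt n k A H f σ → Network n R A H f →
      (A.erase n).card ≤ m → k + m ≤ n → m ≤ d →
      Tri procs S R' d networkCmd σ (12 * D * (m + 1) * 2 ^ ((cubic A H).card / 4)) fun τ =>
        Bdd B R τ ∧ NetKeeps n k σ τ ∧ τ.nat aLevel 0 = k ∧
          Minimizes n A f (τ.nat aVal) (τ.real rVal 0) := by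
  have fi := hfit (.ite (.natLe 1 (.get 6 0)) .skip .skip) (by simp [networkProgs])
  have hc := fi.cost
  have hD : 3 ≤ D := by
    have : (0 : ℝ) ≤ (BExp.natLe 1 (.get 6 0)).cost := Nat.cast_nonneg _
    linarith
  intro m
  induction m with
  | zero =>
    intro k d σ A H f hσ hL hN hm hk hd
    have hA : A = {n} := by
      have h := Finset.card_eq_zero.1 (Nat.le_zero.1 hm)
      rw [← Finset.insert_erase hN.mem, h]
      rfl
    have hno : ¬ ∃ v p q, Eliminable n A H v p q := by
      rintro ⟨v, p, q, he⟩
      have h₁ := he.v_mem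
      rw [hA, Finset.mem_singleton] at h₁
      exact he.v_ne h₁
    refine (((ok_elimAny hB hL hN.le).tri_fit hσ (hfit _ (by simp [networkProgs]))).seq
      (T' := D + (D + (D + D))) fun τ ⟨bτ, sτ, _, h₁⟩ => ?_).mono (T := D + (D + (D + (D + D)))) ?_
      fun _ h => h
    · have Lτ := hL.congr sτ
      refine (Tri.ite (T := D + (D + D)) (fi.fits bτ)
        (fun h => absurd (h₁.1 (by simpa using h)) hno)
        fun _ => ?_).mono (by linarith) fun _ h => h
      refine ((ok_baseFm hB Lτ hN).tri_fit bτ (hfit _ (by simp [networkProgs]))).seq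
        fun ρ ⟨bρ, sρ, _, h₂⟩ => ?_
      have Lρ := Lτ.congr sρ
      refine (Tri.ite (T := D) (fi.fits bρ) (fun _ => ?_)
        fun h => absurd (h₂.2 hA) (by simpa using h)).mono
        (by linarith) fun _ h => h
      refine ((ok_base Lρ hN hA).tri_fit bρ (hfit _ (by simp [networkProgs]))).mono le_rfl
        fun κ ⟨bκ, sκ, hM⟩ => ⟨bκ, ?_, ?_, hM⟩
      · exact (NetKeeps.of_same sτ).trans ((NetKeeps.of_same sρ).trans (NetKeeps.of_same sκ))
      · rw [sκ.nat _, Lρ.level]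
    · have h₂ : (1 : ℝ) ≤ 2 ^ ((cubic A H).card / 4) := one_le_pow₀ (by norm_num)
      push_cast
      nlinarith
  | succ m ih =>
    intro k d σ A H f hσ hL hN hm hk hd
    obtain ⟨d, rfl⟩ : ∃ d', d = d' + 1 := ⟨d - 1, by omega⟩
    obtain ⟨t₁, τ, e₁, le₁, bτ, sτ, _, h₁⟩ := (ok_elimAny hB hL hN.le).tri_fit (procs := procs)
      (d := d + 1) hσ (hfit _ (by simp [networkProgs]))
    have Lτ := hL.congr sτ
    have Kτ : NetKeeps n k σ τ := NetKeeps.of_same sτ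
    have hcard : ∀ v ∈ A, v ≠ n → ((A.erase v).erase n).card ≤ m := fun v hv hvn => by
      rw [Finset.erase_right_comm, Finset.card_erase_of_mem (Finset.mem_erase.2 ⟨hvn, hv⟩)]
      omega
    by_cases he : ∃ v p q, Eliminable n A H v p q
    · obtain ⟨t₂, ρ, e₂, le₂, bρ, sρ, v, p, q, he', v₁, p₁, q₁, Lρ, Bρ, k₁, k₂, k₃⟩ :=
        (ok_elimEnter hB (by omega) bτ Lτ hN he).tri_fit (procs := procs) (d := d + 1) bτ
        (hfit _ (by simp [networkProgs]))
      have Kρ : NetKeeps n k τ ρ :=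
        ⟨sρ.mono (by decide) (by decide), Bρ, fun j hj => k₁ j (by omega),
          fun j hj => k₂ j (by omega),
          fun j hj => k₃ j (by omega), fun j _ => by rw [sρ.nat _],
          fun j _ => by rw [sρ.real _]⟩
      have hrec := ih (k + 1) d ρ _ _ _ bρ Lρ (hN.elim he') (hcard v he'.v_mem he'.v_ne) (by omega)
        (by omega)
      rw [← hproc] at hrec
      obtain ⟨t₃, κ, e₃, le₃, bκ, Kκ, lκ, hM⟩ := hrec.call
      have Fκ : FrameAt n k A H f κ :=
        hL.frame.congr hN.le ((Kτ.trans (Kρ.trans Kκ.pred)).below)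
      obtain ⟨t₄, μ, e₄, le₄, bμ, sμ, lμ, hM'⟩ :=
        (ok_elimLeave (R := R) hB hN he' (by rw [Kκ.same.nat 0, Lρ.n_eq]) lκ (by omega) Fκ
        (by rw [Kκ.var k (by omega), v₁]) (by rw [Kκ.endP k (by omega), p₁])
        (by rw [Kκ.endQ k (by omega), q₁]) rfl hM).tri_fit (procs := procs) (d := d + 1) bκ
        (hfit _ (by simp [networkProgs]))
      have Kμ : NetKeeps n k κ μ := NetKeeps.of_same sμ
      refine ⟨_, μ, .seq e₁ (.iteTrue (fi.fits bτ) (by simpa using h₁.2 he)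
        (.seq e₂ (.seq e₃ e₄))), ?_,
        bμ, Kτ.trans (Kρ.trans (Kκ.pred.trans Kμ)), lμ, ?_⟩
      · refine le_trans ?_ (elim_time (m := m) hD (card_cubic_elim_le hN he'))
        push_cast at le₃ ⊢
        linarith
      · rwa [sμ.real rVal]
    · obtain ⟨t₂, ρ, e₂, le₂, bρ, sρ, _, h₂⟩ := (ok_baseFm hB Lτ hN).tri_fit (procs := procs)
        (d := d + 1) bτ (hfit _ (by simp [networkProgs]))
      have Lρ := Lτ.congr sρ
      have Kρ : NetKeeps n k τ ρ := NetKeeps.of_same sρ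
      have hf₁ : ¬ (BExp.natLe 1 (.get 6 0)).Holds τ := fun h => he (h₁.1 (by simpa using h))
      by_cases hA : A = {n}
      · obtain ⟨t₃, κ, e₃, le₃, bκ, sκ, hM⟩ := (ok_base Lρ hN hA).tri_fit (procs := procs)
          (d := d + 1) bρ (hfit _ (by simp [networkProgs]))
        have Kκ : NetKeeps n k ρ κ := NetKeeps.of_same sκ
        refine ⟨_, κ, .seq e₁ (.iteFalse (fi.fits bτ) hf₁ (.seq e₂ (.iteTrue (fi.fits bρ)
          (by simpa using h₂.2 hA) e₃))), ?_, bκ, Kτ.trans (Kρ.trans Kκ), ?_, hM⟩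
        · have h₂ : (1 : ℝ) ≤ 2 ^ ((cubic A H).card / 4) := one_le_pow₀ (by norm_num)
          have h₃ : 12 * D * 1 ≤ 12 * D * (((m + 1 : ℕ) + 1) * 2 ^ ((cubic A H).card / 4)) := by
            refine mul_le_mul_of_nonneg_left ?_ (by linarith)
            push_cast
            have : (0 : ℝ) ≤ m := Nat.cast_nonneg m
            nlinarith
          push_cast at h₃ ⊢
          linarith
        · rw [sκ.nat _, Lρ.level]
      · have hex : ∃ v ∈ A, v ≠ n := by
          by_contra h
          push Not at h
          exact hA (Finset.eq_singleton_iff_unique_mem.2 ⟨hN.mem, h⟩)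
        have h3 : ∀ u ∈ A, u ≠ n → 3 ≤ (nbrs A H u).card := fun u hu hun => by
          by_contra h
          exact he ⟨u, exists_eliminable hN hu hun (by omega)⟩
        obtain ⟨t₃, κ, e₃, le₃, bκ, sκ, v, hvA, hvn, v₁, p₁, q₁, k₁, k₂, k₃⟩ :=
          (ok_fixPick hB Lρ hN.le hex).tri_fit (procs := procs) (d := d + 1) bρ
          (hfit _ (by simp [networkProgs]))
        have Lκ := Lρ.congr sκ
        have Kκ : NetKeeps n k ρ κ :=
          ⟨sκ.mono (by decide) (by decide), .of_same sκ,
            fun j hj => k₁ j (by omega), fun j hj => k₂ j (by omega),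
            fun j hj => k₃ j (by omega), fun j _ => by rw [sκ.nat _],
            fun j _ => by rw [sκ.real _]⟩
        have hcub := card_cubic_fix_le hN hvA hvn h3
        -- The branch in which `v` receives the value `c`.
        have branch : ∀ c ≤ 1, fixEnterProg c ∈ networkProgs → (fixFillProg c).wf = true →
            (fixFillProg c).wN = [53, 54, 55, 56] → (fixFillProg c).wR = [rCost', rCost', rCost'] →
            ∀ μ : Store, Bdd B R μ → LevelAt n k A H f μ → μ.nat aVar k = v → μ.nat aEndP k = n →
            μ.nat aEndQ k = n → Tri procs S R' (d + 1) (.seq (fixEnterProg c).cmd (.call 1)) μ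
              (D + (12 * D * (m + 1) * 2 ^ ((cubic (A.erase v) H).card / 4) + 1)) fun ν =>
              Bdd B R ν ∧ NetKeeps n k μ ν ∧ ν.nat aLevel 0 = k + 1 ∧
              ν.nat aVar k = v ∧ ν.nat aEndP k = n ∧ ν.nat aEndQ k = n ∧
              (∀ j < (k + 1) * (n + 1), ν.nat aSave j = μ.nat aSave j) ∧
              ν.real rSave k = μ.real rSave k ∧
              Minimizes n (A.erase v) (fixF n f v c) (ν.nat aVal) (ν.real rVal 0) := by
          intro c hc hmem w₁ w₂ w₃ μ bμ Lμ hv hp hq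
          have hwN : (fixEnterProg c).wN = (fixEnterProg 0).wN := by
            change (fixFillProg c).wN ++ _ = _ ++ _
            rw [w₂]; rfl
          have hwR : (fixEnterProg c).wR = (fixEnterProg 0).wR := by
            change (fixFillProg c).wR ++ _ = _ ++ _
            rw [w₃]; rfl
          refine ((ok_fixEnter hB (by omega) bμ Lμ hN hvA hvn hv hp hq hc w₁ w₂ w₃).tri_fit bμ
            (hfit _ hmem)).seq fun ξ ⟨bξ, sξ, Lξ, Bξ⟩ => ?_
          rw [hwN, hwR] at sξ
          have hrec := ih (k + 1) d ξ _ _ _ bξ Lξ (hN.fix hvA hvn hc) (hcard v hvA hvn) (by omega)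
            (by omega)
          rw [← hproc] at hrec
          refine hrec.call.mono le_rfl fun ν ⟨bν, Kν, lν, hM⟩ =>
            ⟨bν, ?_, lν, ?_, ?_, ?_, ?_, ?_, hM⟩
          · exact NetKeeps.trans ⟨sξ.mono (by decide) (by decide), Bξ,
              fun j _ => by rw [sξ.nat _], fun j _ => by rw [sξ.nat _],
              fun j _ => by rw [sξ.nat _], fun j _ => by rw [sξ.nat _],
              fun j _ => by rw [sξ.real _]⟩ Kν.pred
          · rw [Kν.var k (by omega), sξ.nat _, hv]
          · rw [Kν.endP k (by omega), sξ.nat _, hp]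
          · rw [Kν.endQ k (by omega), sξ.nat _, hq]
          · intro j hj
            rw [Kν.save j hj, sξ.nat _]
          · rw [Kν.saveR k (by omega), sξ.real _]
        obtain ⟨t₄, μ, e₄, le₄, bμ, Kμ, lμ, v₂, p₂, q₂, _, _, hM₀⟩ := branch 0 (by omega)
          (by simp [networkProgs]) rfl rfl rfl κ bκ Lκ v₁ p₁ q₁
        obtain ⟨t₅, ν, e₅, le₅, bν, sν, lν, r₁, a₁, a₂, r₂⟩ := (ok_save hB bμ
          (by rw [Kμ.same.nat 0, Lκ.n_eq]) lμ (by omega) v₂ rfl).tri_fit (procs := procs)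
          (d := d + 1) bμ (hfit _ (by simp [networkProgs]))
        have Kν : NetKeeps n k μ ν :=
          ⟨sν.mono (by decide) (by decide), .of_same sν,
            fun j _ => by rw [sν.nat _], fun j _ => by rw [sν.nat _],
            fun j _ => by rw [sν.nat _], a₂, fun j hj => r₂ j (by omega)⟩
        have K₁ := Kτ.trans (Kρ.trans (Kκ.trans (Kμ.trans Kν)))
        have Lν : LevelAt n k A H f ν :=
          ⟨by rw [K₁.same.nat 0, hL.n_eq], lν, hL.frame.congr hN.le K₁.below⟩
        obtain ⟨t₆, ξ, e₆, le₆, bξ, Kξ, lξ, v₃, _, _, a₃, r₃, hM₁⟩ := branch 1 le_rfl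
          (by simp [networkProgs]) rfl rfl rfl ν bν Lν (by rw [sν.nat _, v₂])
          (by rw [sν.nat _, p₂]) (by rw [sν.nat _, q₂])
        obtain ⟨t₇, χ, e₇, le₇, bχ, sχ, lχ, hχ⟩ := (ok_select hB bξ
          (by rw [Kξ.same.nat 0, Lν.n_eq]) lξ (by omega) v₃ rfl).tri_fit (procs := procs)
          (d := d + 1) bξ (hfit _ (by simp [networkProgs]))
        have Kχ : NetKeeps n k ξ χ := NetKeeps.of_same sχ
        cases e₄ with
        | seq e₄ e₄' =>
        cases e₆ with
        | seq e₆ e₆' =>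
        refine ⟨_, χ, .seq e₁ (.iteFalse (fi.fits bτ) hf₁ (.seq e₂ (.iteFalse (fi.fits bρ)
          (fun h => hA (h₂.1 (by simpa using h))) (.seq e₃ (.seq e₄ (.seq e₄' (.seq e₅
            (.seq e₆ (.seq e₆' e₇))))))))), ?_, bχ, K₁.trans (Kξ.trans Kχ), lχ, ?_⟩
        · refine le_trans ?_ (fix_time (m := m) hD hcub)
          push_cast at le₄ le₆ ⊢
          linarith
        · obtain ⟨m₀, m₁⟩ := hM₀.fix hN hvA hvn hM₁
          rw [r₃, r₁] at hχ
          rcases hχ with ⟨h, h', h''⟩ | ⟨h, h', h''⟩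
          · rw [h']
            refine (m₀ h).congr hN.mem fun u hu => ?_
            have hu' : u < n + 1 := by have := hN.le u hu; omega
            rw [h'' u hu', a₃ _ (addr_lt (by omega) hu'), a₁ u hu']
          · rw [h', h'']
            exact m₁ h

/-! ### Weighted vertex cover on graphs of maximum degree three -/

section

variable {n B : ℕ} {R W M : ℝ} {E : ℕ → ℕ → Prop} {w : ℕ → ℝ} {σ : Store}

/-- The graph on the first `n` numbers, with `n` as an isolated vertex. -/
def restrict (n : ℕ) (E : ℕ → ℕ → Prop) (u v : ℕ) : Prop := u < n ∧ v < n ∧ E u v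

open Classical in
/-- The costs whose minimum is the weight of a vertex cover: the weights of the chosen vertices, and
the penalty `M` for each direction of an uncovered edge. -/
noncomputable def coverF (n : ℕ) (E : ℕ → ℕ → Prop) (w : ℕ → ℝ) (M : ℝ) : Costs := fun u v a b =>
  (if u = v then if u < n ∧ a = 1 ∧ b = 1 then w u else 0 else 0) +
    if restrict n E u v ∧ a = 0 ∧ b = 0 then M else 0

open Classical in
/-- The cost of an assignment is the weight of the chosen set plus the penalties. -/
theorem energy_coverF (x : ℕ → ℕ) :
    energy (Finset.range (n + 1)) (coverF n E w M) x = wt n w (fun v => x v = 1) +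
      tot (Finset.range (n + 1)) fun u v =>
        if restrict n E u v ∧ x u = 0 ∧ x v = 0 then M else 0 := by
  have h : ∀ u v, coverF n E w M u v (x u) (x v) =
      (if u = v then if u < n ∧ x u = 1 then w u else 0 else 0) +
        if restrict n E u v ∧ x u = 0 ∧ x v = 0 then M else 0 := by
    intro u v
    unfold coverF
    congr 1
    by_cases h : u = v
    · subst h; simp
    · simp [h]
  simp only [energy, h, tot_add, tot_diag]
  rw [Finset.sum_range_succ, wt]
  simp only [lt_irrefl, false_and, if_false, add_zero]
  congr 1
  refine Finset.sum_congr rfl fun u hu => ?_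
  simp [Finset.mem_range.1 hu]

theorem energy_of_covers {x : ℕ → ℕ} (h : Covers n E fun v => x v = 1) :
    energy (Finset.range (n + 1)) (coverF n E w M) x = wt n w fun v => x v = 1 := by
  classical
  rw [energy_coverF, add_eq_left]
  refine Finset.sum_eq_zero fun u _ => Finset.sum_eq_zero fun v _ => if_neg ?_
  rintro ⟨⟨hu, hv, he⟩, h₁, h₂⟩
  rcases h u hu v hv he with h | h <;> omega

/-- A set that is not a cover pays the penalty `M` at least once. -/
theorem le_energy_of_not_covers {x : ℕ → ℕ} (hM : 0 ≤ M) (hw : ∀ v < n, 0 ≤ w v)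
    (hx : ∀ v < n, x v ≤ 1) (h : ¬ Covers n E fun v => x v = 1) :
    M ≤ energy (Finset.range (n + 1)) (coverF n E w M) x := by
  classical
  rw [energy_coverF]
  have h₀ : 0 ≤ wt n w fun v => x v = 1 := Finset.sum_nonneg fun v hv => by
    have := hw v (by simpa using hv)
    split_ifs <;> simp [this]
  unfold Covers at h
  push Not at h
  obtain ⟨u, hu, v, hv, he, h₁, h₂⟩ := h
  have hu' := hx u hu
  have hv' := hx v hv
  have hnn : ∀ a b, 0 ≤ if restrict n E a b ∧ x a = 0 ∧ x b = 0 then M else 0 := fun a b => by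
    split_ifs <;> simp [hM]
  have h₃ := Finset.single_le_sum
    (f := fun b => if restrict n E u b ∧ x u = 0 ∧ x b = 0 then M else 0)
    (fun b _ => hnn u b) (Finset.mem_range.2 (by omega : v < n + 1))
  have h₄ := Finset.single_le_sum
    (f := fun a => ∑ b ∈ Finset.range (n + 1),
      if restrict n E a b ∧ x a = 0 ∧ x b = 0 then M else 0)
    (fun a _ => Finset.sum_nonneg fun b _ => hnn a b) (Finset.mem_range.2 (by omega : u < n + 1))
  rw [if_pos ⟨⟨hu, hv, he⟩, by omega, by omega⟩] at h₃
  unfold tot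
  linarith

theorem card_nbrs_restrict (u : ℕ) :
    (nbrs (Finset.range (n + 1)) (restrict n E) u).card ≤ (nbrs (Finset.range n) E u).card := by
  refine Finset.card_le_card fun v hv => ?_
  simp only [mem_nbrs, Finset.mem_range, restrict] at hv ⊢
  exact ⟨hv.2.2.1, hv.2.2.2⟩

theorem network_cover (hE : ∀ a < n, ∀ b < n, E a b → E b a) (hirr : ∀ a < n, ¬ E a a)
    (hdeg : ∀ u < n, (nbrs (Finset.range n) E u).card ≤ 3) (hM : 0 ≤ M) (hw : ∀ v < n, 0 ≤ w v)
    (hR : (∑ v ∈ Finset.range n, w v) + (n + 1) ^ 2 * M ≤ R) :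
    Network n R (Finset.range (n + 1)) (restrict n E) (coverF n E w M) := by
  classical
  refine ⟨fun u hu => by simp at hu; omega, by simp,
    fun u v h => ⟨h.2.1, h.1, hE u h.1 v h.2.1 h.2.2⟩,
    fun u h => hirr u h.1 h.2.2, fun u h => absurd h.1 (lt_irrefl n), ?_, fun u _ => ?_,
    fun u v => (if u = v then if u < n then w u else 0 else 0) + M, fun u _ v _ a _ b _ => ?_, ?_⟩
  · intro u _ v _ huv h a _ b _
    simp [coverF, huv, h]
  · by_cases hu : u < n
    · exact (card_nbrs_restrict u).trans (hdeg u hu)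
    · have : nbrs (Finset.range (n + 1)) (restrict n E) u = ∅ := by
        ext v; simp [restrict, hu]
      simp [this]
  · have h₁ : 0 ≤ (if u = v then if u < n ∧ a = 1 ∧ b = 1 then w u else 0 else 0) ∧
        (if u = v then if u < n ∧ a = 1 ∧ b = 1 then w u else 0 else 0) ≤
          if u = v then if u < n then w u else 0 else 0 := by
      by_cases hu : u < n
      · have := hw u hu
        split_ifs <;> simp_all
      · simp [hu]
    have h₂ : 0 ≤ (if restrict n E u v ∧ a = 0 ∧ b = 0 then M else 0) ∧
        (if restrict n E u v ∧ a = 0 ∧ b = 0 then M else 0) ≤ M := by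
      split_ifs <;> simp [hM]
    exact ⟨add_nonneg h₁.1 h₂.1, add_le_add h₁.2 h₂.2⟩
  · rw [tot_add, tot_diag, Finset.sum_range_succ]
    have h₁ : ∑ u ∈ Finset.range n, (if u < n then w u else 0) = ∑ u ∈ Finset.range n, w u :=
      Finset.sum_congr rfl fun u hu => if_pos (Finset.mem_range.1 hu)
    have h₂ : tot (Finset.range (n + 1)) (fun _ _ => M) = (n + 1) ^ 2 * M := by
      simp [tot]; ring
    rw [h₁, h₂]
    simpa using hR

/-- Each vertex of degree three outside a vertex cover has three neighbours in it, so at least half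
of the vertices of degree three belong to the cover. -/
theorem card_cubic_le (hE : ∀ a < n, ∀ b < n, E a b → E b a)
    (hdeg : ∀ u < n, (nbrs (Finset.range n) E u).card ≤ 3) {A : ℕ → Prop} (hA : Covers n E A) :
    (cubic (Finset.range (n + 1)) (restrict n E)).card ≤ 2 * size n A := by
  classical
  set C := (Finset.range n).filter fun v => A v
  set Q := cubic (Finset.range (n + 1)) (restrict n E)
  have hQ : ∀ u ∈ Q, u < n ∧ 3 ≤ (nbrs (Finset.range n) E u).card := by
    intro u hu
    simp only [Q, cubic, Finset.mem_filter] at hu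
    refine ⟨?_, hu.2.trans (card_nbrs_restrict u)⟩
    obtain ⟨v, hv⟩ := Finset.card_pos.1 ((by omega : 0 < 3).trans_le hu.2)
    exact (mem_nbrs.1 hv).2.1
  have h := Finset.card_mul_le_card_mul (s := Q \ C) (t := C) (m := 3) (n := 3) E
    (fun u hu => ?_) fun v hv => ?_
  · have h₁ : Q.card ≤ (Q \ C).card + C.card := by
      rw [← Finset.card_union_of_disjoint Finset.sdiff_disjoint]
      exact Finset.card_le_card fun u hu => by
        by_cases hC : u ∈ C <;> simp [hC, hu]
    have h₂ : size n A = C.card := by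
      unfold size; congr
    omega
  · rw [Finset.mem_sdiff] at hu
    obtain ⟨hun, h3⟩ := hQ u hu.1
    refine h3.trans (Finset.card_le_card fun v hv => ?_)
    simp only [mem_nbrs, Finset.mem_range] at hv
    rw [Finset.mem_bipartiteAbove]
    refine ⟨?_, hv.2⟩
    have hnA : ¬ A u := fun h => hu.2 (by simp [C, hun, h])
    simp [C, hv.1, (hA u hun v hv.1 hv.2).resolve_left hnA]
  · have hvn : v < n := by simp [C] at hv; exact hv.1
    refine (Finset.card_le_card fun u hu => ?_).trans (hdeg v hvn)
    rw [Finset.mem_bipartiteBelow, Finset.mem_sdiff] at hu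
    have := (hQ u hu.1.1).1
    simp [this, hE u this v hvn hu.2]

/-- An assignment of minimum cost is a vertex cover of minimum weight if the penalty exceeds the
weight of the set of all vertices. -/
theorem Minimizes.cover {x : ℕ → ℕ} {val : ℝ} (hw : ∀ v < n, 0 ≤ w v)
    (hM : ∑ v ∈ Finset.range n, w v < M)
    (h : Minimizes n (Finset.range (n + 1)) (coverF n E w M) x val) :
    Covers n E (fun v => x v = 1) ∧ val = wt n w (fun v => x v = 1) ∧
      ∀ A, Covers n E A → val ≤ wt n w A := by
  classical
  have hsum0 : 0 ≤ ∑ v ∈ Finset.range n, w v :=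
    Finset.sum_nonneg fun v hv => hw v (by simpa using hv)
  have hle : ∀ A, Covers n E A → val ≤ wt n w A := fun A hA => by
    have e : ∀ v < n, A v ↔ (if v < n ∧ A v then 1 else 0) = 1 := fun v hv => by simp [hv]
    rw [wt_congr w e, ← energy_of_covers (M := M) (hA.congr fun v hv => (e v hv).1)]
    exact h.le _ (fun u => by split_ifs <;> omega) (by simp)
  have hC : Covers n E fun v => x v = 1 := by
    by_contra hC
    have h₁ := le_energy_of_not_covers (M := M) (by linarith) hw
      (fun v hv => h.le_one v (by simp; omega)) hC
    have h₂ := hle (fun _ => True) fun _ _ _ _ _ => .inl trivial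
    rw [h.eq] at h₂
    linarith [wt_le hw fun _ => True]
  exact ⟨hC, h.eq.trans (energy_of_covers hC), hle⟩

/-- Store the network for vertex covers at level `0`. -/
def initProg : Prog :=
  .seq (.setN aLevel 0 0) (.seq (.loop 53 (vn + 1) (.setN aAlive (vr 53) 1))
  (.seq (.loop 53 (vn + 1) (.loop 54 (vn + 1) (.ite (.and (.and (.lt (vr 53) vn) (.lt (vr 54) vn))
      (.eq (.get 1 (vr 53 * vn + vr 54)) 1))
    (.setN aJoin (vr 53 * (vn + 1) + vr 54) 1) (.setN aJoin (vr 53 * (vn + 1) + vr 54) 0))))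
  (quadProg (.ite (.and (.and (.eq (vr 53) (vr 54)) (.lt (vr 53) vn))
      (.and (.eq (vr 55) 1) (.eq (vr 56) 1)))
    (.setR rCost (costCell 0 (vr 53) (vr 54) (vr 55) (vr 56)) (.get rWgt (vr 53)))
    (.ite (.and (.eq (.get aJoin (vr 53 * (vn + 1) + vr 54)) 1)
      (.and (.eq (vr 55) 0) (.eq (vr 56) 0)))
      (.setR rCost (costCell 0 (vr 53) (vr 54) (vr 55) (vr 56)) (.get rBig 0))
      (.setR rCost (costCell 0 (vr 53) (vr 54) (vr 55) (vr 56)) .zero))))))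

/-- Copy the optimal assignment. -/
def collectProg : Prog :=
  .seq (.setR rBest 0 (.get rVal 0)) (.loop 53 (vn + 1) (.setN aBest (vr 53) (.get aVal (vr 53))))

/-- Solve the problem on graphs of maximum degree three. -/
def cubicCmd : Cmd :=
  .seq weightProg.cmd (.seq initProg.cmd (.seq networkCmd (.seq collectProg.cmd answerProg.cmd)))

/-- The call-free parts. -/
def cubicProgs : List Prog := weightProg :: initProg :: collectProg :: answerProg :: networkProgs

theorem ok_init (hB : n + 5 ≤ B) (hσ : Bdd B R σ) (hg : InputAt n E w M σ)
    (hN : Network n R (Finset.range (n + 1)) (restrict n E) (coverF n E w M)) :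
    Ok B R initProg σ fun τ =>
      LevelAt n 0 (Finset.range (n + 1)) (restrict n E) (coverF n E w M) τ := by
  classical
  unfold initProg
  rw [ok_seq, ok_setN]
  refine ⟨by simp, ?_⟩
  set σ₀ := σ.setNat aLevel (NExp.eval σ 0) (NExp.eval σ 0) with hσ₀
  have s₀ : Same [aLevel] [] σ σ₀ := (Same.refl _ _ σ).setNat _ _ (by decide)
  have b₀ : Bdd B R σ₀ := hσ.setNat _ _ (by simp)
  have g₀ := hg.congr s₀
  have l₀ : σ₀.nat aLevel 0 = 0 := by simp [hσ₀]
  clear_value σ₀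
  refine ((ok_line (get := fun τ => τ.nat aAlive) (LN := [aAlive]) (LR := []) (K := 0)
    (V := fun _ => 1) hB g₀.n_eq (by decide) (by decide) (fun τ v => by simp)
    fun u hu => fills_setN (by simp) (by simp) (by omega)).bdd (by decide) b₀).seq
      fun τ₁ s₁ ⟨b₁, h₁, _⟩ => ?_
  have g₁ := g₀.congr s₁
  have hjoin : ∀ u < n + 1, ∀ v < n + 1,
      (u < n ∧ v < n ∧ τ₁.nat 1 (u * n + v) = 1 ↔ restrict n E u v) := fun u _ v _ =>
    and_congr_right fun hu => and_congr_right fun hv => g₁.adj u hu v hv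
  refine ((ok_square (get := fun τ => τ.nat aJoin) (LN := [aJoin]) (LR := []) (K := 0)
    (V := fun u v => if restrict n E u v then 1 else 0) hB g₁.n_eq (by decide) (by decide)
    (by decide) (fun τ x v h => by rcases h with rfl | rfl <;> simp)
    fun u hu v hv => fills_ite
      (fun h => fills_setN ?_ ?_ ?_)
      (fun h => fills_setN ?_ ?_ ?_)).bdd (by decide) b₁).seq
    fun τ₂ s₂ ⟨b₂, h₂, _⟩ => ?_
  any_goals simp only [BExp.holds_and, BExp.holds_lt, BExp.holds_eq] at h
  any_goals simp [g₁.n_eq] at h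
  · simp [g₁.n_eq]
  · rw [and_assoc, hjoin u hu v hv] at h
    simp [h]
  · split_ifs <;> omega
  · simp [g₁.n_eq]
  · have := hjoin u hu v hv
    rw [if_neg (by tauto)]
    simp
  · split_ifs <;> omega
  have g₂ := g₁.congr s₂
  have h₂' : ∀ u < n + 1, ∀ v < n + 1, (τ₂.nat aJoin (u * (n + 1) + v) = 1 ↔ restrict n E u v) := by
    intro u hu v hv
    have := h₂ u hu v hv
    simp only [zero_mul, zero_add] at this
    rw [this]
    split_ifs with h <;> simp [h]
  refine (ok_quad (r := rCost) (LN := []) (LR := [rCost]) (K := 0) (V := coverF n E w M) hB g₂.n_eq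
    (by simp) fun u hu v hv a ha b hb => fills_ite
      (fun h => fills_setR ?_ ?_ ?_)
      (fun h => fills_ite
        (fun h' => fills_setR ?_ ?_ ?_)
        (fun h' => fills_setR ?_ ?_ ?_))).mono
    fun τ₃ s₃ ⟨h₃, _⟩ => ⟨?_, ?_, ⟨fun u hu => ?_, fun u hu v hv => ?_,
      fun u hu v hv a ha b hb => ?_⟩⟩
  any_goals simp [g₂.n_eq] at h
  any_goals simp [g₂.n_eq, h₂' u hu v hv] at h'
  · simp [g₂.n_eq]
  · obtain ⟨⟨rfl, hu'⟩, rfl, rfl⟩ := h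
    simp [coverF, hu', g₂.wgt u hu']
  · exact hN.le_bound (by simpa using hu) (by simpa using hv) (by omega) (by omega)
  · simp [g₂.n_eq]
  · obtain ⟨hr, rfl, rfl⟩ := h'
    simp [coverF, hr, g₂.big]
  · exact hN.le_bound (by simpa using hu) (by simpa using hv) (by omega) (by omega)
  · simp [g₂.n_eq]
  · have e : ¬ (restrict n E u v ∧ a = 0 ∧ b = 0) := by tauto
    simp only [coverF, e, if_false, add_zero]
    split_ifs
    · exfalso; tauto
    · simp
    · simp
  · exact hN.le_bound (by simpa using hu) (by simpa using hv) (by omega) (by omega)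
  · rw [s₃.nat 0, g₂.n_eq]
  · rw [s₃.nat _, s₂.nat _, s₁.nat _, l₀]
  · have := h₁ u (by omega)
    rw [s₃.nat _, s₂.nat _, this]
    simp; omega
  · have := h₂' u (by simpa using hu) v (by simpa using hv)
    rw [s₃.nat _]; simpa using this
  · exact h₃ u (by simpa using hu) v (by simpa using hv) a (by omega) b (by omega)

theorem ok_collect (hB : n + 5 ≤ B) (hσ : Bdd B R σ) (hn : σ.nat 0 0 = n) :
    Ok B R collectProg σ fun τ => τ.real rBest 0 = σ.real rVal 0 ∧
      ∀ u < n + 1, τ.nat aBest u = σ.nat aVal u := by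
  unfold collectProg
  rw [ok_seq, ok_setR]
  refine ⟨hσ.real _ _, (ok_line (get := fun τ => τ.nat aBest) (LN := [aBest]) (LR := []) (K := 0)
    (V := fun u => σ.nat aVal u) hB (by simpa using hn) (by decide) (by decide) (fun τ v => by simp)
    fun u hu => fills_setN (by simp) (by simp) (hσ.nat _ _)).mono fun τ s ⟨h, _⟩ =>
      ⟨?_, fun u hu => by simpa using h u hu⟩⟩
  rw [s.real _]; simp

/-- The algorithm for graphs of maximum degree three. At most `2 * t` variables have degree three,
and `2 ^ (2 * t / 4) ≤ 1.415 ^ t`. -/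
theorem tri_cubic {procs : List Cmd} {S d t : ℕ} {R' D : ℝ}
    (hproc : procs.getD 1 .skip = networkCmd) (hfit : ∀ p ∈ cubicProgs, Fit B S R R' D p)
    (hB : n + 5 ≤ B) (hw : ∀ v < n, 0 < w v) (hW : 0 < W)
    (hR : (∑ v ∈ Finset.range n, w v) + (n + 1) ^ 2 * (W + ∑ v ∈ Finset.range n, w v) ≤ R)
    (hE : ∀ a < n, ∀ b < n, E a b → E b a) (hirr : ∀ a < n, ¬ E a a)
    (hdeg : ∀ u < n, (nbrs (Finset.range n) E u).card ≤ 3) (hσ : Bdd B R σ)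
    (hg : InstanceAt n E w W σ) (ht : ∃ A, Covers n E A ∧ size n A ≤ t) (hd : n ≤ d) :
    Tri procs S R' d cubicCmd σ (12 * D * (n + 2) * 1.415 ^ t) fun τ => Answers n E w W τ := by
  have hw0 : ∀ v < n, 0 ≤ w v := fun v hv => (hw v hv).le
  have hsum0 : 0 ≤ ∑ v ∈ Finset.range n, w v :=
    Finset.sum_nonneg fun v hv => hw0 v (by simpa using hv)
  set M := W + ∑ v ∈ Finset.range n, w v with hM
  have hM0 : 0 ≤ M := by linarith
  have hMR : M ≤ (n + 1) ^ 2 * M := le_mul_of_one_le_left hM0 (one_le_pow₀ (by simp))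
  have hN := network_cover hE hirr hdeg hM0 hw0 hR
  have hnet := tri_network (S := S) (R' := R') hproc
    (fun p hp => hfit p (by simp [cubicProgs, hp])) hB n 0 d
  have hD : 3 ≤ D := by
    have h := (hfit (.ite (.natLe 1 (.get 6 0)) .skip .skip)
      (by simp [cubicProgs, networkProgs])).cost
    have : (0 : ℝ) ≤ (BExp.natLe 1 (.get 6 0)).cost := Nat.cast_nonneg _
    linarith
  obtain ⟨A, hA, hAt⟩ := ht
  have hpow : (2 : ℝ) ^ ((cubic (Finset.range (n + 1)) (restrict n E)).card / 4) ≤ 1.415 ^ t := by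
    have h := card_cubic_le hE hdeg hA
    calc (2 : ℝ) ^ ((cubic (Finset.range (n + 1)) (restrict n E)).card / 4) ≤ 2 ^ (t / 2) :=
          pow_le_pow_right₀ (by norm_num) (by omega)
      _ ≤ (1.415 ^ 2) ^ (t / 2) := pow_le_pow_left₀ (by norm_num) (by norm_num) _
      _ = 1.415 ^ (2 * (t / 2)) := by rw [pow_mul]
      _ ≤ 1.415 ^ t := pow_le_pow_right₀ (by norm_num) (by omega)
  refine (((ok_weight hB hg hW.le hw0 (by linarith)).tri_fit hσ (hfit _ (by simp [cubicProgs]))).seq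
    fun τ₁ ⟨b₁, s₁, g₁⟩ => ((ok_init hB b₁ g₁ hN).tri_fit b₁ (hfit _ (by simp [cubicProgs]))).seq
    fun τ₂ ⟨b₂, s₂, l₂⟩ => (hnet τ₂ _ _ _ b₂ l₂ hN (by simp [Finset.range_add_one])
      (by omega) hd).seq
    fun τ₃ ⟨b₃, k₃, _, m₃⟩ => ((ok_collect hB b₃ (n := n)
      (by rw [k₃.same.nat 0, l₂.n_eq])).tri_fit b₃ (hfit _ (by simp [cubicProgs]))).seq
    fun τ₄ ⟨b₄, s₄, r₄, h₄⟩ => ((ok_answer hB (hg.congr (LN := networkN ++ [8, aBest, 20])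
      (LR := networkR ++ [rBig, rWgt, rBest]) ((s₁.mono ?_ ?_).trans ((s₂.mono ?_ ?_).trans
      ((k₃.same.mono ?_ ?_).trans (s₄.mono ?_ ?_)))) ?_ ?_ ?_ ?_) ?_ ?_ b₄).tri_fit b₄
      (hfit _ (by simp [cubicProgs]))).mono le_rfl fun _ h => h.2.2).mono ?_ fun _ h => h
  any_goals decide
  · obtain ⟨c₁, c₂, _⟩ := m₃.cover hw0 (by linarith)
    refine ⟨c₁.congr fun v hv h => by rw [h₄ v (by omega), h], ?_⟩
    rw [r₄, c₂]
    exact wt_congr w fun v hv => by rw [h₄ v (by omega)]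
  · rw [r₄]
    exact (m₃.cover hw0 (by linarith)).2.2
  · have h₁ : (1 : ℝ) ≤ 1.415 ^ t := one_le_pow₀ (by norm_num)
    have h₂ : 12 * D * (n + 1) * 2 ^ ((cubic (Finset.range (n + 1)) (restrict n E)).card / 4) ≤
        12 * D * (n + 1) * 1.415 ^ t := mul_le_mul_of_nonneg_left hpow (by positivity)
    nlinarith

end

/-! ### Good minimum vertex covers -/

/-- A graph of maximum degree three with a vertex cover of minimum size. -/
structure CubicMin (n : ℕ) (E : ℕ → ℕ → Prop) (U : ℕ → Prop) : Prop where
  symm : ∀ a < n, ∀ b < n, E a b → E b a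
  irrefl : ∀ a < n, ¬ E a a
  deg : ∀ u < n, (nbrs (Finset.range n) E u).card ≤ 3
  covers : Covers n E U
  le : ∀ A, Covers n E A → size n U ≤ size n A

/-- The vertices `p` and `q` form a component of the graph that is induced by `U`, and `z` is
adjacent to both. -/
def PathAt (n : ℕ) (E : ℕ → ℕ → Prop) (U : ℕ → Prop) (z p q : ℕ) : Prop :=
  U p ∧ U q ∧ E p q ∧ E z p ∧ E z q ∧ ∀ r < n, U r → (E r p → r = q) ∧ (E r q → r = p)

/-- The vertex `x` of a triangle in `U` can be replaced by its neighbour `z`. -/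
def Movable (n : ℕ) (E : ℕ → ℕ → Prop) (U : ℕ → Prop) (x z : ℕ) : Prop :=
  U x ∧ ¬ U z ∧ E x z ∧
    (∃ y < n, ∃ w < n, U y ∧ U w ∧ E x y ∧ E x w ∧ E y w ∧ ¬ (E y z ∧ E w z)) ∧
    ¬ ∃ p < n, ∃ q < n, PathAt n E U z p q

/-- The vertex `p` belongs to a path that may be assigned to the triangle of `x`. -/
def Target (n : ℕ) (E : ℕ → ℕ → Prop) (U : ℕ → Prop) (x p : ℕ) : Prop :=
  ∃ q < n, ∃ z < n, ∃ a < n, U a ∧ (a = x ∨ E x a) ∧ ¬ U z ∧ E a z ∧ PathAt n E U z p q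

open Classical in
/-- The vertices of triangles in `U`. -/
noncomputable def triangular (n : ℕ) (E : ℕ → ℕ → Prop) (U : ℕ → Prop) : Finset ℕ :=
  (Finset.range n).filter fun a => U a ∧ ∃ b < n, ∃ c < n, U b ∧ U c ∧ E a b ∧ E b c ∧ E a c

section

variable {n : ℕ} {E : ℕ → ℕ → Prop} {U : ℕ → Prop} {x y z w u : ℕ}

theorem card_triangular_le : (triangular n E U).card ≤ n := by
  classical
  exact (Finset.card_filter_le _ _).trans_eq (Finset.card_range n)

/-- Every vertex of a minimum vertex cover has a neighbour outside. -/
theorem CubicMin.outside (h : CubicMin n E U) (hx : x < n) (hU : U x) :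
    ∃ z < n, ¬ U z ∧ E x z := by
  classical
  by_contra! hcon
  have hA : Covers n E fun v => U v ∧ v ≠ x := by
    intro a ha b hb hab
    by_cases hax : a = x
    · subst hax
      refine .inr ⟨?_, fun e => h.irrefl a ha (e ▸ hab)⟩
      by_contra hb'
      exact hcon b hb hb' hab
    · by_cases hbx : b = x
      · subst hbx
        refine .inl ⟨?_, hax⟩
        by_contra ha'
        exact hcon a ha ha' (h.symm a ha b hb hab)
      · exact (h.covers a ha b hb hab).imp (⟨·, hax⟩) (⟨·, hbx⟩)
  have h₁ := h.le _ hA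
  have h₂ : size n (fun v => U v ∧ v ≠ x) < size n U := by
    refine Finset.card_lt_card ((Finset.ssubset_iff_of_subset fun v hv => ?_).2 ⟨x, ?_, ?_⟩)
    · simp only [Finset.mem_filter] at hv ⊢
      exact ⟨hv.1, hv.2.1⟩
    · simp [hx, hU]
    · simp
  omega

theorem CubicMin.nbr_cases (h : CubicMin n E U) (hx : x < n) (hy : y < n) (hw : w < n) (hz : z < n)
    (hu : u < n) (hyw : y ≠ w) (hyz : y ≠ z) (hwz : w ≠ z) (ey : E x y) (ew : E x w) (ez : E x z)
    (eu : E x u) : u = y ∨ u = w ∨ u = z := by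
  by_contra! hcon
  have h₁ : ({u, y, w, z} : Finset ℕ) ⊆ nbrs (Finset.range n) E x := by
    simp [Finset.insert_subset_iff, *]
  have h₂ := (Finset.card_le_card h₁).trans (h.deg x hx)
  rw [Finset.card_eq_of_equiv_fin (n := 4) ?_] at h₂
  · omega
  · refine Finset.equivFinOfCardEq ?_
    simp [*]

/-- Exchanging a movable vertex `x` for `z` keeps the size, and all neighbours of `x` are in the
new set. Fewer vertices belong to triangles afterwards: `x` leaves its triangle, and a new
triangle would consist of `z` and two adjacent vertices that were a component of their own. -/
theorem CubicMin.move (h : CubicMin n E U) (hx : x < n) (hz : z < n) (hm : Movable n E U x z) :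
    CubicMin n E (fun v => v = z ∨ (v ≠ x ∧ U v)) ∧
      triangular n E (fun v => v = z ∨ (v ≠ x ∧ U v)) ⊂ triangular n E U := by
  classical
  obtain ⟨Ux, Uz, exz, ⟨y, hy, w, hw, Uy, Uw, exy, exw, eyw, hyw⟩, hp⟩ := hm
  have ne : ∀ a < n, ∀ b, E a b → a ≠ b := fun a ha b hab e => h.irrefl a ha (e ▸ hab)
  have nz : ∀ a, U a → a ≠ z := fun a ha e => Uz (e ▸ ha)
  have hN : ∀ u < n, E x u → u = y ∨ u = w ∨ u = z := fun u hu eu =>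
    h.nbr_cases hx hy hw hz hu (ne y hy w eyw) (nz y Uy) (nz w Uw) exy exw exz eu
  have hxU : ∀ u < n, E x u → u = z ∨ (u ≠ x ∧ U u) := fun u hu eu => by
    rcases hN u hu eu with rfl | rfl | rfl
    · exact .inr ⟨(ne x hx _ eu).symm, Uy⟩
    · exact .inr ⟨(ne x hx _ eu).symm, Uw⟩
    · exact .inl rfl
  have h' : CubicMin n E (fun v => v = z ∨ (v ≠ x ∧ U v)) := by
    refine ⟨h.symm, h.irrefl, h.deg, fun a ha b hb hab => ?_, fun A hA => le_trans ?_ (h.le A hA)⟩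
    · by_cases hax : a = x
      · subst hax; exact .inr (hxU b hb hab)
      by_cases hbx : b = x
      · subst hbx; exact .inl (hxU a ha (h.symm a ha b hb hab))
      exact (h.covers a ha b hb hab).imp (fun h => .inr ⟨hax, h⟩) fun h => .inr ⟨hbx, h⟩
    · have hxm : x ∈ (Finset.range n).filter fun v => U v := by simp [hx, Ux]
      unfold size
      rw [← Finset.card_erase_add_one hxm]
      refine (Finset.card_le_card fun v hv => ?_).trans (Finset.card_insert_le z _)
      simp only [Finset.mem_filter, Finset.mem_insert, Finset.mem_erase] at hv ⊢
      tauto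
  have hyz : ∀ b, U b → E z b → b < n → E b z := fun b _ e hb => h.symm z hz b hb e
  have key : ∀ b < n, ∀ c < n, U b → U c → b ≠ x → c ≠ x → E z b → E b c → E z c → ∀ r < n, U r →
      E r b → r ≠ c → False := by
    intro b hb c hc Ub Uc hbx hcx ezb ebc ezc r hr Ur erb hrc
    have ebz := hyz b Ub ezb hb
    have ecz := hyz c Uc ezc hc
    have ebr := h.symm r hr b hb erb
    have hNb : ∀ u < n, E b u → u = r ∨ u = c ∨ u = z := fun u hu eu =>
      h.nbr_cases hb hr hc hz hu hrc (nz r Ur) (nz c Uc) ebr ebc ebz eu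
    by_cases hrx : r = x
    · subst hrx
      rcases hN b hb erb with rfl | rfl | h₁
      · rcases hNb w hw eyw with h₁ | rfl | h₁
        · exact ne r hx w exw h₁.symm
        · exact hyw ⟨ebz, ecz⟩
        · exact nz w Uw h₁
      · rcases hNb y hy (h.symm y hy b hb eyw) with h₁ | rfl | h₁
        · exact ne r hx y exy h₁.symm
        · exact hyw ⟨ecz, ebz⟩
        · exact nz y Uy h₁
      · exact nz b Ub h₁
    · obtain ⟨u, hu, hu', eu⟩ := h'.outside hb (.inr ⟨hbx, Ub⟩)
      rcases hNb u hu eu with rfl | rfl | rfl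
      · exact hu' (.inr ⟨hrx, Ur⟩)
      · exact hu' (.inr ⟨hcx, Uc⟩)
      · exact hu' (.inl rfl)
  -- The new vertex does not belong to a triangle.
  have hfree : ∀ b < n, ∀ c < n, (b = z ∨ (b ≠ x ∧ U b)) → (c = z ∨ (c ≠ x ∧ U c)) → E z b → E b c →
      E z c → False := by
    intro b hb c hc Ub Uc ezb ebc ezc
    have Ub := Ub.resolve_left (ne z hz b ezb).symm
    have Uc := Uc.resolve_left (ne z hz c ezc).symm
    refine hp ⟨b, hb, c, hc, Ub.2, Uc.2, ebc, ezb, ezc, fun r hr Ur => ⟨fun e => ?_, fun e => ?_⟩⟩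
    · by_contra hrc
      exact key b hb c hc Ub.2 Uc.2 Ub.1 Uc.1 ezb ebc ezc r hr Ur e hrc
    · by_contra hrb
      exact key c hc b hb Uc.2 Ub.2 Uc.1 Ub.1 ezc (h.symm b hb c hc ebc) ezb r hr Ur e hrb
  refine ⟨h', (Finset.ssubset_iff_of_subset fun a ha => ?_).2 ⟨x, ?_, fun hx' => ?_⟩⟩
  · simp only [triangular, Finset.mem_filter, Finset.mem_range] at ha ⊢
    obtain ⟨ha, Ua, b, hb, c, hc, Ub, Uc, eab, ebc, eac⟩ := ha
    have eba := h.symm a ha b hb eab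
    have eca := h.symm a ha c hc eac
    have ecb := h.symm b hb c hc ebc
    have h₁ : a ≠ z := fun e => by subst e; exact hfree b hb c hc Ub Uc eab ebc eac
    have h₂ : b ≠ z := fun e => by subst e; exact hfree a ha c hc Ua Uc eba eac ebc
    have h₃ : c ≠ z := fun e => by subst e; exact hfree a ha b hb Ua Ub eca eab ecb
    exact ⟨ha, (Ua.resolve_left h₁).2, b, hb, c, hc, (Ub.resolve_left h₂).2, (Uc.resolve_left h₃).2,
      eab, ebc, eac⟩
  · simp only [triangular, Finset.mem_filter, Finset.mem_range]
    exact ⟨hx, Ux, y, hy, w, hw, Uy, Uw, exy, eyw, exw⟩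
  · simp only [triangular, Finset.mem_filter] at hx'
    exact hx'.2.1.elim (nz x Ux) fun h => h.1 rfl

end

/-- The test for membership in the current vertex cover. -/
abbrev inB (x : ℕ) : BExp := .eq (.get 4 (vr x)) 1

/-- The test for adjacency. -/
abbrev edgeB (x y : ℕ) : BExp := .eq (.get 1 (vr x * vn + vr y)) 1

/-- The formula for `PathAt`, with the variables `61`, `64` and `65`. -/
def pathFm : Fm :=
  .conj (.base
    (.and (inB 64) (.and (inB 65) (.and (edgeB 64 65) (.and (edgeB 61 64) (edgeB 61 65))))))
    (.all 66 0 (.or (.neg (.base (inB 66))) (.conj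
      (.or (.neg (.base (edgeB 66 64))) (.base (.eq (vr 66) (vr 65))))
      (.or (.neg (.base (edgeB 66 65))) (.base (.eq (vr 66) (vr 64)))))))

/-- The formula for `Movable`, with the variables `60` and `61`. -/
def movableFm : Fm :=
  .conj (.base (.and (inB 60) (.and (.not (inB 61)) (edgeB 60 61))))
  (.conj (.ex 62 0 (.ex 63 0 (.base (.and (inB 62) (.and (inB 63) (.and (edgeB 60 62)
    (.and (edgeB 60 63) (.and (edgeB 62 63) (.not (.and (edgeB 62 61) (edgeB 63 61)))))))))))
    (.neg (.ex 64 0 (.ex 65 0 pathFm))))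

/-- The formula for `Target`, with the variables `60` and `64`. -/
def targetFm : Fm :=
  .ex 65 0 (.ex 61 0 (.ex 62 0 (.conj (.base (.and (inB 62)
    (.and (.not (.and (.not (.eq (vr 62) (vr 60))) (.not (edgeB 60 62))))
      (.and (.not (inB 61)) (edgeB 62 61))))) pathFm)))

/-- Replace one vertex if possible. -/
def moveProg : Prog :=
  .seq (Fm.ex 60 0 (.ex 61 0 movableFm)).prog (.ite (.natLe 1 (.get 6 0))
    (.seq (Fm.choose 60 0 (.ex 61 0 movableFm)) (.seq (Fm.choose 61 0 movableFm)
      (.seq (.setN 4 (vr 60) 0) (.setN 4 (vr 61) 1)))) .skip)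

/-- Local search for a good minimum vertex cover, starting from the given one. -/
def localProg : Prog :=
  .seq (.loop 60 vn (.setN 4 (vr 60) (.get 2 (vr 60)))) (.seq (.loop 67 vn moveProg)
    (.loop 60 vn (.seq (Fm.choose 64 0 targetFm) (.setN 5 (vr 60) (vr 64)))))

section

variable {n B : ℕ} {R : ℝ} {σ : Store}

/-- The graph in the memory. -/
abbrev edgeAt (n : ℕ) (σ : Store) (u v : ℕ) : Prop := σ.nat 1 (u * n + v) = 1

/-- The current vertex cover in the memory. -/
abbrev coverAt (σ : Store) (v : ℕ) : Prop := σ.nat 4 v = 1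

theorem edgeAt_setNat {x : ℕ} (i v : ℕ) (h : 1 ≠ x) : edgeAt n (σ.setNat x i v) = edgeAt n σ := by
  funext a b
  simp [edgeAt, h]

theorem coverAt_setNat {x : ℕ} (i v : ℕ) (h : 4 ≠ x) : coverAt (σ.setNat x i v) = coverAt σ := by
  funext a
  simp [coverAt, h]

theorem holds_pathFm (hn : σ.nat 0 0 = n) : pathFm.Holds σ ↔
    PathAt n (edgeAt n σ) (coverAt σ) (σ.nat 61 0) (σ.nat 64 0) (σ.nat 65 0) := by
  simp only [pathFm, Fm.holds_conj, Fm.holds_all, Fm.holds_or, Fm.holds_neg, Fm.holds_base]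
  simp [PathAt, hn, and_assoc, imp_iff_not_or]

theorem holds_movableFm (hn : σ.nat 0 0 = n) : movableFm.Holds σ ↔
    Movable n (edgeAt n σ) (coverAt σ) (σ.nat 60 0) (σ.nat 61 0) := by
  simp only [movableFm, Fm.holds_conj, Fm.holds_ex, Fm.holds_neg, Fm.holds_base]
  simp [Movable, hn, and_assoc, holds_pathFm, edgeAt_setNat, coverAt_setNat]

theorem holds_targetFm (hn : σ.nat 0 0 = n) : targetFm.Holds σ ↔
    Target n (edgeAt n σ) (coverAt σ) (σ.nat 60 0) (σ.nat 64 0) := by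
  simp only [targetFm, Fm.holds_conj, Fm.holds_ex, Fm.holds_base]
  simp [Target, hn, and_assoc, holds_pathFm, edgeAt_setNat, coverAt_setNat, imp_iff_or_not, or_comm]

/-- No vertex of a triangle can be replaced. -/
def Stuck (n : ℕ) (E : ℕ → ℕ → Prop) (U : ℕ → Prop) : Prop :=
  ∀ x < n, ∀ z < n, ¬ Movable n E U x z

/-- One step of the local search; the number of vertices in triangles bounds the number of steps. -/
theorem ok_move {E : ℕ → ℕ → Prop} (hB : n + 5 ≤ B) (hn : σ.nat 0 0 = n) (hE : edgeAt n σ = E)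
    (h : CubicMin n E (coverAt σ)) :
    Ok B R moveProg σ fun τ => CubicMin n E (coverAt τ) ∧ (Stuck n E (coverAt τ) ∨
      ¬ Stuck n E (coverAt σ) ∧
        (triangular n E (coverAt τ)).card < (triangular n E (coverAt σ)).card) := by
  have hz : ∀ ρ : Store, ρ.nat 0 0 = n → edgeAt n ρ = E → coverAt ρ = coverAt σ →
      ((Fm.ex 61 0 movableFm).Holds ρ ↔ ∃ z < n, Movable n E (coverAt σ) (ρ.nat 60 0) z) := by
    intro ρ h₁ h₂ h₃
    rw [Fm.holds_ex, h₁]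
    refine exists_congr fun z => and_congr_right fun _ => ?_
    rw [holds_movableFm (by simpa using h₁), edgeAt_setNat _ _ (by decide),
      coverAt_setNat _ _ (by decide), h₂, h₃]
    simp
  have hx : (Fm.ex 60 0 (.ex 61 0 movableFm)).Holds σ ↔
      ∃ x < n, ∃ z < n, Movable n E (coverAt σ) x z := by
    rw [Fm.holds_ex, hn]
    refine exists_congr fun x => and_congr_right fun _ => ?_
    rw [hz _ (by simpa using hn) (by rw [edgeAt_setNat _ _ (by decide), hE])
      (coverAt_setNat _ _ (by decide))]
    simp
  refine (Fm.ok_prog _ (by decide) (by rw [hn]; omega)).seq fun τ s ⟨h₁, _⟩ => ?_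
  have cτ : coverAt τ = coverAt σ := by unfold coverAt; rw [s.nat 4]
  have eτ : edgeAt n τ = E := by rw [← hE]; unfold edgeAt; rw [s.nat 1]
  have nτ : τ.nat 0 0 = n := by rw [s.nat 0, hn]
  rw [hx] at h₁
  rw [ok_ite]
  constructor
  · intro h₂
    have hex : ∃ x < n, ∃ z < n, Movable n E (coverAt σ) x z := by
      by_contra hcon
      rw [if_neg hcon] at h₁
      simp [h₁] at h₂
    refine (Fm.ok_choose (by decide) (by omega)).seq fun ρ s ⟨h₃, _⟩ => ?_
    obtain ⟨x₁, x₂⟩ := lastSat_spec (n := τ.nat 0 0 + 0)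
      (P := fun i => (Fm.ex 61 0 movableFm).Holds (τ.setNat 60 0 i)) (by
        have hτ : ∀ i, (Fm.ex 61 0 movableFm).Holds (τ.setNat 60 0 i) ↔
            ∃ z < n, Movable n E (coverAt σ) i z := fun i => by
          rw [hz _ (by simpa using nτ) (by rw [edgeAt_setNat _ _ (by decide), eτ])
            (by rw [coverAt_setNat _ _ (by decide), cτ])]
          simp
        obtain ⟨x, hx, hx'⟩ := hex
        exact ⟨x, by omega, (hτ x).2 hx'⟩)
    rw [← h₃] at x₁ x₂
    have cρ : coverAt ρ = coverAt σ := by rw [← cτ]; unfold coverAt; rw [s.nat 4]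
    have eρ : edgeAt n ρ = E := by rw [← eτ]; unfold edgeAt; rw [s.nat 1]
    have nρ : ρ.nat 0 0 = n := by rw [s.nat 0, nτ]
    rw [hz _ (by simpa using nτ) (by rw [edgeAt_setNat _ _ (by decide), eτ])
      (by rw [coverAt_setNat _ _ (by decide), cτ])] at x₂
    simp only [Store.setNat_nat, and_self, if_true] at x₂
    refine (Fm.ok_choose (by decide) (by omega)).seq fun κ s ⟨h₄, _⟩ => ?_
    obtain ⟨z₁, z₂⟩ := lastSat_spec (n := ρ.nat 0 0 + 0)
      (P := fun i => movableFm.Holds (ρ.setNat 61 0 i)) (by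
        have := (hz ρ nρ eρ cρ).2 x₂
        rwa [Fm.holds_ex] at this)
    rw [← h₄] at z₁ z₂
    rw [holds_movableFm (by simpa using nρ), edgeAt_setNat _ _ (by decide),
      coverAt_setNat _ _ (by decide), eρ, cρ] at z₂
    simp only [Store.setNat_nat, and_self, if_true] at z₂
    have e60 : κ.nat 60 0 = ρ.nat 60 0 := by rw [s.nat 60]
    have hm := h.move (by omega : ρ.nat 60 0 < n) (by omega : κ.nat 61 0 < n) (by simpa using z₂)
    have cκ : coverAt ((κ.setNat 4 (ρ.nat 60 0) 0).setNat 4 (κ.nat 61 0) 1) =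
        fun v => v = κ.nat 61 0 ∨ (v ≠ ρ.nat 60 0 ∧ coverAt σ v) := by
      have : coverAt κ = coverAt σ := by rw [← cρ]; unfold coverAt; rw [s.nat 4]
      funext v
      have hv : κ.nat 4 v = 1 ↔ σ.nat 4 v = 1 := by rw [← eq_iff_iff]; exact congrFun this v
      by_cases h₁ : v = κ.nat 61 0
      · simp [coverAt, h₁]
      · by_cases h₂ : v = ρ.nat 60 0 <;> simp [coverAt, h₁, h₂, hv]
    simp only [ok_seq, ok_setN, NExp.eval_get, NExp.eval_zero, NExp.eval_one, e60]
    refine ⟨Nat.zero_le _, by omega, ?_⟩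
    simp only [Store.setNat_nat, show ¬ (61 = 4) by decide, false_and, if_false]
    rw [cκ]
    exact ⟨hm.1, .inr ⟨fun hs => hs (ρ.nat 60 0) (by omega) (κ.nat 61 0) (by omega)
      (by simpa using z₂), Finset.card_lt_card hm.2⟩⟩
  · intro h₂
    rw [ok_skip, cτ]
    refine ⟨h, .inl fun x hx' z hz' hm => h₂ ?_⟩
    rw [if_pos ⟨x, hx', z, hz', hm⟩] at h₁
    simp [h₁]

theorem ok_local {E : ℕ → ℕ → Prop} (hB : n + 5 ≤ B) (hσ : Bdd B R σ) (hn : σ.nat 0 0 = n)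
    (hE : edgeAt n σ = E) (h : CubicMin n E fun v => σ.nat 2 v = 1) :
    Ok B R localProg σ fun τ => CubicMin n E (coverAt τ) ∧ Stuck n E (coverAt τ) ∧
      ∀ x < n, τ.nat 5 x = lastSat (Target n E (coverAt τ) x) n := by
  have f : Fills B R (fun τ => τ.nat 4) [60] [4] [] (.loop 60 vn
      (.setN 4 (vr 60) (.get 2 (vr 60)))) σ
      (fun j v => ∃ u < NExp.eval σ vn, j = u ∧ v = σ.nat 2 u) :=
    fills_loop (by simp [hn]; omega) (fun τ v => by simp)
      (by omega) fun u hu => fills_setN (by simp) (by simp) (hσ.nat _ _)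
  refine f.ok.seq fun τ s ⟨h₁, _⟩ => ?_
  have nτ : τ.nat 0 0 = n := by rw [s.nat 0, hn]
  have eτ : edgeAt n τ = E := by rw [← hE]; unfold edgeAt; rw [s.nat 1]
  have cτ : CubicMin n E (coverAt τ) := by
    have hU : ∀ v < n, τ.nat 4 v = σ.nat 2 v := fun v hv =>
      h₁ v _ ⟨v, by simpa [hn] using hv, rfl, rfl⟩
    refine ⟨h.symm, h.irrefl, h.deg, h.covers.congr fun v hv h => by rw [coverAt, hU v hv, h],
      fun A hA => (size_mono fun v hv h => ?_).trans (h.le A hA)⟩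
    rwa [coverAt, hU v hv] at h
  have eN : NExp.eval τ vn = n := by simp [nτ]
  let I : ℕ → Store → Prop := fun i ρ => CubicMin n E (coverAt ρ) ∧
    (Stuck n E (coverAt ρ) ∨ (triangular n E (coverAt ρ)).card + i ≤ n)
  have hI : ∀ i (ρ : Store) v, I i ρ → I i (ρ.setNat 67 0 v) := fun i ρ v h => by
    change CubicMin n E (coverAt (ρ.setNat 67 0 v)) ∧ (Stuck n E (coverAt (ρ.setNat 67 0 v)) ∨ _)
    rw [coverAt_setNat _ _ (by decide)]
    exact h
  refine (Ok.loop I (by omega) (hI _ _ _ ⟨cτ, .inr ?_⟩) fun i hi ρ sρ _ ⟨c, k⟩ => ?_).seq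
    fun ρ sρ ⟨c, k⟩ => ?_
  · exact card_triangular_le
  · have eρ : edgeAt n ρ = E := by rw [← eτ]; unfold edgeAt; rw [sρ.nat 1]
    refine (ok_move hB (by rw [sρ.nat 0, nτ]) eρ c).mono
      fun κ _ ⟨c', k'⟩ => hI _ _ _ ⟨c', ?_⟩
    rcases k' with k' | ⟨k', _⟩
    · exact .inl k'
    · rcases k with k | k
      · exact absurd k k'
      · right; omega
  have eρ : edgeAt n ρ = E := by rw [← eτ]; unfold edgeAt; rw [sρ.nat 1]
  have nρ : ρ.nat 0 0 = n := by rw [sρ.nat 0, nτ]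
  have hst : Stuck n E (coverAt ρ) := by
    rcases k with k | k
    · exact k
    · intro x hx z hz ⟨Ux, _, _, ⟨y, hy, w, hw, Uy, Uw, exy, exw, eyw, _⟩, _⟩
      have : x ∈ triangular n E (coverAt ρ) := by
        simp only [triangular, Finset.mem_filter, Finset.mem_range]
        exact ⟨hx, Ux, y, hy, w, hw, Uy, Uw, exy, eyw, exw⟩
      have := Finset.card_pos.2 ⟨x, this⟩
      omega
  have eN' : NExp.eval ρ vn = n := by simp [nρ]
  refine (Ok.loop (fun i κ => ∀ x < i, κ.nat 5 x = lastSat (Target n E (coverAt ρ) x) n)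
    (by omega) (by simp) fun i hi κ sκ hκ hI => ?_).mono fun κ sκ h₂ => ?_
  · have nκ : κ.nat 0 0 = n := by rw [sκ.nat 0, nρ]
    refine (Fm.ok_choose (by decide) (by omega)).seq fun μ sμ ⟨h₂, _⟩ => ?_
    have e₂ : μ.nat 64 0 = lastSat (Target n E (coverAt ρ) i) n := by
      rw [h₂, nκ, add_zero]
      congr 1
      funext p
      rw [eq_iff_iff, holds_targetFm (by simpa using nκ), edgeAt_setNat _ _ (by decide),
        coverAt_setNat _ _ (by decide)]
      have e₃ : edgeAt n κ = E := by rw [← eρ]; unfold edgeAt; rw [sκ.nat 1]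
      have e₄ : coverAt κ = coverAt ρ := by unfold coverAt; rw [sκ.nat 4]
      rw [e₃, e₄]
      simp [hκ]
    have e60 : μ.nat 60 0 = i := by rw [sμ.nat 60, hκ]
    rw [ok_setN]
    simp only [NExp.eval_get, NExp.eval_zero, e60, e₂]
    refine ⟨(lastSat_le _ _).trans (by omega), fun x hx => ?_⟩
    by_cases hxi : x = i
    · simp [hxi]
    · simp [hxi]
      rw [sμ.nat 5]
      exact hI x (by omega)
  · have e₄ : coverAt κ = coverAt ρ := by unfold coverAt; rw [sκ.nat 4]
    rw [e₄]
    exact ⟨c, hst, fun x hx => h₂ x (by omega)⟩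

end

/-! ### The solver and its resources -/

/-- Some vertex has four neighbours. -/
def degFm : Fm :=
  .ex 60 0 (.ex 61 0 (.ex 62 0 (.ex 63 0 (.ex 64 0 (.base (.and (.lt (vr 61) (vr 62))
    (.and (.lt (vr 62) (vr 63)) (.and (.lt (vr 63) (vr 64)) (.and (edgeB 60 61)
      (.and (edgeB 60 62) (.and (edgeB 60 63) (edgeB 60 64))))))))))))

theorem holds_degFm {n : ℕ} {σ : Store} (hn : σ.nat 0 0 = n) : degFm.Holds σ ↔
    ∃ u < n, 3 < (nbrs (Finset.range n) (edgeAt n σ) u).card := by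
  have : degFm.Holds σ ↔ ∃ u < n, ∃ a < n, ∃ b < n, ∃ c < n, ∃ d < n, a < b ∧ b < c ∧ c < d ∧
      edgeAt n σ u a ∧ edgeAt n σ u b ∧ edgeAt n σ u c ∧ edgeAt n σ u d := by
    simp [degFm, hn]
  rw [this]
  refine exists_congr fun u => and_congr_right fun hu => ?_
  constructor
  · rintro ⟨a, ha, b, hb, c, hc, d, hd, hab, hbc, hcd, h₁, h₂, h₃, h₄⟩
    have hs : ({a, b, c, d} : Finset ℕ) ⊆ nbrs (Finset.range n) (edgeAt n σ) u := by
      simp only [Finset.insert_subset_iff, Finset.singleton_subset_iff, mem_nbrs, Finset.mem_range]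
      exact ⟨⟨ha, h₁⟩, ⟨hb, h₂⟩, ⟨hc, h₃⟩, hd, h₄⟩
    refine lt_of_lt_of_le ?_ (Finset.card_le_card hs)
    rw [Finset.card_insert_of_notMem, Finset.card_insert_of_notMem, Finset.card_pair hcd.ne]
    · norm_num
    · simp; omega
    · simp; omega
  · intro h
    obtain ⟨s, hs, hc⟩ := Finset.exists_subset_card_eq (n := 4) h
    have hm : ∀ i, s.orderEmbOfFin hc i < n ∧ edgeAt n σ u (s.orderEmbOfFin hc i) := fun i => by
      simpa using hs (s.orderEmbOfFin_mem hc i)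
    have hlt : ∀ i j : Fin 4, i < j → s.orderEmbOfFin hc i < s.orderEmbOfFin hc j := fun i j h =>
      (s.orderEmbOfFin hc).strictMono h
    exact ⟨_, (hm 0).1, _, (hm 1).1, _, (hm 2).1, _, (hm 3).1, hlt _ _ (by decide),
      hlt _ _ (by decide), hlt _ _ (by decide), (hm 0).2, (hm 1).2, (hm 2).2, (hm 3).2⟩

/-- The algorithm for maximum degree three where it applies, and the general one elsewhere. -/
def solver : Program where
  main := .seq degFm.prog.cmd (.ite (.natLe 1 (.get 6 0)) generalCmd cubicCmd)
  procs := [branchCmd, networkCmd]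

/-- The call-free parts. -/
def solverProgs : List Prog :=
  degFm.prog :: .ite (.natLe 1 (.get 6 0)) .skip .skip :: (generalProgs ++ cubicProgs)

theorem wf_solverProgs : ∀ p ∈ solverProgs, p.wf = true := by decide +kernel

theorem wf_localProg : localProg.wf = true := by decide +kernel

theorem Fit.of_mem {L : List Prog} {B S : ℕ} {R R' D : ℝ} (hw : ∀ p ∈ L, p.wf = true) (hR : 0 ≤ R)
    (h₁ : (L.map fun p => p.space B).sum ≤ S) (h₂ : ((L.map Prog.size).sum : ℕ) * R ≤ R')
    (h₃ : ((L.map fun p => p.time B).sum : ℕ) ≤ D) : ∀ p ∈ L, Fit B S R R' D p := by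
  intro p hp
  refine ⟨hw p hp, (List.single_le_sum (by simp) _ (List.mem_map_of_mem hp)).trans h₁,
    le_trans (mul_le_mul_of_nonneg_right ?_ hR) h₂, le_trans ?_ h₃⟩
  · exact_mod_cast List.single_le_sum (by simp) _ (List.mem_map_of_mem hp)
  · exact_mod_cast List.single_le_sum (by simp) _ (List.mem_map_of_mem (f := fun p => p.time B) hp)

theorem IsPoly.sum {L : List Prog} {f : Prog → ℕ → ℕ} (h : ∀ p ∈ L, IsPoly (f p)) :
    IsPoly fun n => (L.map fun p => f p n).sum := by
  induction L with
  | nil => exact .const 0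
  | cons p L ih =>
    simp only [List.map_cons, List.sum_cons]
    exact (h p (by simp)).add (ih fun q hq => h q (by simp [hq]))

/-- The total running time of the programs in the list. -/
def timeSum (L : List Prog) (n : ℕ) : ℕ := (L.map fun p => p.time (n + 5)).sum

/-- A bound for the resources that the programs in the list need on a graph with `n` vertices. -/
def resources (L : List Prog) (n : ℕ) : ℕ :=
  (L.map fun p => p.space (n + 5)).sum + (L.map Prog.size).sum * (2 * (n + 1) ^ 2) + (n + 1) +
    ((6 * n + 16) * (n + 2) ^ 2 * 2 + 12 * (n + 2) + 2) * timeSum L n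

theorem isPoly_resources (L : List Prog) : IsPoly (resources L) := by
  have hn : IsPoly fun n => n := IsPoly.id
  have h₁ : IsPoly fun n => (n + 1) ^ 2 := by
    simpa only [pow_two] using (hn.add (.const 1)).mul (hn.add (.const 1))
  have h₂ : IsPoly fun n => (n + 2) ^ 2 := by
    simpa only [pow_two] using (hn.add (.const 2)).mul (hn.add (.const 2))
  exact (((IsPoly.sum fun p _ => (IsPoly.space p).comp_add 5).add
    ((IsPoly.const _).mul ((IsPoly.const 2).mul h₁))).add (hn.add (.const 1))).add
    (((((((IsPoly.const 6).mul hn).add (.const 16)).mul h₂).mul (.const 2)).add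
      ((IsPoly.const 12).mul (hn.add (.const 2)))).add (.const 2) |>.mul
      (IsPoly.sum fun p _ => (IsPoly.time p).comp_add 5))

theorem fit_resources {L : List Prog} {n S : ℕ} {M : ℝ} (hw : ∀ p ∈ L, p.wf = true) (hM : 0 ≤ M)
    (hS : resources L n ≤ S) :
    ∀ p ∈ L, Fit (n + 5) S (2 * (n + 1) ^ 2 * M) (S * M) (timeSum L n) p := by
  refine Fit.of_mem hw (by positivity) ?_ ?_ (by rw [timeSum])
  · unfold resources at hS; omega
  · rw [← mul_assoc]
    refine mul_le_mul_of_nonneg_right ?_ hM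
    have : (L.map Prog.size).sum * (2 * (n + 1) ^ 2) ≤ S := by unfold resources at hS; omega
    exact_mod_cast this

/-- The solver on a graph whose minimum vertex cover has at most `t` vertices. -/
theorem tri_solver {n S t : ℕ} {E : ℕ → ℕ → Prop} {w : ℕ → ℝ} {W M X : ℝ} {σ : Store}
    (hS : resources solverProgs n ≤ S) (hE' : edgeAt n σ = E) (hw : ∀ v < n, 0 < w v) (hW : 0 < W)
    (hM : M = W + ∑ v ∈ Finset.range n, w v)
    (hE : ∀ a < n, ∀ b < n, E a b → E b a) (hirr : ∀ a < n, ¬ E a a)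
    (hσ : Bdd (n + 5) (2 * (n + 1) ^ 2 * M) σ) (hg : InstanceAt n E w W σ)
    (hu : ∀ v, σ.nat aUse v = 0) (ht : ∃ A, Covers n E A ∧ size n A ≤ t)
    (hX : (∀ u < n, (nbrs (Finset.range n) E u).card ≤ 3) → 1.415 ^ t ≤ X)
    (hX' : ¬ (∀ u < n, (nbrs (Finset.range n) E u).card ≤ 3) → 1.443 ^ t ≤ X) :
    Tri solver.procs S (S * M) S solver.main σ (S * X) (Answers n E w W) := by
  have hs0 : 0 ≤ ∑ v ∈ Finset.range n, w v :=
    Finset.sum_nonneg fun v hv => (hw v (by simpa using hv)).le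
  have hM0 : 0 ≤ M := by linarith
  have hfit := fit_resources wf_solverProgs hM0 hS
  unfold resources at hS
  generalize timeSum solverProgs n = D at hS hfit
  have hdS : n + 1 ≤ S := by omega
  have hn0 : (0 : ℝ) ≤ n := Nat.cast_nonneg n
  have hD0 : (0 : ℝ) ≤ D := Nat.cast_nonneg D
  have hSD : ((6 * n + 16) * (n + 2) ^ 2 * 2 + 12 * (n + 2) + 2) * D ≤ (S : ℝ) := by
    have : ((6 * n + 16) * (n + 2) ^ 2 * 2 + 12 * (n + 2) + 2) * D ≤ S := by
      omega
    exact_mod_cast this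
  clear hS
  have hMn : M ≤ (n + 1) ^ 2 * M := le_mul_of_one_le_left hM0 (one_le_pow₀ (by linarith))
  have hn1 : (n + 1) * W ≤ (n + 1) ^ 2 * M := by
    have : ((n : ℝ) + 1) * W ≤ (n + 1) * M := by gcongr; linarith
    nlinarith [mul_nonneg hn0 hM0]
  have hfit₁ : ∀ p ∈ generalProgs, Fit (n + 5) S (2 * (n + 1) ^ 2 * M) (S * M) D p :=
    fun p hp => hfit p (by simp [solverProgs, hp])
  have hfit₂ : ∀ p ∈ cubicProgs, Fit (n + 5) S (2 * (n + 1) ^ 2 * M) (S * M) D p :=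
    fun p hp => hfit p (by simp [solverProgs, hp])
  have hfitB := hfit (.ite (.natLe 1 (.get 6 0)) .skip .skip) (by simp [solverProgs])
  have hD3 := hfitB.cost
  have key : Tri solver.procs S (S * M) S solver.main σ
      (D + (BExp.cost (.natLe 1 (.get 6 0)) + 1 + (S - 2 * D) * X)) (Answers n E w W) := by
    refine (((Fm.ok_prog degFm (by decide) (B := n + 5) (by rw [hg.n_eq])).tri_fit hσ
      (hfit _ (by simp [solverProgs])))).seq fun τ ⟨bτ, sτ, h₁, _⟩ => ?_
    have gτ := hg.congr sτ
    rw [holds_degFm hg.n_eq, hE'] at h₁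
    refine Tri.ite (hfitB.fits bτ) (fun h₂ => ?_) fun h₂ => ?_
    · have hdeg : ¬ ∀ u < n, (nbrs (Finset.range n) E u).card ≤ 3 := by
        intro h₃
        rw [if_neg (by push Not; exact h₃)] at h₁
        simp [h₁] at h₂
      refine (tri_general rfl hfit₁ le_rfl hw hW (by linarith) (by rw [← hM]; linarith) hE hirr
        bτ gτ
        (fun v => by rw [sτ.nat aUse, hu]) ht hdS).mono ?_ fun _ h => h
      have hx := hX' hdeg
      have hx0 : (0 : ℝ) ≤ 1.443 ^ t := by positivity
      calc (6 * (n : ℝ) + 16) * (n + 2) ^ 2 * D * 1.443 ^ (t + 1)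
          = (6 * (n : ℝ) + 16) * (n + 2) ^ 2 * D * 1.443 * 1.443 ^ t := by ring
        _ ≤ (6 * (n : ℝ) + 16) * (n + 2) ^ 2 * D * 2 * X := by gcongr; norm_num
        _ ≤ _ := by
          refine mul_le_mul_of_nonneg_right ?_ (hx0.trans hx)
          nlinarith [mul_nonneg hn0 hD0]
    · have hdeg : ∀ u < n, (nbrs (Finset.range n) E u).card ≤ 3 := by
        by_contra h₃
        rw [if_pos (by push Not at h₃; exact h₃)] at h₁
        simp [h₁] at h₂
      refine (tri_cubic rfl hfit₂ le_rfl hw hW (by rw [← hM]; linarith) hE hirr hdeg bτ gτ ht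
        (by omega)).mono ?_ fun _ h => h
      have hx := hX hdeg
      have hx0 : (0 : ℝ) ≤ 1.415 ^ t := by positivity
      calc 12 * (D : ℝ) * (n + 2) * 1.415 ^ t ≤ 12 * (D : ℝ) * (n + 2) * X := by gcongr
        _ ≤ _ := by
          refine mul_le_mul_of_nonneg_right ?_ (hx0.trans hx)
          have : 0 ≤ (6 * (n : ℝ) + 16) * (n + 2) ^ 2 * 2 * D := by positivity
          nlinarith
  refine key.mono ?_ fun _ h => h
  have hX1 : 1 ≤ X := by
    by_cases h : ∀ u < n, (nbrs (Finset.range n) E u).card ≤ 3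
    · exact (one_le_pow₀ (by norm_num)).trans (hX h)
    · exact (one_le_pow₀ (by norm_num)).trans (hX' h)
  nlinarith

/-! ### Graphs on `Fin n` and their encodings -/

section

variable {n : ℕ} {G : SimpleGraph (Fin n)} {E : ℕ → ℕ → Prop}

theorem size_eq_card (A : ℕ → Prop) [DecidablePred A] :
    size n A = (Finset.univ.filter fun v : Fin n => A v).card := by
  rw [Finset.card_filter, ← Finset.sum_range fun v => if A v then 1 else 0, ← Finset.card_filter,
    size]
  congr 1
  ext
  simp

theorem wt_eq_sum (w : ℕ → ℝ) (A : ℕ → Prop) [DecidablePred A] :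
    wt n w A = ∑ v ∈ Finset.univ.filter fun v : Fin n => A v, w v := by
  rw [Finset.sum_filter, ← Finset.sum_range fun v => if A v then w v else 0, ← Finset.sum_filter,
    sum_filter_eq_wt]

theorem covers_iff (hE : ∀ u v : Fin n, E u v ↔ G.Adj u v) (A : ℕ → Prop) [DecidablePred A] :
    Covers n E A ↔ G.IsVertexCover (Finset.univ.filter fun v : Fin n => A v : Finset (Fin n)) := by
  constructor
  · intro h u v huv
    simpa using h u u.2 v v.2 ((hE u v).2 huv)
  · intro h u hu v hv huv
    simpa using h ((hE ⟨u, hu⟩ ⟨v, hv⟩).1 huv)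

/-- A set of vertices as a predicate on natural numbers. -/
def memNat (U : Finset (Fin n)) (v : ℕ) : Prop := ∃ h : v < n, ⟨v, h⟩ ∈ U

open Classical in
theorem filter_memNat (U : Finset (Fin n)) :
    (Finset.univ.filter fun v : Fin n => memNat U v) = U := by
  ext v
  simp [memNat]

theorem isDegreeThree_iff (hE : ∀ u v : Fin n, E u v ↔ G.Adj u v) :
    G.IsDegreeThree ↔ ∀ u < n, (nbrs (Finset.range n) E u).card ≤ 3 := by
  classical
  have key : ∀ u : Fin n, (G.neighborSet u).encard = ((nbrs (Finset.range n) E u).card : ℕ∞) := by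
    intro u
    have h₁ : (nbrs (Finset.range n) E u).card = size n (E u) := rfl
    have h₂ : G.neighborSet u = (Finset.univ.filter fun v : Fin n => E u v : Finset (Fin n)) := by
      ext v
      simp [hE]
    rw [h₁, size_eq_card, h₂, Set.encard_coe_eq_coe_finsetCard]
  constructor
  · intro h u hu
    have := h ⟨u, hu⟩
    rw [key] at this
    exact_mod_cast this
  · intro h u
    rw [key]
    exact_mod_cast h u u.2

/-- The minimum size of a cover, in both descriptions. -/
theorem isMinVertexCover_iff (hE : ∀ u v : Fin n, E u v ↔ G.Adj u v) (A : ℕ → Prop)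
    [DecidablePred A] : G.IsMinVertexCover (Finset.univ.filter fun v : Fin n => A v) ↔
      Covers n E A ∧ ∀ A', Covers n E A' → size n A ≤ size n A' := by
  classical
  rw [SimpleGraph.IsMinVertexCover, ← covers_iff hE, ← size_eq_card]
  refine and_congr_right fun hA => ⟨fun h A' hA' => ?_, fun h => le_antisymm ?_ ?_⟩
  · have := ((covers_iff hE A').1 hA').vertexCoverNum_le
    rw [← h, Set.encard_coe_eq_coe_finsetCard, ← size_eq_card A'] at this
    exact_mod_cast this
  · obtain ⟨s, hs, hc⟩ := G.vertexCoverNum_exists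
    have hf := filter_memNat s.toFinset
    have := h (memNat s.toFinset) ((covers_iff hE _).2 (by rw [hf]; simpa using hc))
    rw [size_eq_card (memNat _), hf] at this
    rw [← hs, Set.encard_eq_coe_toFinset_card]
    exact_mod_cast this
  · have := ((covers_iff hE A).1 hA).vertexCoverNum_le
    rwa [Set.encard_coe_eq_coe_finsetCard, ← size_eq_card] at this

end

section

variable {n : ℕ} (I : WVCInstance n) (U : Finset (Fin n))

theorem edgeAt_inputWith (u v : Fin n) : edgeAt n (I.inputWith U) u v ↔ I.graph.Adj u v := by
  classical
  have h : edgeAt n (I.inputWith U) u v ↔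
      ∃ u' v' : Fin n, I.graph.Adj u' v' ∧ (u : ℕ) * n + v = u' * n + v' := by
    simp [edgeAt, WVCInstance.inputWith]
  rw [h]
  constructor
  · rintro ⟨u', v', huv, e⟩
    obtain ⟨h₁, h₂⟩ := (addr_inj v.2 v'.2).1 e
    rwa [Fin.ext h₁, Fin.ext h₂]
  · exact fun h => ⟨u, v, h, rfl⟩

theorem real_inputWith (v : Fin n) : (I.inputWith U).real 0 v = I.weight v := by
  simp [WVCInstance.inputWith]

theorem total_eq_sum_range :
    I.total = I.budget + ∑ v ∈ Finset.range n, (I.inputWith U).real 0 v := by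
  rw [WVCInstance.total, Finset.sum_range]
  simp_rw [real_inputWith]

theorem instanceAt_inputWith :
    InstanceAt n (edgeAt n (I.inputWith U)) ((I.inputWith U).real 0) I.budget (I.inputWith U) :=
  ⟨by simp [WVCInstance.inputWith], fun _ _ _ _ => Iff.rfl, fun _ _ => rfl,
    by simp [WVCInstance.inputWith]⟩

theorem total_nonneg : 0 ≤ I.total :=
  add_nonneg I.budget_pos.le (Finset.sum_nonneg fun v _ => (I.weight_pos v).le)

theorem bdd_inputWith : Bdd (n + 5) (2 * (n + 1) ^ 2 * I.total) (I.inputWith U) := by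
  have h0 := total_nonneg I
  have hs : 0 ≤ ∑ v, I.weight v := Finset.sum_nonneg fun v _ => (I.weight_pos v).le
  have hR : I.total ≤ 2 * (n + 1) ^ 2 * I.total := by
    refine le_mul_of_one_le_left h0 ?_
    have : (1 : ℝ) ≤ ((n : ℝ) + 1) ^ 2 := one_le_pow₀ (by simp)
    linarith
  refine ⟨fun a i => ?_, fun a i => le_trans ?_ hR⟩
  · simp only [WVCInstance.inputWith]
    split_ifs <;> omega
  · simp only [WVCInstance.inputWith]
    split_ifs with h₁ h₂ h₃ h₄
    · rw [abs_of_pos (I.weight_pos _)]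
      have := Finset.single_le_sum (fun v _ => (I.weight_pos v).le) (Finset.mem_univ ⟨i, h₂⟩)
      have hb := I.budget_pos
      unfold WVCInstance.total
      linarith
    · simpa using h0
    · rw [abs_of_pos I.budget_pos]
      unfold WVCInstance.total
      linarith
    · simpa using h0
    · simpa using h0

theorem edgeAt_symm : ∀ a < n, ∀ b < n, edgeAt n (I.inputWith U) a b →
    edgeAt n (I.inputWith U) b a := fun a ha b hb h =>
  (edgeAt_inputWith I U ⟨b, hb⟩ ⟨a, ha⟩).2 ((edgeAt_inputWith I U ⟨a, ha⟩ ⟨b, hb⟩).1 h).symm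

theorem edgeAt_irrefl : ∀ a < n, ¬ edgeAt n (I.inputWith U) a a := fun a ha h =>
  ((edgeAt_inputWith I U ⟨a, ha⟩ ⟨a, ha⟩).1 h).ne rfl

theorem answeredBy_of_answers {σ : Store}
    (h : Answers n (edgeAt n (I.inputWith U)) ((I.inputWith U).real 0) I.budget σ) :
    I.AnsweredBy σ := by
  classical
  have hE := edgeAt_inputWith I U
  refine h.imp (fun ⟨h₁, h₂, h₃⟩ => ⟨h₁, ?_, ?_⟩) fun ⟨h₁, h₂⟩ => ⟨h₁, fun A ⟨h₃, h₄⟩ => ?_⟩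
  · exact (covers_iff hE _).1 h₂
  · rw [wt_eq_sum] at h₃
    simpa [outputSet, real_inputWith] using h₃
  · have hf := filter_memNat A
    have := h₂ (memNat A) ((covers_iff hE _).2 (by rwa [hf]))
    rw [wt_eq_sum, hf] at this
    simp_rw [real_inputWith] at this
    linarith

theorem solver_runs {S t : ℕ} (hS : resources solverProgs n ≤ S)
    (ht : (t : ℕ∞) = I.graph.vertexCoverNum) :
    ∃ (T : ℕ) (σ : Store), solver.Runs S I.total (I.inputWith U) T σ ∧ I.AnsweredBy σ ∧
      (T : ℝ) ≤ S * (1.443 : ℝ) ^ t ∧ (I.graph.IsDegreeThree → (T : ℝ) ≤ S * (1.415 : ℝ) ^ t) := by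
  classical
  have hE := edgeAt_inputWith I U
  have hcov : ∃ A, Covers n (edgeAt n (I.inputWith U)) A ∧ size n A ≤ t := by
    obtain ⟨s, hs, hc⟩ := I.graph.vertexCoverNum_exists
    have hf := filter_memNat s.toFinset
    refine ⟨memNat s.toFinset, (covers_iff hE _).2 (by rw [hf]; simpa using hc), ?_⟩
    rw [← ht, Set.encard_eq_coe_toFinset_card] at hs
    rw [size_eq_card, hf]
    exact_mod_cast hs.le
  obtain ⟨T, σ, h₁, h₂, h₃⟩ := tri_solver (t := t) (M := I.total)
    (X := if I.graph.IsDegreeThree then 1.415 ^ t else 1.443 ^ t) hS rfl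
    (fun v hv => by rw [real_inputWith I U ⟨v, hv⟩]; exact I.weight_pos _) I.budget_pos
    (total_eq_sum_range I U) (edgeAt_symm I U) (edgeAt_irrefl I U) (bdd_inputWith I U)
    (instanceAt_inputWith I U) (fun v => by simp [WVCInstance.inputWith]) hcov
    (fun h => by rw [if_pos ((isDegreeThree_iff hE).2 h)])
    (fun h => by rw [if_neg (fun h' => h ((isDegreeThree_iff hE).1 h'))])
  refine ⟨T, σ, h₁, answeredBy_of_answers I U h₃, h₂.trans ?_, fun h => ?_⟩
  · split_ifs
    · gcongr
      norm_num
    · exact le_rfl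
  · rwa [if_pos h] at h₂

end

/-! ### The map from triangles to paths -/

section

variable {n : ℕ} {G : SimpleGraph (Fin n)} {E : ℕ → ℕ → Prop} {A : ℕ → Prop}
  {U : Finset (Fin n)}

/-- The description of path components in `PathAt` agrees with the connected components. -/
theorem supp_of_pathAt (hE : ∀ u v : Fin n, E u v ↔ G.Adj u v) (hU : ∀ v : Fin n, v ∈ U ↔ A v)
    {z : ℕ} {p q : (U : Set (Fin n))} (h : PathAt n E A z p.1 q.1) :
    ((G.induce (U : Set (Fin n))).connectedComponentMk p).supp = {p, q} := by
  obtain ⟨-, -, hpq, -, -, hr⟩ := h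
  have hadj : (G.induce (U : Set (Fin n))).Adj p q := (hE _ _).1 hpq
  ext r
  rw [SimpleGraph.ConnectedComponent.mem_supp_iff, SimpleGraph.ConnectedComponent.eq]
  constructor
  · rintro ⟨W⟩
    have key : ∀ a b : (U : Set (Fin n)), (G.induce (U : Set (Fin n))).Walk a b →
        b ∈ ({p, q} : Set (U : Set (Fin n))) → a ∈ ({p, q} : Set (U : Set (Fin n))) := by
      intro a b W hb
      induction W with
      | nil => exact hb
      | @cons a c b hac _ ih =>
        have hac' : E a.1 c.1 := (hE _ _).2 hac
        have ha := hr a.1 a.1.2 ((hU _).1 a.2)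
        rcases ih hb with rfl | rfl
        · exact .inr (Subtype.ext (Fin.ext (ha.1 hac')))
        · exact .inl (Subtype.ext (Fin.ext (ha.2 hac')))
    exact key _ _ W (.inl rfl)
  · rintro (rfl | rfl)
    · exact SimpleGraph.Reachable.refl _
    · exact hadj.symm.reachable

theorem mem_supp_iff_of_isTriangle (hE : ∀ u v : Fin n, E u v ↔ G.Adj u v)
    {c : G.CoverComponent U} (hc : c.IsTriangle) {x : (U : Set (Fin n))} (hx : x ∈ c.supp)
    (a : (U : Set (Fin n))) : a ∈ c.supp ↔ (a.1 : ℕ) = x.1 ∨ E x.1 a.1 := by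
  constructor
  · intro ha
    by_cases h : a = x
    · exact .inl (by rw [h])
    · exact .inr ((hE _ _).2 (hc.2 hx ha (Ne.symm h)))
  · rintro (h | h)
    · rwa [show a = x from Subtype.ext (Fin.ext h)]
    · exact c.mem_supp_of_adj_mem_supp hx ((hE _ _).1 h)

/-- All vertices of a triangle have the same targets. -/
theorem target_congr (hE : ∀ u v : Fin n, E u v ↔ G.Adj u v) (hU : ∀ v : Fin n, v ∈ U ↔ A v)
    {c : G.CoverComponent U} (hc : c.IsTriangle) {x y : (U : Set (Fin n))} (hx : x ∈ c.supp)
    (hy : y ∈ c.supp) : Target n E A x.1 = Target n E A y.1 := by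
  funext p
  refine propext (exists_congr fun q => and_congr_right fun _ => exists_congr fun z =>
    and_congr_right fun _ => exists_congr fun a => and_congr_right fun ha =>
    and_congr_right fun Ua => and_congr_left fun _ => ?_)
  have haU : (⟨a, ha⟩ : Fin n) ∈ (U : Set (Fin n)) := (hU ⟨a, ha⟩).2 Ua
  rw [← mem_supp_iff_of_isTriangle hE hc hx ⟨⟨a, ha⟩, haU⟩,
    ← mem_supp_iff_of_isTriangle hE hc hy ⟨⟨a, ha⟩, haU⟩]

/-- A vertex of a free triangle has a neighbour `z` outside that is not adjacent to the other two
vertices. As the triangle cannot be changed, `z` is adjacent to both ends of a path component. -/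
theorem exists_target (hE : ∀ u v : Fin n, E u v ↔ G.Adj u v) (hU : ∀ v : Fin n, v ∈ U ↔ A v)
    (h : CubicMin n E A) (hs : Stuck n E A) (c : G.FreeTriangle U) :
    ∃ x : (U : Set (Fin n)), x ∈ c.1.supp ∧ ∃ p < n, Target n E A x.1 p := by
  obtain ⟨c, hc, hfree⟩ := c
  obtain ⟨x, y, w, hxy, hxw, hyw, hsupp⟩ := Set.encard_eq_three.1 hc.1
  have hx : x ∈ c.supp := by rw [hsupp]; simp
  have hy : y ∈ c.supp := by rw [hsupp]; simp
  have hw : w ∈ c.supp := by rw [hsupp]; simp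
  obtain ⟨z, hz, Uz, exz⟩ := h.outside x.1.2 ((hU _).1 x.2)
  have hyz : ¬ (E y.1 z ∧ E w.1 z) := by
    rintro ⟨h₁, h₂⟩
    refine hfree ⟨⟨z, hz⟩, fun h' => Uz ((hU _).1 h'), fun v hv => ?_⟩
    rw [hsupp] at hv
    rcases hv with rfl | rfl | rfl
    · exact (hE _ ⟨z, hz⟩).1 exz
    · exact (hE _ ⟨z, hz⟩).1 h₁
    · exact (hE _ ⟨z, hz⟩).1 h₂
  by_cases hp : ∃ p < n, ∃ q < n, PathAt n E A z p q
  · obtain ⟨p, hp, q, hq, hpq⟩ := hp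
    exact ⟨x, hx, p, hp, q, hq, z, hz, x.1, x.1.2, (hU _).1 x.2, .inl rfl, Uz, exz, hpq⟩
  · exact (hs x.1 x.1.2 z hz ⟨(hU _).1 x.2, Uz, exz, ⟨y.1, y.1.2, w.1, w.1.2, (hU _).1 y.2,
      (hU _).1 w.2, (hE _ _).2 (hc.2 hx hy hxy), (hE _ _).2 (hc.2 hx hw hxw),
      (hE _ _).2 (hc.2 hy hw hyw), hyz⟩, hp⟩).elim

/-- If no vertex can be replaced, then the targets define a map from the triangles to the paths. -/
theorem exists_isGoodFor (hE : ∀ u v : Fin n, E u v ↔ G.Adj u v) (hU : ∀ v : Fin n, v ∈ U ↔ A v)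
    (h : CubicMin n E A) (hs : Stuck n E A) {g : ℕ → ℕ}
    (hg : ∀ x < n, g x = lastSat (Target n E A x) n) :
    ∃ f : G.FreeTriangle U → G.PathTwo U, SimpleGraph.IsGoodFor G U f ∧
      ∀ c, ∀ x : (U : Set (Fin n)), x ∈ c.1.supp →
        ∃ y : (U : Set (Fin n)), y ∈ (f c).1.supp ∧ g x.1 = y.1 := by
  have key : ∀ c : G.FreeTriangle U, ∃ d : G.PathTwo U,
      (∃ z : Fin n, z ∉ U ∧ (∃ x : (U : Set (Fin n)), x ∈ c.1.supp ∧ G.Adj x.1 z) ∧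
        ∀ y : (U : Set (Fin n)), y ∈ d.1.supp → G.Adj y.1 z) ∧
      ∀ x : (U : Set (Fin n)), x ∈ c.1.supp →
        ∃ y : (U : Set (Fin n)), y ∈ d.1.supp ∧ g x.1 = y.1 := by
    intro c
    obtain ⟨x, hx, hex⟩ := exists_target hE hU h hs c
    obtain ⟨hp, q, hq, z, hz, a, ha, Ua, hax, Uz, eaz, hpq⟩ := lastSat_spec hex
    have hgx : ∀ y : (U : Set (Fin n)), y ∈ c.1.supp →
        g y.1 = lastSat (Target n E A x.1) n := fun y hy => by
      rw [hg y.1 y.1.2, target_congr hE hU c.2.1 hy hx]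
    generalize lastSat (Target n E A x.1) n = p at hp hpq hgx
    have hpU : (⟨p, hp⟩ : Fin n) ∈ (U : Set (Fin n)) := (hU ⟨p, hp⟩).2 hpq.1
    have hqU : (⟨q, hq⟩ : Fin n) ∈ (U : Set (Fin n)) := (hU ⟨q, hq⟩).2 hpq.2.1
    have hsupp := supp_of_pathAt hE hU (p := ⟨_, hpU⟩) (q := ⟨_, hqU⟩) hpq
    have hadj : (G.induce (U : Set (Fin n))).Adj ⟨_, hpU⟩ ⟨_, hqU⟩ :=
      (hE ⟨p, hp⟩ ⟨q, hq⟩).1 hpq.2.2.1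
    refine ⟨⟨(G.induce (U : Set (Fin n))).connectedComponentMk ⟨⟨p, hp⟩, hpU⟩, ?_, ?_⟩,
      ⟨⟨z, hz⟩, fun h' => Uz ((hU _).1 h'),
      ⟨⟨⟨a, ha⟩, (hU ⟨a, ha⟩).2 Ua⟩, ?_, (hE ⟨a, ha⟩ ⟨z, hz⟩).1 eaz⟩, ?_⟩, fun y hy =>
        ⟨⟨_, hpU⟩, rfl, hgx y hy⟩⟩
    · rw [hsupp, Set.encard_pair hadj.ne]
    · rw [hsupp, SimpleGraph.isClique_iff, Set.pairwise_pair]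
      exact fun _ => ⟨hadj, hadj.symm⟩
    · exact (mem_supp_iff_of_isTriangle hE c.2.1 hx _).2 hax
    · intro y hy
      simp only at hy
      rw [hsupp] at hy
      rcases hy with rfl | rfl
      · exact ((hE ⟨z, hz⟩ ⟨p, hp⟩).1 hpq.2.2.2.1).symm
      · exact ((hE ⟨z, hz⟩ ⟨q, hq⟩).1 hpq.2.2.2.2.1).symm
  choose f hf₁ hf₂ using key
  exact ⟨f, hf₁, hf₂⟩

end

theorem local_runs {n S : ℕ} (I : WVCInstance n) {U : Finset (Fin n)}
    (hS : resources [localProg] n ≤ S) (hU : I.graph.IsMinVertexCover U)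
    (hd : I.graph.IsDegreeThree) :
    ∃ (T : ℕ) (σ : Store), (⟨localProg.cmd, []⟩ : Program).Runs S I.total (I.inputWith U) T σ ∧
      T ≤ S ∧ I.graph.IsMinVertexCover (outputSet n σ) ∧
      ∃ f : I.graph.FreeTriangle (outputSet n σ) → I.graph.PathTwo (outputSet n σ),
        I.graph.IsGoodFor (outputSet n σ) f ∧ EncodesMap I.graph (outputSet n σ) σ f := by
  classical
  have hE := edgeAt_inputWith I U
  have hfilter : (Finset.univ.filter fun v : Fin n => (I.inputWith U).nat 2 v = 1) = U := by
    ext v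
    simp [WVCInstance.inputWith, Fin.val_inj]
  have hmin := (isMinVertexCover_iff hE fun v => (I.inputWith U).nat 2 v = 1).1
    (by rwa [hfilter])
  have hcub : CubicMin n (edgeAt n (I.inputWith U)) fun v => (I.inputWith U).nat 2 v = 1 :=
    ⟨edgeAt_symm I U, edgeAt_irrefl I U, (isDegreeThree_iff hE).1 hd, hmin.1, hmin.2⟩
  have hwf : ∀ p ∈ [localProg], p.wf = true := by simp [wf_localProg]
  have hfit := fit_resources hwf (total_nonneg I) hS localProg (by simp)
  obtain ⟨T, τ, h₁, h₂, bτ, sτ, h₃, h₄, h₅⟩ := (ok_local le_rfl (bdd_inputWith I U)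
    (instanceAt_inputWith I U).n_eq rfl hcub).tri_fit (procs := []) (d := S) (bdd_inputWith I U)
      hfit
  obtain ⟨f, hf₁, hf₂⟩ := exists_isGoodFor (U := outputSet n τ) hE
    (fun v => by simp [outputSet]) h₃ h₄ h₅
  refine ⟨T, τ, h₁, ?_, (isMinVertexCover_iff hE _).2 ⟨h₃.covers, h₃.le⟩, f, hf₁, hf₂⟩
  have h₆ : T ≤ timeSum [localProg] n := by exact_mod_cast h₂
  exact (h₆.trans (Nat.le_mul_of_pos_left _ (by omega))).trans ((Nat.le_add_left _ _).trans hS)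

end RAM

theorem mainTheorem6 :
    -- the problem with a given minimum vertex cover
    (∃ (P : RAM.Program) (C k : ℕ), ∀ (n : ℕ) (I : WVCInstance n) (U : Finset (Fin n)),
      I.graph.IsMinVertexCover U →
      ∃ (T : ℕ) (σ : RAM.Store),
        P.Runs (polyBound C k n) I.total (I.inputWith U) T σ ∧ I.AnsweredBy σ ∧
        (T : ℝ) ≤ polyBound C k n * (1.443 : ℝ) ^ U.card ∧
        (I.graph.IsDegreeThree → (T : ℝ) ≤ polyBound C k n * (1.415 : ℝ) ^ U.card)) ∧
    -- the preprocessing on graphs of maximum degree at most three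
    (∃ (P : RAM.Program) (C k : ℕ), ∀ (n : ℕ) (I : WVCInstance n) (U : Finset (Fin n)),
      I.graph.IsMinVertexCover U → I.graph.IsDegreeThree →
      ∃ (T : ℕ) (σ : RAM.Store),
        P.Runs (polyBound C k n) I.total (I.inputWith U) T σ ∧ T ≤ polyBound C k n ∧
        I.graph.IsMinVertexCover (outputSet n σ) ∧
        ∃ f : I.graph.FreeTriangle (outputSet n σ) → I.graph.PathTwo (outputSet n σ),
          I.graph.IsGoodFor (outputSet n σ) f ∧ EncodesMap I.graph (outputSet n σ) σ f) ∧
    -- the problem without a given vertex cover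
    (∃ (P : RAM.Program) (C k : ℕ), ∀ (n : ℕ) (I : WVCInstance n) (t : ℕ),
      (t : ℕ∞) = I.graph.vertexCoverNum →
      ∃ (T : ℕ) (σ : RAM.Store),
        P.Runs (polyBound C k n) I.total I.input T σ ∧ I.AnsweredBy σ ∧
        (T : ℝ) ≤ polyBound C k n * (1.443 : ℝ) ^ t ∧
        (I.graph.IsDegreeThree → (T : ℝ) ≤ polyBound C k n * (1.415 : ℝ) ^ t)) := by
  obtain ⟨C, k, hS⟩ := RAM.isPoly_resources RAM.solverProgs
  obtain ⟨C', k', hS'⟩ := RAM.isPoly_resources [RAM.localProg]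
  exact ⟨⟨RAM.solver, C, k, fun n I U hU => RAM.solver_runs I U (hS n) hU.2⟩,
    ⟨_, C', k', fun n I U hU hd => RAM.local_runs I (hS' n) hU hd⟩,
    ⟨RAM.solver, C, k, fun n I t ht => RAM.solver_runs I ∅ (hS n) ht⟩⟩
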